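/- **Notation.** Let $\Gamma$ be a finite subgroup of $\mathbb C^*$ and $k$ a commutative $\mathbb Q$-algebra. Let $X=\{x_0\}\cup\{x_\sigma\}_{\sigma\in\Gamma}$ and $Y=\{y_{n,\nu}\}_{n\ge1,\nu\in\Gamma}$, with $x_0,x_\sigma$ of weight $1$ and $y_{n,\nu}$ of weight $n$. Write $(f|w)$ for the coefficient of the word $w$ in a noncommutative series $f$. Let $\Delta$ be the coproduct on $k\langle\langle X\rangle\rangle$ for which the letters are primitive, and $\Delta_*$ (the stuffle coproduct) the continuous algebra morphism on $k\langle\langle Y\rangle\rangle$ with $\Delta_* y_{n,\nu}=y_{n,\nu}\otimes1+1\otimes y_{n,\nu}+\sum_{i+j=n,\ i,j\ge1,\ \kappa\mu=\nu}y_{i,\kappa}\otimes y_{j,\mu}$. Identify $y_{n,\nu}$ with $x_0^{n-1}x_\nu$; let $\pi_Y:k\langle\langle X\rangle\rangle\to k\langle\langle Y\rangle\rangle$ be the projection that kills the words ending in $x_0$. Let $\mathbf{ps}$ be the continuous linear map $y_{s_1,\sigma_1}y_{s_2,\sigma_2}\cdots y_{s_r,\sigma_r}\mapsto y_{s_1,\sigma_1}y_{s_2,\sigma_1\sigma_2}\cdots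 y_{s_r,\sigma_1\cdots\sigma_r}$ of $k\langle\langle Y\rangle\rangle$, and $\mathbf{qs}$ its inverse. Put $y_n=y_{n,1}$ and $c(\Phi)=\sum_{n\ge2}\frac{(-1)^{n-1}}n(\pi_Y(\Phi)|y_n)\,y_1^n$. For a subgroup $\Gamma'\le\Gamma$ with index $d=[\Gamma:\Gamma']$ let $p^1_{\Gamma'}$ be the projection $k\langle\langle X_\Gamma\rangle\rangle\to k\langle\langle X_{\Gamma'}\rangle\rangle$ that kills the words with a letter $x_\sigma$, $\sigma\notin\Gamma'$, and $p^2_{\Gamma'}$ the continuous algebra morphism $x_0\mapsto d\,x_0$, $x_\sigma\mapsto x_{\sigma^d}$. The *weight one relations* for $\Phi$ are: whenever $\sigma,\tau\in\Gamma\setminus\{1\}$ and $p,q\in\mathbb Q$ satisfy $p(\log(1-\sigma)-\log(1-\sigma^{-1}))=q(\log(1-\tau)-\log(1-\tau^{-1}))$ (principal logarithms), then $p\big((\Phi|x_\sigma)-(\Phi|x_{\sigma^{-1}})\big)=q\big((\Phi|x_\tau)-(\Phi|x_{\tau^{-1}})\big)$. - $\mathrm{DMRD}(\Gamma)(k)$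 is the set of $\Phi\in k\langle\langle X\rangle\rangle$ with $(\Phi|1)=1$, $(\Phi|x_0)=(\Phi|x_1)=0$, $\Delta\Phi=\Phi\otimes\Phi$, $\Delta_*\Phi_*=\Phi_*\otimes\Phi_*$ for $\Phi_*=\exp(c(\Phi))\cdot\mathbf{qs}\,\pi_Y(\Phi)$, $p^2_{\Gamma'}(\Phi)=\exp\big(\sum_{\sigma^d=1}(\Phi|x_\sigma)\,x_1\big)\,p^1_{\Gamma'}(\Phi)$ for all $\Gamma'\le\Gamma$, and the weight one relations. - $\mathrm{dmrd}(\Gamma)(k)$ is the set of $\psi\in k\langle\langle X\rangle\rangle$ with $(\psi|x_0)=(\psi|x_1)=0$, $\psi$ primitive for $\Delta$, $\psi_*:=\mathbf{qs}\,\pi_Y(\psi)+c(\psi)$ primitive for $\Delta_*$, $p^2_{\Gamma'}(\psi)=p^1_{\Gamma'}(\psi)+\sum_{\sigma^d=1}(\psi|x_\sigma)\,x_1$ for all $\Gamma'\le\Gamma$, and the weight one relations. $\mathrm{dmrd}_0(\Gamma)(k)$ is the subset of those $\psi$ with $(\psi_*|y_{n,\nu})+(-1)^n(\psi_*|y_{n,\nu^{-1}})=0$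 for all $n\ge1$, $\nu\in\Gamma$. - Fix $\alpha_\Gamma=y_{2,1}=x_0x_1$ if $|\Gamma|\le2$, and $\alpha_\Gamma=x_\nu-x_{\nu^{-1}}$ for some $\nu\in\Gamma$ with $\nu^2\ne1$ if $|\Gamma|\ge3$. For $\lambda\in k$, $\mathrm{DMRD}_\lambda(\Gamma)(k)=\{\Phi\in\mathrm{DMRD}(\Gamma)(k):(\Phi|\alpha_\Gamma)=\lambda\}$. For $\gamma\in\Gamma$ let $t_\gamma$ be the continuous algebra automorphism $x_0\mapsto x_0$, $x_\sigma\mapsto x_{\gamma\sigma}$. $\mathrm{MT}(\Gamma)(k)$ is the group of series with constant term $1$ under $G\circledast H=G\cdot\kappa_G(H)$, where $\kappa_G$ is the continuous algebra morphism $x_0\mapsto x_0$, $x_\sigma\mapsto t_\sigma(G)^{-1}x_\sigma t_\sigma(G)$. Its Lie algebra $\mathfrak{mt}(\Gamma)(k)$ is the set of series without constant term. For such $\psi$ let $d_\psi$ be the continuous derivation $x_0\mapsto0$, $x_\sigma\mapsto[x_\sigma,t_\sigma(\psi)]$, and $s_\psi(\varphi)=\psi\varphi+d_\psi(\varphi)$.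 The bracket of $\mathfrak{mt}(\Gamma)$ (Ihara bracket) is $\langle\psi_1,\psi_2\rangle=[s_{\psi_1},s_{\psi_2}](1)$, and the exponential map is $\mathrm{Exp}(\psi)=\exp(s_\psi)(1)$. Let $\partial_{x_0}$ be the continuous derivation $x_0\mapsto 1$, $x_\sigma\mapsto0$, and let $\mathbf{s}:k\langle\langle Y\rangle\rangle\to k\langle\langle X\rangle\rangle$, $\mathbf{s}(f)=\sum_{i\ge0}\frac{(-1)^i}{i!}\partial_{x_0}^i(f)\,x_0^i$, be the section of $\pi_Y$ with values in $\ker\partial_{x_0}$. **Proposition.** For every finite subgroup $\Gamma\subset\mathbb C^*$ and every commutative $\mathbb Q$-algebra $k$: 1. For every admissible $\alpha_\Gamma$, every $\lambda\in k$, every $\psi\in\mathrm{dmrd}_0(\Gamma)(k)$ and every $\Phi\in\mathrm{DMRD}_\lambda(\Gamma)(k)$, one has $\mathrm{Exp}(\psi)\circledast\Phi=\exp(s_\psi)(\Phi)$ and this series belongs to $\mathrm{DMRD}_\lambda(\Gamma)(k)$. 2. For every $\psi\in\mathrm{dmrd}_0(\Gamma)(k)$, the operator $s_{\mathbf{s}(\mathbf{ps}(\psi_*))}$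 induces, through $\mathbf{qs}\,\pi_Y$, a $k$-linear endomorphism $D$ of $k\langle\langle Y\rangle\rangle$ (that is, $D\circ\mathbf{qs}\,\pi_Y=\mathbf{qs}\,\pi_Y\circ s_{\mathbf{s}(\mathbf{ps}(\psi_*))}$), and $D$ is a coderivation for $\Delta_*$. 3. $\mathrm{dmrd}_0(\Gamma)(k)$ is a $k$-Lie subalgebra of $\mathfrak{mt}(\Gamma)(k)$ for the Ihara bracket. 4. $\mathrm{Exp}(\mathrm{dmrd}_0(\Gamma)(k))$ is a subgroup of $\mathrm{MT}(\Gamma)(k)$. -/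

import Mathlib

noncomputable section

namespace DoubleShuffle

/-! ### Noncommutative formal power series

Words on an alphabet `A` are the elements of `FreeMonoid A`; the empty word is `1`.
A series is the family of its coefficients: `f w` is `(f | w)`. -/

/-- The noncommutative formal power series `k⟨⟨A⟩⟩`. -/
def NCSeries (A k : Type*) : Type _ := FreeMonoid A → k

namespace NCSeries

variable {A B k : Type*}

instance [AddCommGroup k] : AddCommGroup (NCSeries A k) :=
  inferInstanceAs (AddCommGroup (FreeMonoid A → k))

instance {R : Type*} [Semiring R] [AddCommGroup k] [Module R k] : Module R (NCSeries A k) :=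
  inferInstanceAs (Module R (FreeMonoid A → k))

@[ext] theorem ext {f g : NCSeries A k} (h : ∀ w, f w = g w) : f = g := funext h

variable [CommRing k]

open Classical in
/-- A word, seen as a series. -/
def word (w : FreeMonoid A) : NCSeries A k := fun v => if v = w then 1 else 0

/-- A letter, seen as a series. -/
def letter (a : A) : NCSeries A k := word (FreeMonoid.of a)

instance : One (NCSeries A k) := ⟨word 1⟩

/-- Concatenation product: `(f g | w)` is the sum of `(f | u) (g | v)` over all factorisations
`w = u v`. -/
instance : Mul (NCSeries A k) :=
  ⟨fun f g w => ∑ i ∈ Finset.range (w.toList.length + 1),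
    f (FreeMonoid.ofList (w.toList.take i)) * g (FreeMonoid.ofList (w.toList.drop i))⟩

theorem add_apply (f g : NCSeries A k) (w : FreeMonoid A) : (f + g) w = f w + g w := rfl

theorem zero_apply (w : FreeMonoid A) : (0 : NCSeries A k) w = 0 := rfl

theorem one_apply_nil : (1 : NCSeries A k) 1 = 1 := if_pos rfl

theorem one_apply_cons (a : A) (w : FreeMonoid A) :
    (1 : NCSeries A k) (FreeMonoid.of a * w) = 0 :=
  if_neg (fun h => by simpa using congrArg FreeMonoid.length h)

theorem mul_apply_nil (f g : NCSeries A k) : (f * g) 1 = f 1 * g 1 := by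
  change ∑ i ∈ Finset.range 1, _ = _
  rw [Finset.sum_range_one]
  rfl

/-- Removal of the first letter `a`: the coefficient at `w` is `(f | a w)`. -/
def residual (a : A) (f : NCSeries A k) : NCSeries A k := fun v => f (FreeMonoid.of a * v)

theorem mul_apply_cons (f g : NCSeries A k) (a : A) (w : FreeMonoid A) :
    (f * g) (FreeMonoid.of a * w) = f 1 * g (FreeMonoid.of a * w) +
      (residual a f * g) w := by
  change ∑ i ∈ Finset.range (w.toList.length + 1 + 1), _ = _
  rw [Finset.sum_range_succ', add_comm]
  rfl

protected theorem add_mul' (f g h : NCSeries A k) : (f + g) * h = f * h + g * h := by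
  ext w
  exact (Finset.sum_congr rfl fun i _ => add_mul _ _ _).trans Finset.sum_add_distrib

protected theorem mul_add' (f g h : NCSeries A k) : f * (g + h) = f * g + f * h := by
  ext w
  exact (Finset.sum_congr rfl fun i _ => mul_add _ _ _).trans Finset.sum_add_distrib

protected theorem smul_mul' (c : k) (f g : NCSeries A k) : c • f * g = c • (f * g) := by
  ext w
  exact (Finset.sum_congr rfl fun i _ => mul_assoc _ _ _).trans (Finset.mul_sum _ _ _).symm

protected theorem zero_mul' (f : NCSeries A k) : 0 * f = 0 := by
  ext w
  exact Finset.sum_eq_zero fun i _ => zero_mul _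

protected theorem mul_zero' (f : NCSeries A k) : f * 0 = 0 := by
  ext w
  exact Finset.sum_eq_zero fun i _ => mul_zero _

protected theorem one_mul' (f : NCSeries A k) : 1 * f = f := by
  ext w
  induction w using FreeMonoid.inductionOn' with
  | one => rw [mul_apply_nil, one_apply_nil, one_mul]
  | of_mul a v _ =>
    have h : residual a (1 : NCSeries A k) = 0 := by
      ext u
      exact one_apply_cons a u
    rw [mul_apply_cons, one_apply_nil, one_mul, h, NCSeries.zero_mul', zero_apply, add_zero]

protected theorem mul_one' (f : NCSeries A k) : f * 1 = f := by
  ext w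
  induction w using FreeMonoid.inductionOn' generalizing f with
  | one => rw [mul_apply_nil, one_apply_nil, mul_one]
  | of_mul a v ih =>
    rw [mul_apply_cons, one_apply_cons, mul_zero, zero_add, ih]
    rfl

protected theorem mul_assoc' (f g h : NCSeries A k) : f * g * h = f * (g * h) := by
  ext w
  induction w using FreeMonoid.inductionOn' generalizing f with
  | one => simp only [mul_apply_nil, mul_assoc]
  | of_mul a v ih =>
    have key : residual a (f * g) = f 1 • residual a g + residual a f * g := by
      ext u
      exact mul_apply_cons f g a u
    have hs : (f 1 • (residual a g * h)) v = f 1 * (residual a g * h) v := rfl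
    rw [mul_apply_cons, key, NCSeries.add_mul', add_apply, NCSeries.smul_mul', ih,
      mul_apply_cons f, mul_apply_cons g, mul_apply_nil, mul_add, mul_assoc, add_assoc, hs]

instance : Ring (NCSeries A k) :=
  { (inferInstance : AddCommGroup (NCSeries A k)) with
    mul := (· * ·)
    one := 1
    left_distrib := NCSeries.mul_add'
    right_distrib := NCSeries.add_mul'
    zero_mul := NCSeries.zero_mul'
    mul_zero := NCSeries.mul_zero'
    mul_assoc := NCSeries.mul_assoc'
    one_mul := NCSeries.one_mul'
    mul_one := NCSeries.mul_one' }

/-! The infinite sums below are sums of locally finite families: every coefficient is a sum with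
finitely many nonzero terms. -/

/-- Sum of a locally finite sequence of series. -/
def lsum (F : ℕ → NCSeries A k) : NCSeries A k := fun w => ∑ᶠ n, F n w

/-- The continuous linear map on series with prescribed values `T w` on the words `w`. The target
`B → k` is a space of series: `B` is the set of words, or of pairs of words. -/
def extend (T : FreeMonoid A → B → k) (f : NCSeries A k) : B → k :=
  fun b => ∑ᶠ w, f w * T w b

/-- The continuous algebra morphism with prescribed values on the letters. -/
def subst (g : A → NCSeries B k) (f : NCSeries A k) : NCSeries B k :=
  extend (fun w => FreeMonoid.lift g w) f

/-- The Leibniz rule: values on words of the derivation with prescribed values on the letters. -/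
def derWord (D : A → NCSeries A k) : List A → NCSeries A k
  | [] => 0
  | a :: w => D a * word (FreeMonoid.ofList w) + letter a * derWord D w

/-- The continuous derivation with prescribed values on the letters. -/
def der (D : A → NCSeries A k) (f : NCSeries A k) : NCSeries A k :=
  extend (fun w => derWord D w.toList) f

/-- Exponential of a series without constant term. -/
def expS [Algebra ℚ k] (f : NCSeries A k) : NCSeries A k :=
  lsum fun n => (n.factorial : ℚ)⁻¹ • f ^ n

/-- Exponential of an operator that raises degrees, applied to a series. -/
def expOp [Algebra ℚ k] (s : NCSeries A k → NCSeries A k) (f : NCSeries A k) : NCSeries A k :=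
  lsum fun n => (n.factorial : ℚ)⁻¹ • s^[n] f

/-! ### Coproducts

The completed tensor square of `k⟨⟨A⟩⟩` is the space of families indexed by pairs of words, and
the tensor square of the algebra of noncommutative polynomials is the algebra of the monoid of
pairs of words. -/

/-- The completed tensor square of `k⟨⟨A⟩⟩`. -/
abbrev Tensor2 (A k : Type*) : Type _ := FreeMonoid A × FreeMonoid A → k

/-- The tensor `f ⊗ g`. -/
def tmul (f g : NCSeries A k) : Tensor2 A k := fun p => f p.1 * g p.2

/-- Continuous extension to series of a coproduct that is given on words. -/
def coprod (c : FreeMonoid A →* MonoidAlgebra k (FreeMonoid A × FreeMonoid A))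
    (f : NCSeries A k) : Tensor2 A k :=
  extend (fun w p => (c w).coeff p) f

/-- `f` is group-like for the coproduct `c` (apart from the condition on the constant term). -/
def IsGroupLike (c : FreeMonoid A →* MonoidAlgebra k (FreeMonoid A × FreeMonoid A))
    (f : NCSeries A k) : Prop :=
  coprod c f = tmul f f

/-- `f` is primitive for the coproduct `c`. -/
def IsPrimitive (c : FreeMonoid A →* MonoidAlgebra k (FreeMonoid A × FreeMonoid A))
    (f : NCSeries A k) : Prop :=
  coprod c f = tmul 1 f + tmul f 1

/-- `D` is a coderivation for the coproduct `c`:  `c ∘ D = (D ⊗ id + id ⊗ D) ∘ c`. -/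
def IsCoderivation (c : FreeMonoid A →* MonoidAlgebra k (FreeMonoid A × FreeMonoid A))
    (D : NCSeries A k → NCSeries A k) : Prop :=
  ∀ (f : NCSeries A k) (u v : FreeMonoid A), coprod c (D f) (u, v) =
    D (fun u' => coprod c f (u', v)) u + D (fun v' => coprod c f (u, v')) v

end NCSeries

open NCSeries

/-! ### The alphabets `X` and `Y` -/

/-- The alphabet `x₀`, `x_σ` (`σ ∈ G`). -/
abbrev XL (G : Type*) : Type _ := Option G

/-- The letter `x₀`. -/
abbrev x0 {G : Type*} : XL G := none

/-- The letter `x_σ`. -/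
abbrev xl {G : Type*} (σ : G) : XL G := some σ

/-- The alphabet `y_{n,ν}` (`n ≥ 1`, `ν ∈ G`). -/
abbrev YL (G : Type*) : Type _ := ℕ+ × G

section Operations

variable {G k : Type*} [CommGroup G] [CommRing k]

/-- The coproduct `Δ` on words in `X`, for which the letters are primitive. -/
def shuffleWord (G k : Type*) [CommRing k] :
    FreeMonoid (XL G) →* MonoidAlgebra k (FreeMonoid (XL G) × FreeMonoid (XL G)) :=
  FreeMonoid.lift fun a =>
    MonoidAlgebra.single (FreeMonoid.of a, 1) 1 + MonoidAlgebra.single (1, FreeMonoid.of a) 1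

/-- The coproduct `Δ_*` on words in `Y`: the algebra morphism that sends `y_{n,ν}` to
`y_{n,ν} ⊗ 1 + 1 ⊗ y_{n,ν} + ∑ y_{i,κ} ⊗ y_{j,μ}`, the sum over `i, j ≥ 1` and `κ, μ ∈ G` with
`i + j = n` and `κ μ = ν`. -/
def stuffleWord (G k : Type*) [CommGroup G] [CommRing k] :
    FreeMonoid (YL G) →* MonoidAlgebra k (FreeMonoid (YL G) × FreeMonoid (YL G)) :=
  FreeMonoid.lift fun y =>
    MonoidAlgebra.single (FreeMonoid.of y, 1) 1 + MonoidAlgebra.single (1, FreeMonoid.of y) 1 +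
      ∑ i ∈ Finset.Ico 1 y.1, ∑ᶠ κ : G,
        MonoidAlgebra.single (FreeMonoid.of (i, κ), FreeMonoid.of (y.1 - i, κ⁻¹ * y.2)) 1

/-- The embedding of words that identifies `y_{n,ν}` with `x₀^{n-1} x_ν`. -/
def yWord : FreeMonoid (YL G) →* FreeMonoid (XL G) :=
  FreeMonoid.lift fun y => FreeMonoid.of x0 ^ ((y.1 : ℕ) - 1) * FreeMonoid.of (xl y.2)

/-- The embedding `k⟨⟨Y⟩⟩ → k⟨⟨X⟩⟩`. -/
def inclY (f : NCSeries (YL G) k) : NCSeries (XL G) k :=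
  extend (fun w => word (yWord w)) f

/-- The projection `π_Y : k⟨⟨X⟩⟩ → k⟨⟨Y⟩⟩`, dual to the embedding. -/
def piY (f : NCSeries (XL G) k) : NCSeries (YL G) k := fun w => f (yWord w)

/-- Successive products, after a word whose letters have product `p`. -/
def psAux : G → List (YL G) → List (YL G)
  | _, [] => []
  | p, y :: w => (y.1, p * y.2) :: psAux (p * y.2) w

/-- Successive quotients, after the letter of index `p`. -/
def qsAux : G → List (YL G) → List (YL G)
  | _, [] => []
  | p, y :: w => (y.1, p⁻¹ * y.2) :: qsAux y.2 w

/-- `y_{s₁,σ₁} y_{s₂,σ₂} ⋯ ↦ y_{s₁,σ₁} y_{s₂,σ₁σ₂} ⋯`. -/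
def psWord (w : FreeMonoid (YL G)) : FreeMonoid (YL G) := FreeMonoid.ofList (psAux 1 w.toList)

/-- `y_{s₁,σ₁} y_{s₂,σ₂} ⋯ ↦ y_{s₁,σ₁} y_{s₂,σ₂/σ₁} ⋯`. -/
def qsWord (w : FreeMonoid (YL G)) : FreeMonoid (YL G) := FreeMonoid.ofList (qsAux 1 w.toList)

theorem qsAux_psAux (p : G) (w : List (YL G)) : qsAux p (psAux p w) = w := by
  induction w generalizing p with
  | nil => rfl
  | cons y w ih => simp [psAux, qsAux, ih]

theorem psAux_qsAux (p : G) (w : List (YL G)) : psAux p (qsAux p w) = w := by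
  induction w generalizing p with
  | nil => rfl
  | cons y w ih => simp [psAux, qsAux, ih]

theorem qsWord_psWord (w : FreeMonoid (YL G)) : qsWord (psWord w) = w := qsAux_psAux 1 w.toList

theorem psWord_qsWord (w : FreeMonoid (YL G)) : psWord (qsWord w) = w := psAux_qsAux 1 w.toList

/-- The operator `ps` on series: the word `w` is sent to `psWord w`, so that the coefficient of
the image at `w` is the coefficient at `qsWord w`. -/
def ps (f : NCSeries (YL G) k) : NCSeries (YL G) k := fun w => f (qsWord w)

/-- The operator `qs` on series, inverse to `ps`. -/
def qs (f : NCSeries (YL G) k) : NCSeries (YL G) k := fun w => f (psWord w)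

/-- The action of `γ ∈ G`: `x₀ ↦ x₀`, `x_σ ↦ x_{γσ}`. -/
def tAct (γ : G) (f : NCSeries (XL G) k) : NCSeries (XL G) k :=
  subst (fun a => letter (a.map fun σ => γ * σ)) f

/-- `κ_F`: the continuous algebra endomorphism `x₀ ↦ x₀`, `x_σ ↦ t_σ(F)⁻¹ x_σ t_σ(F)`. -/
def kappa (F : NCSeries (XL G) k) : NCSeries (XL G) k → NCSeries (XL G) k :=
  subst fun a => match a with
    | none => letter x0
    | some σ => Ring.inverse (tAct σ F) * letter (xl σ) * tAct σ F

/-- The product `F ⊛ H = F κ_F(H)`. -/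
def mtMul (F H : NCSeries (XL G) k) : NCSeries (XL G) k := F * kappa F H

/-- The underlying set of the group `MT`: series with constant term `1`. -/
def MT (G k : Type*) [CommRing k] : Set (NCSeries (XL G) k) := {F | F 1 = 1}

/-- The underlying space of the Lie algebra `mt`: series without constant term. -/
def mt (G k : Type*) [CommRing k] : Set (NCSeries (XL G) k) := {ψ | ψ 1 = 0}

/-- The special derivation `d_ψ`: `x₀ ↦ 0`, `x_σ ↦ [x_σ, t_σ(ψ)]`. -/
def dOp (ψ : NCSeries (XL G) k) : NCSeries (XL G) k → NCSeries (XL G) k :=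
  der fun a => match a with
    | none => 0
    | some σ => letter (xl σ) * tAct σ ψ - tAct σ ψ * letter (xl σ)

/-- The tangential action `s_ψ(φ) = ψ φ + d_ψ(φ)`, the linearisation at `F = 1` of
`F ↦ F ⊛ φ`. -/
def sOp (ψ φ : NCSeries (XL G) k) : NCSeries (XL G) k := ψ * φ + dOp ψ φ

/-- The Lie bracket of `mt` (Ihara bracket): `[s_{ψ₁}, s_{ψ₂}](1)`, which is
`[ψ₁, ψ₂] + d_{ψ₁}(ψ₂) - d_{ψ₂}(ψ₁)`. -/
def ihara (ψ₁ ψ₂ : NCSeries (XL G) k) : NCSeries (XL G) k :=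
  sOp ψ₁ (sOp ψ₂ 1) - sOp ψ₂ (sOp ψ₁ 1)

/-- The exponential map `mt → MT`: the flow at time one, issued from the unit `1`, of the
translation-invariant vector field `F ↦ s_ψ(F)`. -/
def mtExp [Algebra ℚ k] (ψ : NCSeries (XL G) k) : NCSeries (XL G) k := expOp (sOp ψ) 1

/-- The derivation `∂_{x₀}`: `x₀ ↦ 1`, `x_σ ↦ 0`. -/
def partial0 : NCSeries (XL G) k → NCSeries (XL G) k :=
  der fun a => match a with
    | none => 1
    | some _ => 0

/-- The section of `π_Y` with values in the kernel of `∂_{x₀}`: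
`f ↦ ∑_i (-1)^i / i! ∂_{x₀}^i(f) x₀^i`. -/
def sec [Algebra ℚ k] (f : NCSeries (YL G) k) : NCSeries (XL G) k :=
  lsum fun i => ((-1) ^ i * (i.factorial : ℚ)⁻¹) • (partial0^[i] (inclY f) * letter x0 ^ i)

/-- The series `∑_{n ≥ 2} (-1)^{n-1} / n (π_Y(Φ) | y_n) y_1^n`, where `y_n = y_{n,1}`. -/
def corr [Algebra ℚ k] (Φ : NCSeries (XL G) k) : NCSeries (YL G) k :=
  lsum fun n => if h : 2 ≤ n then
    ((-1) ^ (n - 1) / n : ℚ) • piY Φ (FreeMonoid.of (⟨n, by omega⟩, 1)) • letter (1, 1) ^ n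
  else 0

/-- `Φ_* = Φ_corr · qs π_Y(Φ)`, where `Φ_corr` is the exponential of `corr Φ`. -/
def starGroup [Algebra ℚ k] (Φ : NCSeries (XL G) k) : NCSeries (YL G) k :=
  expS (corr Φ) * qs (piY Φ)

/-- `ψ_* = qs π_Y(ψ) + ψ_corr`. -/
def starLie [Algebra ℚ k] (ψ : NCSeries (XL G) k) : NCSeries (YL G) k :=
  qs (piY ψ) + corr ψ

/-- The projection `p¹` to the alphabet of a subgroup `H`, dual to the inclusion of words: it
deletes the words with a letter `x_σ`, `σ ∉ H`. -/
def proj1 (H : Subgroup G) (f : NCSeries (XL G) k) : NCSeries (XL H) k :=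
  fun w => f (FreeMonoid.map (Option.map Subtype.val) w)

/-- The morphism `p²`: `x₀ ↦ [G : H] x₀`, `x_σ ↦ x_{σ^[G : H]}`. -/
def proj2 (H : Subgroup G) (f : NCSeries (XL G) k) : NCSeries (XL H) k :=
  subst (fun a => match a with
    | none => (H.index : k) • letter x0
    | some σ => letter (xl ⟨σ ^ H.index, H.pow_index_mem σ⟩)) f

/-- The sum of the coefficients of the `x_σ` with `σ^[G : H] = 1`. -/
def distCoeff (H : Subgroup G) (f : NCSeries (XL G) k) : k :=
  ∑ᶠ (σ : G) (_ : σ ^ H.index = 1), f (FreeMonoid.of (xl σ))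

end Operations

/-! ### The sets `DMRD`, `dmrd`, `dmrd₀` -/

section Sets

variable (Γ : Subgroup ℂˣ) (k : Type*) [CommRing k] [Algebra ℚ k]

/-- The weight one relations: the numbers `log(1-σ) - log(1-σ⁻¹)`, `σ ∈ Γ \ {1}`, are rational
multiples of `iπ`, and every rational proportionality between two of them is imposed on the
corresponding differences of coefficients. -/
def WeightOne {Γ : Subgroup ℂˣ} {k : Type*} [CommRing k] [Algebra ℚ k]
    (Φ : NCSeries (XL Γ) k) : Prop :=
  ∀ σ τ : Γ, σ ≠ 1 → τ ≠ 1 → ∀ p q : ℚ,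
    (p : ℂ) * (Complex.log (1 - (σ : ℂˣ)) - Complex.log (1 - (σ⁻¹ : ℂˣ))) =
      (q : ℂ) * (Complex.log (1 - (τ : ℂˣ)) - Complex.log (1 - (τ⁻¹ : ℂˣ))) →
    p • (Φ (FreeMonoid.of (xl σ)) - Φ (FreeMonoid.of (xl σ⁻¹))) =
      q • (Φ (FreeMonoid.of (xl τ)) - Φ (FreeMonoid.of (xl τ⁻¹)))

/-- The set `DMRD(Γ)(k)`. -/
def DMRD : Set (NCSeries (XL Γ) k) :=
  {Φ | Φ 1 = 1 ∧ Φ (FreeMonoid.of x0) = 0 ∧ Φ (FreeMonoid.of (xl 1)) = 0 ∧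
    IsGroupLike (shuffleWord Γ k) Φ ∧ IsGroupLike (stuffleWord Γ k) (starGroup Φ) ∧
    (∀ H : Subgroup Γ, proj2 H Φ = expS (distCoeff H Φ • letter (xl 1)) * proj1 H Φ) ∧
    WeightOne Φ}

/-- The set `dmrd(Γ)(k)`, the linearisation of `DMRD(Γ)(k)` at `1`. -/
def dmrd : Set (NCSeries (XL Γ) k) :=
  {ψ | ψ (FreeMonoid.of x0) = 0 ∧ ψ (FreeMonoid.of (xl 1)) = 0 ∧
    IsPrimitive (shuffleWord Γ k) ψ ∧ IsPrimitive (stuffleWord Γ k) (starLie ψ) ∧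
    (∀ H : Subgroup Γ, proj2 H ψ = proj1 H ψ + distCoeff H ψ • letter (xl 1)) ∧
    WeightOne ψ}

/-- The set `dmrd₀(Γ)(k)` of the non-exceptional elements of `dmrd(Γ)(k)`:
`(ψ_* | y_{n,ν}) + (-1)^n (ψ_* | y_{n,ν⁻¹}) = 0` for all `n` and `ν`. -/
def dmrd0 : Set (NCSeries (XL Γ) k) :=
  {ψ | ψ ∈ dmrd Γ k ∧ ∀ (n : ℕ+) (ν : Γ), starLie ψ (FreeMonoid.of (n, ν)) +
    (-1) ^ (n : ℕ) * starLie ψ (FreeMonoid.of (n, ν⁻¹)) = 0}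

/-- The admissible choices of the homogeneous polynomial `α_Γ`: `y_{2,1} = x₀ x_1` if `Γ` has at
most two elements, and otherwise any of the `y_{1,ν} - y_{1,ν⁻¹} = x_ν - x_{ν⁻¹}` with
`ν² ≠ 1`. -/
def alphaSet : Set (MonoidAlgebra ℚ (FreeMonoid (XL Γ))) :=
  {α | (Nat.card Γ ≤ 2 ∧
      α = MonoidAlgebra.single (FreeMonoid.of x0 * FreeMonoid.of (xl 1)) 1) ∨
    (3 ≤ Nat.card Γ ∧ ∃ ν : Γ, ν ^ 2 ≠ 1 ∧
      α = MonoidAlgebra.single (FreeMonoid.of (xl ν)) 1 -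
        MonoidAlgebra.single (FreeMonoid.of (xl ν⁻¹)) 1)}

/-- The pairing `(Φ | α)` of a series with a rational polynomial. -/
def pairing {A k : Type*} [CommRing k] [Algebra ℚ k] (Φ : NCSeries A k)
    (α : MonoidAlgebra ℚ (FreeMonoid A)) : k :=
  α.coeff.sum fun w c => c • Φ w

/-- The set `DMRD_l(Γ)(k)` of the elements `Φ` of `DMRD(Γ)(k)` with `(Φ | α) = l`. -/
def DMRDFiber (α : MonoidAlgebra ℚ (FreeMonoid (XL Γ))) (l : k) : Set (NCSeries (XL Γ) k) :=
  {Φ | Φ ∈ DMRD Γ k ∧ pairing Φ α = l}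

end Sets

end DoubleShuffle

end

/-! The operator `s_ψ` satisfies `s_ψ(fg) = s_ψ(f) g + f d_ψ(g)`, so `exp(s_ψ)` is multiplicative
over the automorphism `exp(d_ψ)`, and the latter is `κ` of `Exp(ψ)` on letters. Hence the flow of
`s_ψ` is left translation by `Exp(ψ)` (`mtMul_mtExp`), and part 1 says that this flow preserves each
relation that defines `DMRD_λ`.

Three of the relations are formal. Since `ψ` is primitive, `s_ψ` is a coderivation for `Δ`, and
exponentials of coderivations preserve group-like series (`qcop_eq_tmul_of_isExp`). Both projections
to a subgroup intertwine the tangential actions, which gives the distribution relations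
(`proj2_expOp`). The weight one relations and `λ` only see words with one letter other than `x₀`,
where the flow just adds the coefficients of `ψ` (`expOp_sOp_apply_of_depth`).

The stuffle relation is the heart. The series `s(ps(ψ_*))` is `ψ` plus a power series in `x_1`,
whose own tangential action is left multiplication. The operator `D` that it induces on series in
`Y` obeys a Leibniz rule along first letters (`inducedOp_letter_mul_word`), so the coderivation
property reduces to the primitivity of `D(1) = ψ_*` and to an identity for the values on letters.
These values are expressed by the coefficients `P_j(w)` of the words `w x₀^j`
(`inducedLetter_apply`), and their quasi-shuffle sums have the required form as soon as the sums
`lastSum` have a reversal symmetry, that is, `defect` vanishes (`DihedralFamily.defect_eq_zero`).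

That symmetry is the combinatorial core. The shuffle antipode and the quasi-shuffle antipode
together give a cyclic rotation rule for the defect (`rotation`); primitivity and the parity
condition of `dmrd₀` show that inserting a letter gives a shorter defect (`stf_defect`). By
induction on length the defect is antisymmetric under rotation and killed by insertion of a letter,
and these two facts force twice the defect to be zero.

Once `D` is a coderivation, `exp(D)` carries `Φ_*` to the star series of the flow of `Φ`, because
the correction terms add up along the flow (`isExp_starGroup`).

For part 3 the bracket is a commutator of coderivations evaluated at `1`, in which the corrections
cancel. For part 4 the Campbell-Hausdorff formula is avoided: `Exp(dmrd₀)` consists of the elements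
of `DMRD` whose depth one coefficients satisfy the parity condition (`mem_image_mtExp_iff`). Indeed
the lowest order term of such an element is in `dmrd₀`, and successive approximation converges
because `dmrd₀` is cut out by finite linear forms. This description is stable under the flow, hence
under products. -/

set_option linter.unusedSectionVars false

noncomputable section

namespace DoubleShuffle

namespace NCSeries

/-! ### Row-finite linear maps -/

section RowFinite

variable {W V U k : Type*} [CommRing k]

/-- Linear forms on families that only involve finitely many coefficients. -/
def FinForm (φ : (W → k) → k) : Prop := ∃ c : W →₀ k, ∀ f, φ f = c.sum fun w r => r * f w

/-- Continuous linear maps between spaces of families: every coefficient of the image is a finite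
linear combination of coefficients of the argument. -/
def Cts (F : (W → k) → (V → k)) : Prop := ∀ v, FinForm fun f => F f v

theorem FinForm.eval (w : W) : FinForm fun f : W → k => f w :=
  ⟨Finsupp.single w 1, fun f => by simp⟩

theorem FinForm.zero : FinForm fun _ : W → k => (0 : k) := ⟨0, fun f => by simp⟩

theorem FinForm.add {φ χ : (W → k) → k} (hφ : FinForm φ) (hχ : FinForm χ) :
    FinForm fun f => φ f + χ f := by
  classical
  obtain ⟨c, hc⟩ := hφ
  obtain ⟨d, hd⟩ := hχ
  refine ⟨c + d, fun f => (congrArg₂ (· + ·) (hc f) (hd f)).trans ?_⟩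
  rw [Finsupp.sum_add_index'] <;> intros <;> ring

theorem FinForm.const_mul {φ : (W → k) → k} (a : k) (hφ : FinForm φ) :
    FinForm fun f => a * φ f := by
  obtain ⟨c, hc⟩ := hφ
  refine ⟨a • c, fun f => (congrArg (a * ·) (hc f)).trans ?_⟩
  rw [Finsupp.sum_smul_index' (by intros; ring), Finsupp.mul_sum]
  exact Finsupp.sum_congr fun _ _ => by simp [mul_assoc]

theorem FinForm.mul_const {φ : (W → k) → k} (hφ : FinForm φ) (a : k) :
    FinForm fun f => φ f * a := by
  simpa only [mul_comm] using hφ.const_mul a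

theorem FinForm.neg {φ : (W → k) → k} (hφ : FinForm φ) : FinForm fun f => -φ f := by
  simpa using hφ.const_mul (-1)

theorem FinForm.sub {φ χ : (W → k) → k} (hφ : FinForm φ) (hχ : FinForm χ) :
    FinForm fun f => φ f - χ f := by
  simpa only [sub_eq_add_neg] using hφ.add hχ.neg

theorem FinForm.sum {ι : Type*} (s : Finset ι) {φ : ι → (W → k) → k}
    (h : ∀ i ∈ s, FinForm (φ i)) : FinForm fun f => ∑ i ∈ s, φ i f := by
  classical
  induction s using Finset.induction_on with
  | empty => simpa using FinForm.zero
  | insert i s hi ih =>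
    simp only [Finset.sum_insert hi]
    exact (h i (Finset.mem_insert_self i s)).add
      (ih fun j hj => h j (Finset.mem_insert_of_mem hj))

theorem FinForm.comp {φ : (V → k) → k} {F : (W → k) → (V → k)} (hφ : FinForm φ) (hF : Cts F) :
    FinForm fun f => φ (F f) := by
  obtain ⟨c, hc⟩ := hφ
  simp only [hc, Finsupp.sum]
  exact FinForm.sum _ fun v _ => (hF v).const_mul _

theorem FinForm.map_add {φ : (W → k) → k} (h : FinForm φ) (f g : W → k) :
    φ (f + g) = φ f + φ g := by
  obtain ⟨c, hc⟩ := h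
  simp [hc, Finsupp.sum, mul_add, Finset.sum_add_distrib]

theorem FinForm.map_smul {φ : (W → k) → k} (h : FinForm φ) (a : k) (f : W → k) :
    φ (a • f) = a * φ f := by
  obtain ⟨c, hc⟩ := h
  simp [hc, Finsupp.sum, Finset.mul_sum, mul_left_comm]

theorem Cts.id : Cts (fun f : W → k => f) := fun w => FinForm.eval w

theorem Cts.comp {F : (V → k) → (U → k)} {G : (W → k) → (V → k)} (hF : Cts F) (hG : Cts G) :
    Cts fun f => F (G f) := fun u => (hF u).comp hG

theorem Cts.add {F G : (W → k) → (V → k)} (hF : Cts F) (hG : Cts G) :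
    Cts fun f => F f + G f := fun v => (hF v).add (hG v)

theorem Cts.zero : Cts fun _ : W → k => (0 : V → k) := fun _ => FinForm.zero

theorem Cts.const_smul {F : (W → k) → (V → k)} (a : k) (hF : Cts F) :
    Cts fun f => a • F f := fun v => (hF v).const_mul a

theorem Cts.precomp (φ : V → W) : Cts (k := k) fun f v => f (φ v) := fun v => FinForm.eval (φ v)

theorem Cts.map_add {F : (W → k) → (V → k)} (h : Cts F) (f g : W → k) :
    F (f + g) = F f + F g := funext fun v => (h v).map_add f g

theorem Cts.map_smul {F : (W → k) → (V → k)} (h : Cts F) (a : k) (f : W → k) :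
    F (a • f) = a • F f := funext fun v => (h v).map_smul a f

theorem Cts.map_zero {F : (W → k) → (V → k)} (h : Cts F) : F 0 = 0 := by
  simpa using h.map_smul 0 0

theorem Cts.map_neg {F : (W → k) → (V → k)} (h : Cts F) (f : W → k) : F (-f) = -F f := by
  simpa using h.map_smul (-1) f

theorem Cts.map_sub {F : (W → k) → (V → k)} (h : Cts F) (f g : W → k) :
    F (f - g) = F f - F g := by rw [sub_eq_add_neg, h.map_add, h.map_neg, ← sub_eq_add_neg]

theorem Cts.map_sum {F : (W → k) → (V → k)} (h : Cts F) {ι : Type*} (s : Finset ι)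
    (f : ι → W → k) : F (∑ i ∈ s, f i) = ∑ i ∈ s, F (f i) := by
  classical
  induction s using Finset.induction_on with
  | empty => simpa using h.map_zero
  | insert i s hi ih => rw [Finset.sum_insert hi, Finset.sum_insert hi, h.map_add, ih]

/-- A continuous linear map, as a linear map. -/
def Cts.toLinear {F : (W → k) → (V → k)} (h : Cts F) : (W → k) →ₗ[k] (V → k) where
  toFun := F
  map_add' := h.map_add
  map_smul' := h.map_smul

end RowFinite

/-! ### Words, letters and the concatenation product -/

section Words

variable {A B V k : Type*} [CommRing k]

theorem word_self (w : FreeMonoid A) : (word w : NCSeries A k) w = 1 := if_pos rfl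

theorem word_ne {v w : FreeMonoid A} (h : v ≠ w) : (word w : NCSeries A k) v = 0 := if_neg h

theorem FinForm.apply_word {φ : (FreeMonoid A → k) → k} {c : FreeMonoid A →₀ k}
    (hc : ∀ f, φ f = c.sum fun w r => r * f w) (w : FreeMonoid A) :
    φ (word w : NCSeries A k) = c w := by
  classical
  refine (hc _).trans ?_
  rw [Finsupp.sum, Finset.sum_eq_single w]
  · rw [word_self, mul_one]
  · intro b _ hb
    rw [word_ne hb, mul_zero]
  · intro hw
    rw [Finsupp.notMem_support_iff.1 hw, zero_mul]

theorem extend_of_cts {F : (FreeMonoid A → k) → (V → k)} (hF : Cts F) (f : NCSeries A k) :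
    extend (fun w => F (word w : NCSeries A k)) f = F f := by
  funext v
  obtain ⟨c, hc⟩ := hF v
  have h : ∀ w, F (word w : NCSeries A k) v = c w := FinForm.apply_word hc
  refine Eq.trans ?_ (hc f).symm
  change ∑ᶠ w, f w * F (word w : NCSeries A k) v = _
  rw [Finsupp.sum, finsum_congr fun w => congrArg (f w * ·) (h w)]
  rw [finsum_eq_sum_of_support_subset (s := c.support)]
  · exact Finset.sum_congr rfl fun w _ => mul_comm _ _
  · intro w hw
    simp only [Function.mem_support] at hw
    simpa using right_ne_zero_of_mul hw

/-- Each coefficient of a continuous map is a finite combination whose entries are the values on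
words. Most identities between operators below are checked on words through this principle. -/
theorem Cts.ext {F G : NCSeries A k → (V → k)} (hF : Cts (W := FreeMonoid A) F)
    (hG : Cts (W := FreeMonoid A) G) (h : ∀ w, F (word w) = G (word w)) (f : NCSeries A k) :
    F f = G f :=
  (extend_of_cts hF f).symm.trans
    ((congrArg (fun T => extend T f) (funext h)).trans (extend_of_cts hG f))

theorem cts_extend {T : FreeMonoid A → V → k} (hT : ∀ v, {w | T w v ≠ 0}.Finite) :
    Cts (fun f : FreeMonoid A → k => extend T f) := by
  intro v
  refine ⟨Finsupp.onFinset (hT v).toFinset (fun w => T w v) (by simp), fun f => ?_⟩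
  change ∑ᶠ w, f w * T w v = _
  rw [Finsupp.onFinset_sum _ (by simp), finsum_eq_sum_of_support_subset (s := (hT v).toFinset)]
  · exact Finset.sum_congr rfl fun w _ => mul_comm _ _
  · intro w hw
    simp only [Function.mem_support] at hw
    simpa using right_ne_zero_of_mul hw

theorem extend_word (T : FreeMonoid A → V → k) (w : FreeMonoid A) :
    extend T (word w : NCSeries A k) = T w := by
  funext v
  change ∑ᶠ u, (word w : NCSeries A k) u * T u v = _
  rw [finsum_eq_single _ w, word_self, one_mul]
  intro u hu
  rw [word_ne hu, zero_mul]

theorem cts_mul_left (f : NCSeries A k) :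
    Cts (W := FreeMonoid A) (V := FreeMonoid A) (fun g : NCSeries A k => (f * g : NCSeries A k)) := by
  intro w
  exact FinForm.sum _ fun i _ => (FinForm.eval _).const_mul _

theorem cts_mul_right (g : NCSeries A k) :
    Cts (W := FreeMonoid A) (V := FreeMonoid A) (fun f : NCSeries A k => (f * g : NCSeries A k)) := by
  intro w
  exact FinForm.sum _ fun i _ => (FinForm.eval _).mul_const _

theorem sub_apply (f g : NCSeries A k) (w : FreeMonoid A) : (f - g) w = f w - g w := rfl

theorem smul_apply (a : k) (f : NCSeries A k) (w : FreeMonoid A) : (a • f) w = a * f w := rfl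

theorem sum_apply {ι : Type*} (s : Finset ι) (f : ι → NCSeries A k) (w : FreeMonoid A) :
    (∑ i ∈ s, f i) w = ∑ i ∈ s, f i w := Finset.sum_apply (M := fun _ => k) w s f

theorem mul_smul' (c : k) (f g : NCSeries A k) : f * c • g = c • (f * g) :=
  (cts_mul_left f).map_smul c g

instance : IsScalarTower k (NCSeries A k) (NCSeries A k) := ⟨NCSeries.smul_mul'⟩

instance : SMulCommClass k (NCSeries A k) (NCSeries A k) :=
  ⟨fun c f g => (mul_smul' c f g).symm⟩

theorem word_one : (word 1 : NCSeries A k) = 1 := rfl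

theorem letter_mul_nil (a : A) (f : NCSeries A k) : (letter a * f : NCSeries A k) 1 = 0 := by
  rw [mul_apply_nil, letter, word_ne, zero_mul]
  intro h
  simpa using congrArg FreeMonoid.length h

theorem residual_letter_self (a : A) : residual a (letter a : NCSeries A k) = 1 := by
  ext w
  by_cases hw : w = 1
  · subst hw
    rw [one_apply_nil]
    exact if_pos rfl
  · refine Eq.trans (if_neg ?_) (if_neg hw).symm
    rw [← mul_one (FreeMonoid.of a)]
    intro h
    rw [mul_one (FreeMonoid.of a)] at h
    exact hw (by simpa using (h.trans (mul_one _).symm))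

theorem residual_letter_ne {a b : A} (h : a ≠ b) : residual a (letter b : NCSeries A k) = 0 := by
  ext w
  refine if_neg fun e => h ?_
  have : a :: w.toList = [b] := e
  exact (List.cons.inj this).1

theorem residual_mul (a : A) (f g : NCSeries A k) :
    residual a (f * g) = f 1 • residual a g + residual a f * g := by
  ext w
  exact mul_apply_cons f g a w

theorem letter_one (a : A) : (letter a : NCSeries A k) 1 = 0 := by
  simpa using letter_mul_nil (k := k) a 1

theorem letter_mul_cons_self (a : A) (f : NCSeries A k) (w : FreeMonoid A) :
    (letter a * f : NCSeries A k) (FreeMonoid.of a * w) = f w := by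
  rw [mul_apply_cons, letter_one, zero_mul, zero_add, residual_letter_self, one_mul]

theorem letter_mul_cons_ne {a b : A} (h : b ≠ a) (f : NCSeries A k) (w : FreeMonoid A) :
    (letter a * f : NCSeries A k) (FreeMonoid.of b * w) = 0 := by
  rw [mul_apply_cons, letter_one, zero_mul, zero_add, residual_letter_ne h, zero_mul, zero_apply]

theorem letter_mul_word (a : A) (w : FreeMonoid A) :
    (letter a * word w : NCSeries A k) = word (FreeMonoid.of a * w) := by
  ext v
  induction v using FreeMonoid.inductionOn' with
  | one =>
    rw [letter_mul_nil, word_ne]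
    intro h
    have := congrArg FreeMonoid.length h
    rw [FreeMonoid.length_mul, FreeMonoid.length_of, FreeMonoid.length_one] at this
    omega
  | of_mul b v _ =>
    by_cases hb : b = a
    · subst hb
      rw [letter_mul_cons_self]
      by_cases hv : v = w
      · rw [hv, word_self, word_self]
      · rw [word_ne hv, word_ne (fun h => hv (mul_left_cancel h))]
    · rw [letter_mul_cons_ne hb, word_ne]
      intro h
      exact hb (List.cons.inj h).1

theorem word_mul_word (u v : FreeMonoid A) :
    (word u * word v : NCSeries A k) = word (u * v) := by
  induction u using FreeMonoid.inductionOn' with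
  | one => rw [word_one, one_mul, one_mul]
  | of_mul a u ih => rw [← letter_mul_word, mul_assoc, ih, letter_mul_word, mul_assoc]

/-- The right-hand counterpart of `mul_apply_cons`. The induction still peels letters from the left,
so `f` has to vary through its residuals. -/
theorem mul_apply_snoc (f g : NCSeries A k) (a : A) (w : FreeMonoid A) :
    (f * g) (w * FreeMonoid.of a) = f (w * FreeMonoid.of a) * g 1 +
      (f * (show NCSeries A k from fun v => g (v * FreeMonoid.of a)) : NCSeries A k) w := by
  induction w using FreeMonoid.inductionOn' generalizing f with
  | one =>
    rw [one_mul, ← mul_one (FreeMonoid.of a), mul_apply_cons, mul_apply_nil, mul_apply_nil,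
      mul_one, one_mul, add_comm]
    rfl
  | of_mul b w ih =>
    rw [mul_assoc, mul_apply_cons, ih, mul_apply_cons, ← mul_assoc]
    simp only [residual, mul_assoc]
    ring

/-- A continuous linear map that is multiplicative on words is multiplicative. -/
theorem cts_mul_ext {F : NCSeries A k → NCSeries B k}
    (hF : Cts (W := FreeMonoid A) (V := FreeMonoid B) F) (h1 : F 1 = 1)
    (hm : ∀ (a : A) (w : FreeMonoid A), F (word (FreeMonoid.of a * w)) =
      F (letter a) * F (word w)) (f g : NCSeries A k) : F (f * g) = F f * F g := by
  refine Cts.ext (hF.comp (cts_mul_right g)) ((cts_mul_right (F g)).comp hF) (fun u => ?_) f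
  refine Cts.ext (hF.comp (cts_mul_left (word u))) ((cts_mul_left (F (word u))).comp hF)
    (fun v => ?_) g
  change F (word u * word v) = F (word u) * F (word v)
  rw [word_mul_word]
  induction u using FreeMonoid.inductionOn' with
  | one => rw [word_one, h1, one_mul, one_mul]
  | of_mul a u ih => rw [mul_assoc, hm, ih, hm, mul_assoc]

end Words

/-! ### Order of a family -/

section Order

variable {W k : Type*} [CommRing k]

/-- The families supported in degrees `≥ n`. -/
def ordGE (k : Type*) [CommRing k] (deg : W → ℕ) (n : ℕ) : Submodule k (W → k) where
  carrier := {f | ∀ w, deg w < n → f w = 0}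
  zero_mem' := fun _ _ => rfl
  add_mem' := fun {f g} hf hg w hw => by simp [hf w hw, hg w hw]
  smul_mem' := fun c f hf w hw => by simp [hf w hw]

theorem ordGE_anti {deg : W → ℕ} {m n : ℕ} (h : m ≤ n) : ordGE k deg n ≤ ordGE k deg m :=
  fun _ hf w hw => hf w (hw.trans_le h)

theorem mem_ordGE_zero {deg : W → ℕ} (f : W → k) : f ∈ ordGE k deg 0 :=
  fun _ h => absurd h (Nat.not_lt_zero _)

theorem eq_of_forall_ordGE {deg : W → ℕ} {f g : W → k} (h : ∀ n, f - g ∈ ordGE k deg n) :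
    f = g := funext fun w => sub_eq_zero.1 (h (deg w + 1) w (Nat.lt_succ_self _))

theorem mul_mem_ordGE {A : Type*} {deg : FreeMonoid A → ℕ}
    (hdeg : ∀ u v, deg (u * v) = deg u + deg v) {m n : ℕ} {f g : NCSeries A k}
    (hf : f ∈ ordGE k deg m) (hg : g ∈ ordGE k deg n) :
    (f * g : NCSeries A k) ∈ ordGE k deg (m + n) := by
  intro w hw
  refine Finset.sum_eq_zero fun i _ => ?_
  have h : deg (FreeMonoid.ofList (w.toList.take i)) + deg (FreeMonoid.ofList (w.toList.drop i))
      = deg w := by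
    rw [← hdeg, ← FreeMonoid.ofList_append, List.take_append_drop, FreeMonoid.ofList_toList]
  rcases lt_or_ge (deg (FreeMonoid.ofList (w.toList.take i))) m with h1 | h1
  · rw [hf _ h1, zero_mul]
  · rw [hg _ (by omega), mul_zero]

end Order

/-! ### Substitutions and derivations -/

section Subst

variable {A B k : Type*} [CommRing k]

/-- Every letter contributes at least one degree. Over a finite alphabet this leaves finitely many
words that contribute to a given coefficient, which makes `subst` continuous. -/
theorem lift_mem_ordGE {g : A → NCSeries B k} (hg : ∀ a, g a 1 = 0) (w : FreeMonoid A) :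
    FreeMonoid.lift g w ∈ ordGE k FreeMonoid.length w.length := by
  induction w using FreeMonoid.inductionOn' with
  | one => exact mem_ordGE_zero _
  | of_mul a w ih =>
    rw [map_mul, FreeMonoid.lift_eval_of, FreeMonoid.length_mul, FreeMonoid.length_of]
    refine mul_mem_ordGE FreeMonoid.length_mul (fun v hv => ?_) ih
    rw [FreeMonoid.length_eq_zero.1 (Nat.lt_one_iff.1 hv), hg]

theorem finite_length_le [Finite A] (n : ℕ) : {w : FreeMonoid A | w.length ≤ n}.Finite :=
  List.finite_length_le A n

theorem cts_subst [Finite A] {g : A → NCSeries B k} (hg : ∀ a, g a 1 = 0) :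
    Cts (W := FreeMonoid A) (V := FreeMonoid B) (subst g) := by
  refine cts_extend fun v => (finite_length_le v.length).subset fun w hw => ?_
  by_contra h
  exact hw (lift_mem_ordGE hg w v (not_le.1 h))

theorem subst_word (g : A → NCSeries B k) (w : FreeMonoid A) :
    subst g (word w) = FreeMonoid.lift g w := extend_word _ w

theorem subst_letter (g : A → NCSeries B k) (a : A) : subst g (letter a) = g a := by
  rw [letter, subst_word, FreeMonoid.lift_eval_of]

theorem subst_one (g : A → NCSeries B k) : subst g 1 = 1 := by
  rw [← word_one, subst_word, map_one]

theorem subst_mul [Finite A] {g : A → NCSeries B k} (hg : ∀ a, g a 1 = 0) (f h : NCSeries A k) :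
    subst g (f * h) = subst g f * subst g h :=
  cts_mul_ext (cts_subst hg) (subst_one g)
    (fun a w => by rw [subst_word, map_mul, FreeMonoid.lift_eval_of, subst_letter, subst_word]) f h

/-- A continuous multiplicative map is a substitution. -/
theorem eq_subst [Finite A] {g : A → NCSeries B k} (hg : ∀ a, g a 1 = 0)
    {F : NCSeries A k → NCSeries B k} (hF : Cts (W := FreeMonoid A) (V := FreeMonoid B) F)
    (h1 : F 1 = 1) (hm : ∀ (a : A) (f : NCSeries A k), F (letter a * f) = g a * F f)
    (f : NCSeries A k) : F f = subst g f := by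
  refine Cts.ext hF (cts_subst hg) (fun w => ?_) f
  induction w using FreeMonoid.inductionOn' with
  | one => exact h1.trans (subst_one g).symm
  | of_mul a w ih =>
    rw [← letter_mul_word, hm, ih, subst_mul hg, subst_letter]

/-- The Leibniz rule replaces one letter by a series that may have a constant term, as for `∂_{x₀}`,
so at most one unit of length is lost. This is the finiteness behind the continuity of `der`. -/
theorem length_le_of_derWord_ne_zero {D : A → NCSeries A k} {l : List A} {v : FreeMonoid A}
    (h : derWord D l v ≠ 0) : l.length ≤ v.length + 1 := by
  induction l generalizing v with
  | nil => simp
  | cons a l ih =>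
    rw [derWord, add_apply] at h
    by_contra hlen
    simp only [List.length_cons, not_le] at hlen
    apply h
    have h1 : (D a * word (FreeMonoid.ofList l) : NCSeries A k) v = 0 := by
      refine mul_mem_ordGE (m := 0) (n := l.length) FreeMonoid.length_mul (mem_ordGE_zero _)
        (fun u hu => word_ne ?_) v (by omega)
      rintro rfl
      exact lt_irrefl _ hu
    have h2 : (letter a * derWord D l : NCSeries A k) v = 0 := by
      induction v using FreeMonoid.inductionOn' with
      | one => exact letter_mul_nil _ _
      | of_mul b v _ =>
        by_cases hb : b = a
        · subst hb
          rw [letter_mul_cons_self]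
          by_contra h0
          have := ih h0
          simp only [FreeMonoid.length_mul, FreeMonoid.length_of] at hlen
          omega
        · exact letter_mul_cons_ne hb _ _
    rw [h1, h2, add_zero]

theorem cts_der [Finite A] (D : A → NCSeries A k) : 
    Cts (W := FreeMonoid A) (V := FreeMonoid A) (der D) :=
  cts_extend fun v => (finite_length_le (v.length + 1)).subset fun _ hw => length_le_of_derWord_ne_zero hw

theorem der_word (D : A → NCSeries A k) (w : FreeMonoid A) :
    der D (word w) = derWord D w.toList := extend_word _ w

theorem der_one (D : A → NCSeries A k) : der D (1 : NCSeries A k) = 0 := der_word D 1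

theorem der_letter (D : A → NCSeries A k) (a : A) : der D (letter a) = D a := by
  rw [letter, der_word]
  change D a * word 1 + letter a * 0 = D a
  rw [word_one, mul_one, mul_zero, add_zero]

theorem der_letter_mul_word (D : A → NCSeries A k) (a : A) (w : FreeMonoid A) :
    der D (letter a * word w) = D a * word w + letter a * der D (word w) := by
  rw [letter_mul_word, der_word, der_word]
  rfl

theorem der_letter_mul [Finite A] (D : A → NCSeries A k) (a : A) (f : NCSeries A k) :
    der D (letter a * f) = D a * f + letter a * der D f :=
  Cts.ext ((cts_der D).comp (cts_mul_left _))
    ((cts_mul_left (D a)).add ((cts_mul_left (letter a)).comp (cts_der D)))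
    (fun w => der_letter_mul_word D a w) f

theorem der_mul [Finite A] (D : A → NCSeries A k) (f g : NCSeries A k) :
    der D (f * g) = der D f * g + f * der D g := by
  refine Cts.ext ((cts_der D).comp (cts_mul_right g))
    (((cts_mul_right g).comp (cts_der D)).add (cts_mul_right (der D g))) (fun w => ?_) f
  change der D (word w * g) = der D (word w) * g + (word w : NCSeries A k) * der D g
  induction w using FreeMonoid.inductionOn' with
  | one => rw [word_one, der_one, one_mul, one_mul, zero_mul, zero_add]
  | of_mul a w ih =>
    rw [← letter_mul_word, mul_assoc, der_letter_mul, ih, der_letter_mul]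
    simp only [mul_add, add_mul, mul_assoc, add_assoc]

end Subst

end NCSeries

end DoubleShuffle
end

noncomputable section

namespace DoubleShuffle

/-! ### Sums and exponentials in filtered spaces -/

section Filtered

variable {M M₁ M₂ M₃ : Type*} [AddCommGroup M] [Module ℚ M] [AddCommGroup M₁] [Module ℚ M₁]
  [AddCommGroup M₂] [Module ℚ M₂] [AddCommGroup M₃] [Module ℚ M₃]

/-- `f` is the sum of the sequence `u` for the topology of the filtration `O`. -/
def HasFSum (O : ℕ → Submodule ℚ M) (u : ℕ → M) (f : M) : Prop :=
  ∀ N, f - ∑ n ∈ Finset.range N, u n ∈ O N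

/-- The filtration `O` is separated. -/
def FSep (O : ℕ → Submodule ℚ M) : Prop := ∀ f, (∀ n, f ∈ O n) → f = 0

theorem HasFSum.unique {O : ℕ → Submodule ℚ M} (hO : FSep O) {u : ℕ → M} {f g : M}
    (hf : HasFSum O u f) (hg : HasFSum O u g) : f = g := by
  refine sub_eq_zero.1 (hO _ fun N => ?_)
  have := sub_mem (hf N) (hg N)
  rwa [sub_sub_sub_cancel_right] at this

theorem HasFSum.map {O : ℕ → Submodule ℚ M} {O₁ : ℕ → Submodule ℚ M₁} {u : ℕ → M} {f : M}
    (h : HasFSum O u f) (F : M →ₗ[ℚ] M₁) (hF : ∀ n, ∀ x ∈ O n, F x ∈ O₁ n) :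
    HasFSum O₁ (fun n => F (u n)) (F f) := fun N => by
  have := hF N _ (h N)
  rwa [map_sub, map_sum] at this

theorem HasFSum.add {O : ℕ → Submodule ℚ M} {u v : ℕ → M} {f g : M}
    (hf : HasFSum O u f) (hg : HasFSum O v g) : HasFSum O (fun n => u n + v n) (f + g) :=
  fun N => by
    rw [Finset.sum_add_distrib, add_sub_add_comm]
    exact add_mem (hf N) (hg N)

/-- The square and the triangular partial sums of a double series differ by terms with `i + j ≥ N`.
This is the estimate behind every Cauchy product of exponentials. -/
theorem sum_range_sum_range_sub_mem {O : ℕ → Submodule ℚ M} (hanti : Antitone O)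
    {G : ℕ → ℕ → M} (hG : ∀ i j, G i j ∈ O (i + j)) (N : ℕ) :
    ∑ i ∈ Finset.range N, ∑ j ∈ Finset.range N, G i j -
      ∑ n ∈ Finset.range N, ∑ p ∈ Finset.HasAntidiagonal.antidiagonal n, G p.1 p.2 ∈ O N := by
  rw [← Finset.sum_product', Finset.sum_sigma', ← Finset.sum_filter_add_sum_filter_not
    (Finset.range N ×ˢ Finset.range N) fun p => p.1 + p.2 < N]
  have h : ∑ p ∈ (Finset.range N ×ˢ Finset.range N).filter (fun p => p.1 + p.2 < N), G p.1 p.2 =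
      ∑ x ∈ (Finset.range N).sigma fun n => Finset.HasAntidiagonal.antidiagonal n, G x.2.1 x.2.2 := by
    refine Finset.sum_bij' (fun p _ => ⟨p.1 + p.2, p⟩) (fun x _ => x.2) ?_ ?_ ?_ ?_ ?_
    · intro p hp
      simp only [Finset.mem_filter] at hp
      simpa using hp.2
    · rintro ⟨n, p⟩ hx
      simp only [Finset.mem_sigma, Finset.mem_range, Finset.HasAntidiagonal.mem_antidiagonal] at hx
      simp only [Finset.mem_filter, Finset.mem_product, Finset.mem_range]
      omega
    · intro p _
      rfl
    · rintro ⟨n, p⟩ hx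
      simp only [Finset.mem_sigma, Finset.HasAntidiagonal.mem_antidiagonal] at hx
      obtain ⟨_, rfl⟩ := hx
      rfl
    · intro p _
      rfl
  rw [h, add_sub_cancel_left]
  refine Submodule.sum_mem _ fun p hp => ?_
  simp only [Finset.mem_filter, not_lt] at hp
  exact hanti hp.2 (hG _ _)

/-- `g` is the value at `f` of the exponential of the operator `s`. -/
def IsExp (O : ℕ → Submodule ℚ M) (s : Module.End ℚ M) (f g : M) : Prop :=
  HasFSum O (fun n => (n.factorial : ℚ)⁻¹ • (s ^ n) f) g

/-- The operator `s` raises degrees. -/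
def Raises (O : ℕ → Submodule ℚ M) (s : Module.End ℚ M) : Prop :=
  ∀ n, ∀ f ∈ O n, s f ∈ O (n + 1)

theorem Raises.pow_mem {O : ℕ → Submodule ℚ M} {s : Module.End ℚ M} (hs : Raises O s)
    {m : ℕ} {f : M} (hf : f ∈ O m) (n : ℕ) : (s ^ n) f ∈ O (n + m) := by
  induction n with
  | zero => simpa using hf
  | succ n ih =>
    rw [pow_succ', Module.End.mul_apply, Nat.succ_add]
    exact hs _ _ ih

theorem IsExp.map {O : ℕ → Submodule ℚ M} {O₁ : ℕ → Submodule ℚ M₁} {s : Module.End ℚ M}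
    {s₁ : Module.End ℚ M₁} {f g : M} (h : IsExp O s f g) (F : M →ₗ[ℚ] M₁)
    (hF : ∀ n, ∀ x ∈ O n, F x ∈ O₁ n) (hs : ∀ x, F (s x) = s₁ (F x)) :
    IsExp O₁ s₁ (F f) (F g) := by
  have key : ∀ n, F ((s ^ n) f) = (s₁ ^ n) (F f) := by
    intro n
    induction n with
    | zero => rfl
    | succ n ih => rw [pow_succ', Module.End.mul_apply, hs, ih, pow_succ', Module.End.mul_apply]
  have := HasFSum.map h F hF
  simp only [map_smul, key] at this
  exact this

/-- On the tensor product the operators `s ⊗ 1` and `1 ⊗ d` commute, so the binomial theorem applies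
there; the map induced by `B` intertwines their sum with `S`. -/
theorem pow_apply_bilin {S : Module.End ℚ M₃} {s : Module.End ℚ M₁} {d : Module.End ℚ M₂}
    (B : M₁ →ₗ[ℚ] M₂ →ₗ[ℚ] M₃) (h : ∀ u v, S (B u v) = B (s u) v + B u (d v)) (n : ℕ)
    (f : M₁) (g : M₂) : (n.factorial : ℚ)⁻¹ • (S ^ n) (B f g) =
      ∑ p ∈ Finset.HasAntidiagonal.antidiagonal n, B ((p.1.factorial : ℚ)⁻¹ • (s ^ p.1) f)
        ((p.2.factorial : ℚ)⁻¹ • (d ^ p.2) g) := by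
  have key : (S ^ n) (B f g) = ∑ p ∈ Finset.HasAntidiagonal.antidiagonal n,
      (n.choose p.1 : ℚ) • B ((s ^ p.1) f) ((d ^ p.2) g) := by
    have hc : Commute (LinearMap.rTensor M₂ s) (LinearMap.lTensor M₁ d) := by
      refine TensorProduct.ext' fun x y => ?_
      simp
    have hL : ∀ x, S (TensorProduct.lift B x) =
        TensorProduct.lift B ((LinearMap.rTensor M₂ s + LinearMap.lTensor M₁ d) x) := by
      intro x
      induction x using TensorProduct.induction_on with
      | zero => simp
      | tmul x y => simp [h]
      | add x y hx hy => simp only [map_add, hx, hy]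
    have hL' : ∀ n x, (S ^ n) (TensorProduct.lift B x) = TensorProduct.lift B
        (((LinearMap.rTensor M₂ s + LinearMap.lTensor M₁ d) ^ n) x) := by
      intro n x
      induction n with
      | zero => rfl
      | succ n ih =>
        rw [pow_succ', Module.End.mul_apply, ih, hL, pow_succ', Module.End.mul_apply]
    have := hL' n (f ⊗ₜ g)
    rw [hc.add_pow', TensorProduct.lift.tmul] at this
    rw [this, LinearMap.sum_apply, map_sum]
    refine Finset.sum_congr rfl fun p _ => ?_
    rw [LinearMap.rTensor_pow, LinearMap.lTensor_pow, LinearMap.smul_apply, map_nsmul]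
    simp [Nat.cast_smul_eq_nsmul]
  rw [key, Finset.smul_sum]
  refine Finset.sum_congr rfl fun p hp => ?_
  rw [map_smul, map_smul, LinearMap.smul_apply, smul_smul, smul_smul]
  congr 1
  rw [Finset.HasAntidiagonal.mem_antidiagonal] at hp
  subst hp
  rw [Nat.cast_add_choose]
  have h1 := Nat.cast_ne_zero (R := ℚ).2 (p.1 + p.2).factorial_ne_zero
  field_simp

/-- The exponential of a derivation-like operator is multiplicative. -/
theorem IsExp.bilin {O₁ : ℕ → Submodule ℚ M₁} {O₂ : ℕ → Submodule ℚ M₂}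
    {O₃ : ℕ → Submodule ℚ M₃} (hanti : Antitone O₃) (h₁0 : ∀ f, f ∈ O₁ 0) (h₂0 : ∀ f, f ∈ O₂ 0)
    {S : Module.End ℚ M₃} {s : Module.End ℚ M₁} {d : Module.End ℚ M₂} (hs : Raises O₁ s)
    (hd : Raises O₂ d) (B : M₁ →ₗ[ℚ] M₂ →ₗ[ℚ] M₃)
    (hB : ∀ i j, ∀ x ∈ O₁ i, ∀ y ∈ O₂ j, B x y ∈ O₃ (i + j))
    (h : ∀ u v, S (B u v) = B (s u) v + B u (d v)) {u f : M₁} {v g : M₂}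
    (hf : IsExp O₁ s u f) (hg : IsExp O₂ d v g) : IsExp O₃ S (B u v) (B f g) := by
  intro N
  simp only [pow_apply_bilin B h]
  have hG : ∀ i j, B ((i.factorial : ℚ)⁻¹ • (s ^ i) u) ((j.factorial : ℚ)⁻¹ • (d ^ j) v) ∈
      O₃ (i + j) := fun i j => hB _ _ _ (Submodule.smul_mem _ _ (hs.pow_mem (h₁0 u) i)) _
        (Submodule.smul_mem _ _ (hd.pow_mem (h₂0 v) j))
  -- With partial sums `f_N`, `g_N`, the difference to be bounded is `B(f - f_N, g) + B(f_N, g -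
  -- g_N)` plus the square minus the triangle.
  have h1 := sum_range_sum_range_sub_mem hanti hG N
  have h2 := hB _ _ _ (hf N) _ (h₂0 g)
  have h3 := hB 0 N (∑ i ∈ Finset.range N, (i.factorial : ℚ)⁻¹ • (s ^ i) u) (h₁0 _) _ (hg N)
  rw [zero_add] at h3
  rw [add_zero] at h2
  have h4 := add_mem (add_mem h2 h3) h1
  simp only [map_sub, map_sum, LinearMap.sub_apply, LinearMap.sum_apply] at h4 ⊢
  convert h4 using 1
  rw [Finset.sum_comm (s := Finset.range N) (t := Finset.range N)]
  abel

theorem pow_apply_commute {a b : Module.End ℚ M} (hab : Commute a b) (n : ℕ) (u : M) :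
    (n.factorial : ℚ)⁻¹ • ((a + b) ^ n) u = ∑ p ∈ Finset.HasAntidiagonal.antidiagonal n,
      (p.1.factorial : ℚ)⁻¹ • (a ^ p.1) ((p.2.factorial : ℚ)⁻¹ • (b ^ p.2) u) := by
  rw [hab.add_pow', LinearMap.sum_apply, Finset.smul_sum]
  refine Finset.sum_congr rfl fun p hp => ?_
  rw [LinearMap.smul_apply, Module.End.mul_apply, map_smul, smul_smul, ← Nat.cast_smul_eq_nsmul ℚ,
    smul_smul]
  congr 1
  rw [Finset.HasAntidiagonal.mem_antidiagonal] at hp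
  subst hp
  rw [Nat.cast_add_choose]
  have h1 := Nat.cast_ne_zero (R := ℚ).2 (p.1 + p.2).factorial_ne_zero
  field_simp

theorem IsExp.mem_of_mem {O : ℕ → Submodule ℚ M} (hanti : Antitone O) {a : Module.End ℚ M}
    (ha : Raises O a) {N : ℕ} {f g : M} (hf : f ∈ O N) (h : IsExp O a f g) : g ∈ O N := by
  have h1 := h N
  rw [← sub_add_cancel g (∑ n ∈ Finset.range N, (n.factorial : ℚ)⁻¹ • (a ^ n) f)]
  exact add_mem h1 (Submodule.sum_mem _ fun n _ => Submodule.smul_mem _ _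
    (hanti (Nat.le_add_left _ _) (ha.pow_mem hf n)))

/-- Exponentials of commuting operators compose. -/
theorem IsExp.commute {O : ℕ → Submodule ℚ M} (hanti : Antitone O) (h0 : ∀ f, f ∈ O 0)
    {a b : Module.End ℚ M} (ha : Raises O a) (hb : Raises O b) (hab : Commute a b) {u f g : M}
    (hf : IsExp O b u f) (hg : IsExp O a f g) : IsExp O (a + b) u g := by
  intro N
  simp only [pow_apply_commute hab]
  have hG : ∀ i j, (i.factorial : ℚ)⁻¹ • (a ^ i) ((j.factorial : ℚ)⁻¹ • (b ^ j) u) ∈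
      O (i + j) := fun i j => Submodule.smul_mem _ _ (ha.pow_mem
        (Submodule.smul_mem _ _ (hb.pow_mem (h0 u) j)) i)
  -- The remainder splits into that of `exp(a)` at `f`, the truncation of `exp(a)` applied to the
  -- remainder of `exp(b)` at `u`, and the square minus the triangle.
  have h1 := sum_range_sum_range_sub_mem hanti hG N
  have h2 := hg N
  have h3 : ∑ i ∈ Finset.range N, (i.factorial : ℚ)⁻¹ • (a ^ i)
      (f - ∑ j ∈ Finset.range N, (j.factorial : ℚ)⁻¹ • (b ^ j) u) ∈ O N :=
    Submodule.sum_mem _ fun i _ => Submodule.smul_mem _ _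
      (hanti (Nat.le_add_left _ _) (ha.pow_mem (hf N) i))
  have h4 := add_mem (add_mem h2 h3) h1
  convert h4 using 1
  simp only [map_sub, map_sum, smul_sub, Finset.smul_sum, Finset.sum_sub_distrib]
  abel

theorem IsExp.zero {O : ℕ → Submodule ℚ M} (h0 : ∀ f, f ∈ O 0) (u : M) :
    IsExp O (0 : Module.End ℚ M) u u := by
  intro N
  cases N with
  | zero => exact h0 _
  | succ N =>
    rw [Finset.sum_range_succ', Finset.sum_eq_zero fun i _ => by simp]
    simp

theorem IsExp.unique {O : ℕ → Submodule ℚ M} (hO : FSep O) {s : Module.End ℚ M} {f g h : M}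
    (hg : IsExp O s f g) (hh : IsExp O s f h) : g = h := HasFSum.unique hO hg hh

end Filtered

/-! ### Degree filtrations of series and their exponentials -/

namespace NCSeries

variable {W A k : Type*} [CommRing k] [Algebra ℚ k]

/-- The families supported in degrees `≥ n`, as a rational subspace. -/
def fil (k : Type*) [CommRing k] [Algebra ℚ k] (deg : W → ℕ) (n : ℕ) : Submodule ℚ (W → k) :=
  (ordGE k deg n).restrictScalars ℚ

theorem fil_sep (deg : W → ℕ) : FSep (fil k deg) :=
  fun _ h => funext fun w => h (deg w + 1) w (Nat.lt_succ_self _)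

theorem fil_anti (deg : W → ℕ) : Antitone (fil k deg) := fun _ _ h => ordGE_anti h

theorem fil_zero (deg : W → ℕ) (f : W → k) : f ∈ fil k deg 0 := mem_ordGE_zero f

/-- The filtration of `k⟨⟨A⟩⟩` attached to a degree. -/
def sfil (k : Type*) [CommRing k] [Algebra ℚ k] (deg : FreeMonoid A → ℕ) (n : ℕ) :
    Submodule ℚ (NCSeries A k) := fil k deg n

theorem sfil_sep (deg : FreeMonoid A → ℕ) : FSep (sfil k deg) := fil_sep deg

theorem sfil_anti (deg : FreeMonoid A → ℕ) : Antitone (sfil k deg) := fil_anti deg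

theorem sfil_zero (deg : FreeMonoid A → ℕ) (f : NCSeries A k) : f ∈ sfil k deg 0 :=
  fil_zero deg f

theorem hasFSum_lsum {deg : FreeMonoid A → ℕ} {F : ℕ → NCSeries A k}
    (h : ∀ n, F n ∈ sfil k deg n) : HasFSum (sfil k deg) F (lsum F) := by
  intro N w hw
  change (∑ᶠ n, F n w) - (∑ n ∈ Finset.range N, F n) w = 0
  rw [sum_apply, finsum_eq_sum_of_support_subset (s := Finset.range N), sub_self]
  intro n hn
  simp only [Finset.coe_range, Set.mem_Iio]
  by_contra hN
  exact hn (h n w (hw.trans_le (not_lt.1 hN)))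

theorem isExp_expOp {deg : FreeMonoid A → ℕ} {s : Module.End ℚ (NCSeries A k)}
    (hs : Raises (sfil k deg) s) (f : NCSeries A k) :
    IsExp (sfil k deg) s f (expOp s f) := by
  have := hasFSum_lsum (deg := deg) (F := fun n => (n.factorial : ℚ)⁻¹ • (s ^ n) f)
    fun n => Submodule.smul_mem _ _ (hs.pow_mem (sfil_zero deg f) n)
  unfold IsExp expOp
  simpa only [Module.End.pow_apply] using this

instance : IsScalarTower ℚ (NCSeries A k) (NCSeries A k) :=
  ⟨fun q f g => by
    have h : ∀ h : NCSeries A k, q • h = algebraMap ℚ k q • h := fun h => by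
      ext w
      exact (algebraMap_smul k q (h w)).symm
    simp only [smul_eq_mul, h, smul_mul_assoc]⟩

instance : SMulCommClass ℚ (NCSeries A k) (NCSeries A k) :=
  ⟨fun q f g => by
    have h : ∀ h : NCSeries A k, q • h = algebraMap ℚ k q • h := fun h => by
      ext w
      exact (algebraMap_smul k q (h w)).symm
    simp only [smul_eq_mul, h, mul_smul_comm]⟩

/-- Left multiplication, as a rational operator. -/
def mulL (f : NCSeries A k) : Module.End ℚ (NCSeries A k) := LinearMap.mulLeft ℚ f

@[simp] theorem mulL_apply (f g : NCSeries A k) : mulL f g = f * g := rfl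

theorem mulL_pow_apply (f g : NCSeries A k) (n : ℕ) : (mulL f ^ n) g = f ^ n * g := by
  rw [mulL, LinearMap.pow_mulLeft]
  rfl

theorem mul_mem_sfil {deg : FreeMonoid A → ℕ} (hdeg : ∀ u v, deg (u * v) = deg u + deg v)
    {m n : ℕ} {f g : NCSeries A k} (hf : f ∈ sfil k deg m) (hg : g ∈ sfil k deg n) :
    f * g ∈ sfil k deg (m + n) := mul_mem_ordGE hdeg hf hg

theorem raises_mulL {deg : FreeMonoid A → ℕ} (hdeg : ∀ u v, deg (u * v) = deg u + deg v)
    {f : NCSeries A k} (hf : f ∈ sfil k deg 1) : Raises (sfil k deg) (mulL f) := by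
  intro n g hg
  rw [add_comm]
  exact mul_mem_sfil hdeg hf hg

theorem isExp_expS_mul {deg : FreeMonoid A → ℕ} (hdeg : ∀ u v, deg (u * v) = deg u + deg v)
    {c : NCSeries A k} (hc : c ∈ sfil k deg 1) (f : NCSeries A k) :
    IsExp (sfil k deg) (mulL c) f (expS c * f) := by
  have hp : ∀ n, c ^ n ∈ sfil k deg n := by
    intro n
    induction n with
    | zero => exact sfil_zero deg _
    | succ n ih =>
      rw [pow_succ]
      exact mul_mem_sfil hdeg ih hc
  have h1 := hasFSum_lsum (deg := deg) (F := fun n => (n.factorial : ℚ)⁻¹ • c ^ n)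
    fun n => Submodule.smul_mem _ _ (hp n)
  have h2 := h1.map (LinearMap.mulRight ℚ f) (O₁ := sfil k deg)
    fun n x hx => by simpa using mul_mem_sfil hdeg hx (sfil_zero deg f )
  simp only [LinearMap.mulRight_apply, smul_mul_assoc] at h2
  simp only [IsExp, mulL_pow_apply]
  exact h2

theorem isExp_expS {deg : FreeMonoid A → ℕ} (hdeg : ∀ u v, deg (u * v) = deg u + deg v)
    {c : NCSeries A k} (hc : c ∈ sfil k deg 1) :
    IsExp (sfil k deg) (mulL c) 1 (expS c) := by
  simpa using isExp_expS_mul hdeg hc 1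

/-- Left multiplications by commuting series commute, so their exponentials compose; both sides are
then values at `1` of one exponential. -/
theorem expS_add {deg : FreeMonoid A → ℕ} (hdeg : ∀ u v, deg (u * v) = deg u + deg v)
    {c d : NCSeries A k} (hc : c ∈ sfil k deg 1) (hd : d ∈ sfil k deg 1) (hcd : c * d = d * c) :
    expS (c + d) = expS c * expS d := by
  have h1 := isExp_expS hdeg (add_mem hc hd)
  have h2 := (isExp_expS hdeg hd).commute (sfil_anti deg) (sfil_zero deg) (raises_mulL hdeg hc)
    (raises_mulL hdeg hd) (by
      refine LinearMap.ext fun x => ?_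
      simp only [Module.End.mul_apply, mulL_apply, ← mul_assoc, hcd]) (isExp_expS_mul hdeg hc _)
  refine IsExp.unique (sfil_sep deg) h1 ?_
  convert h2 using 1
  exact LinearMap.ext fun x => by simp [add_mul]

/-- The inverse is the geometric series of `1 - f`, which has no constant term. -/
theorem isUnit_of_apply_one {A k : Type*} [CommRing k] [Algebra ℚ k] {f : NCSeries A k}
    (hf : f 1 = 1) : IsUnit f := by
  set u : NCSeries A k := 1 - f
  have hu : u ∈ sfil k FreeMonoid.length 1 := fun w hw => by
    rw [FreeMonoid.length_eq_zero.1 (Nat.lt_one_iff.1 hw)]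
    change (1 : NCSeries A k) 1 - f 1 = 0
    rw [one_apply_nil, hf, sub_self]
  have hp : ∀ n, u ^ n ∈ sfil k FreeMonoid.length n := by
    intro n
    induction n with
    | zero => exact sfil_zero _ _
    | succ n ih =>
      rw [pow_succ]
      exact mul_mem_sfil FreeMonoid.length_mul ih hu
  have h1 := hasFSum_lsum hp
  have hfu : f = 1 - u := (sub_sub_cancel 1 f).symm
  have hl : f * lsum (fun n => u ^ n) = 1 := by
    refine sub_eq_zero.1 (sfil_sep FreeMonoid.length _ fun N => ?_)
    have h2 := mul_mem_sfil FreeMonoid.length_mul (sfil_zero _ f ) (h1 N)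
    rw [zero_add, mul_sub] at h2
    have h3 : f * ∑ n ∈ Finset.range N, u ^ n = 1 - u ^ N := by
      rw [hfu, mul_neg_geom_sum]
    rw [h3, ← sub_add] at h2
    simpa using sub_mem h2 (hp N)
  have hr : lsum (fun n => u ^ n) * f = 1 := by
    refine sub_eq_zero.1 (sfil_sep FreeMonoid.length _ fun N => ?_)
    have h2 := mul_mem_sfil FreeMonoid.length_mul (h1 N) (sfil_zero _ f )
    rw [add_zero, sub_mul] at h2
    have h3 : (∑ n ∈ Finset.range N, u ^ n) * f = 1 - u ^ N := by
      rw [hfu, geom_sum_mul_neg]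
    rw [h3, ← sub_add] at h2
    simpa using sub_mem h2 (hp N)
  exact ⟨⟨f, _, hl, hr⟩, rfl⟩

end NCSeries

end DoubleShuffle
end

noncomputable section

namespace DoubleShuffle

/-! ### Quasi-shuffles of lists

`stf op ε P u v` is the sum of the values of `P` over the quasi-shuffles of `u` and `v`, where a
contraction replaces letters `a`, `b` by `op a b` and has weight `ε`. -/

section QuasiShuffle

variable {A k : Type*} [CommRing k]

/-- Sum of `P` over the quasi-shuffles of two lists. -/
def stf (op : A → A → A) (ε : k) : (List A → k) → List A → List A → k
  | P, [], v => P v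
  | P, a :: u, [] => P (a :: u)
  | P, a :: u, b :: v => stf op ε (fun w => P (a :: w)) u (b :: v) +
      stf op ε (fun w => P (b :: w)) (a :: u) v + ε * stf op ε (fun w => P (op a b :: w)) u v
termination_by _ u v => u.length + v.length

/-- Sum of `P` over the contractions of the list `g :: r`. -/
def contrAux (op : A → A → A) (ε : k) : (List A → k) → A → List A → k
  | P, g, [] => P [g]
  | P, g, b :: r => contrAux op ε (fun w => P (g :: w)) b r + ε * contrAux op ε P (op g b) r

/-- Sum of `P` over the contractions of a list. -/
def contr (op : A → A → A) (ε : k) (P : List A → k) : List A → k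
  | [] => P []
  | g :: r => contrAux op ε P g r

/-- Sum of `P` over the quasi-shuffles, that start with a contraction of letters of `g :: r`
beginning with `g`, of a contraction of `g :: r` and of `q`. -/
def startAux (op : A → A → A) (ε : k) : (List A → k) → A → List A → List A → k
  | P, g, [], q => P (g :: q)
  | P, g, b :: r, q => contrAux op ε (fun c => stf op ε (fun w => P (g :: w)) c q) b r +
      ε * startAux op ε P (op g b) r q

variable {op : A → A → A} {ε : k}

@[simp] theorem stf_nil_left (P : List A → k) (v : List A) : stf op ε P [] v = P v := by
  rw [stf]

@[simp] theorem stf_nil_right (P : List A → k) (u : List A) : stf op ε P u [] = P u := by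
  cases u <;> rw [stf]

theorem stf_cons_cons (P : List A → k) (a b : A) (u v : List A) :
    stf op ε P (a :: u) (b :: v) = stf op ε (fun w => P (a :: w)) u (b :: v) +
      stf op ε (fun w => P (b :: w)) (a :: u) v + ε * stf op ε (fun w => P (op a b :: w)) u v := by
  rw [stf]

/-- Induction principle for pairs of lists. -/
theorem pair_induction {p : List A → List A → Prop} (hl : ∀ v, p [] v) (hr : ∀ u, p u [])
    (hc : ∀ a u b v, p u (b :: v) → p (a :: u) v → p u v → p (a :: u) (b :: v)) (u v : List A) :
    p u v := by
  induction u generalizing v with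
  | nil => exact hl v
  | cons a u ihu =>
    induction v with
    | nil => exact hr _
    | cons b v ihv => exact hc a u b v (ihu _) ihv (ihu _)

theorem finForm_stf (u v : List A) : NCSeries.FinForm fun P : List A → k => stf op ε P u v := by
  refine pair_induction (p := fun u v => NCSeries.FinForm fun P : List A → k => stf op ε P u v)
    (fun v => ?_) (fun u => ?_) (fun a u b v h1 h2 h3 => ?_) u v
  · simpa using NCSeries.FinForm.eval v
  · simpa using NCSeries.FinForm.eval u
  · simp only [stf_cons_cons]
    exact ((h1.comp (NCSeries.Cts.precomp (a :: ·))).add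
      (h2.comp (NCSeries.Cts.precomp (b :: ·)))).add
      ((h3.comp (NCSeries.Cts.precomp (op a b :: ·))).const_mul ε)

/-- Quasi-shuffles, read from the last letters. -/
theorem stf_concat_concat (a b : A) (u v : List A) (P : List A → k) :
    stf op ε P (u ++ [a]) (v ++ [b]) = stf op ε (fun w => P (w ++ [a])) u (v ++ [b]) +
      stf op ε (fun w => P (w ++ [b])) (u ++ [a]) v +
      ε * stf op ε (fun w => P (w ++ [op a b])) u v := by
  refine pair_induction (p := fun u v => ∀ P : List A → k,
    stf op ε P (u ++ [a]) (v ++ [b]) = stf op ε (fun w => P (w ++ [a])) u (v ++ [b]) +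
      stf op ε (fun w => P (w ++ [b])) (u ++ [a]) v +
      ε * stf op ε (fun w => P (w ++ [op a b])) u v) (fun v => ?_) (fun u => ?_)
    (fun c u d v h1 h2 h3 P => ?_) u v P
  · induction v with
    | nil =>
      intro P
      simp only [List.nil_append, stf_cons_cons, stf_nil_left, stf_nil_right, List.cons_append]
      ring
    | cons d v ih =>
      intro P
      simp only [List.nil_append, List.cons_append, stf_cons_cons, stf_nil_left] at ih ⊢
      rw [ih]
      ring
  · induction u with
    | nil =>
      intro P
      simp only [List.nil_append, stf_cons_cons, stf_nil_left, stf_nil_right, List.cons_append]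
      ring
    | cons d u ih =>
      intro P
      simp only [List.nil_append, List.cons_append, stf_cons_cons, stf_nil_right] at ih ⊢
      rw [ih]
      ring
  · simp only [List.cons_append, stf_cons_cons] at h1 h2 h3 ⊢
    rw [h1, h2, h3]
    ring

theorem stf_reverse (u v : List A) (P : List A → k) :
    stf op ε (fun w => P w.reverse) u.reverse v.reverse = stf op ε P u v := by
  refine pair_induction (p := fun u v => ∀ P : List A → k,
    stf op ε (fun w => P w.reverse) u.reverse v.reverse = stf op ε P u v) (fun v P => ?_)
    (fun u P => ?_) (fun a u b v h1 h2 h3 P => ?_) u v P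
  · simp
  · simp
  · rw [List.reverse_cons, List.reverse_cons, stf_concat_concat, stf_cons_cons]
    simp only [List.reverse_append, List.reverse_cons, List.reverse_nil, List.nil_append,
      List.singleton_append]
    rw [← h1, ← h2, ← h3]
    simp only [List.reverse_cons]

theorem stf_map {B : Type*} {op' : B → B → B} (φ : A → B)
    (hφ : ∀ a b, φ (op a b) = op' (φ a) (φ b)) (u v : List A) (P : List B → k) :
    stf op ε (fun w => P (w.map φ)) u v = stf op' ε P (u.map φ) (v.map φ) := by
  refine pair_induction (p := fun u v => ∀ P : List B → k,
    stf op ε (fun w => P (w.map φ)) u v = stf op' ε P (u.map φ) (v.map φ)) (fun v P => ?_)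
    (fun u P => ?_) (fun a u b v h1 h2 h3 P => ?_) u v P
  · simp
  · simp
  · simp only [List.map_cons, stf_cons_cons, hφ]
    rw [← h3, ← List.map_cons, ← h1, ← List.map_cons, ← h2]

theorem contrAux_add (P Q : List A → k) (g : A) (r : List A) :
    contrAux op ε (fun w => P w + Q w) g r = contrAux op ε P g r + contrAux op ε Q g r := by
  induction r generalizing g P Q with
  | nil => rfl
  | cons b r ih =>
    simp only [contrAux, ih]
    ring

theorem contrAux_mul (c : k) (P : List A → k) (g : A) (r : List A) :
    contrAux op ε (fun w => c * P w) g r = c * contrAux op ε P g r := by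
  induction r generalizing g P with
  | nil => rfl
  | cons b r ih =>
    simp only [contrAux, ih]
    ring

theorem contr_mul (c : k) (P : List A → k) (r : List A) :
    contr op ε (fun w => c * P w) r = c * contr op ε P r := by
  cases r with
  | nil => rfl
  | cons g r => exact contrAux_mul c P g r

theorem contrAux_zero_weight (P : List A → k) (g : A) (r : List A) :
    contrAux op 0 P g r = P (g :: r) := by
  induction r generalizing g P with
  | nil => rfl
  | cons b r ih => simp only [contrAux, ih, zero_mul, add_zero]

theorem contr_zero_weight (P : List A → k) (r : List A) : contr op 0 P r = P r := by
  cases r with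
  | nil => rfl
  | cons g r => exact contrAux_zero_weight P g r

/-- The last two letters are kept apart or merged. The definition merges from the left, so
associativity is needed to perform the last merging first. -/
theorem contrAux_concat (hassoc : ∀ a b c, op (op a b) c = op a (op b c)) (x y g : A) (r : List A) (P : List A → k) :
    contrAux op ε P g (r ++ [x, y]) = contrAux op ε (fun w => P (w ++ [y])) g (r ++ [x]) +
      ε * contrAux op ε P g (r ++ [op x y]) := by
  induction r generalizing g P with
  | nil =>
    simp only [List.nil_append, contrAux, List.cons_append, hassoc]
    ring
  | cons b r ih =>
    simp only [List.cons_append, contrAux, ih]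
    ring

theorem contr_concat (hassoc : ∀ a b c, op (op a b) c = op a (op b c)) (x y : A) (r : List A)
    (P : List A → k) :
    contr op ε P (r ++ [x, y]) = contr op ε (fun w => P (w ++ [y])) (r ++ [x]) +
      ε * contr op ε P (r ++ [op x y]) := by
  cases r with
  | nil => rfl
  | cons g r => exact contrAux_concat hassoc x y g r P

theorem contr_reverse (hcomm : ∀ a b, op a b = op b a)
    (hassoc : ∀ a b c, op (op a b) c = op a (op b c)) (r : List A) (P : List A → k) :
    contr op ε (fun w => P w.reverse) r.reverse = contr op ε P r := by
  -- Induction on the length, since the merged list `op a b :: r` is not a sublist of `a :: b :: r`.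
  suffices h : ∀ n, ∀ r : List A, r.length = n → ∀ P : List A → k,
      contr op ε (fun w => P w.reverse) r.reverse = contr op ε P r from h _ r rfl P
  intro n
  induction n with
  | zero =>
    intro r hr P
    rw [List.length_eq_zero_iff.1 hr]
    rfl
  | succ n ih =>
    rintro (_ | ⟨a, _ | ⟨b, r⟩⟩) hr P
    · simp at hr
    · rfl
    · have e : (a :: b :: r).reverse = r.reverse ++ [b, a] := by simp
      rw [e, contr_concat hassoc]
      have h1 := ih (b :: r) (by simpa using hr) (fun w => P (a :: w))
      have h2 := ih (op a b :: r) (by simpa using hr) P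
      rw [List.reverse_cons] at h1 h2
      simp only [List.reverse_append, List.reverse_cons, List.reverse_nil, List.nil_append,
        List.singleton_append]
      rw [h1, hcomm b a, h2]
      rfl

theorem contr_map {B : Type*} {op' : B → B → B} (φ : A → B)
    (hφ : ∀ a b, φ (op a b) = op' (φ a) (φ b)) (r : List A) (P : List B → k) :
    contr op ε (fun w => P (w.map φ)) r = contr op' ε P (r.map φ) := by
  cases r with
  | nil => rfl
  | cons g r =>
    simp only [contr, List.map_cons]
    induction r generalizing g P with
    | nil => rfl
    | cons b r ih =>
      have := ih (fun w => P (φ g :: w)) b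
      simp only [contrAux, List.map_cons, ih, hφ, this]

theorem startAux_nil (P : List A → k) (g : A) (r : List A) :
    startAux op ε P g r [] = contrAux op ε P g r := by
  induction r generalizing g with
  | nil => rfl
  | cons b r ih => simp only [startAux, contrAux, ih, stf_nil_right]

/-- The quasi-shuffles of contractions of `g :: r` with `b :: q` are sorted by their first letter:
either it is made of letters of `g :: r` alone, or it involves `b`, possibly merged with a beginning
of `g :: r`. -/
theorem contrAux_stf (hcomm : ∀ a b, op a b = op b a)
    (hassoc : ∀ a b c, op (op a b) c = op a (op b c)) (P : List A → k) (g b : A) (r q : List A) :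
    contrAux op ε (fun c => stf op ε P c (b :: q)) g r =
      startAux op ε P g r (b :: q) + startAux op ε P b (g :: r) q := by
  induction r generalizing g with
  | nil =>
    simp only [contrAux, startAux, stf_cons_cons, stf_nil_left, hcomm g b]
    ring
  | cons h r ih =>
    simp only [contrAux, stf_cons_cons, contrAux_add, contrAux_mul, ih]
    simp only [startAux, contrAux, hcomm g b, hassoc]
    ring

/-- A family whose sums over quasi-shuffles of nonempty lists vanish. -/
def ShPrim (op : A → A → A) (ε : k) (P : List A → k) : Prop :=
  P [] = 0 ∧ ∀ u v, u ≠ [] → v ≠ [] → stf op ε P u v = 0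

theorem contr_eq_zero {P : List A → k} (h : ∀ w, w ≠ [] → P w = 0) (g : A) (r : List A) :
    contrAux op ε P g r = 0 := by
  induction r generalizing g P with
  | nil => exact h _ (by simp)
  | cons b r ih =>
    simp only [contrAux]
    rw [ih (P := fun w => P (g :: w)) (fun w _ => h _ (by simp)), ih h]
    ring

/-- For a primitive family the left side of `contrAux_stf` vanishes, so moving the first letter of
`q` to the front of `g :: r` changes the sign. Iteration empties `q` and reverses it. -/
theorem ShPrim.startAux_eq (hcomm : ∀ a b, op a b = op b a)
    (hassoc : ∀ a b c, op (op a b) c = op a (op b c)) {P : List A → k} (hP : ShPrim op ε P)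
    (g : A) (r q : List A) :
    startAux op ε P g r q = (-1) ^ q.length * contr op ε P (q.reverse ++ g :: r) := by
  induction q generalizing g r with
  | nil => simp [startAux_nil, contr]
  | cons b q ih =>
    have h1 := contrAux_stf (ε := ε) hcomm hassoc P g b r q
    rw [contr_eq_zero (fun w hw => hP.2 w _ hw (by simp))] at h1
    rw [eq_neg_of_add_eq_zero_left h1.symm, ih, List.length_cons, pow_succ, List.reverse_cons,
      List.append_assoc, List.singleton_append]
    ring

/-- The antipode of a primitive family. -/
theorem ShPrim.antipode (hcomm : ∀ a b, op a b = op b a)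
    (hassoc : ∀ a b c, op (op a b) c = op a (op b c)) {P : List A → k} (hP : ShPrim op ε P)
    (b : A) (q : List A) :
    P (b :: q) = (-1) ^ q.length * contr op ε P (b :: q).reverse := by
  have := hP.startAux_eq hcomm hassoc b [] q
  rw [startAux] at this
  rw [this, List.reverse_cons]

/-- In the antipode formula for `w ++ [x, y]`, the contractions that merge `y` with `x` are those of
the list ending in `op x y`, with the opposite sign. They cancel, and only those that begin with a
bare `y` remain. -/
theorem ShPrim.reverse_antipode (hcomm : ∀ a b, op a b = op b a)
    (hassoc : ∀ a b c, op (op a b) c = op a (op b c)) {P : List A → k} (hP : ShPrim op ε P)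
    (w : List A) (x y : A) :
    P (w ++ [x, y]) + ε * P (w ++ [op x y]) =
      (-1) ^ (w.length + 1) * contr op ε (fun c => P (y :: c)) (w ++ [x]).reverse := by
  have h0 : ∀ v : List A, v ≠ [] → P v = (-1) ^ (v.length + 1) * contr op ε P v.reverse := by
    intro v hv
    cases v with
    | nil => exact absurd rfl hv
    | cons b q =>
      rw [hP.antipode hcomm hassoc, List.length_cons, pow_succ, pow_succ]
      ring
  rw [h0 (w ++ [x, y]) (by simp), h0 (w ++ [op x y]) (by simp)]
  simp only [List.reverse_append, List.reverse_cons, List.reverse_nil, List.nil_append,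
    List.cons_append, contr, contrAux, List.length_append, List.length_cons, List.length_nil]
  rw [hcomm y x]
  ring

end QuasiShuffle

end DoubleShuffle
end

noncomputable section

namespace DoubleShuffle

/-! ### Lists of letters `y_{n,ν}` -/

section YLists

variable {G k : Type*} [CommGroup G] [CommRing k]

/-- Contraction of two letters. -/
def yop (a b : YL G) : YL G := (a.1 + b.1, a.2 * b.2)

theorem yop_comm (a b : YL G) : yop a b = yop b a := by
  simp only [yop, add_comm, mul_comm]

theorem yop_assoc (a b c : YL G) : yop (yop a b) c = yop a (yop b c) := by
  simp only [yop, add_assoc, mul_assoc]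

/-- The letter `y_{n,ν⁻¹}`. -/
def yinv (a : YL G) : YL G := (a.1, a.2⁻¹)

theorem yinv_yop (a b : YL G) : yinv (yop a b) = yop (yinv a) (yinv b) := by
  simp only [yinv, yop, mul_inv]

theorem yinv_yinv (a : YL G) : yinv (yinv a) = a := by simp [yinv]

/-- The weight of a list. -/
def wtL (w : List (YL G)) : ℕ := (w.map fun y => (y.1 : ℕ)).sum

/-- The product of the group elements of a list. -/
def totL (w : List (YL G)) : G := (w.map fun y => y.2).prod

/-- Reversal of a list with inversion of the group elements. -/
def iota (w : List (YL G)) : List (YL G) := (w.map yinv).reverse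

/-- The letter `y_{v+1,μ}`. -/
def yl (v : ℕ) (μ : G) : YL G := (v.succPNat, μ)

@[simp] theorem wtL_nil : wtL ([] : List (YL G)) = 0 := rfl

@[simp] theorem wtL_cons (a : YL G) (w : List (YL G)) : wtL (a :: w) = a.1 + wtL w := by
  simp [wtL]

@[simp] theorem wtL_append (u v : List (YL G)) : wtL (u ++ v) = wtL u + wtL v := by
  simp [wtL]

@[simp] theorem totL_nil : totL ([] : List (YL G)) = 1 := rfl

@[simp] theorem totL_cons (a : YL G) (w : List (YL G)) : totL (a :: w) = a.2 * totL w := by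
  simp [totL]

@[simp] theorem totL_append (u v : List (YL G)) : totL (u ++ v) = totL u * totL v := by
  simp [totL]

@[simp] theorem wtL_reverse (w : List (YL G)) : wtL w.reverse = wtL w := by
  simp [wtL, List.sum_reverse]

@[simp] theorem totL_reverse (w : List (YL G)) : totL w.reverse = totL w :=
  ((List.reverse_perm w).map _).prod_eq

@[simp] theorem wtL_iota (w : List (YL G)) : wtL (iota w) = wtL w := by
  rw [iota, wtL_reverse, wtL, List.map_map]
  rfl

@[simp] theorem totL_iota (w : List (YL G)) : totL (iota w) = (totL w)⁻¹ := by
  rw [iota, totL_reverse]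
  induction w with
  | nil => simp
  | cons a w ih => simp [ih, yinv, mul_comm]

@[simp] theorem iota_nil : iota ([] : List (YL G)) = [] := rfl

@[simp] theorem iota_cons (a : YL G) (w : List (YL G)) : iota (a :: w) = iota w ++ [yinv a] := by
  simp [iota]

@[simp] theorem iota_append (u v : List (YL G)) : iota (u ++ v) = iota v ++ iota u := by
  simp [iota]

@[simp] theorem iota_iota (w : List (YL G)) : iota (iota w) = w := by
  induction w with
  | nil => rfl
  | cons a w ih => simp [ih, yinv_yinv]

@[simp] theorem length_iota (w : List (YL G)) : (iota w).length = w.length := by simp [iota]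

@[simp] theorem iota_eq_nil {w : List (YL G)} : iota w = [] ↔ w = [] := by simp [iota]

@[simp] theorem yl_fst (v : ℕ) (μ : G) : ((yl v μ).1 : ℕ) = v + 1 := rfl

@[simp] theorem yl_snd (v : ℕ) (μ : G) : (yl v μ).2 = μ := rfl

@[simp] theorem yinv_yl (v : ℕ) (μ : G) : yinv (yl v μ) = yl v μ⁻¹ := rfl

@[simp] theorem yinv_fst (a : YL G) : (yinv a).1 = a.1 := rfl

@[simp] theorem yinv_snd (a : YL G) : (yinv a).2 = a.2⁻¹ := rfl

@[simp] theorem yop_fst (a b : YL G) : ((yop a b).1 : ℕ) = a.1 + b.1 := rfl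

@[simp] theorem yop_snd (a b : YL G) : (yop a b).2 = a.2 * b.2 := rfl

theorem exists_yl (a : YL G) : ∃ v μ, a = yl v μ :=
  ⟨a.1.natPred, a.2, by
    obtain ⟨n, ν⟩ := a
    simp [yl]⟩

theorem yop_yl (a b : ℕ) (μ ν : G) : yop (yl a μ) (yl b ν) = yl (a + b + 1) (μ * ν) := by
  refine Prod.ext (PNat.coe_injective ?_) rfl
  simp only [yop_fst, yl_fst]
  ring

theorem neg_one_pow_eq {a b : ℕ} (h : a % 2 = b % 2) : (-1 : k) ^ a = (-1) ^ b := by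
  rw [neg_one_pow_eq_pow_mod_two, h, ← neg_one_pow_eq_pow_mod_two]

theorem contr_congr {ε : k} {P Q : List (YL G) → k} {w : List (YL G)}
    (h : ∀ c, wtL c = wtL w → totL c = totL w → P c = Q c) :
    contr yop ε P w = contr yop ε Q w := by
  cases w with
  | nil => exact h _ rfl rfl
  | cons g r =>
    simp only [contr]
    induction r generalizing g P Q with
    | nil => exact h _ rfl rfl
    | cons b r ih =>
      simp only [contrAux]
      congr 1
      · refine ih b fun c h1 h2 => h _ ?_ ?_
        · simp only [wtL_cons] at h1 ⊢
          rw [h1]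
        · simp only [totL_cons] at h2 ⊢
          rw [h2]
      · congr 1
        refine ih _ fun c h1 h2 => h _ ?_ ?_
        · simp only [wtL_cons, yop_fst] at h1 ⊢
          rw [h1, add_assoc]
        · simp only [totL_cons, yop_snd] at h2 ⊢
          rw [h2, mul_assoc]

/-- Quasi-shuffling preserves the weight and the product of the labels. The length is preserved only
if no letters merge, whence the clause for `ε = 0`. -/
theorem stf_congr {ε : k} {u v : List (YL G)} {P Q : List (YL G) → k}
    (h : ∀ c, wtL c = wtL u + wtL v → totL c = totL u * totL v →
      (ε = 0 → c.length = u.length + v.length) → P c = Q c) :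
    stf yop ε P u v = stf yop ε Q u v := by
  refine pair_induction (p := fun u v => ∀ P Q : List (YL G) → k,
    (∀ c, wtL c = wtL u + wtL v → totL c = totL u * totL v →
      (ε = 0 → c.length = u.length + v.length) → P c = Q c) →
    stf yop ε P u v = stf yop ε Q u v) (fun v P Q h => ?_) (fun u P Q h => ?_)
    (fun a u b v h1 h2 h3 P Q h => ?_) u v P Q h
  · simpa using h v (by simp) (by simp) (by simp)
  · simpa using h u (by simp) (by simp) (by simp)
  · rw [stf_cons_cons, stf_cons_cons]
    congr 1
    · congr 1
      · refine h1 _ _ fun c h4 h5 h6 => h _ ?_ ?_ ?_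
        · simp only [wtL_cons] at h4 ⊢
          omega
        · simp only [totL_cons] at h5 ⊢
          rw [h5, mul_assoc]
        · intro h7
          have := h6 h7
          simp only [List.length_cons] at this ⊢
          omega
      · refine h2 _ _ fun c h4 h5 h6 => h _ ?_ ?_ ?_
        · simp only [wtL_cons] at h4 ⊢
          omega
        · simp only [totL_cons] at h5 ⊢
          rw [h5, mul_left_comm]
        · intro h7
          have := h6 h7
          simp only [List.length_cons] at this ⊢
          omega
    · by_cases hε : ε = 0
      · rw [hε, zero_mul, zero_mul]
      · congr 1
        refine h3 _ _ fun c h4 h5 _ => h _ ?_ ?_ fun h7 => absurd h7 hε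
        · simp only [wtL_cons, yop_fst] at h4 ⊢
          omega
        · simp only [totL_cons, yop_snd] at h5 ⊢
          rw [h5, mul_mul_mul_comm]

theorem stf_mul {A : Type*} {op : A → A → A} {ε : k} (c : k) (P : List A → k) (u v : List A) :
    stf op ε (fun w => c * P w) u v = c * stf op ε P u v :=
  (finForm_stf u v).map_smul c P

theorem stf_add {A : Type*} {op : A → A → A} {ε : k} (P Q : List A → k) (u v : List A) :
    stf op ε (fun w => P w + Q w) u v = stf op ε P u v + stf op ε Q u v :=
  (finForm_stf u v).map_add P Q

theorem stf_iota {ε : k} (P : List (YL G) → k) (u v : List (YL G)) :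
    stf yop ε (fun w => P (iota w)) u v = stf yop ε P (iota u) (iota v) := by
  have := stf_map (ε := ε) (op := yop) (op' := yop) yinv yinv_yop u v (fun w => P w.reverse)
  refine this.trans ?_
  rw [← stf_reverse (iota u) (iota v) P, iota, iota, List.reverse_reverse, List.reverse_reverse]

/-- Merged terms are strictly shorter than the plain shuffles. In an induction on length this turns
quasi-shuffle relations into shuffle relations. -/
theorem stf_zero_weight {A : Type*} {op : A → A → A} {P : List A → k} {u v : List A} {ε : k}
    (h : ∀ c, c.length < u.length + v.length → P c = 0) :
    stf op ε P u v = stf op 0 P u v := by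
  refine pair_induction (p := fun u v => ∀ P : List A → k,
    (∀ c, c.length < u.length + v.length → P c = 0) → stf op ε P u v = stf op 0 P u v)
    (fun v P h => ?_) (fun u P h => ?_) (fun a u b v h1 h2 h3 P h => ?_) u v P h
  · simp
  · simp
  · rw [stf_cons_cons, stf_cons_cons]
    rw [h1 (fun w => P (a :: w)) fun c hc => h _ (by simp only [List.length_cons] at hc ⊢; omega),
      h2 (fun w => P (b :: w)) fun c hc => h _ (by simp only [List.length_cons] at hc ⊢; omega)]
    -- No quasi-shuffle of `u` and `v` is longer than the two lists together.
    have h4 : ∀ (e : k) (Q : List A → k), (∀ c, c.length ≤ u.length + v.length → Q c = 0) →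
        stf op e Q u v = 0 := by
      intro e
      clear h h1 h2 h3
      refine pair_induction (p := fun u v => ∀ Q : List A → k,
        (∀ c, c.length ≤ u.length + v.length → Q c = 0) → stf op e Q u v = 0)
        (fun v Q h => ?_) (fun u Q h => ?_) (fun a u b v h1 h2 h3 Q h => ?_) u v
      · simpa using h v (by simp)
      · simpa using h u (by simp)
      · rw [stf_cons_cons, h1, h2, h3]
        · ring
        all_goals
          intro c hc
          apply h
          simp only [List.length_cons] at hc ⊢
          omega
    rw [h4 ε _ fun c hc => h _ (by simp only [List.length_cons] at hc ⊢; omega),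
      h4 0 _ fun c hc => h _ (by simp only [List.length_cons] at hc ⊢; omega), mul_zero, mul_zero]

end YLists

/-! ### Families with dihedral symmetry -/

section Dihedral

variable {G k : Type*} [CommGroup G] [CommRing k]

/-- The combinatorial content of the double shuffle relations for the family of the coefficients
`P j w` of the words `w x₀^j` of a series in the kernel of `∂_{x₀}`. -/
structure DihedralFamily (P : ℕ → List (YL G) → k) : Prop where
  prim : ∀ j, ShPrim yop 1 (P j)
  rev : ∀ j m μ w, P j (yl m μ :: w) =
    (-1) ^ (wtL w + m + j) * P m (yl j (μ * totL w) :: iota w)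
  parity : ∀ j y, P j [y] + (-1) ^ (y.1 + j) * P j [yinv y] = 0

/-- Sum over the two ways to attach a letter to the end of a list. -/
def snoc2 (F : List (YL G) → k) (w : List (YL G)) (y : YL G) : k :=
  match w.reverse with
  | [] => F [y]
  | x :: r => F (r.reverse ++ [x, y]) + F (r.reverse ++ [yop x y])

/-- Sum over the two ways to attach a letter to the beginning of a list. -/
def cons2 (F : List (YL G) → k) (y : YL G) : List (YL G) → k
  | [] => F [y]
  | x :: r => F (y :: x :: r) + F (yop y x :: r)

@[simp] theorem snoc2_concat (F : List (YL G) → k) (w : List (YL G)) (x y : YL G) :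
    snoc2 F (w ++ [x]) y = F (w ++ [x, y]) + F (w ++ [yop x y]) := by
  simp [snoc2]

/-- The sums `∑_i P_{l+i} Y_i`. -/
def lastSum (P : ℕ → List (YL G) → k) (l : ℕ) (w : List (YL G)) : k :=
  match w.reverse with
  | [] => 0
  | x :: r => P l w + P (l + x.1) r.reverse

@[simp] theorem lastSum_nil (P : ℕ → List (YL G) → k) (l : ℕ) : lastSum P l [] = 0 := rfl

@[simp] theorem lastSum_concat (P : ℕ → List (YL G) → k) (l : ℕ) (w : List (YL G)) (x : YL G) :
    lastSum P l (w ++ [x]) = P l (w ++ [x]) + P (l + x.1) w := by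
  simp [lastSum]

/-- The image of `lastSum` under the reversal of lists. -/
def firstSum (P : ℕ → List (YL G) → k) (l : ℕ) (w : List (YL G)) : k :=
  (-1) ^ (l + 1 + wtL w) * lastSum P l (iota w)

/-- The defect of symmetry of `lastSum`. -/
def defect (P : ℕ → List (YL G) → k) (l : ℕ) (w : List (YL G)) : k :=
  lastSum P l w - firstSum P l w

theorem eq_nil_or_concat' (w : List (YL G)) : w = [] ∨ ∃ v x, w = v ++ [x] := by
  rcases List.eq_nil_or_concat w with h | ⟨v, x, h⟩
  · exact Or.inl h
  · exact Or.inr ⟨v, x, by simpa using h⟩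

/-- Removal of the attached letter raises the index by `m + 1`, removal of the merged letter by `m +
1` plus the weight of the last letter of `w`. The two leftovers recombine into a `lastSum` at index
`l + m + 1`. -/
theorem snoc2_lastSum (P : ℕ → List (YL G) → k) (l m : ℕ) (κ : G) {w : List (YL G)}
    (hw : w ≠ []) : snoc2 (lastSum P l) w (yl m κ) =
      snoc2 (P l) w (yl m κ) + lastSum P (l + m + 1) w := by
  obtain ⟨v, x, rfl⟩ := (eq_nil_or_concat' w).resolve_left hw
  have h1 : v ++ [x, yl m κ] = (v ++ [x]) ++ [yl m κ] := by simp
  rw [snoc2_concat, snoc2_concat, h1, lastSum_concat, lastSum_concat, lastSum_concat, yl_fst,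
    yop_fst, yl_fst, ← add_assoc l m 1, show l + ((x.1 : ℕ) + (m + 1)) = l + m + 1 + x.1 by ring]
  ring

namespace DihedralFamily

variable {P : ℕ → List (YL G) → k}

/-- By `ShPrim.reverse_antipode`, attaching a letter at the end is a signed sum over contractions of
lists that begin with it, where `rev` applies. Contractions commute with the inversion of labels and
with reversal, so the outcome has the same shape again. -/
theorem snoc2_eq (hP : DihedralFamily P) (j m : ℕ) (κ : G) {w : List (YL G)} (hw : w ≠ []) :
    snoc2 (P j) w (yl m κ) =
      (-1) ^ (wtL w + m + j) * snoc2 (P m) (iota w) (yl j (κ * totL w)) := by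
  have key : ∀ (i : ℕ) (y : YL G) (u : List (YL G)), u ≠ [] → snoc2 (P i) u y =
      (-1) ^ u.length * contr yop 1 (fun c => P i (y :: c)) u.reverse := by
    intro i y u hu
    obtain ⟨v, x, rfl⟩ := (eq_nil_or_concat' u).resolve_left hu
    have := (hP.prim i).reverse_antipode yop_comm yop_assoc v x y
    rw [one_mul] at this
    rw [snoc2_concat, this, List.length_append, List.length_singleton]
  rw [key _ _ _ hw, key _ _ _ (by simpa using hw), length_iota, mul_left_comm]
  congr 1
  have h1 : contr yop 1 (fun c => P j (yl m κ :: c)) w.reverse = contr yop 1 (fun c =>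
      (-1) ^ (wtL w + m + j) * P m (yl j (κ * totL w) :: iota c)) w.reverse := by
    refine contr_congr fun c h1 h2 => ?_
    rw [hP.rev, h1, h2, wtL_reverse, totL_reverse]
  rw [h1, contr_mul]
  congr 1
  have h2 := contr_map (ε := (1 : k)) (op := yop) (op' := yop) yinv yinv_yop w.reverse
    (fun c => P m (yl j (κ * totL w) :: c.reverse))
  refine h2.trans ?_
  rw [List.map_reverse]
  have h3 := contr_reverse (ε := (1 : k)) yop_comm yop_assoc (w.map yinv)
    (fun c => P m (yl j (κ * totL w) :: c))
  rw [h3, iota, List.reverse_reverse]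

/-- Under `rev` the index `l` becomes a first letter `y_{l+1}`, and the last letter `y_{i+1}`
becomes the index `i`. The label of the new first letter is the one for which the product of all
labels is `1`: the lists are cyclic words with one letter hidden in the index. -/
theorem firstSum_concat (hP : DihedralFamily P) (l i : ℕ) (κ : G) (w : List (YL G)) :
    firstSum P l (w ++ [yl i κ]) = cons2 (P i) (yl l (totL w * κ)⁻¹) w := by
  have h0 := (hP.prim (l + (i + 1))).1
  cases w with
  | nil =>
    have h1 : iota ([] ++ [yl i κ]) = [] ++ [yl i κ⁻¹] := by simp
    rw [firstSum, h1, lastSum_concat, List.nil_append, yl_fst, List.nil_append, h0, add_zero, hP.rev l i]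
    simp only [cons2, iota_nil, totL_nil, wtL_cons, wtL_nil, yl_fst, mul_one,
      one_mul]
    rw [← mul_assoc, ← pow_add, neg_one_pow_eq (b := 0) (by omega), pow_zero, one_mul]
  | cons x w =>
    obtain ⟨a, α, rfl⟩ := exists_yl x
    have h1 : iota (yl a α :: w ++ [yl i κ]) = (yl i κ⁻¹ :: iota w) ++ [yl a α⁻¹] := by simp
    have h2 : κ⁻¹ * totL (iota w ++ [yl a α⁻¹]) = (totL (yl a α :: w) * κ)⁻¹ := by
      simp [mul_comm]
    have h3 : κ⁻¹ * totL (iota w) = (totL (yl a α :: w) * κ)⁻¹ * α := by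
      simp only [totL_iota, totL_cons, yl_snd, mul_inv]
      rw [mul_comm, mul_right_comm, mul_comm α⁻¹, inv_mul_cancel_right]
    rw [firstSum, h1, lastSum_concat, yl_fst, List.cons_append (a := yl i κ⁻¹), hP.rev l i,
      hP.rev (l + (a + 1)) i, h2, h3]
    simp only [cons2, yop_yl, iota_append, iota_cons, iota_nil, iota_iota, yinv_yl, inv_inv,
      List.nil_append, List.cons_append, wtL_cons, wtL_append, wtL_nil,
      wtL_iota, yl_fst]
    rw [mul_add, ← mul_assoc, ← mul_assoc, ← pow_add, ← pow_add, Even.neg_one_pow,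
      Even.neg_one_pow]
    · simp only [one_mul, add_assoc]
    all_goals
      rw [Nat.even_iff]
      omega

theorem cons2_lastSum (hP : DihedralFamily P) (l m : ℕ) (κ : G) {w : List (YL G)}
    (hw : w ≠ []) : cons2 (lastSum P m) (yl l (totL w * κ)⁻¹) w =
      snoc2 (firstSum P l) w (yl m κ) := by
  obtain ⟨v, x, rfl⟩ := (eq_nil_or_concat' w).resolve_left hw
  obtain ⟨i, μ, rfl⟩ := exists_yl x
  have h1 : v ++ [yl i μ, yl m κ] = (v ++ [yl i μ]) ++ [yl m κ] := by simp
  rw [snoc2_concat, h1, firstSum_concat hP, yop_yl, firstSum_concat hP]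
  have h2 : totL (v ++ [yl i μ]) = totL v * μ := by simp
  rw [h2, mul_assoc (totL v) μ κ]
  generalize (totL v * (μ * κ))⁻¹ = ρ
  have e : m + (i + 1) = i + m + 1 := by ring
  cases v with
  | nil =>
    have h3 : [yl l ρ, yl i μ] = [yl l ρ] ++ [yl i μ] := rfl
    have h4 : lastSum P m [yop (yl l ρ) (yl i μ)] = P m [yop (yl l ρ) (yl i μ)] := by
      have := lastSum_concat P m [] (yop (yl l ρ) (yl i μ))
      rwa [(hP.prim _).1, add_zero] at this
    simp only [cons2, List.nil_append]
    rw [h4, h3, lastSum_concat, yl_fst, e]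
    ring
  | cons a v =>
    have h3 : yl l ρ :: a :: (v ++ [yl i μ]) = (yl l ρ :: a :: v) ++ [yl i μ] := rfl
    have h4 : yop (yl l ρ) a :: (v ++ [yl i μ]) = (yop (yl l ρ) a :: v) ++ [yl i μ] := rfl
    simp only [cons2, List.cons_append]
    rw [h3, h4, lastSum_concat, lastSum_concat, yl_fst, e]
    simp only [List.cons_append]
    ring

theorem cons2_firstSum (hP : DihedralFamily P) (l m : ℕ) (κ : G) {w : List (YL G)}
    (hw : w ≠ []) : cons2 (firstSum P m) (yl l (totL w * κ)⁻¹) w =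
      snoc2 (P l) w (yl m κ) + firstSum P (m + l + 1) w := by
  have h1 : ∀ ρ : G, cons2 (firstSum P m) (yl l ρ) w =
      (-1) ^ (m + l + wtL w) * snoc2 (lastSum P m) (iota w) (yl l ρ⁻¹) := by
    intro ρ
    cases w with
    | nil => exact absurd rfl hw
    | cons x w =>
      simp only [cons2, firstSum, iota_cons, snoc2_concat, wtL_cons, yop_fst, yl_fst, yinv_yop,
        yinv_yl, List.append_assoc, List.singleton_append]
      rw [yop_comm, mul_add, neg_one_pow_eq (b := m + l + (x.1 + wtL w)),
        neg_one_pow_eq (a := m + 1 + (l + 1 + x.1 + wtL w)) (b := m + l + (x.1 + wtL w))]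
      all_goals omega
  rw [h1, inv_inv, snoc2_lastSum _ _ _ _ (by simpa using hw), hP.snoc2_eq l m κ hw, mul_add,
    firstSum, mul_comm κ]
  congr 2
  all_goals exact neg_one_pow_eq (by omega)

/-- A `lastSum` with a letter attached in front is a `firstSum` with a letter attached at the end,
so these contributions cancel. The terms `snoc2 (P l)` cancel as well, and one defect with a larger
index is left. Up to merged and shorter terms, the defect is thus antisymmetric under rotation of
the cyclic word. -/
theorem rotation (hP : DihedralFamily P) (l m : ℕ) (κ : G) {w : List (YL G)} (hw : w ≠ []) :
    snoc2 (defect P l) w (yl m κ) + cons2 (defect P m) (yl l (totL w * κ)⁻¹) w =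
      defect P (m + l + 1) w := by
  have h1 : snoc2 (defect P l) w (yl m κ) =
      snoc2 (lastSum P l) w (yl m κ) - snoc2 (firstSum P l) w (yl m κ) := by
    obtain ⟨v, x, rfl⟩ := (eq_nil_or_concat' w).resolve_left hw
    simp only [snoc2_concat, defect]
    ring
  have h2 : ∀ y, cons2 (defect P m) y w = cons2 (lastSum P m) y w - cons2 (firstSum P m) y w := by
    intro y
    cases w with
    | nil => exact absurd rfl hw
    | cons x w =>
      simp only [cons2, defect]
      ring
  rw [h1, h2, hP.cons2_lastSum l m κ hw, hP.cons2_firstSum l m κ hw, snoc2_lastSum _ _ _ _ hw,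
    defect, add_comm l m]
  ring

/-- The quasi-shuffle sums of `P l` itself vanish, so only terms with a removed last letter count.
If that letter is `a`, a quasi-shuffle of `u` with `[b]` remains, which contributes only for empty
`u`. -/
theorem stf_lastSum (hP : DihedralFamily P) (l : ℕ) (u : List (YL G)) (a b : YL G) :
    stf yop 1 (lastSum P l) (u ++ [a]) [b] = lastSum P (l + b.1) (u ++ [a]) +
      (if u = [] then P (l + a.1) [b] else 0) := by
  have h0 := stf_concat_concat (ε := (1 : k)) (op := yop) a b u [] (lastSum P l)
  have h1 := stf_concat_concat (ε := (1 : k)) (op := yop) a b u [] (P l)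
  have h2 := (hP.prim l).2 (u ++ [a]) [b] (by simp) (by simp)
  simp only [List.nil_append, stf_nil_right, lastSum_concat, one_mul, stf_add] at h0 h1
  rw [h2] at h1
  rw [h0, lastSum_concat]
  have h3 : stf yop 1 (P (l + a.1)) u [b] = if u = [] then P (l + a.1) [b] else 0 := by
    split_ifs with h
    · rw [h, stf_nil_left]
    · exact (hP.prim _).2 _ _ h (by simp)
  rw [h3, yop_fst, show l + ((a.1 : ℕ) + b.1) = l + b.1 + a.1 by ring]
  linear_combination -h1

/-- The boundary term of `stf_lastSum`, present for lists of length one, cancels against its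
reversed image by the parity condition. -/
theorem stf_defect (hP : DihedralFamily P) (l : ℕ) (b : YL G) {u : List (YL G)} (hu : u ≠ []) :
    stf yop 1 (defect P l) u [b] = defect P (l + b.1) u := by
  have key : ∀ (b : YL G) {u : List (YL G)}, u ≠ [] → stf yop 1 (lastSum P l) u [b] =
      lastSum P (l + b.1) u + (if u.length = 1 then P (l + wtL u) [b] else 0) := by
    intro b u hu
    obtain ⟨v, x, rfl⟩ := (eq_nil_or_concat' u).resolve_left hu
    rw [hP.stf_lastSum]
    by_cases hv : v = []
    · simp [hv]
    · simp [hv]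
  have h1 : stf yop 1 (defect P l) u [b] = stf yop 1 (lastSum P l) u [b] +
      (-1) ^ (l + wtL u + b.1) * stf yop 1 (lastSum P l) (iota u) [yinv b] := by
    have e : stf yop 1 (defect P l) u [b] = stf yop 1 (fun w => lastSum P l w +
        (-1) ^ (l + wtL u + b.1) * lastSum P l (iota w)) u [b] := by
      refine stf_congr fun c h1 _ _ => ?_
      simp only [wtL_cons, wtL_nil, add_zero] at h1
      rw [defect, firstSum, h1, sub_eq_add_neg, ← neg_mul, ← neg_one_mul ((-1) ^ _), ← pow_succ']
      congr 2
      exact neg_one_pow_eq (by omega)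
    rw [e, stf_add, stf_mul, stf_iota]
    simp
  rw [h1, key b hu, key (yinv b) (by simpa using hu), length_iota, wtL_iota, yinv_fst]
  have h2 := hP.parity (l + wtL u) b
  rw [defect, firstSum, sub_eq_add_neg, ← neg_mul, ← neg_one_mul ((-1) ^ _), ← pow_succ',
    neg_one_pow_eq (a := l + b.1 + 1 + wtL u + 1) (b := l + wtL u + b.1) (by omega)]
  rw [neg_one_pow_eq (b := l + wtL u + b.1) (by omega)] at h2
  split_ifs
  · linear_combination h2
  · ring

/-- By induction on the length all merged terms may be ignored. Then the defect changes sign under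
rotation of the cyclic word and vanishes on insertions of a letter; comparing an insertion with a
rotated insertion gives twice the defect equal to zero. -/
theorem defect_eq_zero (hP : DihedralFamily P) (h2 : ∀ x : k, x + x = 0 → x = 0) (l : ℕ)
    (w : List (YL G)) : defect P l w = 0 := by
  suffices h : ∀ n, ∀ w : List (YL G), w.length = n → ∀ l, defect P l w = 0 from h _ w rfl l
  intro n
  induction n using Nat.strong_induction_on with
  | _ n ih =>
  intro w hw l
  rcases w with _ | ⟨b, _ | ⟨y, w⟩⟩
  · simp [defect, firstSum]
  · have h3 := lastSum_concat P l [] b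
    have h4 := lastSum_concat P l [] (yinv b)
    simp only [List.nil_append, (hP.prim _).1, add_zero] at h3 h4
    have h5 := hP.parity l b
    rw [defect, firstSum, iota_cons, iota_nil, List.nil_append, h3, h4, ← h5, wtL_cons, wtL_nil,
      neg_one_pow_eq (a := l + 1 + (b.1 + 0)) (b := b.1 + l + 1) (by omega), pow_succ]
    ring
  · simp only [List.length_cons] at hw
    obtain ⟨v, ρ, rfl⟩ := exists_yl y
    obtain ⟨j, β, rfl⟩ := exists_yl b
    have rot : ∀ (l m : ℕ) (κ : G) (u : List (YL G)), u.length = w.length + 1 →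
        defect P l (u ++ [yl m κ]) = -defect P m (yl l (totL u * κ)⁻¹ :: u) := by
      intro l m κ u hu
      have hu0 : u ≠ [] := by
        rintro rfl
        simp at hu
      have h3 := hP.rotation l m κ hu0
      rw [ih u.length (by omega) u rfl] at h3
      have h4 : snoc2 (defect P l) u (yl m κ) = defect P l (u ++ [yl m κ]) := by
        obtain ⟨x, z, rfl⟩ := (eq_nil_or_concat' u).resolve_left hu0
        rw [snoc2_concat, ih _ _ (x ++ [yop z (yl m κ)]) rfl, add_zero]
        · simp
        · simp only [List.length_append, List.length_singleton] at hu ⊢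
          omega
      have h5 : ∀ y, cons2 (defect P m) y u = defect P m (y :: u) := by
        intro y
        cases u with
        | nil => exact absurd rfl hu0
        | cons x u =>
          rw [cons2, ih _ _ (yop y x :: u) rfl, add_zero]
          simp only [List.length_cons] at hu ⊢
          omega
      rw [h4, h5] at h3
      exact eq_neg_of_add_eq_zero_left h3
    -- The right side of `stf_defect` is a defect on a shorter list, and so are the merged terms on
    -- the left.
    have ins : ∀ (l : ℕ) (b : YL G) (u : List (YL G)), u.length = w.length + 1 →
        stf yop 0 (defect P l) u [b] = 0 := by
      intro l b u hu
      have hu0 : u ≠ [] := by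
        rintro rfl
        simp at hu
      rw [← stf_zero_weight (ε := 1), hP.stf_defect l b hu0, ih u.length (by omega) u rfl]
      intro c hc
      refine ih _ ?_ c rfl l
      simp only [List.length_singleton] at hc
      omega
    have r0 := ins l (yl j β) (yl v ρ :: w) (by simp)
    rw [stf_cons_cons, stf_nil_right, zero_mul, add_zero] at r0
    -- The label that gives the cyclic word product `1`; the index `l` becomes the visible letter
    -- `y_{l+1,μ}` after rotation.
    set μ := (β * ρ * totL w)⁻¹ with hμ
    have r2 := ins v (yl j β) (w ++ [yl l μ]) (by simp)
    have e := stf_concat_concat (ε := (0 : k)) (op := yop) (yl l μ) (yl j β) w []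
      (defect P v)
    simp only [List.nil_append, stf_nil_right, zero_mul, add_zero] at e
    rw [e] at r2
    have h3 : stf yop 0 (fun c => defect P v (c ++ [yl l μ])) w [yl j β] =
        stf yop 0 (fun c => (-1) * defect P l (yl v ρ :: c)) w [yl j β] := by
      refine stf_congr fun c _ h4 h5 => ?_
      rw [rot v l μ c (by simpa using h5 rfl), h4, neg_one_mul]
      have : (totL w * totL [yl j β] * μ)⁻¹ = ρ := by
        refine inv_eq_of_mul_eq_one_right ?_
        simp only [totL_cons, totL_nil, yl_snd, mul_one]
        rw [mul_right_comm _ μ ρ, hμ, mul_inv_eq_one]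
        simp [mul_comm, mul_left_comm]
      rw [this]
    have h6 : (totL (w ++ [yl l μ]) * β)⁻¹ = ρ := by
      refine inv_eq_of_mul_eq_one_right ?_
      simp only [totL_append, totL_cons, totL_nil, yl_snd, mul_one]
      rw [mul_right_comm _ μ β, mul_right_comm _ μ ρ, hμ, mul_inv_eq_one]
      simp [mul_comm, mul_left_comm]
    have h7 : (totL (yl v ρ :: w) * μ)⁻¹ = β := by
      refine inv_eq_of_mul_eq_one_right ?_
      simp only [totL_cons, yl_snd]
      rw [mul_right_comm _ μ β, hμ, mul_inv_eq_one]
      simp [mul_comm, mul_left_comm]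
    rw [h3, stf_mul, rot v j β _ (by simp), h6, ← List.cons_append, rot j l μ _ (by simp), h7] at r2
    -- Let `T` be the defect wanted and `S` the sum over insertions of `b` into `w`, preceded by
    -- `y_{v+1,ρ}`. Then `r0` reads `S + T = 0`. In `r2` the insertions were rotated once and the
    -- remaining term twice, so it reads `-S + T = 0`.
    refine h2 _ ?_
    linear_combination r0 + r2

end DihedralFamily

end Dihedral

end DoubleShuffle
end

/-! ### Quasi-shuffle coproducts on series -/

noncomputable section

namespace DoubleShuffle

namespace NCSeries

variable {A k : Type*} [CommRing k]

theorem FinForm.swap {U V : Type*} {φ : (U → k) → k} {χ : (V → k) → k} (hφ : FinForm φ)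
    (hχ : FinForm χ) (T : U → V → k) :
    φ (fun u => χ (fun v => T u v)) = χ (fun v => φ (fun u => T u v)) := by
  obtain ⟨c, hc⟩ := hφ
  obtain ⟨d, hd⟩ := hχ
  simp only [hc, hd, Finsupp.sum, Finset.mul_sum]
  rw [Finset.sum_comm]
  exact Finset.sum_congr rfl fun _ _ => Finset.sum_congr rfl fun _ _ => mul_left_comm _ _ _

/-- Coproduct defined by quasi-shuffles of words. -/
def qcop (op : A → A → A) (ε : k) (f : NCSeries A k) : Tensor2 A k :=
  fun p => stf op ε (fun l => f (FreeMonoid.ofList l)) p.1.toList p.2.toList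

theorem cts_qcop (op : A → A → A) (ε : k) :
    Cts (W := FreeMonoid A) (V := FreeMonoid A × FreeMonoid A) (qcop op ε) := fun p =>
  (finForm_stf (op := op) (ε := ε) p.1.toList p.2.toList).comp (W := FreeMonoid A)
    (Cts.precomp FreeMonoid.ofList)

theorem qcop_one_left (op : A → A → A) (ε : k) (f : NCSeries A k) (v : FreeMonoid A) :
    qcop op ε f (1, v) = f v := stf_nil_left _ _

theorem qcop_one_right (op : A → A → A) (ε : k) (f : NCSeries A k) (u : FreeMonoid A) :
    qcop op ε f (u, 1) = f u := stf_nil_right _ _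

theorem qcop_cons_cons (op : A → A → A) (ε : k) (f : NCSeries A k) (a b : A)
    (u v : FreeMonoid A) : qcop op ε f (FreeMonoid.of a * u, FreeMonoid.of b * v) =
      qcop op ε (residual a f) (u, FreeMonoid.of b * v) +
      qcop op ε (residual b f) (FreeMonoid.of a * u, v) +
      ε * qcop op ε (residual (op a b) f) (u, v) := stf_cons_cons _ _ _ _ _

/-- Action of an operator on the first factor of a tensor. -/
def op1 (F : NCSeries A k → NCSeries A k) (T : Tensor2 A k) : Tensor2 A k :=
  fun p => F (fun u => T (u, p.2)) p.1

/-- Action of an operator on the second factor of a tensor. -/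
def op2 (F : NCSeries A k → NCSeries A k) (T : Tensor2 A k) : Tensor2 A k :=
  fun p => F (fun v => T (p.1, v)) p.2

/-- `Cts` for operators on series. -/
abbrev CtsS {B : Type*} (F : NCSeries A k → NCSeries B k) : Prop :=
  Cts (W := FreeMonoid A) (V := FreeMonoid B) F

theorem cts_op1 {F : NCSeries A k → NCSeries A k} (hF : CtsS F) :
    Cts (W := FreeMonoid A × FreeMonoid A) (V := FreeMonoid A × FreeMonoid A) (op1 F) :=
  fun p => (hF p.1).comp (W := FreeMonoid A × FreeMonoid A) (Cts.precomp fun u => (u, p.2))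

theorem cts_op2 {F : NCSeries A k → NCSeries A k} (hF : CtsS F) :
    Cts (W := FreeMonoid A × FreeMonoid A) (V := FreeMonoid A × FreeMonoid A) (op2 F) :=
  fun p => (hF p.2).comp (W := FreeMonoid A × FreeMonoid A) (Cts.precomp fun v => (p.1, v))

theorem op1_op2 {F H : NCSeries A k → NCSeries A k} (hF : CtsS F) (hH : CtsS H)
    (T : Tensor2 A k) : op1 F (op2 H T) = op2 H (op1 F T) := by
  funext p
  exact FinForm.swap (hF p.1) (hH p.2) fun u v => T (u, v)

theorem op1_op1 (F H : NCSeries A k → NCSeries A k) (T : Tensor2 A k) :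
    op1 F (op1 H T) = op1 (fun f => F (H f)) T := rfl

theorem op2_op2 (F H : NCSeries A k → NCSeries A k) (T : Tensor2 A k) :
    op2 F (op2 H T) = op2 (fun f => F (H f)) T := rfl

theorem op1_add_op (F H : NCSeries A k → NCSeries A k) (T : Tensor2 A k) :
    op1 (fun f => F f + H f) T = op1 F T + op1 H T := rfl

theorem op2_add_op (F H : NCSeries A k → NCSeries A k) (T : Tensor2 A k) :
    op2 (fun f => F f + H f) T = op2 F T + op2 H T := rfl

theorem op1_tmul {F : NCSeries A k → NCSeries A k} (hF : CtsS F) (f g : NCSeries A k) :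
    op1 F (tmul f g) = tmul (F f) g := by
  funext p
  change F (fun u => f u * g p.2) p.1 = F f p.1 * g p.2
  have h := congrFun (hF.map_smul (g p.2) f) p.1
  rw [mul_comm (F f p.1)]
  refine Eq.trans ?_ h
  congr 1
  funext u
  exact mul_comm _ _

theorem op2_tmul {F : NCSeries A k → NCSeries A k} (hF : CtsS F) (f g : NCSeries A k) :
    op2 F (tmul f g) = tmul f (F g) := by
  funext p
  exact congrFun (hF.map_smul (f p.1) g) p.2

/-- Product of tensors. -/
def conv (S T : Tensor2 A k) : Tensor2 A k := fun p =>
  ∑ i ∈ Finset.range (p.1.toList.length + 1), ∑ j ∈ Finset.range (p.2.toList.length + 1),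
    S (FreeMonoid.ofList (p.1.toList.take i), FreeMonoid.ofList (p.2.toList.take j)) *
      T (FreeMonoid.ofList (p.1.toList.drop i), FreeMonoid.ofList (p.2.toList.drop j))

theorem conv_add (S S' T : Tensor2 A k) : conv (S + S') T = conv S T + conv S' T := by
  funext p
  simp only [conv, Pi.add_apply, add_mul, Finset.sum_add_distrib]

theorem conv_smul (c : k) (S T : Tensor2 A k) : conv (c • S) T = c • conv S T := by
  funext p
  simp only [conv, Pi.smul_apply, smul_eq_mul, mul_assoc, Finset.mul_sum]

theorem conv_sum {ι : Type*} (s : Finset ι) (S : ι → Tensor2 A k) (T : Tensor2 A k) :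
    conv (∑ i ∈ s, S i) T = ∑ i ∈ s, conv (S i) T := by
  classical
  induction s using Finset.induction_on with
  | empty =>
    funext p
    simp [conv]
  | insert i s hi ih => rw [Finset.sum_insert hi, conv_add, ih, Finset.sum_insert hi]

theorem conv_tmul (f g : NCSeries A k) (T : Tensor2 A k) :
    conv (tmul f g) T = op1 (f * ·) (op2 (g * ·) T) := by
  funext p
  change _ = ∑ i ∈ Finset.range (p.1.toList.length + 1), f _ *
    ∑ j ∈ Finset.range (p.2.toList.length + 1), g _ * T _
  simp only [conv, tmul, Finset.mul_sum, mul_assoc]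

/-- Quasi-shuffling and deconcatenation form a bialgebra: cutting a quasi-shuffle in two cuts both
lists. The first factor varies in the induction because it absorbs the first letters. -/
theorem stf_convolution {op : A → A → A} {ε : k} (g : List A → k) (u v : List A)
    (f : List A → k) :
    stf op ε (fun w => ∑ i ∈ Finset.range (w.length + 1), f (w.take i) * g (w.drop i)) u v =
      ∑ i ∈ Finset.range (u.length + 1), ∑ j ∈ Finset.range (v.length + 1),
        stf op ε f (u.take i) (v.take j) * stf op ε g (u.drop i) (v.drop j) := by
  refine pair_induction (p := fun u v => ∀ f : List A → k,
    stf op ε (fun w => ∑ i ∈ Finset.range (w.length + 1), f (w.take i) * g (w.drop i)) u v =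
      ∑ i ∈ Finset.range (u.length + 1), ∑ j ∈ Finset.range (v.length + 1),
        stf op ε f (u.take i) (v.take j) * stf op ε g (u.drop i) (v.drop j)) (fun v f => ?_)
    (fun u f => ?_) (fun a u b v h1 h2 h3 f => ?_) u v f
  · simp
  · simp
  · have e : ∀ c : A, (fun w : List A => ∑ i ∈ Finset.range ((c :: w).length + 1),
        f ((c :: w).take i) * g ((c :: w).drop i)) = fun w =>
        (∑ i ∈ Finset.range (w.length + 1), f (c :: w.take i) * g (w.drop i)) +
          f [] * g (c :: w) := by
      intro c
      funext w
      rw [List.length_cons, Finset.sum_range_succ']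
      rfl
    rw [stf_cons_cons, e, e, e, stf_add, stf_add, stf_add, stf_mul, stf_mul, stf_mul,
      h1 fun w => f (a :: w), h2 fun w => f (b :: w), h3 fun w => f (op a b :: w)]
    simp only [List.length_cons, Finset.sum_range_succ' _ (u.length + 1),
      Finset.sum_range_succ' _ (v.length + 1), List.take_succ_cons, List.drop_succ_cons,
      List.take_zero, List.drop_zero, stf_nil_left, stf_nil_right, stf_cons_cons, add_mul,
      Finset.sum_add_distrib, Finset.mul_sum, mul_add, mul_assoc]
    ring

theorem qcop_mul (op : A → A → A) (ε : k) (f g : NCSeries A k) :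
    qcop op ε (f * g) = conv (qcop op ε f) (qcop op ε g) := by
  funext p
  exact stf_convolution (fun l => g (FreeMonoid.ofList l)) p.1.toList p.2.toList
    fun l => f (FreeMonoid.ofList l)

theorem one_apply_ne {w : FreeMonoid A} (h : w ≠ 1) : (1 : NCSeries A k) w = 0 := if_neg h

theorem of_mul_ne_one (a : A) (w : FreeMonoid A) : FreeMonoid.of a * w ≠ 1 :=
  List.cons_ne_nil a w.toList

theorem qcop_eq_iff {op : A → A → A} {ε : k} {f : NCSeries A k} :
    qcop op ε f = tmul 1 f + tmul f 1 ↔ ShPrim op ε fun l => f (FreeMonoid.ofList l) := by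
  constructor
  · intro h
    refine ⟨?_, fun u v hu hv => ?_⟩
    · have := congrFun h (1, 1)
      rw [qcop_one_left] at this
      have h1 : f 1 = (1 : NCSeries A k) 1 * f 1 + f 1 * (1 : NCSeries A k) 1 := this
      rw [one_apply_nil, one_mul, mul_one] at h1
      exact left_eq_add.1 h1
    · have := congrFun h (FreeMonoid.ofList u, FreeMonoid.ofList v)
      have h1 : stf op ε (fun l => f (FreeMonoid.ofList l)) u v =
          (1 : NCSeries A k) (FreeMonoid.ofList u) * f (FreeMonoid.ofList v) +
            f (FreeMonoid.ofList u) * (1 : NCSeries A k) (FreeMonoid.ofList v) := this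
      rw [one_apply_ne (w := FreeMonoid.ofList u) hu, one_apply_ne (w := FreeMonoid.ofList v) hv,
        zero_mul, mul_zero,
        add_zero] at h1
      exact h1
  · rintro ⟨h0, h⟩
    funext ⟨u, v⟩
    simp only [Pi.add_apply, tmul]
    by_cases hu : u = 1
    · subst hu
      rw [qcop_one_left, one_apply_nil, one_mul, (show f 1 = 0 from h0), zero_mul, add_zero]
    · by_cases hv : v = 1
      · subst hv
        rw [qcop_one_right, one_apply_nil, mul_one, (show f 1 = 0 from h0), mul_zero, zero_add]
      · rw [one_apply_ne hu, one_apply_ne hv, zero_mul, mul_zero, add_zero]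
        exact h _ _ hu hv

/-- Primitive series for a quasi-shuffle coproduct. -/
def QPrim (op : A → A → A) (ε : k) (f : NCSeries A k) : Prop :=
  qcop op ε f = tmul 1 f + tmul f 1

theorem qprim_of_cts {op : A → A → A} {ε : k} {f g : NCSeries A k} (hf : QPrim op ε f)
    (hg : QPrim op ε g) (a b : k) : QPrim op ε (a • f + b • g) := by
  unfold QPrim at *
  rw [show qcop op ε (a • f + b • g) = a • qcop op ε f + b • qcop op ε g from
    ((cts_qcop op ε).map_add _ _).trans (congrArg₂ (· + ·) ((cts_qcop op ε).map_smul _ _)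
      ((cts_qcop op ε).map_smul _ _)), hf, hg]
  funext p
  simp only [Pi.add_apply, Pi.smul_apply, tmul, smul_eq_mul, add_apply, smul_apply]
  ring

theorem QPrim.add {op : A → A → A} {ε : k} {f g : NCSeries A k} (hf : QPrim op ε f)
    (hg : QPrim op ε g) : QPrim op ε (f + g) := by
  simpa using qprim_of_cts hf hg 1 1

theorem QPrim.commutator {op : A → A → A} {ε : k} {f g : NCSeries A k} (hf : QPrim op ε f)
    (hg : QPrim op ε g) : QPrim op ε (f * g - g * f) := by
  unfold QPrim at *
  rw [show qcop op ε (f * g - g * f) = qcop op ε (f * g) - qcop op ε (g * f) from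
    (cts_qcop op ε).map_sub _ _, qcop_mul, qcop_mul, hf, hg]
  simp only [conv_add, conv_tmul]
  have h : ∀ x y a b c d : NCSeries A k, op1 (x * ·) (op2 (y * ·) (tmul a b + tmul c d)) =
      tmul (x * a) (y * b) + tmul (x * c) (y * d) := by
    intro x y a b c d
    rw [show op2 (y * ·) (tmul a b + tmul c d) = op2 (y * ·) (tmul a b) + op2 (y * ·) (tmul c d)
      from (cts_op2 (cts_mul_left y)).map_add _ _, op2_tmul (cts_mul_left y),
      op2_tmul (cts_mul_left y), show op1 (x * ·) (tmul a (y * b) + tmul c (y * d)) =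
      op1 (x * ·) (tmul a (y * b)) + op1 (x * ·) (tmul c (y * d))
      from (cts_op1 (cts_mul_left x)).map_add _ _, op1_tmul (cts_mul_left x),
      op1_tmul (cts_mul_left x)]
  rw [h, h, h, h]
  simp only [one_mul, mul_one]
  funext p
  simp only [Pi.add_apply, Pi.sub_apply, tmul, sub_apply]
  ring

/-- The contractions `op a b = y` are listed by `S y`. -/
def Contractions (op : A → A → A) (ε : k) (S : A → Finset (A × A)) : Prop :=
  ε ≠ 0 → ∀ y a b, (a, b) ∈ S y ↔ op a b = y

/-- Dual form of the recursion of quasi-shuffles on first letters: the first letter of a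
quasi-shuffle comes from the left word, from the right word, or from a pair listed in `S`. -/
theorem qcop_letter_mul {op : A → A → A} {ε : k} {S : A → Finset (A × A)}
    (hS : Contractions op ε S) (y : A) (g : NCSeries A k) :
    qcop op ε (letter y * g) = op1 (letter y * ·) (qcop op ε g) +
      op2 (letter y * ·) (qcop op ε g) +
      ε • ∑ p ∈ S y, op1 (letter p.1 * ·) (op2 (letter p.2 * ·) (qcop op ε g)) := by
  classical
  have h1 : ∀ (a b : A) (w : FreeMonoid A) (f : NCSeries A k),
      (letter a * f : NCSeries A k) (FreeMonoid.of b * w) = if b = a then f w else 0 := by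
    intro a b w f
    split_ifs with h
    · rw [h, letter_mul_cons_self]
    · exact letter_mul_cons_ne h f w
  have h2 : ∀ a b : A, residual b (letter a * g) = if b = a then g else 0 := by
    intro a b
    ext w
    refine (h1 a b w g).trans ?_
    split_ifs <;> rfl
  have h3 : ∀ (p : Prop) [Decidable p] (q : FreeMonoid A × FreeMonoid A),
      qcop op ε (if p then g else 0) q = if p then qcop op ε g q else 0 := by
    intro p _ q
    split_ifs
    · rfl
    · exact congrFun (cts_qcop op ε).map_zero q
  funext ⟨u, v⟩
  simp only [Pi.add_apply, Pi.smul_apply, Finset.sum_apply, smul_eq_mul]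
  cases u using FreeMonoid.casesOn with
  | one =>
    have e1 : op1 (letter y * ·) (qcop op ε g) (1, v) = 0 := letter_mul_nil _ _
    have e2 : ∀ p ∈ S y, op1 (letter p.1 * ·) (op2 (letter p.2 * ·) (qcop op ε g)) (1, v) = 0 :=
      fun p _ => letter_mul_nil _ _
    rw [qcop_one_left, e1, Finset.sum_eq_zero e2, mul_zero, add_zero, zero_add]
    have e3 : (fun v => qcop op ε g (1, v)) = g := funext fun w => qcop_one_left op ε g w
    exact congrArg (fun f : NCSeries A k => (letter y * f : NCSeries A k) v) e3.symm
  | of_mul a u =>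
    cases v using FreeMonoid.casesOn with
    | one =>
      have e1 : op2 (letter y * ·) (qcop op ε g) (FreeMonoid.of a * u, 1) = 0 :=
        letter_mul_nil _ _
      have e2 : ∀ p ∈ S y, op1 (letter p.1 * ·) (op2 (letter p.2 * ·) (qcop op ε g))
          (FreeMonoid.of a * u, 1) = 0 := by
        intro p _
        rw [op1_op2 (cts_mul_left _) (cts_mul_left _)]
        exact letter_mul_nil _ _
      rw [qcop_one_right, e1, Finset.sum_eq_zero e2, mul_zero, add_zero, add_zero]
      have e3 : (fun v => qcop op ε g (v, 1)) = g := funext fun w => qcop_one_right op ε g w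
      exact congrArg (fun f : NCSeries A k => (letter y * f : NCSeries A k)
        (FreeMonoid.of a * u)) e3.symm
    | of_mul b v =>
      have e1 : op1 (letter y * ·) (qcop op ε g) (FreeMonoid.of a * u, FreeMonoid.of b * v) =
          if a = y then qcop op ε g (u, FreeMonoid.of b * v) else 0 := h1 _ _ _ _
      have e2 : op2 (letter y * ·) (qcop op ε g) (FreeMonoid.of a * u, FreeMonoid.of b * v) =
          if b = y then qcop op ε g (FreeMonoid.of a * u, v) else 0 := h1 _ _ _ _
      have e3 : ∀ p : A × A, op1 (letter p.1 * ·) (op2 (letter p.2 * ·) (qcop op ε g))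
          (FreeMonoid.of a * u, FreeMonoid.of b * v) =
          if p = (a, b) then qcop op ε g (u, v) else 0 := by
        intro p
        refine (h1 _ _ _ _).trans ?_
        have : op2 (letter p.2 * ·) (qcop op ε g) (u, FreeMonoid.of b * v) =
          if b = p.2 then qcop op ε g (u, v) else 0 := h1 _ _ _ _
        rw [this, ← ite_and]
        refine if_congr ?_ rfl rfl
        rw [Prod.ext_iff, eq_comm, eq_comm (a := b)]
      rw [qcop_cons_cons, h2, h2, h2, h3, h3, h3, e1, e2]
      simp only [e3]
      rw [Finset.sum_ite_eq']
      congr 1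
      by_cases hε : ε = 0
      · rw [hε, zero_mul, zero_mul]
      · congr 1
        refine if_congr ?_ rfl rfl
        rw [hS hε]

/-- A coproduct on words that is given by quasi-shuffles is the quasi-shuffle coproduct. -/
theorem coprod_eq_qcop {op : A → A → A} {ε : k} {S : A → Finset (A × A)}
    (hS : Contractions op ε S)
    {c : FreeMonoid A →* MonoidAlgebra k (FreeMonoid A × FreeMonoid A)}
    (hc : ∀ y, c (FreeMonoid.of y) = MonoidAlgebra.single (FreeMonoid.of y, 1) 1 +
      MonoidAlgebra.single (1, FreeMonoid.of y) 1 +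
      ∑ p ∈ S y, MonoidAlgebra.single (FreeMonoid.of p.1, FreeMonoid.of p.2) ε)
    (f : NCSeries A k) : coprod c f = qcop op ε f := by
  -- On words both coproducts obey the same recursion on the first letter; continuity of `qcop` does
  -- the rest.
  have key : ∀ w : FreeMonoid A, (fun p => (c w).coeff p) = qcop op ε (word w) := by
    intro w
    induction w using FreeMonoid.inductionOn' with
    | one =>
      classical
      rw [map_one, word_one]
      have h1 : ∀ a : A, residual a (1 : NCSeries A k) = 0 :=
        fun a => NCSeries.ext fun u => one_apply_cons a u
      funext ⟨u, v⟩
      have h2 : (1 : MonoidAlgebra k (FreeMonoid A × FreeMonoid A)).coeff (u, v) =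
          if u = 1 ∧ v = 1 then 1 else 0 := by
        rw [MonoidAlgebra.one_def, MonoidAlgebra.coeff_single, Finsupp.single_apply]
        refine if_congr ?_ rfl rfl
        rw [eq_comm, Prod.mk_eq_one]
      refine h2.trans ?_
      cases u using FreeMonoid.casesOn with
      | one =>
        rw [qcop_one_left]
        exact if_congr (by simp) rfl rfl
      | of_mul a u =>
        rw [if_neg (fun h => of_mul_ne_one a u h.1)]
        cases v using FreeMonoid.casesOn with
        | one => rw [qcop_one_right, one_apply_ne (of_mul_ne_one a u)]
        | of_mul b v =>
          rw [qcop_cons_cons, h1, h1, h1]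
          have h0 : qcop op ε (0 : NCSeries A k) = 0 := (cts_qcop op ε).map_zero
          simp [h0]
    | of_mul y w ih =>
      rw [map_mul, hc, ← letter_mul_word, qcop_letter_mul hS, ← ih]
      have h1 : ∀ (a b : FreeMonoid A) (r : k) (x : MonoidAlgebra k (FreeMonoid A × FreeMonoid A)),
          (fun p => (MonoidAlgebra.single (a, b) r * x).coeff p) =
            r • op1 (word a * ·) (op2 (word b * ·) fun p => x.coeff p) := by
        intro a b r x
        induction x using MonoidAlgebra.induction_linear with
        | zero =>
          funext p
          have e : (fun p => (0 : MonoidAlgebra k (FreeMonoid A × FreeMonoid A)).coeff p) =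
            (0 : Tensor2 A k) := rfl
          rw [e, (cts_op2 (cts_mul_left (word b))).map_zero,
            (cts_op1 (cts_mul_left (word a))).map_zero]
          simp
        | add x y hx hy =>
          have e : (fun p => (x + y).coeff p) =
            ((fun p => x.coeff p : Tensor2 A k) + fun p => y.coeff p) := rfl
          rw [e, (cts_op2 (cts_mul_left (word b))).map_add,
            (cts_op1 (cts_mul_left (word a))).map_add, smul_add, ← hx, ← hy, mul_add]
          rfl
        | single m s =>
          obtain ⟨m1, m2⟩ := m
          classical
          have e : (fun p => (MonoidAlgebra.single (m1, m2) s).coeff p) =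
              s • tmul (word m1 : NCSeries A k) (word m2) := by
            funext ⟨p1, p2⟩
            rw [MonoidAlgebra.coeff_single, Finsupp.single_apply]
            simp only [Pi.smul_apply, tmul, word, Prod.mk.injEq, smul_eq_mul, ite_and, mul_ite,
              mul_one, mul_zero, eq_comm (a := m1), eq_comm (a := m2)]
            split_ifs <;> rfl
          rw [MonoidAlgebra.single_mul_single, e, (cts_op2 (cts_mul_left (word b))).map_smul,
            (cts_op1 (cts_mul_left (word a))).map_smul, op2_tmul (cts_mul_left (word b)),
            op1_tmul (cts_mul_left (word a)), smul_smul, word_mul_word, word_mul_word]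
          funext ⟨p1, p2⟩
          rw [Prod.mk_mul_mk, MonoidAlgebra.coeff_single, Finsupp.single_apply]
          simp only [Pi.smul_apply, tmul, word, Prod.mk.injEq, smul_eq_mul, ite_and, mul_ite,
              mul_one, mul_zero, eq_comm (a := a * m1), eq_comm (a := b * m2)]
          split_ifs <;> rfl
      have h2 : ∀ (F G H : MonoidAlgebra k (FreeMonoid A × FreeMonoid A)),
          (fun p => ((F + G + H) * (c w)).coeff p) = (fun p => (F * c w).coeff p) +
            (fun p => (G * c w).coeff p) + (fun p => (H * c w).coeff p) := by
        intro F G H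
        rw [add_mul, add_mul]
        rfl
      have h3 : (fun p => ((∑ p ∈ S y, MonoidAlgebra.single
          (FreeMonoid.of p.1, FreeMonoid.of p.2) ε) * (c w)).coeff p) =
          ∑ q ∈ S y, (fun p => (MonoidAlgebra.single
          (FreeMonoid.of q.1, FreeMonoid.of q.2) ε * (c w)).coeff p) := by
        funext p
        rw [Finset.sum_mul, MonoidAlgebra.coeff_sum, Finset.sum_apply, Finsupp.finsetSum_apply]
      rw [h2, h1, h1, h3, one_smul, one_smul, Finset.smul_sum]
      have h4 : ∀ T : Tensor2 A k, op1 (word (1 : FreeMonoid A) * ·) T = T := by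
        intro T
        funext p
        exact congrFun (one_mul (M := NCSeries A k) _) _
      have h5 : ∀ T : Tensor2 A k, op2 (word (1 : FreeMonoid A) * ·) T = T := by
        intro T
        funext p
        exact congrFun (one_mul (M := NCSeries A k) _) _
      rw [h4, h5]
      refine congrArg₂ (· + ·) rfl (Finset.sum_congr rfl fun q _ => h1 _ _ _ _)
  have h := extend_of_cts (cts_qcop op ε) f
  rw [← h]
  unfold coprod
  simp only [key]

theorem qcop_one (op : A → A → A) (ε : k) : qcop op ε (1 : NCSeries A k) = tmul 1 1 := by
  funext ⟨u, v⟩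
  cases u using FreeMonoid.casesOn with
  | one => rw [qcop_one_left, tmul, one_apply_nil, one_mul]
  | of_mul a u =>
    cases v using FreeMonoid.casesOn with
    | one => rw [qcop_one_right, tmul, one_apply_nil, mul_one]
    | of_mul b v =>
      have h1 : ∀ a : A, residual a (1 : NCSeries A k) = 0 :=
        fun a => NCSeries.ext fun u => one_apply_cons a u
      have h0 : qcop op ε (0 : NCSeries A k) = 0 := (cts_qcop op ε).map_zero
      rw [qcop_cons_cons, h1, h1, h1, h0, tmul, one_apply_cons]
      simp

/-- A coderivation criterion for operators satisfying a Leibniz rule. -/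
theorem qcop_coderivation {op : A → A → A} {ε : k} {S : A → Finset (A × A)}
    (hS : Contractions op ε S) {D : NCSeries A k → NCSeries A k} (hD : CtsS D)
    {d : A → NCSeries A k} (hd : ∀ y w, D (letter y * word w) = d y * word w +
      letter y * D (word w)) (h1 : QPrim op ε (D 1))
    (hy : ∀ y, qcop op ε (d y) = tmul 1 (d y) + tmul (d y) 1 +
      ε • ∑ p ∈ S y, (tmul (d p.1) (letter p.2) + tmul (letter p.1) (d p.2)))
    (f : NCSeries A k) :
    qcop op ε (D f) = op1 D (qcop op ε f) + op2 D (qcop op ε f) := by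
  -- The Leibniz rule is assumed on words only, and is extended here by continuity so that it can be
  -- applied inside the tensor factors.
  have hd' : ∀ y f, D (letter y * f) = d y * f + letter y * D f := fun y f =>
    Cts.ext (hD.comp (cts_mul_left (letter y)))
      ((cts_mul_left (d y)).add ((cts_mul_left (letter y)).comp hD)) (fun w => hd y w) f
  refine Cts.ext ((cts_qcop op ε).comp hD) (((cts_op1 hD).comp (cts_qcop op ε)).add
    ((cts_op2 hD).comp (cts_qcop op ε))) (fun w => ?_) f
  change qcop op ε (D (word w)) = op1 D (qcop op ε (word w)) + op2 D (qcop op ε (word w))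
  induction w using FreeMonoid.inductionOn' with
  | one =>
    rw [word_one, h1, qcop_one, op1_tmul hD, op2_tmul hD, add_comm]
  | of_mul y w ih =>
    rw [← letter_mul_word]
    set T := qcop op ε (word w) with hT
    have e1 : ∀ (F : NCSeries A k → NCSeries A k), CtsS F → ∀ T T', op1 F (T + T') =
        op1 F T + op1 F T' := fun F hF T T' => (cts_op1 hF).map_add T T'
    have e2 : ∀ (F : NCSeries A k → NCSeries A k), CtsS F → ∀ T T', op2 F (T + T') =
        op2 F T + op2 F T' := fun F hF T T' => (cts_op2 hF).map_add T T'
    have e3 : ∀ (y : A) (T : Tensor2 A k), op1 D (op1 (letter y * ·) T) =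
        op1 (d y * ·) T + op1 (letter y * ·) (op1 D T) := by
      intro y T
      simp only [op1_op1, hd', op1_add_op]
    have e4 : ∀ (y : A) (T : Tensor2 A k), op2 D (op2 (letter y * ·) T) =
        op2 (d y * ·) T + op2 (letter y * ·) (op2 D T) := by
      intro y T
      simp only [op2_op2, hd', op2_add_op]
    have i1 : op1 D (ε • ∑ p ∈ S y, op1 (letter p.1 * ·) (op2 (letter p.2 * ·) T)) =
        ε • ∑ p ∈ S y, (op1 (d p.1 * ·) (op2 (letter p.2 * ·) T) +
          op1 (letter p.1 * ·) (op2 (letter p.2 * ·) (op1 D T))) := by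
      rw [(cts_op1 hD).map_smul, (cts_op1 hD).map_sum]
      refine congrArg _ (Finset.sum_congr rfl fun p _ => ?_)
      rw [e3, op1_op2 hD (cts_mul_left _)]
    have i2 : op2 D (ε • ∑ p ∈ S y, op1 (letter p.1 * ·) (op2 (letter p.2 * ·) T)) =
        ε • ∑ p ∈ S y, (op1 (letter p.1 * ·) (op2 (d p.2 * ·) T) +
          op1 (letter p.1 * ·) (op2 (letter p.2 * ·) (op2 D T))) := by
      rw [(cts_op2 hD).map_smul, (cts_op2 hD).map_sum]
      refine congrArg _ (Finset.sum_congr rfl fun p _ => ?_)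
      rw [← op1_op2 (cts_mul_left _) hD, e4, e1 _ (cts_mul_left _)]
    have i3 : ∑ p ∈ S y, op1 (letter p.1 * ·) (op2 (letter p.2 * ·) (op1 D T + op2 D T)) =
        ∑ p ∈ S y, (op1 (letter p.1 * ·) (op2 (letter p.2 * ·) (op1 D T)) +
          op1 (letter p.1 * ·) (op2 (letter p.2 * ·) (op2 D T))) := by
      refine Finset.sum_congr rfl fun p _ => ?_
      rw [e2 _ (cts_mul_left _), e1 _ (cts_mul_left _)]
    have i4 : ∀ T : Tensor2 A k, op1 ((1 : NCSeries A k) * ·) T = T := by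
      intro T
      simp only [one_mul]
      rfl
    have i5 : ∀ T : Tensor2 A k, op2 ((1 : NCSeries A k) * ·) T = T := by
      intro T
      simp only [one_mul]
      rfl
    have i6 : qcop op ε (d y * word w + letter y * D (word w)) =
      qcop op ε (d y * word w) + qcop op ε (letter y * D (word w)) := (cts_qcop op ε).map_add _ _
    rw [hd', i6, qcop_mul, hy, qcop_letter_mul hS, qcop_letter_mul hS, ih, ← hT, e1 _ hD, e1 _ hD,
      e2 _ hD, e2 _ hD, i1, i2, e3, e4, i3, conv_add, conv_add, conv_smul, conv_sum, conv_tmul,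
      conv_tmul, i4, i5, op1_op2 hD (cts_mul_left _), ← op1_op2 (cts_mul_left _) hD,
      e1 _ (cts_mul_left _), e2 _ (cts_mul_left _)]
    simp only [conv_add, conv_tmul, Finset.sum_add_distrib, smul_add]
    abel

end NCSeries

end DoubleShuffle
end

noncomputable section

namespace DoubleShuffle

open NCSeries

/-! ### The two coproducts as quasi-shuffle coproducts -/

section Coproducts

variable {G k : Type*} [CommRing k]

/-- Dummy contraction for the shuffle coproduct. -/
def shop (_ _ : XL G) : XL G := none

theorem contractions_shop : Contractions (shop (G := G)) (0 : k) (fun _ => ∅) :=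
  fun h => absurd rfl h

theorem coprod_shuffleWord (f : NCSeries (XL G) k) :
    coprod (shuffleWord G k) f = qcop shop 0 f :=
  coprod_eq_qcop contractions_shop (fun y => by
    rw [shuffleWord, FreeMonoid.lift_eval_of, Finset.sum_empty, add_zero]) f

theorem isPrimitive_shuffleWord {f : NCSeries (XL G) k} :
    IsPrimitive (shuffleWord G k) f ↔ QPrim shop 0 f := by
  rw [IsPrimitive, coprod_shuffleWord, QPrim]

variable [CommGroup G] [Fintype G]

open Classical in
/-- The pairs of letters with contraction `y`. -/
def splits (y : YL G) : Finset (YL G × YL G) :=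
  (Finset.Ico 1 y.1 ×ˢ Finset.univ).image fun p => ((p.1, p.2), (y.1 - p.1, p.2⁻¹ * y.2))

theorem contractions_yop : Contractions (yop (G := G)) (1 : k) splits := by
  classical
  rintro - y ⟨i, κ⟩ ⟨j, μ⟩
  simp only [splits, Finset.mem_image, Finset.mem_product, Finset.mem_Ico, Finset.mem_univ,
    and_true, Prod.mk.injEq, Prod.exists, yop]
  constructor
  · rintro ⟨i', κ', ⟨-, h⟩, ⟨rfl, rfl⟩, rfl, rfl⟩
    refine Prod.ext (PNat.add_sub_of_lt h) ?_
    simp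
  · rintro rfl
    refine ⟨i, κ, ⟨one_le, PNat.lt_add_right _ _⟩, ⟨rfl, rfl⟩, ?_, by simp⟩
    rw [add_comm]
    exact PNat.add_sub

theorem coprod_stuffleWord (f : NCSeries (YL G) k) :
    coprod (stuffleWord G k) f = qcop yop 1 f :=
  coprod_eq_qcop contractions_yop (fun y => by
    classical
    rw [stuffleWord, FreeMonoid.lift_eval_of, splits, Finset.sum_image, Finset.sum_product]
    · simp only [finsum_eq_sum_of_fintype]
    · rintro ⟨i, κ⟩ - ⟨j, μ⟩ - h
      simp only [Prod.mk.injEq] at h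
      exact Prod.ext h.1.1 h.1.2) f

end Coproducts

/-! ### Pull-back of series along maps of alphabets -/

namespace NCSeries

section Pull

variable {A B C k : Type*} [CommRing k]

section CtsS

variable {F H : NCSeries A k → NCSeries B k}

theorem CtsS.add (hF : CtsS F) (hH : CtsS H) : CtsS fun f => F f + H f := Cts.add hF hH

theorem CtsS.const_smul (c : k) (hF : CtsS F) : CtsS fun f => c • F f := Cts.const_smul c hF

theorem CtsS.comp {F : NCSeries B k → NCSeries C k} {H : NCSeries A k → NCSeries B k}
    (hF : CtsS F) (hH : CtsS H) : CtsS fun f => F (H f) := Cts.comp hF hH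

theorem CtsS.map_add (hF : CtsS F) (f g : NCSeries A k) : F (f + g) = F f + F g :=
  Cts.map_add hF f g

theorem CtsS.map_sub (hF : CtsS F) (f g : NCSeries A k) : F (f - g) = F f - F g :=
  Cts.map_sub hF f g

theorem CtsS.map_smul (hF : CtsS F) (c : k) (f : NCSeries A k) : F (c • f) = c • F f :=
  Cts.map_smul hF c f

theorem CtsS.map_zero (hF : CtsS F) : F 0 = 0 := Cts.map_zero hF

theorem CtsS.mul_left (f : NCSeries A k) : CtsS fun g : NCSeries A k => f * g := cts_mul_left f

end CtsS

/-- Removal of a prefix: the coefficient at `v` is `(f | u v)`. -/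
def shiftL (u : FreeMonoid A) (f : NCSeries A k) : NCSeries A k := fun v => f (u * v)

theorem shiftL_apply (u : FreeMonoid A) (f : NCSeries A k) (v : FreeMonoid A) :
    shiftL u f v = f (u * v) := rfl

theorem residual_apply (a : A) (f : NCSeries A k) (v : FreeMonoid A) :
    residual a f v = f (FreeMonoid.of a * v) := rfl

/-- The series `w ↦ (f | φ(w))`. -/
def pull (φ : A → B) (f : NCSeries B k) : NCSeries A k := fun w => f (FreeMonoid.map φ w)

theorem cts_pull (φ : A → B) : CtsS (pull (k := k) φ) := Cts.precomp _

theorem pull_mul (φ : A → B) (f g : NCSeries B k) : pull φ (f * g) = pull φ f * pull φ g := by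
  ext w
  induction w using FreeMonoid.inductionOn' generalizing f with
  | one =>
    rw [mul_apply_nil]
    exact mul_apply_nil f g
  | of_mul a w ih =>
    rw [mul_apply_cons]
    change (f * g : NCSeries B k) (FreeMonoid.map φ (FreeMonoid.of a * w)) = _
    rw [map_mul, FreeMonoid.map_of, mul_apply_cons]
    refine congrArg₂ (· + ·) (by rw [pull, pull, map_mul, FreeMonoid.map_of, map_one]) ?_
    exact ih (residual (φ a) f)

theorem pull_one (φ : A → B) : pull φ (1 : NCSeries B k) = 1 := by
  classical
  ext w
  exact if_congr (List.map_eq_nil_iff (l := w.toList) (f := φ)) rfl rfl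

theorem pull_pull (φ : A → B) (χ : B → C) (f : NCSeries C k) :
    pull φ (pull χ f) = pull (χ ∘ φ) f := by
  ext w
  exact congrArg f (congrFun (congrArg DFunLike.coe (FreeMonoid.map_comp χ φ)) w).symm

theorem pull_id (f : NCSeries A k) : pull id f = f := by
  ext w
  exact congrArg f (List.map_id w.toList)

theorem pull_letter {φ : A → B} (hφ : Function.Injective φ) (a : A) :
    pull φ (letter (φ a) : NCSeries B k) = letter a := by
  classical
  ext w
  exact if_congr ((List.map_injective_iff.2 hφ).eq_iff (a := w.toList) (b := [a])) rfl rfl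

theorem pull_letter_of_notMem {φ : A → B} {b : B} (hb : ∀ a, φ a ≠ b) :
    pull φ (letter b : NCSeries B k) = 0 := by
  ext w
  refine if_neg ?_
  intro h
  have h1 : w.toList.map φ = [b] := h
  rw [List.map_eq_singleton_iff] at h1
  obtain ⟨a, -, ha⟩ := h1
  exact hb a ha

/-- Relabelling by a bijection amounts to reading coefficients through the inverse. This gives the
group action on series a form without infinite sums. -/
theorem subst_letter_equiv [Finite A] (e : A ≃ B) (f : NCSeries A k) :
    subst (fun a => letter (e a)) f = pull e.symm f := by
  refine (eq_subst (fun a => letter_one _) (cts_pull _) (pull_one _) (fun a g => ?_) f).symm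
  have := pull_letter (k := k) e.symm.injective (e a)
  rw [e.symm_apply_apply] at this
  rw [pull_mul, this]

theorem qcop_pull {op : A → A → A} {op' : B → B → B} {ε : k} (φ : A → B)
    (hφ : ∀ a b, φ (op a b) = op' (φ a) (φ b)) (f : NCSeries B k) (p : FreeMonoid A × FreeMonoid A) :
    qcop op ε (pull φ f) p = qcop op' ε f (FreeMonoid.map φ p.1, FreeMonoid.map φ p.2) :=
  stf_map φ hφ p.1.toList p.2.toList fun l => f (FreeMonoid.ofList l)

theorem QPrim.pull {op : A → A → A} {op' : B → B → B} {ε : k} {φ : A → B}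
    (hφ : ∀ a b, φ (op a b) = op' (φ a) (φ b)) {f : NCSeries B k} (hf : QPrim op' ε f) :
    QPrim op ε (pull φ f) := by
  funext p
  rw [qcop_pull φ hφ, hf]
  have h : ∀ w : FreeMonoid A, (1 : NCSeries B k) (FreeMonoid.map φ w) = (1 : NCSeries A k) w :=
    fun w => congrFun (pull_one φ) w
  simp only [Pi.add_apply, tmul, h, NCSeries.pull]

theorem mem_ordGE_pull (φ : A → B) {n : ℕ} {f : NCSeries B k}
    (hf : f ∈ ordGE k FreeMonoid.length n) : pull φ f ∈ ordGE k FreeMonoid.length n := by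
  intro w hw
  refine hf _ ?_
  exact (List.length_map (as := w.toList) φ).trans_lt hw

theorem qprim_letter {op : A → A → A} (a : A) : QPrim op 0 (letter a : NCSeries A k) := by
  have h := qcop_letter_mul (op := op) (ε := (0 : k)) (S := fun _ => ∅) (fun h => absurd rfl h) a 1
  rw [mul_one, zero_smul, add_zero, qcop_one, op1_tmul (cts_mul_left _), op2_tmul (cts_mul_left _),
    mul_one] at h
  rw [QPrim, h, add_comm]

theorem ordGE_one_iff {f : NCSeries A k} : f ∈ ordGE k FreeMonoid.length 1 ↔ f 1 = 0 := by
  constructor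
  · intro h
    exact h 1 Nat.one_pos
  · intro h w hw
    rw [FreeMonoid.length_eq_zero.1 (Nat.lt_one_iff.1 hw), h]

theorem letter_mem_ordGE (a : A) : (letter a : NCSeries A k) ∈ ordGE k FreeMonoid.length 1 :=
  ordGE_one_iff.2 (letter_one a)

theorem derWord_mem_ordGE {D : A → NCSeries A k} {d : ℕ}
    (hD : ∀ a, D a ∈ ordGE k FreeMonoid.length (d + 1)) (l : List A) :
    derWord D l ∈ ordGE k FreeMonoid.length (l.length + d) := by
  induction l with
  | nil => exact fun w _ => rfl
  | cons a l ih =>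
    have h1 : (word (FreeMonoid.ofList l) : NCSeries A k) ∈ ordGE k FreeMonoid.length l.length := by
      refine fun v hv => word_ne ?_
      rintro rfl
      exact lt_irrefl _ hv
    have h2 := mul_mem_ordGE FreeMonoid.length_mul (hD a) h1
    have h3 := mul_mem_ordGE FreeMonoid.length_mul (letter_mem_ordGE (k := k) a) ih
    rw [show d + 1 + l.length = (a :: l).length + d by rw [List.length_cons]; ring] at h2
    rw [show 1 + (l.length + d) = (a :: l).length + d by rw [List.length_cons]; ring] at h3
    exact Submodule.add_mem _ h2 h3

theorem der_mem_ordGE {D : A → NCSeries A k} {d : ℕ}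
    (hD : ∀ a, D a ∈ ordGE k FreeMonoid.length (d + 1)) {n : ℕ} {f : NCSeries A k}
    (hf : f ∈ ordGE k FreeMonoid.length n) : der D f ∈ ordGE k FreeMonoid.length (n + d) := by
  intro w hw
  refine finsum_eq_zero_of_forall_eq_zero fun v => ?_
  by_cases hv : v.length < n
  · rw [hf v hv, zero_mul]
  · have h := derWord_mem_ordGE hD v.toList w
      (hw.trans_le (Nat.add_le_add_right (not_lt.1 hv) d))
    exact (congrArg (f v * ·) h).trans (mul_zero _)

/-- Two continuous operators that satisfy the same Leibniz rule along a morphism. -/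
theorem eq_of_leibniz {T F H : NCSeries A k → NCSeries B k} (hF : CtsS F) (hH : CtsS H)
    (h1 : F 1 = H 1) {dl : A → NCSeries B k} {g : A → NCSeries B k}
    (mF : ∀ a f, F (letter a * f) = dl a * T f + g a * F f)
    (mH : ∀ a f, H (letter a * f) = dl a * T f + g a * H f) (f : NCSeries A k) : F f = H f := by
  refine Cts.ext hF hH (fun w => ?_) f
  induction w using FreeMonoid.inductionOn' with
  | one => exact h1
  | of_mul a w ih => rw [← letter_mul_word, mF, mH, ih]

end Pull

end NCSeries

end DoubleShuffle
end

noncomputable section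

namespace DoubleShuffle

open NCSeries

namespace NCSeries

/-! ### Exponentials of continuous operators -/

section Exponentials

variable {A B k : Type*} [CommRing k] [Algebra ℚ k]

theorem Cts.map_rat_smul {V W : Type*} {F : (W → k) → (V → k)} (hF : Cts F) (q : ℚ) (f : W → k) :
    F (q • f) = q • F f := by
  have h1 : q • f = algebraMap ℚ k q • f := (algebraMap_smul k q f).symm
  have h2 : q • F f = algebraMap ℚ k q • F f := (algebraMap_smul k q (F f)).symm
  rw [h1, h2, hF.map_smul]

theorem CtsS.map_rat_smul {F : NCSeries A k → NCSeries B k} (hF : CtsS F) (q : ℚ)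
    (f : NCSeries A k) : F (q • f) = q • F f := Cts.map_rat_smul hF q f

/-- A continuous operator as a rational linear map. -/
def CtsS.lin {F : NCSeries A k → NCSeries B k} (hF : CtsS F) :
    NCSeries A k →ₗ[ℚ] NCSeries B k where
  toFun := F
  map_add' := Cts.map_add hF
  map_smul' := Cts.map_rat_smul hF

@[simp] theorem CtsS.lin_apply {F : NCSeries A k → NCSeries B k} (hF : CtsS F)
    (f : NCSeries A k) : hF.lin f = F f := rfl

theorem isExp_expOp_cts {deg : FreeMonoid A → ℕ} {s : NCSeries A k → NCSeries A k} (hs : CtsS s)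
    (hr : ∀ n, ∀ f ∈ ordGE k deg n, s f ∈ ordGE k deg (n + 1)) (f : NCSeries A k) :
    IsExp (sfil k deg) hs.lin f (expOp s f) := isExp_expOp (s := hs.lin) hr f

theorem cts_iterate {s : NCSeries A k → NCSeries A k} (hs : CtsS s) (n : ℕ) : CtsS s^[n] := by
  induction n with
  | zero => exact Cts.id
  | succ n ih =>
    exact CtsS.comp (H := s) ih hs

theorem cts_expOp {deg : FreeMonoid A → ℕ} {s : NCSeries A k → NCSeries A k} (hs : CtsS s)
    (hr : ∀ n, ∀ f ∈ ordGE k deg n, s f ∈ ordGE k deg (n + 1)) : CtsS (expOp s) := by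
  intro w
  have h : ∀ f : NCSeries A k, expOp s f w =
      ∑ n ∈ Finset.range (deg w + 1), algebraMap ℚ k (n.factorial : ℚ)⁻¹ * (s^[n] f) w := by
    intro f
    have h1 := isExp_expOp_cts hs hr f (deg w + 1) w (Nat.lt_succ_self _)
    rw [sub_apply, sub_eq_zero, sum_apply] at h1
    rw [h1]
    refine Finset.sum_congr rfl fun n _ => ?_
    rw [Module.End.pow_apply]
    exact (algebraMap_smul k (n.factorial : ℚ)⁻¹ _).symm
  have h2 : (fun f : FreeMonoid A → k => expOp s f w) = fun f =>
      ∑ n ∈ Finset.range (deg w + 1), algebraMap ℚ k (n.factorial : ℚ)⁻¹ * (s^[n] f) w :=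
    funext h
  rw [h2]
  exact FinForm.sum _ fun n _ => (cts_iterate hs n w).const_mul _

end Exponentials

end NCSeries

/-! ### The tangential operators -/

section Tangential

variable {G k : Type*} [CommGroup G] [Finite G] [CommRing k]

theorem tAct_eq_pull (γ : G) (f : NCSeries (XL G) k) :
    tAct γ f = pull (Option.map (γ⁻¹ * ·)) f :=
  subst_letter_equiv (Equiv.optionCongr (Equiv.mulLeft γ)) f

theorem cts_tAct (γ : G) : CtsS (tAct (k := k) γ) := cts_subst fun _ => letter_one _

theorem tAct_mul (γ : G) (f g : NCSeries (XL G) k) : tAct γ (f * g) = tAct γ f * tAct γ g :=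
  subst_mul (fun _ => letter_one _) f g

theorem tAct_one (γ : G) : tAct γ (1 : NCSeries (XL G) k) = 1 := subst_one _

theorem tAct_letter_none (γ : G) : tAct γ (letter x0 : NCSeries (XL G) k) = letter x0 :=
  subst_letter _ _

theorem tAct_letter_some (γ σ : G) : tAct γ (letter (xl σ) : NCSeries (XL G) k) =
    letter (xl (γ * σ)) := subst_letter _ _

theorem tAct_apply_one (γ : G) (f : NCSeries (XL G) k) : tAct γ f 1 = f 1 := by
  rw [tAct_eq_pull]
  rfl

theorem tAct_tAct (γ δ : G) (f : NCSeries (XL G) k) : tAct γ (tAct δ f) = tAct (γ * δ) f := by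
  rw [tAct_eq_pull, tAct_eq_pull, tAct_eq_pull, pull_pull]
  congr 1
  funext a
  cases a with
  | none => rfl
  | some σ => simp [mul_assoc]

theorem tAct_one_left (f : NCSeries (XL G) k) : tAct 1 f = f := by
  rw [tAct_eq_pull]
  refine Eq.trans ?_ (pull_id f)
  congr 1
  funext a
  cases a with
  | none => rfl
  | some σ => simp

theorem NCSeries.QPrim.tAct {f : NCSeries (XL G) k} (hf : QPrim shop 0 f) (γ : G) :
    QPrim shop 0 (tAct γ f) := by
  rw [tAct_eq_pull]
  exact hf.pull fun _ _ => rfl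

theorem cts_dOp (ψ : NCSeries (XL G) k) : CtsS (dOp ψ) := cts_der _

theorem dOp_one (ψ : NCSeries (XL G) k) : dOp ψ 1 = 0 := der_one _

theorem dOp_mul (ψ f g : NCSeries (XL G) k) : dOp ψ (f * g) = dOp ψ f * g + f * dOp ψ g :=
  der_mul _ f g

theorem dOp_letter_none (ψ : NCSeries (XL G) k) : dOp ψ (letter x0) = 0 := der_letter _ _

theorem dOp_letter_some (ψ : NCSeries (XL G) k) (σ : G) : dOp ψ (letter (xl σ)) =
    letter (xl σ) * tAct σ ψ - tAct σ ψ * letter (xl σ) := der_letter _ _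

/-- The values of `d_ψ` on letters are equivariant, since translation by `γ` carries `[x_σ, t_σ(ψ)]`
to the same expression for `γσ`. -/
theorem tAct_dOp (γ : G) (ψ f : NCSeries (XL G) k) :
    tAct γ (dOp ψ f) = dOp ψ (tAct γ f) := by
  refine eq_of_leibniz (T := tAct γ) (dl := fun a => tAct γ (dOp ψ (letter a)))
    (g := fun a => tAct γ (letter a)) ((cts_tAct γ).comp (cts_dOp ψ))
    ((cts_dOp ψ).comp (cts_tAct γ)) ?_ (fun a f => ?_) (fun a f => ?_) f
  · rw [dOp_one, tAct_one, dOp_one]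
    exact (cts_tAct γ).map_zero
  · rw [dOp_mul, ← tAct_mul, ← tAct_mul]
    exact (cts_tAct γ).map_add _ _
  · rw [tAct_mul, dOp_mul]
    congr 2
    cases a with
    | none =>
      rw [tAct_letter_none, dOp_letter_none]
      exact (cts_tAct γ).map_zero.symm
    | some σ =>
      rw [tAct_letter_some, dOp_letter_some, dOp_letter_some]
      refine Eq.trans ?_ ((cts_tAct γ).map_sub _ _).symm
      rw [tAct_mul, tAct_mul, tAct_tAct, tAct_letter_some]

theorem dOp_add (ψ φ f : NCSeries (XL G) k) : dOp (ψ + φ) f = dOp ψ f + dOp φ f := by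
  refine eq_of_leibniz (T := id) (dl := fun a => dOp ψ (letter a) + dOp φ (letter a))
    (g := letter) (cts_dOp (ψ + φ)) ((cts_dOp ψ).add (cts_dOp φ)) ?_ (fun a f => ?_)
    (fun a f => ?_) f
  · rw [dOp_one, dOp_one, dOp_one, add_zero]
  · rw [dOp_mul]
    congr 2
    cases a with
    | none => rw [dOp_letter_none, dOp_letter_none, dOp_letter_none, add_zero]
    | some σ =>
      have h : tAct σ (ψ + φ) = tAct σ ψ + tAct σ φ := (cts_tAct σ).map_add _ _
      rw [dOp_letter_some, dOp_letter_some, dOp_letter_some, h]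
      simp only [mul_add, add_mul]
      abel
  · rw [dOp_mul, dOp_mul, id, mul_add, add_mul]
    abel

theorem dOp_smul (c : k) (ψ f : NCSeries (XL G) k) : dOp (c • ψ) f = c • dOp ψ f := by
  refine eq_of_leibniz (T := id) (dl := fun a => c • dOp ψ (letter a))
    (g := letter) (cts_dOp (c • ψ)) ((cts_dOp ψ).const_smul c) ?_ (fun a f => ?_)
    (fun a f => ?_) f
  · rw [dOp_one, dOp_one, smul_zero]
  · rw [dOp_mul]
    congr 2
    cases a with
    | none => rw [dOp_letter_none, dOp_letter_none, smul_zero]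
    | some σ =>
      have h : tAct σ (c • ψ) = c • tAct σ ψ := (cts_tAct σ).map_smul _ _
      rw [dOp_letter_some, dOp_letter_some, h, smul_sub, smul_mul_assoc, mul_smul_comm]
  · rw [dOp_mul, smul_add, id, smul_mul_assoc, mul_smul_comm]

theorem tAct_mem_ordGE (σ : G) {n : ℕ} {f : NCSeries (XL G) k}
    (hf : f ∈ ordGE k FreeMonoid.length n) : tAct σ f ∈ ordGE k FreeMonoid.length n := by
  rw [tAct_eq_pull]
  exact mem_ordGE_pull _ hf

theorem dOp_mem_ordGE_add {ψ : NCSeries (XL G) k} {d : ℕ} (hψ : ψ ∈ ordGE k FreeMonoid.length d)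
    {n : ℕ} {f : NCSeries (XL G) k} (hf : f ∈ ordGE k FreeMonoid.length n) :
    dOp ψ f ∈ ordGE k FreeMonoid.length (n + d) := by
  refine der_mem_ordGE (fun a => ?_) hf
  cases a with
  | none => exact Submodule.zero_mem _
  | some σ =>
    have h := tAct_mem_ordGE σ hψ
    have h1 := mul_mem_ordGE FreeMonoid.length_mul (letter_mem_ordGE (k := k) (xl σ)) h
    rw [add_comm] at h1
    exact Submodule.sub_mem _ h1 (mul_mem_ordGE FreeMonoid.length_mul h (letter_mem_ordGE _))

theorem dOp_mem_ordGE {ψ : NCSeries (XL G) k} (hψ : ψ 1 = 0) {n : ℕ} {f : NCSeries (XL G) k}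
    (hf : f ∈ ordGE k FreeMonoid.length n) : dOp ψ f ∈ ordGE k FreeMonoid.length (n + 1) :=
  dOp_mem_ordGE_add (ordGE_one_iff.2 hψ) hf

theorem cts_sOp (ψ : NCSeries (XL G) k) : CtsS (sOp ψ) := (CtsS.mul_left ψ).add (cts_dOp ψ)

theorem sOp_one (ψ : NCSeries (XL G) k) : sOp ψ 1 = ψ := by
  rw [sOp, dOp_one, mul_one, add_zero]

theorem sOp_mul (ψ f g : NCSeries (XL G) k) : sOp ψ (f * g) = sOp ψ f * g + f * dOp ψ g := by
  rw [sOp, sOp, dOp_mul, add_mul, mul_assoc, add_assoc]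

theorem sOp_add (ψ φ f : NCSeries (XL G) k) : sOp (ψ + φ) f = sOp ψ f + sOp φ f := by
  rw [sOp, sOp, sOp, dOp_add, add_mul]
  abel

theorem sOp_smul (c : k) (ψ f : NCSeries (XL G) k) : sOp (c • ψ) f = c • sOp ψ f := by
  rw [sOp, sOp, dOp_smul, smul_mul_assoc, smul_add]

theorem sOp_mem_ordGE_add {ψ : NCSeries (XL G) k} {d : ℕ} (hψ : ψ ∈ ordGE k FreeMonoid.length d)
    {n : ℕ} {f : NCSeries (XL G) k} (hf : f ∈ ordGE k FreeMonoid.length n) :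
    sOp ψ f ∈ ordGE k FreeMonoid.length (n + d) := by
  have h := mul_mem_ordGE FreeMonoid.length_mul hψ hf
  rw [add_comm] at h
  exact Submodule.add_mem _ h (dOp_mem_ordGE_add hψ hf)

theorem sOp_mem_ordGE {ψ : NCSeries (XL G) k} (hψ : ψ 1 = 0) (n : ℕ) (f : NCSeries (XL G) k)
    (hf : f ∈ ordGE k FreeMonoid.length n) : sOp ψ f ∈ ordGE k FreeMonoid.length (n + 1) :=
  sOp_mem_ordGE_add (ordGE_one_iff.2 hψ) hf

/-- The translate by `σ` of the tangential action commutes with left multiplication by `x_σ`. -/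
theorem tAct_mul_add_dOp_letter (ψ f : NCSeries (XL G) k) (σ : G) :
    tAct σ ψ * (letter (xl σ) * f) + dOp ψ (letter (xl σ) * f) =
      letter (xl σ) * (tAct σ ψ * f + dOp ψ f) := by
  rw [dOp_mul, dOp_letter_some]
  simp only [mul_add, sub_mul, mul_assoc]
  abel

/-- The case `σ = 1` of the previous identity. It makes every power series in `x_1` commute with the
tangential actions, which is why all corrections can be carried along. -/
theorem sOp_letter_one_mul (ψ f : NCSeries (XL G) k) :
    sOp ψ (letter (xl 1) * f) = letter (xl 1) * sOp ψ f := by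
  have h := tAct_mul_add_dOp_letter ψ f 1
  rwa [tAct_one_left] at h

/-- Moving a first letter `y` across `s_ψ` costs `[ψ, y] + d_ψ(y)`. This is a sum of commutators of
primitive series, hence primitive, as the criterion on letters requires. -/
theorem sOp_coderivation {ψ : NCSeries (XL G) k} (hψ : QPrim shop 0 ψ) (f : NCSeries (XL G) k) :
    qcop shop 0 (sOp ψ f) = op1 (sOp ψ) (qcop shop 0 f) + op2 (sOp ψ) (qcop shop 0 f) := by
  refine qcop_coderivation contractions_shop (cts_sOp ψ)
    (d := fun a => ψ * letter a - letter a * ψ + dOp ψ (letter a)) (fun y w => ?_)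
    (by rwa [sOp_one]) (fun y => ?_) f
  · rw [sOp, sOp, dOp_mul]
    simp only [mul_add, sub_mul, add_mul, mul_assoc]
    abel
  · rw [Finset.sum_empty, smul_zero, add_zero]
    refine QPrim.add (hψ.commutator (qprim_letter y)) ?_
    cases y with
    | none =>
      rw [dOp_letter_none, QPrim]
      refine (cts_qcop shop (0 : k)).map_zero.trans ?_
      funext p
      simp [tmul, NCSeries.zero_apply]
    | some σ =>
      rw [dOp_letter_some]
      exact (qprim_letter _).commutator (hψ.tAct σ)

end Tangential

/-! ### The flow of the tangential action and the group law -/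

section Exponential

variable {G k : Type*} [CommGroup G] [Finite G] [CommRing k] [Algebra ℚ k]

/-- Multiplication of series, as a bilinear map. -/
def mulBilin (A k : Type*) [CommRing k] [Algebra ℚ k] :
    NCSeries A k →ₗ[ℚ] NCSeries A k →ₗ[ℚ] NCSeries A k := LinearMap.mul ℚ (NCSeries A k)

theorem isExp_mul {A : Type*} {S s d : Module.End ℚ (NCSeries A k)}
    (hs : Raises (sfil k FreeMonoid.length) s) (hd : Raises (sfil k FreeMonoid.length) d)
    (h : ∀ u v, S (u * v) = s u * v + u * d v) {u v f g : NCSeries A k}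
    (hf : IsExp (sfil k FreeMonoid.length) s u f) (hg : IsExp (sfil k FreeMonoid.length) d v g) :
    IsExp (sfil k FreeMonoid.length) S (u * v) (f * g) :=
  IsExp.bilin (sfil_anti _) (sfil_zero _) (sfil_zero _) hs hd (mulBilin A k)
    (fun _ _ _ hx _ hy => mul_mem_sfil FreeMonoid.length_mul hx hy) h hf hg

variable {ψ : NCSeries (XL G) k}

theorem isExp_sOp (hψ : ψ 1 = 0) (f : NCSeries (XL G) k) :
    IsExp (sfil k FreeMonoid.length) (cts_sOp ψ).lin f (expOp (sOp ψ) f) :=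
  isExp_expOp_cts (cts_sOp ψ) (sOp_mem_ordGE hψ) f

theorem isExp_dOp (hψ : ψ 1 = 0) (f : NCSeries (XL G) k) :
    IsExp (sfil k FreeMonoid.length) (cts_dOp ψ).lin f (expOp (dOp ψ) f) :=
  isExp_expOp_cts (cts_dOp ψ) (fun _ _ => dOp_mem_ordGE hψ) f

theorem raises_sOp (hψ : ψ 1 = 0) : Raises (sfil k FreeMonoid.length) (cts_sOp ψ).lin :=
  sOp_mem_ordGE hψ

theorem raises_dOp (hψ : ψ 1 = 0) : Raises (sfil k FreeMonoid.length) (cts_dOp ψ).lin :=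
  fun _ _ => dOp_mem_ordGE hψ

theorem expOp_apply_one {s : NCSeries (XL G) k → NCSeries (XL G) k} (hs : CtsS s)
    (hr : ∀ n, ∀ f ∈ ordGE k FreeMonoid.length n, s f ∈ ordGE k FreeMonoid.length (n + 1))
    (f : NCSeries (XL G) k) : expOp s f 1 = f 1 := by
  have h := isExp_expOp_cts hs hr f 1 1 Nat.one_pos
  rw [NCSeries.sub_apply, sub_eq_zero, Finset.sum_range_one] at h
  rw [h]
  simp

theorem mtExp_apply_one (hψ : ψ 1 = 0) : mtExp ψ 1 = 1 :=
  (expOp_apply_one (cts_sOp ψ) (sOp_mem_ordGE hψ) 1).trans one_apply_nil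

theorem IsExp.of_apply_eq_zero {M : Type*} [AddCommGroup M] [Module ℚ M]
    {O : ℕ → Submodule ℚ M} (h0 : ∀ f, f ∈ O 0) {s : Module.End ℚ M} {u : M} (h : s u = 0) :
    IsExp O s u u := by
  intro N
  cases N with
  | zero => exact h0 _
  | succ N =>
    rw [Finset.sum_range_succ', Finset.sum_eq_zero fun i _ => by
      rw [pow_succ, Module.End.mul_apply, h, map_zero, smul_zero]]
    simp

theorem expOp_dOp_letter_none (hψ : ψ 1 = 0) : expOp (dOp ψ) (letter x0) = letter x0 :=
  IsExp.unique (sfil_sep _) (isExp_dOp hψ _)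
    (IsExp.of_apply_eq_zero (sfil_zero _) (dOp_letter_none ψ))

theorem expOp_dOp_one (hψ : ψ 1 = 0) : expOp (dOp ψ) 1 = 1 :=
  IsExp.unique (sfil_sep _) (isExp_dOp hψ _)
    (IsExp.of_apply_eq_zero (sfil_zero _) (dOp_one ψ))

theorem expOp_dOp_mul (hψ : ψ 1 = 0) (f g : NCSeries (XL G) k) :
    expOp (dOp ψ) (f * g) = expOp (dOp ψ) f * expOp (dOp ψ) g :=
  IsExp.unique (sfil_sep _) (isExp_dOp hψ _)
    (isExp_mul (raises_dOp hψ) (raises_dOp hψ) (dOp_mul ψ) (isExp_dOp hψ f) (isExp_dOp hψ g))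

theorem expOp_sOp_mul (hψ : ψ 1 = 0) (f g : NCSeries (XL G) k) :
    expOp (sOp ψ) (f * g) = expOp (sOp ψ) f * expOp (dOp ψ) g :=
  IsExp.unique (sfil_sep _) (isExp_sOp hψ _)
    (isExp_mul (raises_sOp hψ) (raises_dOp hψ) (sOp_mul ψ) (isExp_sOp hψ f) (isExp_dOp hψ g))

theorem tAct_mem_sfil (σ : G) {n : ℕ} {f : NCSeries (XL G) k}
    (hf : f ∈ sfil k FreeMonoid.length n) : tAct σ f ∈ sfil k FreeMonoid.length n :=
  tAct_mem_ordGE σ hf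

/-- Consider the operator `f ↦ t_σ(ψ) f + d_ψ(f)`. It is a derivation-like operator over `d_ψ` and
it commutes with left multiplication by `x_σ`. Its exponential at `x_σ` can therefore be computed in
two ways, and these are the two sides. Equivalently, `exp(d_ψ)` conjugates `x_σ` by the translate of
`Exp(ψ)`. -/
theorem tAct_mtExp_mul (hψ : ψ 1 = 0) (σ : G) :
    tAct σ (mtExp ψ) * expOp (dOp ψ) (letter (xl σ)) = letter (xl σ) * tAct σ (mtExp ψ) := by
  have hS : CtsS fun f => tAct σ ψ * f + dOp ψ f := (CtsS.mul_left _).add (cts_dOp ψ)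
  have hr : Raises (sfil k FreeMonoid.length) hS.lin := by
    intro n f hf
    have h := mul_mem_sfil FreeMonoid.length_mul (tAct_mem_sfil σ
      (show ψ ∈ sfil k FreeMonoid.length 1 from ordGE_one_iff.2 hψ)) hf
    rw [add_comm] at h
    exact Submodule.add_mem _ h (dOp_mem_ordGE hψ hf)
  have h1 : IsExp (sfil k FreeMonoid.length) hS.lin 1 (tAct σ (mtExp ψ)) := by
    have h := (isExp_sOp hψ 1).map (O₁ := sfil k FreeMonoid.length) (s₁ := hS.lin)
      (cts_tAct σ).lin (fun n x hx => tAct_mem_sfil σ hx) (fun x => by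
        simp only [CtsS.lin_apply, sOp]
        rw [(cts_tAct σ).map_add, tAct_mul, tAct_dOp])
    simp only [CtsS.lin_apply, tAct_one] at h
    exact h
  have h2 := isExp_mul hr (raises_dOp hψ) (S := hS.lin) (fun u v => by
    simp only [CtsS.lin_apply]
    rw [dOp_mul, add_mul, mul_assoc, add_assoc]) h1 (isExp_dOp hψ (letter (xl σ)))
  have h3 := h1.map (O₁ := sfil k FreeMonoid.length) (s₁ := hS.lin)
    (CtsS.mul_left (letter (xl σ))).lin (fun n x hx => by
      have := mul_mem_sfil FreeMonoid.length_mul (sfil_zero _ (letter (xl σ))) hx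
      rwa [zero_add] at this) (fun x => (tAct_mul_add_dOp_letter ψ x σ).symm)
  simp only [CtsS.lin_apply, mul_one, one_mul] at h2 h3
  exact IsExp.unique (sfil_sep _) h2 h3

/-- The flow of the tangential action is left translation in the group `MT`. -/
theorem mtMul_mtExp (hψ : ψ 1 = 0) (Φ : NCSeries (XL G) k) :
    mtMul (mtExp ψ) Φ = expOp (sOp ψ) Φ := by
  -- The exponential of a derivation is a continuous morphism, so a comparison on letters is enough.
  have hk : expOp (dOp ψ) Φ = kappa (mtExp ψ) Φ := by
    refine eq_subst (fun a => ?_) (cts_expOp (cts_dOp ψ) fun _ _ => dOp_mem_ordGE hψ)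
      (expOp_dOp_one hψ) (fun a f => ?_) Φ
    · cases a with
      | none => exact letter_one _
      | some σ =>
        refine (mul_apply_nil _ _).trans ?_
        rw [mul_apply_nil, letter_one, mul_zero, zero_mul]
    · rw [expOp_dOp_mul hψ]
      congr 1
      cases a with
      | none => exact expOp_dOp_letter_none hψ
      | some σ =>
        have hu : IsUnit (tAct σ (mtExp ψ)) :=
          isUnit_of_apply_one ((tAct_apply_one _ _).trans (mtExp_apply_one hψ))
        change _ = Ring.inverse (tAct σ (mtExp ψ)) * letter (xl σ) * tAct σ (mtExp ψ)
        rw [mul_assoc, ← tAct_mtExp_mul hψ, ← mul_assoc, Ring.inverse_mul_cancel _ hu, one_mul]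
  rw [mtMul, ← hk, mtExp, ← expOp_sOp_mul hψ, one_mul]

end Exponential

end DoubleShuffle
end

noncomputable section

namespace DoubleShuffle

open NCSeries

/-! ### Raising one weight -/

section UpSum

variable {G k : Type*} [CommGroup G] [CommRing k]

/-- The letter `y_{n+1,ν}`. -/
def yup (a : YL G) : YL G := (a.1 + 1, a.2)

/-- The sum `∑ n_i Q(⋯ y_{n_i + 1,ν_i} ⋯)`. -/
def upSum : (List (YL G) → k) → List (YL G) → k
  | _, [] => 0
  | Q, a :: w => (a.1 : ℕ) * Q (yup a :: w) + upSum (fun v => Q (a :: v)) w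

theorem yWord_cons (a : YL G) (w : List (YL G)) :
    yWord (FreeMonoid.ofList (a :: w)) = FreeMonoid.of x0 ^ ((a.1 : ℕ) - 1) *
      (FreeMonoid.of (xl a.2) * yWord (FreeMonoid.ofList w)) := by
  rw [FreeMonoid.ofList_cons, map_mul, yWord, FreeMonoid.lift_eval_of, mul_assoc]

theorem upSum_add (P Q : List (YL G) → k) (w : List (YL G)) :
    upSum (fun v => P v + Q v) w = upSum P w + upSum Q w := by
  induction w generalizing P Q with
  | nil => simp [upSum]
  | cons a w ih =>
    simp only [upSum, ih]
    ring

theorem upSum_eq_zero {Q : List (YL G) → k} {w : List (YL G)}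
    (h : ∀ v, v.length = w.length → Q v = 0) : upSum Q w = 0 := by
  induction w generalizing Q with
  | nil => rfl
  | cons a w ih => rw [upSum, h _ (by simp), ih fun v hv => h _ (by simp [hv]), mul_zero, add_zero]

theorem yop_yup_left (a b : YL G) : yop (yup a) b = yup (yop a b) :=
  Prod.ext (add_right_comm _ _ _) rfl

theorem yop_yup_right (a b : YL G) : yop a (yup b) = yup (yop a b) :=
  Prod.ext (add_assoc _ _ _).symm rfl

/-- The coefficient attached to a merged letter is the sum of the two weights, so raising one weight
is a derivation of the quasi-shuffle product. -/
theorem stf_upSum (u v : List (YL G)) (Q : List (YL G) → k) :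
    stf yop 1 (upSum Q) u v = upSum (fun x => stf yop 1 Q x v) u +
      upSum (fun x => stf yop 1 Q u x) v := by
  refine pair_induction (p := fun u v => ∀ Q : List (YL G) → k,
    stf yop 1 (upSum Q) u v = upSum (fun x => stf yop 1 Q x v) u +
      upSum (fun x => stf yop 1 Q u x) v) (fun v Q => ?_) (fun u Q => ?_)
    (fun a u b v h1 h2 h3 Q => ?_) u v Q
  · simp [upSum]
  · simp [upSum]
  · simp only [stf_cons_cons, upSum, stf_add, stf_mul, h1, h2, h3, upSum_add, yop_yup_left,
      yop_yup_right, yop_fst, one_mul]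
    push_cast
    ring

theorem ShPrim.upSum {P : List (YL G) → k} (hP : ShPrim yop 1 P) : ShPrim yop 1 (upSum P) := by
  refine ⟨rfl, fun u v hu hv => ?_⟩
  rw [stf_upSum, upSum_eq_zero, upSum_eq_zero, add_zero]
  · intro x hx
    refine hP.2 _ _ hu ?_
    rintro rfl
    exact hv (List.length_eq_zero_iff.1 hx.symm)
  · intro x hx
    refine hP.2 _ _ ?_ hv
    rintro rfl
    exact hu (List.length_eq_zero_iff.1 hx.symm)

theorem upSum_psAux (p : G) (w : List (YL G)) (Q : List (YL G) → k) :
    upSum Q (psAux p w) = upSum (fun v => Q (psAux p v)) w := by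
  induction w generalizing p Q with
  | nil => rfl
  | cons a w ih =>
    simp only [psAux, upSum, ih]
    rfl

end UpSum

/-! ### The derivation `∂_{x₀}` -/

section Partial

variable {G k : Type*} [Finite G] [CommRing k]

theorem cts_partial0 : CtsS (partial0 (G := G) (k := k)) := cts_der _

/-- Dually, `∂_{x₀}` is the shuffle with the letter `x₀`: both sides satisfy the Leibniz rule with
the same values on letters. -/
theorem partial0_apply (f : NCSeries (XL G) k) (w : FreeMonoid (XL G)) :
    partial0 f w = qcop shop 0 f (FreeMonoid.of x0, w) := by
  have hH : CtsS fun (f : NCSeries (XL G) k) => (fun w => qcop shop 0 f (FreeMonoid.of x0, w) :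
      NCSeries (XL G) k) := Cts.comp (Cts.precomp fun w => (FreeMonoid.of x0, w)) (cts_qcop shop 0)
  refine congrFun (eq_of_leibniz (T := id) (dl := fun a => match a with
    | none => 1
    | some _ => 0) (g := letter) cts_partial0 hH ?_ (fun a f => der_letter_mul _ a f)
    (fun a f => ?_) f) w
  · refine (der_one _).trans ?_
    ext w
    change 0 = qcop shop 0 (1 : NCSeries (XL G) k) (FreeMonoid.of x0, w)
    rw [qcop_one]
    have h := one_apply_cons (k := k) (x0 : XL G) 1
    rw [mul_one] at h
    rw [tmul, h, zero_mul]
  · ext w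
    change qcop shop 0 (letter a * f) (FreeMonoid.of x0, w) = _
    rw [qcop_letter_mul contractions_shop]
    rw [zero_smul, add_zero]
    refine congrArg₂ (fun x y : k => x + y) ?_ rfl
    change (letter a * (id fun u => qcop shop 0 f (u, w) : NCSeries (XL G) k) :
      NCSeries (XL G) k) (FreeMonoid.of x0) = _
    rw [← mul_one (FreeMonoid.of x0)]
    cases a with
    | none =>
      rw [letter_mul_cons_self]
      refine (qcop_one_left shop (0 : k) f w).trans ?_
      exact congrFun (one_mul f).symm w
    | some σ =>
      rw [letter_mul_cons_ne (by simp)]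
      exact congrFun (zero_mul f).symm w

theorem partial0_apply_one (f : NCSeries (XL G) k) : partial0 f 1 = f (FreeMonoid.of x0) := by
  rw [partial0_apply, qcop_one_right]

theorem partial0_apply_cons (f : NCSeries (XL G) k) (b : XL G) (v : FreeMonoid (XL G)) :
    partial0 f (FreeMonoid.of b * v) = f (FreeMonoid.of x0 * (FreeMonoid.of b * v)) +
      partial0 (NCSeries.residual b f) v := by
  rw [partial0_apply, partial0_apply, ← mul_one (FreeMonoid.of x0), qcop_cons_cons, zero_mul,
    add_zero, qcop_one_left, mul_one]
  rfl

theorem partial0_pow_mul (f : NCSeries (XL G) k) (m : ℕ) (v : FreeMonoid (XL G)) :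
    partial0 f (FreeMonoid.of x0 ^ m * v) = m * f (FreeMonoid.of x0 ^ (m + 1) * v) +
      partial0 (shiftL (FreeMonoid.of x0 ^ m) f) v := by
  induction m generalizing f with
  | zero =>
    have h : shiftL (1 : FreeMonoid (XL G)) f = f := NCSeries.ext fun w => by
      rw [shiftL_apply, one_mul]
    rw [pow_zero, one_mul, Nat.cast_zero, zero_mul, zero_add, h]
  | succ m ih =>
    have h : shiftL (FreeMonoid.of x0 ^ m) (NCSeries.residual x0 f) =
        shiftL (FreeMonoid.of x0 ^ (m + 1)) f := NCSeries.ext fun w => by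
      rw [shiftL_apply, shiftL_apply, residual_apply, pow_succ', mul_assoc]
    rw [pow_succ', mul_assoc, partial0_apply_cons, ih, h, residual_apply]
    simp only [pow_succ', mul_assoc]
    push_cast
    ring

theorem partial0_pow (f : NCSeries (XL G) k) (m : ℕ) :
    partial0 f (FreeMonoid.of x0 ^ m) = (m + 1) * f (FreeMonoid.of x0 ^ (m + 1)) := by
  have h := partial0_pow_mul f m 1
  rw [mul_one, mul_one, partial0_apply_one, shiftL_apply, ← pow_succ] at h
  rw [h]
  ring

/-- There are `n` places to insert `x₀` in a block `x₀^{n-1} x_σ`, and `j + 1` in the final power of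
`x₀`. -/
theorem partial0_yWord [CommGroup G] (f : NCSeries (XL G) k) (w : List (YL G)) (j : ℕ) :
    partial0 f (yWord (FreeMonoid.ofList w) * FreeMonoid.of x0 ^ j) =
      upSum (fun v => f (yWord (FreeMonoid.ofList v) * FreeMonoid.of x0 ^ j)) w +
      (j + 1) * f (yWord (FreeMonoid.ofList w) * FreeMonoid.of x0 ^ (j + 1)) := by
  induction w generalizing f with
  | nil =>
    have h : yWord (FreeMonoid.ofList ([] : List (YL G))) = 1 := rfl
    rw [upSum, h, one_mul, one_mul, partial0_pow, zero_add]
  | cons a w ih =>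
    obtain ⟨n, hn⟩ : ∃ n : ℕ, (a.1 : ℕ) = n + 1 := ⟨_, (Nat.succ_pred_eq_of_pos a.1.pos).symm⟩
    have h2 : ((yup a).1 : ℕ) = n + 1 + 1 := by
      rw [← hn]
      rfl
    simp only [upSum, yWord_cons, hn, h2, Nat.add_sub_cancel, mul_assoc]
    rw [partial0_pow_mul, partial0_apply_cons]
    have h3 := ih (NCSeries.residual (xl a.2) (shiftL (FreeMonoid.of x0 ^ n) f))
    rw [h3]
    simp only [residual_apply, shiftL_apply, pow_succ, mul_assoc, yup]
    push_cast
    ring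

theorem partial0_eq_zero {ψ : NCSeries (XL G) k} (hψ : QPrim shop 0 ψ)
    (h0 : ψ (FreeMonoid.of x0) = 0) : partial0 ψ = 0 := by
  ext w
  rw [partial0_apply, hψ]
  have h := one_apply_cons (k := k) (x0 : XL G) 1
  rw [mul_one] at h
  simp only [Pi.add_apply, tmul]
  rw [h, h0, zero_mul, zero_mul, add_zero]
  rfl

theorem QPrim_apply_one {A : Type*} {op : A → A → A} {ε : k} {f : NCSeries A k}
    (hf : QPrim op ε f) : f 1 = 0 := (qcop_eq_iff.1 hf).1

theorem apply_x0_pow [Algebra ℚ k] {ψ : NCSeries (XL G) k} (hψ : QPrim shop 0 ψ)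
    (h0 : ψ (FreeMonoid.of x0) = 0) (j : ℕ) : ψ (FreeMonoid.of x0 ^ j) = 0 := by
  cases j with
  | zero => exact QPrim_apply_one hψ
  | succ j =>
    have h := partial0_pow ψ j
    rw [partial0_eq_zero hψ h0] at h
    have h1 : IsUnit ((j : k) + 1) := by
      have := (IsUnit.mk0 ((j : ℚ) + 1) (by positivity)).map (algebraMap ℚ k)
      simpa using this
    exact h1.mul_right_eq_zero.1 h.symm

/-- The antipode formula for weight `ε = 0`, where no contraction survives. -/
theorem apply_reverse {ψ : NCSeries (XL G) k} (hψ : QPrim shop 0 ψ) (w : List (XL G)) :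
    ψ (FreeMonoid.ofList w.reverse) = (-1) ^ (w.length + 1) * ψ (FreeMonoid.ofList w) := by
  cases w with
  | nil =>
    have h : ψ (FreeMonoid.ofList []) = 0 := QPrim_apply_one hψ
    rw [List.reverse_nil, h, mul_zero]
  | cons b q =>
    have h := (qcop_eq_iff.1 hψ).antipode (fun _ _ => rfl) (fun _ _ _ => rfl) b q
    rw [contr_zero_weight] at h
    rw [h, ← mul_assoc, ← pow_add, List.length_cons, Even.neg_one_pow, one_mul]
    rw [Nat.even_iff]
    omega

end Partial

end DoubleShuffle
end

noncomputable section

namespace DoubleShuffle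

open NCSeries

namespace NCSeries

/-! ### Power series in a single letter -/

section PowSeries

variable {A k : Type*} [CommRing k]

/-- The series `∑ c_n a^n` in one letter. -/
def powSeries (a : A) (c : ℕ → k) : NCSeries A k := lsum fun n => c n • letter a ^ n

theorem letter_pow (a : A) (n : ℕ) : (letter a : NCSeries A k) ^ n = word (FreeMonoid.of a ^ n) := by
  induction n with
  | zero => rw [pow_zero, pow_zero, word_one]
  | succ n ih => rw [pow_succ', pow_succ', ih, letter_mul_word]

theorem length_of_pow (a : A) (n : ℕ) : (FreeMonoid.of a ^ n).length = n := by
  induction n with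
  | zero => rfl
  | succ n ih => rw [pow_succ', FreeMonoid.length_mul, ih, FreeMonoid.length_of, add_comm]

open Classical in
theorem powSeries_apply (a : A) (c : ℕ → k) (w : FreeMonoid A) :
    powSeries a c w = if w = FreeMonoid.of a ^ w.length then c w.length else 0 := by
  change ∑ᶠ n, c n * ((letter a : NCSeries A k) ^ n) w = _
  simp only [letter_pow, word]
  rw [finsum_eq_single _ w.length]
  · split_ifs <;> simp
  · intro n hn
    rw [if_neg, mul_zero]
    rintro rfl
    exact hn (length_of_pow a n).symm

theorem powSeries_apply_cons (a b : A) (c : ℕ → k) (w : FreeMonoid A) :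
    powSeries a c (FreeMonoid.of b * w) = residual b (powSeries a c) w := rfl

theorem residual_powSeries_self (a : A) (c : ℕ → k) :
    residual a (powSeries a c) = powSeries a fun n => c (n + 1) := by
  classical
  ext w
  rw [residual_apply, powSeries_apply, powSeries_apply, FreeMonoid.length_mul,
    FreeMonoid.length_of, add_comm 1, pow_succ']
  refine if_congr ?_ rfl rfl
  exact mul_right_inj _

theorem residual_powSeries_ne {a b : A} (h : b ≠ a) (c : ℕ → k) :
    residual b (powSeries a c) = 0 := by
  classical
  ext w
  rw [residual_apply, powSeries_apply, FreeMonoid.length_mul,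
    FreeMonoid.length_of, add_comm 1, pow_succ', if_neg, NCSeries.zero_apply]
  intro h1
  have h2 : b :: w.toList = a :: (FreeMonoid.of a ^ w.length).toList := h1
  exact h (List.cons.inj h2).1

theorem powSeries_apply_one (a : A) (c : ℕ → k) : powSeries a c 1 = c 0 := by
  classical
  rw [powSeries_apply]
  exact if_pos rfl

theorem powSeries_add (a : A) (c d : ℕ → k) :
    powSeries a (fun n => c n + d n) = powSeries a c + powSeries a d := by
  classical
  ext w
  rw [NCSeries.add_apply, powSeries_apply, powSeries_apply, powSeries_apply]
  split_ifs <;> simp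

theorem powSeries_reverse (a : A) (c : ℕ → k) (w : List A) :
    powSeries a c (FreeMonoid.ofList w.reverse) = powSeries a c (FreeMonoid.ofList w) := by
  classical
  have h : ∀ n, FreeMonoid.of a ^ n = FreeMonoid.ofList (List.replicate n a) := by
    intro n
    induction n with
    | zero => rfl
    | succ n ih => 
      rw [pow_succ', ih]
      rfl
  rw [powSeries_apply, powSeries_apply, h, h]
  have e1 : (FreeMonoid.ofList w).length = w.length := rfl
  have e2 : (FreeMonoid.ofList w.reverse).length = w.length := List.length_reverse
  rw [e1, e2]
  refine if_congr ?_ rfl rfl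
  constructor
  · intro h
    have h1 : w.reverse = List.replicate w.length a := h
    have h2 := congrArg List.reverse h1
    rw [List.reverse_reverse, List.reverse_replicate] at h2
    exact h2
  · intro h
    have h1 : w = List.replicate w.length a := h
    have h2 := congrArg List.reverse h1
    rw [List.reverse_replicate] at h2
    exact h2

variable [Algebra ℚ k]

theorem hasFSum_powSeries (a : A) (c : ℕ → k) : HasFSum (sfil k FreeMonoid.length)
    (fun n => c n • letter a ^ n) (powSeries a c) := by
  refine hasFSum_lsum fun n => ?_
  refine (ordGE k FreeMonoid.length n).smul_mem (c n) ?_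
  rw [letter_pow]
  intro w hw
  refine word_ne ?_
  rintro rfl
  rw [length_of_pow] at hw
  exact lt_irrefl _ hw

theorem mul_powSeries_comm (a : A) (c : ℕ → k) :
    letter a * powSeries a c = powSeries a c * letter a := by
  have h1 := (hasFSum_powSeries a c).map (O₁ := sfil k FreeMonoid.length)
    (LinearMap.mulLeft ℚ (letter a)) fun n x hx => by
      have := mul_mem_sfil FreeMonoid.length_mul (sfil_zero _ (letter a)) hx
      rwa [zero_add] at this
  have h2 := (hasFSum_powSeries a c).map (O₁ := sfil k FreeMonoid.length)
    (LinearMap.mulRight ℚ (letter a)) fun n x hx =>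
      mul_mem_sfil FreeMonoid.length_mul hx (sfil_zero _ (letter a))
  refine HasFSum.unique (sfil_sep _) h1 ?_
  simp only [LinearMap.mulRight_apply, LinearMap.mulLeft_apply] at h2 ⊢
  refine Eq.subst (motive := fun u => HasFSum _ u _) ?_ h2
  funext n
  rw [mul_smul_comm, smul_mul_assoc, pow_mul_comm']

end PowSeries

end NCSeries

/-! ### The correction series -/

section Corr

variable {G k : Type*} [CommGroup G] [Finite G] [CommRing k] [Algebra ℚ k]

theorem tAct_powSeries (σ : G) (c : ℕ → k) :
    tAct σ (powSeries (xl 1) c) = powSeries (xl σ) c := by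
  have h1 := (hasFSum_powSeries (xl (1 : G)) c).map (O₁ := sfil k FreeMonoid.length)
    (cts_tAct σ).lin fun n x hx => tAct_mem_sfil σ hx
  refine HasFSum.unique (sfil_sep _) h1 ?_
  have h2 : ∀ n, tAct σ ((letter (xl (1 : G)) : NCSeries (XL G) k) ^ n) = letter (xl σ) ^ n := by
    intro n
    induction n with
    | zero => rw [pow_zero, pow_zero, tAct_one]
    | succ n ih => rw [pow_succ, tAct_mul, ih, tAct_letter_some, mul_one, pow_succ]
  simp only [CtsS.lin_apply, (cts_tAct σ).map_smul, h2]
  exact hasFSum_powSeries (xl σ) c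

/-- The translate by `σ` is a power series in `x_σ`, which commutes with `x_σ`. Power series in
`x_1` thus act tangentially by left multiplication alone. -/
theorem dOp_powSeries (c : ℕ → k) (f : NCSeries (XL G) k) : dOp (powSeries (xl 1) c) f = 0 := by
  refine eq_of_leibniz (T := id) (dl := fun _ => 0) (g := letter) (H := fun _ => 0)
    (cts_dOp (powSeries (xl 1) c)) Cts.zero (dOp_one _) (fun a f => ?_) (fun a f => ?_) f
  · rw [dOp_mul]
    congr 2
    cases a with
    | none => exact dOp_letter_none _
    | some σ => rw [dOp_letter_some, tAct_powSeries, mul_powSeries_comm, sub_self]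
  · exact ((congrArg₂ (fun x y : NCSeries (XL G) k => x + y) (zero_mul _) (mul_zero _)).trans
      (add_zero _)).symm

theorem sOp_powSeries (c : ℕ → k) (f : NCSeries (XL G) k) :
    sOp (powSeries (xl 1) c) f = powSeries (xl 1) c * f := by
  rw [sOp, dOp_powSeries, add_zero]

theorem partial0_powSeries (c : ℕ → k) : partial0 (powSeries (xl (1 : G)) c) = 0 := by
  have h0 : ∀ c : ℕ → k, ∀ w, powSeries (xl (1 : G)) c (FreeMonoid.of x0 * w) = 0 := fun c w =>
    congrFun (residual_powSeries_ne (by simp) c) w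
  ext w
  induction w using FreeMonoid.inductionOn' generalizing c with
  | one =>
    rw [partial0_apply_one, ← mul_one (FreeMonoid.of x0), h0]
    rfl
  | of_mul b v ih =>
    rw [partial0_apply_cons, h0, zero_add]
    by_cases hb : b = xl 1
    · rw [hb, residual_powSeries_self]
      exact ih _
    · rw [residual_powSeries_ne hb, (cts_partial0 (G := G) (k := k)).map_zero]
      rfl

theorem piY_powSeries (c : ℕ → k) :
    piY (powSeries (xl (1 : G)) c) = powSeries ((1, 1) : YL G) c := by
  ext w
  induction w using FreeMonoid.inductionOn' generalizing c with
  | one => rw [piY, map_one, powSeries_apply_one, powSeries_apply_one]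
  | of_mul a w ih =>
    obtain ⟨n, hn⟩ : ∃ n : ℕ, (a.1 : ℕ) = n + 1 := ⟨_, (Nat.succ_pred_eq_of_pos a.1.pos).symm⟩
    rw [powSeries_apply_cons]
    change powSeries (xl (1 : G)) c (yWord (FreeMonoid.ofList (a :: w.toList))) = _
    rw [yWord_cons, hn, Nat.add_sub_cancel]
    cases n with
    | zero =>
      have ha1 : a.1 = 1 := PNat.coe_injective hn
      rw [pow_zero, one_mul, powSeries_apply_cons]
      by_cases ha : a.2 = 1
      · rw [ha, residual_powSeries_self, show a = (1, 1) from Prod.ext ha1 ha,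
          residual_powSeries_self]
        exact ih _
      · rw [residual_powSeries_ne (by simpa using ha),
          residual_powSeries_ne (fun h => ha (congrArg Prod.snd h))]
        rfl
    | succ n =>
      rw [residual_powSeries_ne, pow_succ', mul_assoc, powSeries_apply_cons,
        residual_powSeries_ne (by simp)]
      · rfl
      · rintro rfl
        simp at hn

theorem qs_powSeries (c : ℕ → k) :
    qs (powSeries ((1, 1) : YL G) c) = powSeries ((1, 1) : YL G) c := by
  ext w
  induction w using FreeMonoid.inductionOn' generalizing c with
  | one => rfl
  | of_mul a w ih =>
    have h : qs (powSeries ((1, 1) : YL G) c) (FreeMonoid.of a * w) = powSeries ((1, 1) : YL G) c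
        (FreeMonoid.of (a.1, 1 * a.2) * FreeMonoid.ofList (psAux (1 * a.2) w.toList)) := rfl
    rw [h, one_mul, powSeries_apply_cons, powSeries_apply_cons]
    by_cases ha : a = (1, 1)
    · rw [ha, residual_powSeries_self]
      exact ih _
    · rw [residual_powSeries_ne ha]
      rfl

theorem ps_qs (f : NCSeries (YL G) k) : ps (qs f) = f := by
  ext w
  exact congrArg f (psWord_qsWord w)

theorem qs_ps (f : NCSeries (YL G) k) : qs (ps f) = f := by
  ext w
  exact congrArg f (qsWord_psWord w)

/-- The coefficients of the correction `corr ψ`. -/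
def corrCoeff (ψ : NCSeries (XL G) k) (n : ℕ) : k :=
  if 2 ≤ n then ((-1) ^ (n - 1) / n : ℚ) • ψ (FreeMonoid.of x0 ^ (n - 1) * FreeMonoid.of (xl 1))
  else 0

theorem corr_eq_powSeries (ψ : NCSeries (XL G) k) : corr ψ = powSeries (1, 1) (corrCoeff ψ) := by
  unfold corr powSeries
  congr 1
  funext n
  unfold corrCoeff
  split_ifs with h
  · ext w
    have h1 : piY ψ (FreeMonoid.of (⟨n, by omega⟩, 1)) =
        ψ (FreeMonoid.of x0 ^ (n - 1) * FreeMonoid.of (xl 1)) := by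
      rw [piY, yWord, FreeMonoid.lift_eval_of]
      rfl
    rw [h1]
    exact (smul_mul_assoc _ _ _).symm
  · rw [zero_smul]

/-- The correction, as a series in `x_1`. -/
def corrX (ψ : NCSeries (XL G) k) : NCSeries (XL G) k := powSeries (xl 1) (corrCoeff ψ)

theorem qs_add (f g : NCSeries (YL G) k) : qs (f + g) = qs f + qs g := rfl

theorem piY_add (f g : NCSeries (XL G) k) : piY (f + g) = piY f + piY g := rfl

/-- Power series in `x_1` become the same power series in `y_1` under `π_Y`, and `qs` fixes them.
The correction can therefore be made in the letters `X`, before projecting. -/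
theorem starLie_eq (ψ : NCSeries (XL G) k) : starLie ψ = qs (piY (ψ + corrX ψ)) := by
  rw [piY_add, qs_add, corrX, piY_powSeries, qs_powSeries, starLie, corr_eq_powSeries]

end Corr

end DoubleShuffle
end

noncomputable section

namespace DoubleShuffle

open NCSeries

/-! ### Words in `X` and words in `Y` -/

section Words

variable {G k : Type*} [CommGroup G] [CommRing k]

/-- Reading a word in `Y` off a word in `X`. -/
def parse : ℕ → List (XL G) → List (YL G)
  | _, [] => []
  | n, none :: l => parse (n + 1) l
  | n, some σ :: l => (n.succPNat, σ) :: parse 0 l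

theorem parse_pow_mul (n m : ℕ) (v : FreeMonoid (XL G)) :
    parse n (FreeMonoid.of x0 ^ m * v).toList = parse (n + m) v.toList := by
  induction m generalizing n with
  | zero => rw [pow_zero, one_mul, add_zero]
  | succ m ih =>
    rw [pow_succ', mul_assoc]
    refine Eq.trans ?_ ((ih (n + 1)).trans (by rw [add_right_comm, add_assoc]))
    rfl

theorem parse_yWord (w : List (YL G)) : parse 0 (yWord (FreeMonoid.ofList w)).toList = w := by
  induction w with
  | nil => rfl
  | cons a w ih =>
    rw [yWord_cons, parse_pow_mul, zero_add]
    refine Eq.trans ?_ (congrArg (a :: ·) ih)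
    change ((((a.1 : ℕ) - 1).succPNat, a.2) :: _ : List (YL G)) = _
    congr 1
    exact Prod.ext (PNat.coe_injective (Nat.sub_add_cancel a.1.pos)) rfl

theorem yWord_injective : Function.Injective (yWord (G := G)) := fun u v h =>
  (parse_yWord u.toList).symm.trans ((congrArg (fun w => parse 0 (FreeMonoid.toList w)) h).trans
    (parse_yWord v.toList))

theorem exists_yWord_mul_pow (v : FreeMonoid (XL G)) :
    ∃ (w : List (YL G)) (j : ℕ), v = yWord (FreeMonoid.ofList w) * FreeMonoid.of x0 ^ j := by
  induction v using FreeMonoid.inductionOn' with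
  | one => exact ⟨[], 0, rfl⟩
  | of_mul a v ih =>
    obtain ⟨w, j, rfl⟩ := ih
    cases a with
    | some σ =>
      refine ⟨(1, σ) :: w, j, ?_⟩
      rw [yWord_cons, PNat.one_coe, Nat.sub_self, pow_zero, one_mul, mul_assoc]
    | none =>
      cases w with
      | nil => exact ⟨[], j + 1, by rw [pow_succ']; rfl⟩
      | cons a w =>
        refine ⟨yup a :: w, j, ?_⟩
        have h : ((yup a).1 : ℕ) - 1 = (a.1 : ℕ) - 1 + 1 := (Nat.sub_add_cancel a.1.pos).symm
        rw [yWord_cons, yWord_cons, h, pow_succ']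
        simp only [mul_assoc]
        rfl

theorem eq_of_mul_of_eq {A : Type*} {u v : FreeMonoid A} {a b : A}
    (h : u * FreeMonoid.of a = v * FreeMonoid.of b) : u = v ∧ a = b := by
  have h1 : u.toList ++ [a] = v.toList ++ [b] := h
  have h2 := List.append_inj' h1 rfl
  exact ⟨h2.1, (List.cons.inj h2.2).1⟩

theorem mul_of_ne_one {A : Type*} (u : FreeMonoid A) (a : A) : u * FreeMonoid.of a ≠ 1 := by
  intro h
  have h1 : u.toList ++ [a] = [] := h
  simp at h1

theorem yWord_concat (w : List (YL G)) (a : YL G) : yWord (FreeMonoid.ofList (w ++ [a])) =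
    yWord (FreeMonoid.ofList w) * FreeMonoid.of x0 ^ ((a.1 : ℕ) - 1) * FreeMonoid.of (xl a.2) := by
  rw [FreeMonoid.ofList_append, map_mul, yWord_cons, ← mul_assoc, ← mul_assoc]
  exact mul_one _

theorem yWord_ne (w : List (YL G)) (z : FreeMonoid (XL G)) :
    yWord (FreeMonoid.ofList w) ≠ z * FreeMonoid.of x0 := by
  rcases eq_nil_or_concat' w with rfl | ⟨v, a, rfl⟩
  · exact (mul_of_ne_one z x0).symm
  · rw [yWord_concat]
    intro h
    have := (eq_of_mul_of_eq h).2
    simp at this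

theorem mul_letter_apply_self {A : Type*} (f : NCSeries A k) (a : A) (w : FreeMonoid A) :
    (f * letter a : NCSeries A k) (w * FreeMonoid.of a) = f w := by
  classical
  rw [mul_apply_snoc, letter_one, mul_zero, zero_add]
  have h : (show NCSeries A k from fun v => (letter a : NCSeries A k) (v * FreeMonoid.of a)) = 1 := by
    ext v
    refine if_congr ?_ rfl rfl
    constructor
    · intro h
      exact (eq_of_mul_of_eq (u := v) (v := 1) h).1
    · rintro rfl
      rfl
  exact (congrArg (fun g : NCSeries A k => (f * g : NCSeries A k) w) h).trans
    (congrFun (mul_one f) w)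

theorem mul_letter_apply_ne {A : Type*} (f : NCSeries A k) {a b : A} (hab : b ≠ a)
    (w : FreeMonoid A) : (f * letter a : NCSeries A k) (w * FreeMonoid.of b) = 0 := by
  classical
  rw [mul_apply_snoc, letter_one, mul_zero, zero_add]
  have h : (show NCSeries A k from fun v => (letter a : NCSeries A k) (v * FreeMonoid.of b)) = 0 := by
    ext v
    refine if_neg ?_
    intro h
    exact hab (eq_of_mul_of_eq (u := v) (v := 1) h).2
  exact (congrArg (fun g : NCSeries A k => (f * g : NCSeries A k) w) h).trans
    (congrFun (mul_zero f) w)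

theorem piY_mul_letter (f : NCSeries (XL G) k) : piY (f * letter x0) = 0 := by
  ext w
  change (f * letter x0 : NCSeries (XL G) k) (yWord (FreeMonoid.ofList w.toList)) = 0
  rcases eq_nil_or_concat' w.toList with h | ⟨v, a, h⟩
  · rw [h]
    refine (mul_apply_nil _ _).trans ?_
    rw [letter_one, mul_zero]
  · rw [h, yWord_concat]
    exact mul_letter_apply_ne f (by simp) _

theorem inclY_yWord (h : NCSeries (YL G) k) (w : FreeMonoid (YL G)) : inclY h (yWord w) = h w := by
  change ∑ᶠ u, h u * (word (yWord u) : NCSeries (XL G) k) (yWord w) = _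
  rw [finsum_eq_single _ w, word_self, mul_one]
  intro u hu
  rw [word_ne (fun e => hu (yWord_injective e).symm), mul_zero]

theorem piY_inclY (h : NCSeries (YL G) k) : piY (inclY h) = h := NCSeries.ext (inclY_yWord h)

theorem inclY_mul_of (h : NCSeries (YL G) k) (z : FreeMonoid (XL G)) :
    inclY h (z * FreeMonoid.of x0) = 0 :=
  finsum_eq_zero_of_forall_eq_zero fun u =>
    (congrArg (h u * ·) (word_ne (yWord_ne u.toList z).symm)).trans (mul_zero _)

theorem cts_inclY : CtsS (inclY (G := G) (k := k)) := by
  refine cts_extend fun v => Set.Subsingleton.finite fun u hu w hw => yWord_injective ?_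
  have h1 : v = yWord u := by
    by_contra h
    exact hu (word_ne h)
  have h2 : v = yWord w := by
    by_contra h
    exact hw (word_ne h)
  rw [← h1, h2]

theorem inclY_word (w : FreeMonoid (YL G)) :
    inclY (word w : NCSeries (YL G) k) = word (yWord w) := extend_word _ w

/-- Words that end in `x₀` form the last term, the others are words in `Y`. Identities modulo the
kernel of `π_Y` can thus be tested on right multiples of `x₀`. -/
theorem eq_inclY_add (g : NCSeries (XL G) k) :
    ∃ h : NCSeries (XL G) k, g = inclY (piY g) + h * letter x0 := by
  refine ⟨fun v => g (v * FreeMonoid.of x0), ?_⟩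
  ext v
  obtain ⟨w, j, rfl⟩ := exists_yWord_mul_pow v
  rw [NCSeries.add_apply]
  cases j with
  | zero =>
    rw [pow_zero, mul_one, inclY_yWord]
    have := congrFun (piY_mul_letter (fun v => g (v * FreeMonoid.of x0) : NCSeries (XL G) k))
      (FreeMonoid.ofList w)
    exact (add_eq_left.2 this).symm
  | succ j =>
    rw [pow_succ, ← mul_assoc, inclY_mul_of, zero_add]
    exact (mul_letter_apply_self (fun v => g (v * FreeMonoid.of x0) : NCSeries (XL G) k) _ _).symm

end Words

/-! ### The section of `π_Y` as a Taylor sum -/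

section Section

variable {G k : Type*} [CommGroup G] [Finite G] [CommRing k] [Algebra ℚ k]

/-- The Taylor sum that defines the section of `π_Y`. -/
def taylor (g : NCSeries (XL G) k) : NCSeries (XL G) k :=
  lsum fun i => ((-1) ^ i * (i.factorial : ℚ)⁻¹) • (partial0^[i] g * letter x0 ^ i)

theorem letter_pow_mem {A : Type*} (a : A) (n : ℕ) :
    (letter a : NCSeries A k) ^ n ∈ sfil k FreeMonoid.length n := by
  rw [letter_pow]
  intro w hw
  refine word_ne ?_
  rintro rfl
  rw [length_of_pow] at hw
  exact lt_irrefl _ hw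

theorem hasFSum_taylor (g : NCSeries (XL G) k) : HasFSum (sfil k FreeMonoid.length)
    (fun i => ((-1) ^ i * (i.factorial : ℚ)⁻¹) • (partial0^[i] g * letter x0 ^ i))
    (taylor g) := by
  refine hasFSum_lsum fun n => Submodule.smul_mem _ _ ?_
  have := mul_mem_sfil FreeMonoid.length_mul (sfil_zero _ (partial0^[n] g)) (letter_pow_mem x0 n)
  rwa [zero_add] at this

theorem taylor_add (f g : NCSeries (XL G) k) : taylor (f + g) = taylor f + taylor g := by
  refine HasFSum.unique (sfil_sep _) (hasFSum_taylor (f + g)) ?_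
  have h := (hasFSum_taylor f).add (hasFSum_taylor g)
  refine Eq.subst (motive := fun u => HasFSum _ u _) ?_ h
  funext n
  rw [(cts_iterate (cts_partial0 (G := G) (k := k)) n).map_add, add_mul, smul_add]

theorem taylor_of_partial0_eq_zero {g : NCSeries (XL G) k} (hg : partial0 g = 0) :
    taylor g = g := by
  refine HasFSum.unique (sfil_sep _) (hasFSum_taylor g) ?_
  have h : ∀ n, partial0^[n + 1] g = 0 := by
    intro n
    rw [Function.iterate_succ_apply, hg]
    exact (cts_iterate (cts_partial0 (G := G) (k := k)) n).map_zero
  intro N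
  cases N with
  | zero => exact sfil_zero _ _
  | succ N =>
    rw [Finset.sum_range_succ', Finset.sum_eq_zero fun n _ => by rw [h, zero_mul, smul_zero]]
    simp

theorem partial0_mul (f g : NCSeries (XL G) k) :
    partial0 (f * g) = partial0 f * g + f * partial0 g := der_mul _ f g

theorem partial0_letter : partial0 (letter x0 : NCSeries (XL G) k) = 1 := der_letter _ _

theorem iterate_partial0_mul_letter (g : NCSeries (XL G) k) (n : ℕ) :
    partial0^[n + 1] (g * letter x0) =
      partial0^[n + 1] g * letter x0 + (n + 1 : ℚ) • partial0^[n] g := by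
  induction n with
  | zero =>
    simp only [zero_add, Function.iterate_one, Nat.cast_zero, one_smul, Function.iterate_zero, id]
    rw [partial0_mul, partial0_letter, mul_one]
  | succ n ih =>
    rw [Function.iterate_succ_apply', ih, (cts_partial0 (G := G) (k := k)).map_add, partial0_mul,
      partial0_letter, mul_one, (cts_partial0 (G := G) (k := k)).map_rat_smul]
    rw [← Function.iterate_succ_apply' partial0 n g, ← Function.iterate_succ_apply' partial0 (n + 1) g]
    push_cast
    module

/-- As `∂_{x₀}(x₀) = 1`, the partial sums telescope to a single term with an increasing power of
`x₀`. Hence the Taylor sum only depends on the image under `π_Y`. -/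
theorem taylor_mul_letter (g : NCSeries (XL G) k) : taylor (g * letter x0) = 0 := by
  refine HasFSum.unique (sfil_sep _) (hasFSum_taylor _) fun N => ?_
  cases N with
  | zero => exact sfil_zero _ _
  | succ N =>
    have h : ∀ N, ∑ n ∈ Finset.range (N + 1), ((-1) ^ n * (n.factorial : ℚ)⁻¹) •
        (partial0^[n] (g * letter x0) * letter x0 ^ n) =
        ((-1) ^ N * (N.factorial : ℚ)⁻¹) • (partial0^[N] g * letter x0 ^ (N + 1)) := by
      intro N
      induction N with
      | zero => simp
      | succ N ih =>
        rw [Finset.sum_range_succ, ih, iterate_partial0_mul_letter, add_mul, smul_mul_assoc,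
          mul_assoc, ← pow_succ']
        have h1 : ((-1) ^ N * (N.factorial : ℚ)⁻¹) =
            -(((-1) ^ (N + 1) * ((N + 1).factorial : ℚ)⁻¹) * (N + 1)) := by
          have h2 := Nat.cast_ne_zero (R := ℚ).2 N.factorial_ne_zero
          have h3 : (N : ℚ) + 1 ≠ 0 := by positivity
          rw [Nat.factorial_succ]
          push_cast
          field_simp
          ring
        rw [h1]
        module
    rw [h, zero_sub]
    refine Submodule.neg_mem _ (Submodule.smul_mem _ _ ?_)
    have := mul_mem_sfil FreeMonoid.length_mul (sfil_zero _ (partial0^[N] g))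
      (letter_pow_mem x0 (N + 1))
    rwa [zero_add] at this

/-- The section recovers the series in the kernel of `∂_{x₀}`. -/
theorem sec_piY {g : NCSeries (XL G) k} (hg : partial0 g = 0) : sec (piY g) = g := by
  obtain ⟨h, hh⟩ := eq_inclY_add g
  have h1 := congrArg taylor hh
  rw [taylor_add, taylor_mul_letter, add_zero, taylor_of_partial0_eq_zero hg] at h1
  exact h1.symm

/-- The corrected series already lies in the kernel of `∂_{x₀}`, where the section inverts `π_Y`. -/
theorem sec_ps_starLie {ψ : NCSeries (XL G) k} (hψ : QPrim shop 0 ψ)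
    (h0 : ψ (FreeMonoid.of x0) = 0) : sec (ps (starLie ψ)) = ψ + corrX ψ := by
  rw [starLie_eq, ps_qs, sec_piY]
  rw [(cts_partial0 (G := G) (k := k)).map_add, partial0_eq_zero hψ h0, corrX, partial0_powSeries,
    add_zero]

end Section

end DoubleShuffle
end

noncomputable section

namespace DoubleShuffle

open NCSeries

/-! ### The family of coefficients attached to a series -/

section Family

variable {G k : Type*} [CommGroup G] [CommRing k]

/-- The coefficients of a series at the words of `ps`-twisted words in `Y` followed by a power of
`x₀`. -/
def family (f : NCSeries (XL G) k) (j : ℕ) (w : List (YL G)) : k :=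
  f (yWord (FreeMonoid.ofList (psAux 1 w)) * FreeMonoid.of x0 ^ j)

/-- The word in `X` of a list, after a letter of index `p`. -/
def xword (p : G) (w : List (YL G)) : List (XL G) :=
  (yWord (FreeMonoid.ofList (psAux p w))).toList

theorem psAux_append (p : G) (u v : List (YL G)) :
    psAux p (u ++ v) = psAux p u ++ psAux (p * totL u) v := by
  induction u generalizing p with
  | nil => simp [psAux]
  | cons a u ih => simp [psAux, ih, mul_assoc]

theorem toList_x0_pow (n : ℕ) :
    (FreeMonoid.of (x0 : XL G) ^ n).toList = List.replicate n none := by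
  induction n with
  | zero => rfl
  | succ n ih =>
    rw [pow_succ', List.replicate_succ, ← ih]
    rfl

theorem xword_cons (p : G) (a : YL G) (w : List (YL G)) : xword p (a :: w) =
    List.replicate ((a.1 : ℕ) - 1) none ++ some (p * a.2) :: xword (p * a.2) w := by
  rw [xword, psAux, yWord_cons, FreeMonoid.toList_mul, toList_x0_pow]
  rfl

theorem xword_concat (p : G) (w : List (YL G)) (a : YL G) : xword p (w ++ [a]) =
    xword p w ++ (List.replicate ((a.1 : ℕ) - 1) none ++ [some (p * totL w * a.2)]) := by
  rw [xword, psAux_append, psAux, psAux, yWord_concat, FreeMonoid.toList_mul, FreeMonoid.toList_mul,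
    toList_x0_pow, List.append_assoc]
  rfl

theorem length_xword (p : G) (w : List (YL G)) : (xword p w).length = wtL w := by
  induction w generalizing p with
  | nil => rfl
  | cons a w ih =>
    have := a.1.pos
    rw [xword_cons, List.length_append, List.length_replicate, List.length_cons, ih, wtL_cons]
    omega

/-- The labels along the word are successive products that start at `p`. Read backwards they start
at `p` times the total product, and the successive ratios are inverted: reversal of words becomes
`iota` on lists. -/
theorem reverse_xword (p : G) (w : List (YL G)) : (some p :: xword p w).reverse =
    some (p * totL w) :: xword (p * totL w) (iota w) := by
  induction w generalizing p with
  | nil => simp [xword, psAux]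
  | cons a w ih =>
    rw [xword_cons, ← List.cons_append, List.reverse_append, ih, iota_cons, xword_concat,
      List.reverse_cons, List.reverse_replicate, totL_cons, totL_iota, ← mul_assoc p]
    simp [mul_assoc]

theorem psAux_yl (p : G) (m : ℕ) (μ : G) (w : List (YL G)) :
    xword p (yl m μ :: w) = List.replicate m none ++ some (p * μ) :: xword (p * μ) w := by
  rw [xword_cons]
  rfl

theorem family_eq (f : NCSeries (XL G) k) (j : ℕ) (w : List (YL G)) :
    family f j w = f (FreeMonoid.ofList (xword 1 w ++ List.replicate j none)) := by
  rw [family, xword, FreeMonoid.ofList_append, ← toList_x0_pow]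
  rfl

theorem family_rev {f : NCSeries (XL G) k} (hf : ∀ l : List (XL G),
    f (FreeMonoid.ofList l.reverse) = (-1) ^ (l.length + 1) * f (FreeMonoid.ofList l))
    (j m : ℕ) (μ : G) (w : List (YL G)) : family f j (yl m μ :: w) =
      (-1) ^ (wtL w + m + j) * family f m (yl j (μ * totL w) :: iota w) := by
  rw [family_eq, family_eq, psAux_yl, psAux_yl, one_mul, one_mul, List.append_assoc]
  have h := hf (List.replicate j none ++ (some (μ * totL w) :: xword (μ * totL w) (iota w)) ++
    List.replicate m none)
  rw [List.reverse_append, List.reverse_append, List.reverse_replicate, List.reverse_replicate,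
    reverse_xword, totL_iota, iota_iota, mul_inv_cancel_right] at h
  rw [h, List.length_append, List.length_append, List.length_replicate, List.length_replicate,
    List.length_cons, length_xword, wtL_iota]
  congr 1
  exact neg_one_pow_eq (by omega)

/-- Vanishing of `∂_{x₀}` expresses the coefficients with one more trailing `x₀` by those with one
weight raised. -/
theorem family_upSum [Finite G] {f : NCSeries (XL G) k} (hf : partial0 f = 0) (j : ℕ)
    (w : List (YL G)) : (j + 1) * family f (j + 1) w = -upSum (family f j) w := by
  have h := partial0_yWord f (psAux 1 w) j
  rw [hf, upSum_psAux] at h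
  rw [eq_neg_iff_add_eq_zero, add_comm]
  exact h.symm

end Family

/-! ### The dihedral family of a non-exceptional series -/

section Dihedral

variable {G k : Type*} [CommGroup G] [Finite G] [CommRing k] [Algebra ℚ k]

theorem isUnit_natCast_add_one (n : ℕ) : IsUnit ((n : k) + 1) := by
  have := (IsUnit.mk0 ((n : ℚ) + 1) (by positivity)).map (algebraMap ℚ k)
  simpa using this

theorem eq_zero_of_add_self {x : k} (h : x + x = 0) : x = 0 := by
  have h1 := isUnit_natCast_add_one (k := k) 1
  refine (IsUnit.mul_right_eq_zero h1 (b := x)).1 ?_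
  rw [Nat.cast_one, add_mul, one_mul, h]

/-- Primitivity and parity at index `j + 1` follow from those at index `j` by `family_upSum`,
because `upSum` preserves primitivity and `j + 1` is invertible. Only index `0` has to be supplied;
the reversal rule is the antipode in the letters `X`. -/
theorem dihedralFamily {f : NCSeries (XL G) k} (hf : ∀ l : List (XL G),
      f (FreeMonoid.ofList l.reverse) = (-1) ^ (l.length + 1) * f (FreeMonoid.ofList l))
    (hp : partial0 f = 0) (hs : ShPrim yop 1 (family f 0))
    (hpar : ∀ y, family f 0 [y] + (-1) ^ (y.1 : ℕ) * family f 0 [yinv y] = 0) :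
    DihedralFamily (family f) where
  prim j := by
    induction j with
    | zero => exact hs
    | succ j ih =>
      obtain ⟨u, hu⟩ := isUnit_natCast_add_one (k := k) j
      have h : family f (j + 1) = fun w => -(↑u⁻¹ : k) * upSum (family f j) w := by
        funext w
        rw [neg_mul, ← mul_neg, ← family_upSum hp, ← hu, Units.inv_mul_cancel_left]
      rw [h]
      refine ⟨(congrArg (-(↑u⁻¹ : k) * ·) ih.upSum.1).trans (mul_zero _), fun x y hx hy => ?_⟩
      rw [stf_mul, ih.upSum.2 x y hx hy, mul_zero]
  rev := family_rev hf
  parity j := by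
    induction j with
    | zero => simpa using hpar
    | succ j ih =>
      intro y
      refine (isUnit_natCast_add_one (k := k) j).mul_right_eq_zero.1 ?_
      have h1 := family_upSum hp j [y]
      have h2 := family_upSum hp j [yinv y]
      have h3 := ih (yup y)
      have h4 : ((yup y).1 : ℕ) = y.1 + 1 := rfl
      have h5 : yup (yinv y) = yinv (yup y) := rfl
      simp only [upSum, add_zero, h5, yinv_fst] at h1 h2
      rw [mul_add, mul_left_comm, h1, h2, add_comm j 1, ← add_assoc, ← h4]
      linear_combination -((y.1 : ℕ) : k) * h3

/-- The conditions on a series under which its tangential action is a coderivation for the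
stuffle coproduct. -/
structure NonExceptional (ψ : NCSeries (XL G) k) : Prop where
  prim : QPrim shop 0 ψ
  x0_apply : ψ (FreeMonoid.of x0) = 0
  star : QPrim yop 1 (starLie ψ)
  parity : ∀ (n : ℕ+) (ν : G), starLie ψ (FreeMonoid.of (n, ν)) +
    (-1) ^ (n : ℕ) * starLie ψ (FreeMonoid.of (n, ν⁻¹)) = 0

/-- The sum of a series and of its correction. -/
def corrected (ψ : NCSeries (XL G) k) : NCSeries (XL G) k := ψ + corrX ψ

theorem family_corrected (ψ : NCSeries (XL G) k) (w : List (YL G)) :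
    family (corrected ψ) 0 w = starLie ψ (FreeMonoid.ofList w) := by
  rw [starLie_eq, family, pow_zero, mul_one]
  rfl

theorem piY_of (f : NCSeries (XL G) k) (y : YL G) : piY f (FreeMonoid.of y) =
    f (FreeMonoid.of x0 ^ ((y.1 : ℕ) - 1) * FreeMonoid.of (xl y.2)) := by
  rw [piY, yWord, FreeMonoid.lift_eval_of]

theorem qs_of (f : NCSeries (YL G) k) (y : YL G) : qs f (FreeMonoid.of y) = f (FreeMonoid.of y) := by
  change f (FreeMonoid.of (y.1, 1 * y.2)) = _
  rw [one_mul]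

theorem corr_of (ψ : NCSeries (XL G) k) (y : YL G) : corr ψ (FreeMonoid.of y) = 0 := by
  classical
  rw [corr_eq_powSeries, powSeries_apply]
  split_ifs with h
  · rfl
  · rfl

theorem starLie_of (ψ : NCSeries (XL G) k) (y : YL G) : starLie ψ (FreeMonoid.of y) =
    ψ (FreeMonoid.of x0 ^ ((y.1 : ℕ) - 1) * FreeMonoid.of (xl y.2)) := by
  rw [starLie, NCSeries.add_apply, corr_of, add_zero, qs_of, piY_of]

namespace NonExceptional

variable {ψ : NCSeries (XL G) k}

theorem apply_one (hψ : NonExceptional ψ) : ψ 1 = 0 := QPrim_apply_one hψ.prim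

/-- The parity condition at `ν = 1` says that twice the coefficient of `y_n` vanishes for even `n`.
-/
theorem corrCoeff_of_even (hψ : NonExceptional ψ) {n : ℕ} (hn : Even n) : corrCoeff ψ n = 0 := by
  unfold corrCoeff
  split_ifs with h
  · have h1 := hψ.parity ⟨n, by omega⟩ 1
    rw [inv_one, starLie_of] at h1
    simp only [PNat.mk_coe, hn.neg_one_pow, one_mul] at h1
    rw [eq_zero_of_add_self h1, smul_zero]
  · rfl

/-- The words `x_1^n` are palindromes, so the correction is compatible with the sign exactly because
its even coefficients vanish. A first use of non-exceptionality. -/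
theorem corrected_reverse (hψ : NonExceptional ψ) (l : List (XL G)) : corrected ψ (FreeMonoid.ofList l.reverse) =
    (-1) ^ (l.length + 1) * corrected ψ (FreeMonoid.ofList l) := by
  classical
  rw [corrected, NCSeries.add_apply, NCSeries.add_apply, apply_reverse hψ.prim, corrX,
    powSeries_reverse, mul_add]
  congr 1
  rcases Nat.even_or_odd l.length with h | h
  · rw [powSeries_apply, show (FreeMonoid.ofList l).length = l.length from rfl,
      hψ.corrCoeff_of_even h, ite_self, mul_zero]
  · rw [(h.add_one).neg_one_pow, one_mul]

theorem partial0_corrected (hψ : NonExceptional ψ) : partial0 (corrected ψ) = 0 := by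
  rw [corrected, (cts_partial0 (G := G) (k := k)).map_add, partial0_eq_zero hψ.prim hψ.x0_apply,
    corrX, partial0_powSeries, add_zero]

theorem sec_eq (hψ : NonExceptional ψ) : sec (ps (starLie ψ)) = corrected ψ := sec_ps_starLie hψ.prim hψ.x0_apply

theorem dihedral (hψ : NonExceptional ψ) : DihedralFamily (family (corrected ψ)) := by
  have h : family (corrected ψ) 0 = fun w => starLie ψ (FreeMonoid.ofList w) :=
    funext fun w => family_corrected ψ w
  refine dihedralFamily hψ.corrected_reverse hψ.partial0_corrected ?_ fun y => ?_
  · rw [h]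
    exact qcop_eq_iff.1 hψ.star
  · rw [h]
    exact hψ.parity y.1 y.2

theorem defect_eq_zero (hψ : NonExceptional ψ) (l : ℕ) (w : List (YL G)) : defect (family (corrected ψ)) l w = 0 :=
  hψ.dihedral.defect_eq_zero (fun _ => eq_zero_of_add_self) l w

end NonExceptional

end Dihedral

end DoubleShuffle
end

noncomputable section

namespace DoubleShuffle

open NCSeries

/-! ### Cutting the last letter of a list -/

section Cut

variable {G k : Type*} [CommGroup G] [CommRing k]

/-- The sum `∑ P_{i-m-1} Y_i`, over `i > m`. -/
def lastCut (P : ℕ → List (YL G) → k) (m : ℕ) (w : List (YL G)) : k :=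
  match w.reverse with
  | [] => 0
  | x :: r => if m + 1 ≤ (x.1 : ℕ) then P (x.1 - (m + 1)) r.reverse else 0

@[simp] theorem lastCut_nil (P : ℕ → List (YL G) → k) (m : ℕ) : lastCut P m [] = 0 := rfl

@[simp] theorem lastCut_concat (P : ℕ → List (YL G) → k) (m : ℕ) (w : List (YL G)) (x : YL G) :
    lastCut P m (w ++ [x]) = if m + 1 ≤ (x.1 : ℕ) then P (x.1 - (m + 1)) w else 0 := by
  simp [lastCut]

/-- The contribution of a letter to the quasi-shuffle sums of `lastCut`. -/
def cutTerm (P : ℕ → List (YL G) → k) (m : ℕ) (u : List (YL G)) (b : YL G) : k :=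
  if m + 1 ≤ (b.1 : ℕ) then lastSum P (b.1 - (m + 1)) u else lastCut P (m - b.1) u

/-- A function of letters, extended by zero to lists. -/
def onLetter (F : YL G → k) : List (YL G) → k
  | [b] => F b
  | _ => 0

theorem onLetter_of_ne_nil (F : YL G → k) {w : List (YL G)} (hw : w ≠ []) (b : YL G) :
    onLetter F (w ++ [b]) = 0 := by
  rcases w with _ | ⟨a, _ | ⟨c, w⟩⟩
  · exact absurd rfl hw
  · rfl
  · rfl

theorem onLetter_add (F H : YL G → k) (w : List (YL G)) :
    onLetter F w + onLetter H w = onLetter (fun b => F b + H b) w := by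
  rcases w with _ | ⟨a, _ | ⟨c, w⟩⟩ <;> simp [onLetter]

theorem onLetter_mul_iota (c : ℕ → k) (F : YL G → k) (w : List (YL G)) :
    c (wtL w) * onLetter F (iota w) = onLetter (fun b => c b.1 * F (yinv b)) w := by
  rcases eq_nil_or_concat' w with rfl | ⟨u, x, rfl⟩
  · simp [onLetter]
  · rcases eq_nil_or_concat' u with rfl | ⟨v, y, rfl⟩
    · simp [onLetter]
    · rw [onLetter_of_ne_nil _ (by simp)]
      have : onLetter F (iota (v ++ [y] ++ [x])) = 0 := by
        simp only [iota_append, iota_cons, iota_nil, List.nil_append]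
        rcases hv : iota v with _ | ⟨z, l⟩ <;> rfl
      rw [this, mul_zero]

theorem onLetter_congr {F H : YL G → k} {w : List (YL G)} (h : ∀ b, w = [b] → F b = H b) :
    onLetter F w = onLetter H w := by
  rcases w with _ | ⟨a, _ | ⟨c, w⟩⟩
  · rfl
  · exact h a rfl
  · rfl

theorem onLetter_eq_zero {F : YL G → k} {w : List (YL G)} (h : ∀ b, w = [b] → F b = 0) :
    onLetter F w = 0 := by
  rcases w with _ | ⟨a, _ | ⟨c, w⟩⟩
  · rfl
  · exact h a rfl
  · rfl

/-- After sorting by last letters, each term is a quasi-shuffle sum of some `P j`, zero unless one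
of the lists involved is empty. Only the cases where `u` or `v` is a single letter survive. -/
theorem stf_lastCut {P : ℕ → List (YL G) → k} (hP : ∀ j, ShPrim yop 1 (P j)) (m : ℕ)
    {u v : List (YL G)} (hu : u ≠ []) (hv : v ≠ []) : stf yop 1 (lastCut P m) u v =
      onLetter (cutTerm P m u) v + onLetter (cutTerm P m v) u := by
  obtain ⟨u, a, rfl⟩ := (eq_nil_or_concat' u).resolve_left hu
  obtain ⟨v, b, rfl⟩ := (eq_nil_or_concat' v).resolve_left hv
  have e : ∀ (c : YL G) (u v : List (YL G)), stf yop 1 (fun w => lastCut P m (w ++ [c])) u v =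
      if m + 1 ≤ (c.1 : ℕ) then stf yop 1 (P (c.1 - (m + 1))) u v else 0 := by
    intro c u v
    simp only [lastCut_concat]
    split_ifs
    · rfl
    · have := stf_mul (op := yop) (ε := (1 : k)) 0 (fun _ => 0) u v
      simpa using this
  rw [stf_concat_concat, e, e, e, one_mul, yop_fst]
  by_cases hu : u = []
  · subst hu
    by_cases hv : v = []
    · subst hv
      simp only [List.nil_append, stf_nil_left, stf_nil_right, onLetter, cutTerm]
      have h0 : ∀ j, P j [] = 0 := fun j => (hP j).1
      have h1 := fun l => lastSum_concat P l [] b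
      have h2 := fun l => lastSum_concat P l [] a
      have h3 := fun l => lastCut_concat P l [] b
      have h4 := fun l => lastCut_concat P l [] a
      simp only [List.nil_append, h0, add_zero, ite_self] at h1 h2 h3 h4
      simp only [h1, h2, h3, h4, h0, ite_self, add_zero]
      ring
    · rw [onLetter_of_ne_nil _ hv, zero_add, stf_nil_left, stf_nil_left, List.nil_append,
        (hP _).2 _ _ (by simp) hv]
      simp only [onLetter, cutTerm, lastSum_concat, lastCut_concat, ite_self, add_zero]
      have ha := a.1.pos
      have hb := b.1.pos
      by_cases h : m + 1 ≤ (a.1 : ℕ)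
      · rw [if_pos h, if_pos (by omega), if_pos h]
        congr 2
        omega
      · rw [if_neg h, if_neg h, zero_add]
        refine ite_congr (propext (by omega)) (fun _ => ?_) fun _ => rfl
        congr 1
        omega
  · rw [onLetter_of_ne_nil _ hu, add_zero]
    by_cases hv : v = []
    · subst hv
      rw [stf_nil_right, stf_nil_right, List.nil_append, (hP _).2 _ _ hu (by simp)]
      simp only [onLetter, cutTerm, lastSum_concat, lastCut_concat, ite_self, zero_add]
      have ha := a.1.pos
      have hb := b.1.pos
      by_cases h : m + 1 ≤ (b.1 : ℕ)
      · rw [if_pos h, if_pos (by omega), if_pos h]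
        congr 2
        omega
      · rw [if_neg h, if_neg h, zero_add]
        refine ite_congr (propext (by omega)) (fun _ => ?_) fun _ => rfl
        congr 1
        omega
    · rw [onLetter_of_ne_nil _ hv, (hP _).2 _ _ hu (by simp), (hP _).2 _ _ (by simp) hv,
        (hP _).2 _ _ hu hv]
      simp

open Classical in
/-- The values of the coderivation on the letters. -/
def cutSum (P : ℕ → List (YL G) → k) (m : ℕ) (ν : G) (w : List (YL G)) : k :=
  if totL w = ν then lastCut P m w + (-1) ^ (m + 1 + wtL w) * lastCut P m (iota w) else 0

/-- For a letter of weight above `m` the two terms add up to a `defect`, so they cancel. This is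
where the reversal symmetry is spent. A letter of weight `n ≤ m` leaves the same expression with `m`
replaced by `m - n`. -/
theorem cutTerm_add {P : ℕ → List (YL G) → k} (hd : ∀ l w, defect P l w = 0) (m : ℕ)
    (u : List (YL G)) (b : YL G) :
    cutTerm P m u b + (-1) ^ (m + 1 + wtL u + b.1) * cutTerm P m (iota u) (yinv b) =
      if (b.1 : ℕ) ≤ m then lastCut P (m - b.1) u + (-1) ^ (m - b.1 + 1 + wtL u) *
        lastCut P (m - b.1) (iota u) else 0 := by
  unfold cutTerm
  rw [yinv_fst]
  by_cases h : m + 1 ≤ (b.1 : ℕ)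
  · rw [if_pos h, if_pos h, if_neg (by omega)]
    have := hd (b.1 - (m + 1)) u
    rw [defect, firstSum] at this
    rw [← this, sub_eq_add_neg, ← neg_mul, ← neg_one_mul ((-1) ^ _), ← pow_succ']
    congr 2
    exact neg_one_pow_eq (by omega)
  · rw [if_neg h, if_neg h, if_pos (by omega)]
    congr 2
    exact neg_one_pow_eq (by omega)

/-- The surviving terms match the contractions in the coproduct of the letter of weight `m + 1` and
label `ν`: a letter `b` on one side, and on the other the value on the letter of weight `m + 1 -
b.1` and label `ν b.2⁻¹`. -/
theorem stf_cutSum {P : ℕ → List (YL G) → k} (hP : ∀ j, ShPrim yop 1 (P j))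
    (hd : ∀ l w, defect P l w = 0) (m : ℕ) (ν : G) {u v : List (YL G)} (hu : u ≠ []) (hv : v ≠ []) :
    stf yop 1 (cutSum P m ν) u v =
      onLetter (fun b => if (b.1 : ℕ) ≤ m then cutSum P (m - b.1) (ν * b.2⁻¹) u else 0) v +
      onLetter (fun a => if (a.1 : ℕ) ≤ m then cutSum P (m - a.1) (ν * a.2⁻¹) v else 0) u := by
  classical
  by_cases h : totL u * totL v = ν
  · have e : stf yop 1 (cutSum P m ν) u v = stf yop 1 (fun w => lastCut P m w +
        (-1) ^ (m + 1 + wtL u + wtL v) * lastCut P m (iota w)) u v := by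
      refine stf_congr fun c h1 h2 _ => ?_
      rw [cutSum, if_pos (h2.trans h), h1, add_assoc (m + 1)]
    have h2 : onLetter (cutTerm P m v) u + (-1) ^ (m + 1 + wtL u + wtL v) *
        onLetter (cutTerm P m (iota v)) (iota u) = onLetter (fun b => cutTerm P m v b +
        (-1) ^ (m + 1 + wtL v + b.1) * cutTerm P m (iota v) (yinv b)) u := by
      rw [add_right_comm]
      exact (congrArg (onLetter (cutTerm P m v) u + ·) (onLetter_mul_iota (fun n =>
        (-1 : k) ^ (m + 1 + wtL v + n)) (cutTerm P m (iota v)) u)).trans (onLetter_add _ _ _)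
    have h1 : onLetter (cutTerm P m u) v + (-1) ^ (m + 1 + wtL u + wtL v) *
        onLetter (cutTerm P m (iota u)) (iota v) = onLetter (fun b => cutTerm P m u b +
        (-1) ^ (m + 1 + wtL u + b.1) * cutTerm P m (iota u) (yinv b)) v :=
      (congrArg (onLetter (cutTerm P m u) v + ·) (onLetter_mul_iota (fun n =>
        (-1 : k) ^ (m + 1 + wtL u + n)) (cutTerm P m (iota u)) v)).trans (onLetter_add _ _ _)
    rw [e, stf_add, stf_mul, stf_iota, stf_lastCut hP m hu hv,
      stf_lastCut hP m (by simpa using hu) (by simpa using hv), mul_add, add_add_add_comm, h1, h2]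
    simp only [cutTerm_add hd]
    refine congrArg₂ (· + ·) (onLetter_congr fun b hb => ?_) (onLetter_congr fun a ha => ?_)
    · subst hb
      rw [totL_cons, totL_nil, mul_one] at h
      rw [cutSum, if_pos (eq_mul_inv_of_mul_eq h)]
    · subst ha
      rw [totL_cons, totL_nil, mul_one] at h
      have h' : totL v = ν * a.2⁻¹ := by rw [← h, mul_comm a.2, mul_inv_cancel_right]
      rw [cutSum, if_pos h']
  · have e : stf yop 1 (cutSum P m ν) u v = stf yop 1 (fun _ => 0 * 0) u v := by
      refine stf_congr fun c _ h2 _ => ?_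
      rw [cutSum, if_neg (h2 ▸ h), zero_mul]
    have hb : onLetter (fun b => if (b.1 : ℕ) ≤ m then cutSum P (m - b.1) (ν * b.2⁻¹) u else 0) v =
        0 := onLetter_eq_zero fun b hb => by
      subst hb
      rw [totL_cons, totL_nil, mul_one] at h
      have h' : totL u ≠ ν * b.2⁻¹ := fun h' => h (by rw [h', inv_mul_cancel_right])
      rw [cutSum, if_neg h', ite_self]
    have ha : onLetter (fun a => if (a.1 : ℕ) ≤ m then cutSum P (m - a.1) (ν * a.2⁻¹) v else 0) u =
        0 := onLetter_eq_zero fun a ha => by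
      subst ha
      rw [totL_cons, totL_nil, mul_one] at h
      have h' : totL v ≠ ν * a.2⁻¹ := fun h' => h (by rw [h', mul_comm, inv_mul_cancel_right])
      rw [cutSum, if_neg h', ite_self]
    rw [e, stf_mul, zero_mul, hb, ha, add_zero]

variable [Fintype G]

/-- A splitting of `y` is determined by its second letter, so at most one term is nonzero, and it
occurs when `v` is a single letter of smaller weight. -/
theorem sum_splits_right (F : YL G → NCSeries (YL G) k) (y : YL G) (u v : FreeMonoid (YL G)) :
    ∑ p ∈ splits y, F p.1 u * (letter p.2 : NCSeries (YL G) k) v =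
      onLetter (fun b => if b.1 < y.1 then F (y.1 - b.1, y.2 * b.2⁻¹) u else 0) v.toList := by
  classical
  have hl : ∀ p : YL G, v.toList ≠ [p] → (letter p : NCSeries (YL G) k) v = 0 :=
    fun p hp => word_ne hp
  rcases hv : v.toList with _ | ⟨b, _ | ⟨c, w⟩⟩
  · exact Finset.sum_eq_zero fun p _ => by rw [hl _ (by simp [hv]), mul_zero]
  · simp only [onLetter]
    have hb : v = FreeMonoid.of b := hv
    split_ifs with h
    · rw [Finset.sum_eq_single ((y.1 - b.1, y.2 * b.2⁻¹), b)]
      · rw [hb, letter, word_self, mul_one]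
      · rintro ⟨p, q⟩ hp hpb
        rw [hl, mul_zero]
        rw [hv]
        intro hq
        obtain rfl : b = q := (List.cons.inj hq).1
        refine hpb (Prod.ext ?_ rfl)
        -- The set of splittings does not depend on the coefficients; `ℤ` supplies `1 ≠ 0`, which
        -- could fail in `k`.
        have := (contractions_yop (k := ℤ) one_ne_zero y p b).1 hp
        subst this
        refine Prod.ext ?_ ?_
        · change p.1 = p.1 + b.1 - b.1
          exact PNat.coe_injective (by rw [PNat.sub_coe, if_pos (PNat.lt_add_left _ _)]; simp)
        · change p.2 = p.2 * b.2 * b.2⁻¹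
          rw [mul_inv_cancel_right]
      · intro hp
        refine absurd ((contractions_yop (k := ℤ) one_ne_zero y _ b).2 ?_) hp
        refine Prod.ext ?_ ?_
        · change y.1 - b.1 + b.1 = y.1
          rw [add_comm]
          exact PNat.add_sub_of_lt h
        · change y.2 * b.2⁻¹ * b.2 = y.2
          rw [inv_mul_cancel_right]
    · refine Finset.sum_eq_zero fun p hp => ?_
      rw [hl, mul_zero]
      rw [hv]
      intro hq
      obtain rfl : b = p.2 := (List.cons.inj hq).1
      have := (contractions_yop (k := ℤ) one_ne_zero y p.1 p.2).1 hp
      refine h ?_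
      rw [← this]
      exact PNat.lt_add_left _ _
  · exact Finset.sum_eq_zero fun p _ => by rw [hl _ (by simp [hv]), mul_zero]

theorem sum_splits_left (F : YL G → NCSeries (YL G) k) (y : YL G) (u v : FreeMonoid (YL G)) :
    ∑ p ∈ splits y, (letter p.1 : NCSeries (YL G) k) u * F p.2 v =
      onLetter (fun a => if a.1 < y.1 then F (y.1 - a.1, y.2 * a.2⁻¹) v else 0) u.toList := by
  rw [← sum_splits_right F y v u]
  refine Finset.sum_bij' (fun p _ => p.swap) (fun p _ => p.swap) ?_ ?_ (fun _ _ => rfl)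
    (fun _ _ => rfl) (fun _ _ => mul_comm _ _) <;>
  · rintro ⟨p, q⟩ hp
    have h := contractions_yop (G := G) (k := ℤ) one_ne_zero y
    exact (h _ _).2 ((yop_comm _ _).trans ((h _ _).1 hp))

/-- The coderivation property on the letters. -/
theorem qcop_cutSum {P : ℕ → List (YL G) → k} (hP : ∀ j, ShPrim yop 1 (P j))
    (hd : ∀ l w, defect P l w = 0) {d : YL G → NCSeries (YL G) k}
    (h : ∀ y w, d y w = cutSum P ((y.1 : ℕ) - 1) y.2 w.toList) (y : YL G) :
    qcop yop 1 (d y) = tmul 1 (d y) + tmul (d y) 1 +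
      (1 : k) • ∑ p ∈ splits y, (tmul (d p.1) (letter p.2) + tmul (letter p.1) (d p.2)) := by
  have h1 : ∀ y, d y 1 = 0 := by
    intro y
    refine (h y 1).trans ?_
    have : (1 : FreeMonoid (YL G)).toList = [] := rfl
    rw [this, cutSum]
    simp only [iota_nil, lastCut_nil, mul_zero, add_zero, ite_self]
  funext ⟨u, v⟩
  simp only [Pi.add_apply, one_smul, Finset.sum_apply, tmul]
  rw [Finset.sum_add_distrib, sum_splits_right, sum_splits_left]
  have hs : ∀ b : YL G, ((y.1 - b.1 : ℕ+) : ℕ) - 1 = (y.1 : ℕ) - 1 - b.1 ∨ ¬ b.1 < y.1 := by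
    intro b
    by_cases hb : b.1 < y.1
    · left
      rw [PNat.sub_coe, if_pos hb]
      omega
    · exact Or.inr hb
  have hlt : ∀ b : YL G, b.1 < y.1 ↔ (b.1 : ℕ) ≤ (y.1 : ℕ) - 1 := by
    intro b
    rw [← PNat.coe_lt_coe]
    have := y.1.pos
    omega
  have hF : ∀ (b : YL G) (w : FreeMonoid (YL G)), (if b.1 < y.1 then
      d (y.1 - b.1, y.2 * b.2⁻¹) w else 0) = if (b.1 : ℕ) ≤ (y.1 : ℕ) - 1 then
      cutSum P ((y.1 : ℕ) - 1 - b.1) (y.2 * b.2⁻¹) w.toList else 0 := by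
    intro b w
    refine ite_congr (propext (hlt b)) (fun hb => ?_) fun _ => rfl
    rw [h, (hs b).resolve_right (not_not.2 ((hlt b).2 hb))]
  have z : ∀ w : List (YL G), onLetter (fun _ => (0 : k)) w = 0 :=
    fun w => onLetter_eq_zero fun _ _ => rfl
  by_cases hu : u = 1
  · subst hu
    simp only [h1, ite_self, z]
    rw [qcop_one_left, one_apply_nil]
    simp [onLetter]
  · by_cases hv : v = 1
    · subst hv
      simp only [h1, ite_self, z]
      rw [qcop_one_right, one_apply_nil]
      simp [onLetter]
    · rw [one_apply_ne hu, one_apply_ne hv, zero_mul, mul_zero, zero_add, zero_add]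
      simp only [hF]
      have := stf_cutSum hP hd ((y.1 : ℕ) - 1) y.2 (u := u.toList) (v := v.toList) hu hv
      refine Eq.trans ?_ this
      exact congrArg (fun Q => stf yop (1 : k) Q u.toList v.toList) (funext fun l => h y _)

end Cut

end DoubleShuffle
end

noncomputable section

namespace DoubleShuffle

open NCSeries

/-! ### The coderivation induced by the tangential action -/

section Read

variable {G k : Type*} [CommGroup G] [CommRing k]

/-- The coefficients at the words of the form `yWord` of `ps`-twisted words, after a letter of
index `p`. -/
def readY (p : G) (g : NCSeries (XL G) k) : NCSeries (YL G) k :=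
  fun v => g (yWord (FreeMonoid.ofList (psAux p v.toList)))

theorem cts_readY (p : G) : CtsS (readY (k := k) p) := Cts.precomp _

theorem readY_one_eq (g : NCSeries (XL G) k) : readY 1 g = qs (piY g) := rfl

theorem readY_apply_one (p : G) (g : NCSeries (XL G) k) : readY p g 1 = g 1 := rfl

theorem readY_cons (p : G) (g : NCSeries (XL G) k) (a : YL G) (v : FreeMonoid (YL G)) :
    readY p g (FreeMonoid.of a * v) = g (FreeMonoid.of x0 ^ ((a.1 : ℕ) - 1) *
      (FreeMonoid.of (xl (p * a.2)) *
        yWord (FreeMonoid.ofList (psAux (p * a.2) v.toList)))) := by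
  change g (yWord (FreeMonoid.ofList ((a.1, p * a.2) :: psAux (p * a.2) v.toList))) = _
  rw [yWord_cons]

theorem psAux_injective (p : G) : Function.Injective (psAux (G := G) p) := fun u v h =>
  (qsAux_psAux p u).symm.trans ((congrArg (qsAux p) h).trans (qsAux_psAux p v))

theorem readY_word (p : G) (w : List (YL G)) :
    readY p (word (yWord (FreeMonoid.ofList (psAux p w))) : NCSeries (XL G) k) =
      word (FreeMonoid.ofList w) := by
  classical
  ext v
  refine if_congr ?_ rfl rfl
  constructor
  · intro h
    exact psAux_injective p (yWord_injective h)
  · rintro rfl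
    rfl

theorem readY_one_series (p : G) : readY p (1 : NCSeries (XL G) k) = 1 := readY_word p []

theorem shiftL_one {A : Type*} (f : NCSeries A k) : shiftL 1 f = f := NCSeries.ext fun w => by
  rw [shiftL_apply, one_mul]

theorem shiftL_pow_succ {A : Type*} (a : A) (m : ℕ) (f : NCSeries A k) :
    shiftL (FreeMonoid.of a ^ (m + 1)) f = shiftL (FreeMonoid.of a ^ m) (residual a f) :=
  NCSeries.ext fun w => by
    rw [shiftL_apply, shiftL_apply, residual_apply, pow_succ', mul_assoc]

theorem shiftL_mul {A : Type*} (a : A) (m : ℕ) (f : NCSeries A k) {g : NCSeries A k}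
    (hg : residual a g = 0) :
    shiftL (FreeMonoid.of a ^ m) (f * g) = shiftL (FreeMonoid.of a ^ m) f * g := by
  induction m generalizing f with
  | zero => rw [pow_zero, shiftL_one, shiftL_one]
  | succ m ih =>
    rw [shiftL_pow_succ, residual_mul, hg, smul_zero, zero_add, ih, shiftL_pow_succ]

theorem residual_letter_mul_self {A : Type*} (a : A) (f : NCSeries A k) :
    residual a (letter a * f) = f := NCSeries.ext fun w => letter_mul_cons_self a f w

theorem residual_letter_mul_ne {A : Type*} {a b : A} (h : b ≠ a) (f : NCSeries A k) :
    residual b (letter a * f) = 0 := NCSeries.ext fun w => letter_mul_cons_ne h f w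

theorem readY_mul_cons (p ν : G) (C g : NCSeries (XL G) k) (a : YL G) :
    NCSeries.residual a (readY p (C * (letter (xl ν) * g))) =
      shiftL (FreeMonoid.of x0 ^ ((a.1 : ℕ) - 1)) C 1 •
        readY (p * a.2) (NCSeries.residual (xl (p * a.2)) (letter (xl ν) * g)) +
      readY (p * a.2) (NCSeries.residual (xl (p * a.2))
        (shiftL (FreeMonoid.of x0 ^ ((a.1 : ℕ) - 1)) C) * (letter (xl ν) * g)) := by
  ext v
  have h := congrFun (shiftL_mul x0 ((a.1 : ℕ) - 1) C
    (residual_letter_mul_ne (a := xl ν) (b := x0) (by simp) g))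
    (FreeMonoid.of (xl (p * a.2)) * yWord (FreeMonoid.ofList (psAux (p * a.2) v.toList)))
  have h2 := congrFun (residual_mul (xl (p * a.2)) (shiftL (FreeMonoid.of x0 ^ ((a.1 : ℕ) - 1)) C)
    (letter (xl ν) * g)) (yWord (FreeMonoid.ofList (psAux (p * a.2) v.toList)))
  rw [residual_apply, readY_cons]
  exact h.trans h2

/-- Past the letter `x_ν` the successive products start afresh from `ν`, whatever came before. This
is what lets `qs π_Y` respect products cut at a letter `x_ν`. -/
theorem readY_mul (p ν : G) (C g : NCSeries (XL G) k) :
    readY p (C * (letter (xl ν) * g)) = readY p (C * letter (xl ν)) * readY ν g := by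
  ext v
  induction v using FreeMonoid.inductionOn' generalizing p C with
  | one =>
    rw [readY_apply_one, mul_apply_nil, letter_mul_nil, mul_zero, mul_apply_nil, readY_apply_one,
      mul_apply_nil, letter_one, mul_zero, zero_mul]
  | of_mul a v ih =>
    have e := readY_mul_cons p ν C 1 a
    rw [mul_one] at e
    have e0 : readY p (C * letter (xl ν)) 1 = 0 := by
      rw [readY_apply_one, mul_apply_nil, letter_one, mul_zero]
    rw [mul_apply_cons, e0, zero_mul, zero_add, e, add_mul, NCSeries.add_apply]
    refine (congrFun (readY_mul_cons p ν C g a) v).trans ?_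
    rw [NCSeries.add_apply]
    refine congrArg₂ (fun x y : k => x + y) ?_ (ih _ _)
    by_cases h : p * a.2 = ν
    · rw [h, residual_letter_mul_self, residual_letter_self, readY_one_series, smul_mul_assoc,
        one_mul]
    · have h1 : xl (p * a.2) ≠ xl ν := by simpa using h
      rw [residual_letter_mul_ne h1, residual_letter_ne h1, (cts_readY (p * a.2)).map_zero,
        smul_zero, zero_mul]

theorem yWord_of (y : YL G) : yWord (FreeMonoid.of y) =
    FreeMonoid.of x0 ^ ((y.1 : ℕ) - 1) * FreeMonoid.of (xl y.2) := by
  rw [yWord, FreeMonoid.lift_eval_of]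

theorem word_yWord_of (y : YL G) : (word (yWord (FreeMonoid.of y)) : NCSeries (XL G) k) =
    letter x0 ^ ((y.1 : ℕ) - 1) * letter (xl y.2) := by
  rw [yWord_of, letter_pow]
  exact (word_mul_word _ _).symm

theorem readY_letter (y : YL G) :
    readY 1 (letter x0 ^ ((y.1 : ℕ) - 1) * letter (xl y.2) : NCSeries (XL G) k) = letter y := by
  have := readY_word (k := k) 1 [y]
  rw [psAux, one_mul] at this
  rw [← word_yWord_of]
  exact this

theorem map_psAux (γ p : G) (w : List (YL G)) :
    FreeMonoid.map (Option.map (γ * ·)) (yWord (FreeMonoid.ofList (psAux p w))) =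
      yWord (FreeMonoid.ofList (psAux (γ * p) w)) := by
  induction w generalizing p with
  | nil => rfl
  | cons a w ih =>
    rw [psAux, psAux, yWord_cons, yWord_cons, map_mul, map_mul, map_pow, FreeMonoid.map_of,
      FreeMonoid.map_of, ih, mul_assoc]
    rfl

theorem word_yWord_cons (p : G) (y : YL G) (w : List (YL G)) :
    (word (yWord (FreeMonoid.ofList (psAux p (y :: w)))) : NCSeries (XL G) k) =
      letter x0 ^ ((y.1 : ℕ) - 1) * (letter (xl (p * y.2)) *
        word (yWord (FreeMonoid.ofList (psAux (p * y.2) w)))) := by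
  rw [psAux, yWord_cons, letter_pow, letter, word_mul_word, word_mul_word]

theorem cts_ps : CtsS (ps (G := G) (k := k)) := Cts.precomp _

theorem ps_word (w : List (YL G)) :
    ps (word (FreeMonoid.ofList w) : NCSeries (YL G) k) = word (FreeMonoid.ofList (psAux 1 w)) := by
  classical
  ext v
  refine if_congr ?_ rfl rfl
  constructor
  · intro h
    rw [← psWord_qsWord v, h]
    rfl
  · rintro rfl
    exact qsAux_psAux 1 w

variable [Finite G]

theorem readY_tAct (ν p : G) (g : NCSeries (XL G) k) : readY (ν * p) (tAct ν g) = readY p g := by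
  ext v
  rw [tAct_eq_pull]
  change g (FreeMonoid.map (Option.map (ν⁻¹ * ·))
    (yWord (FreeMonoid.ofList (psAux (ν * p) v.toList)))) = _
  rw [map_psAux, inv_mul_cancel_left]
  rfl

theorem tAct_word (ν p : G) (w : List (YL G)) :
    tAct ν (word (yWord (FreeMonoid.ofList (psAux p w))) : NCSeries (XL G) k) =
      word (yWord (FreeMonoid.ofList (psAux (ν * p) w))) := by
  induction w generalizing p with
  | nil => exact tAct_one ν
  | cons a w ih =>
    have hp : ∀ m, tAct ν ((letter x0 : NCSeries (XL G) k) ^ m) = letter x0 ^ m := by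
      intro m
      induction m with
      | zero => rw [pow_zero, tAct_one]
      | succ m ih => rw [pow_succ, tAct_mul, ih, tAct_letter_none]
    rw [word_yWord_cons, word_yWord_cons, tAct_mul, tAct_mul, hp, tAct_letter_some, ih, mul_assoc]

/-- The operator on `k⟨⟨Y⟩⟩` induced by the tangential action of `f`. -/
def inducedOp (f : NCSeries (XL G) k) (h : NCSeries (YL G) k) : NCSeries (YL G) k :=
  qs (piY (sOp f (inclY (ps h))))

theorem cts_inducedOp (f : NCSeries (XL G) k) : CtsS (inducedOp f) :=
  (cts_readY 1).comp ((cts_sOp f).comp (cts_inclY.comp cts_ps))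

/-- The values of the induced operator on the letters. -/
def inducedLetter (f : NCSeries (XL G) k) (y : YL G) : NCSeries (YL G) k :=
  readY 1 ((f * letter x0 ^ ((y.1 : ℕ) - 1) - letter x0 ^ ((y.1 : ℕ) - 1) * tAct y.2 f) *
    letter (xl y.2))

theorem dOp_x0_pow (f : NCSeries (XL G) k) (m : ℕ) : dOp f (letter x0 ^ m) = 0 := by
  induction m with
  | zero => rw [pow_zero, dOp_one]
  | succ m ih => rw [pow_succ, dOp_mul, ih, dOp_letter_none, zero_mul, mul_zero, add_zero]

theorem inducedOp_word (f : NCSeries (XL G) k) (w : List (YL G)) :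
    inducedOp f (word (FreeMonoid.ofList w)) =
      readY 1 (sOp f (word (yWord (FreeMonoid.ofList (psAux 1 w))))) := by
  rw [inducedOp, ps_word, inclY_word, readY_one_eq]

/-- With `m = y.1 - 1` and `ν = y.2`, the word in `X` is `x₀^m x_ν t_ν(X0)`. The identity for
`t_σ(ψ) f + d_ψ(f)` turns the action on the tail into `t_ν(s_f(X0))`, at the price of `f x₀^m - x₀^m
t_ν(f)` in front of `x_ν`. Reading from index `ν` absorbs the translation, so the tail is again an
induced action. -/
theorem inducedOp_letter_mul_word (f : NCSeries (XL G) k) (y : YL G) (w : FreeMonoid (YL G)) :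
    inducedOp f (letter y * word w) =
      inducedLetter f y * word w + letter y * inducedOp f (word w) := by
  rw [letter_mul_word]
  change inducedOp f (word (FreeMonoid.ofList (y :: w.toList))) =
    _ + _ * inducedOp f (word (FreeMonoid.ofList w.toList))
  rw [inducedOp_word, inducedOp_word, word_yWord_cons, one_mul]
  have hX := tAct_word (k := k) y.2 1 w.toList
  rw [mul_one] at hX
  have hw := readY_word (k := k) y.2 w.toList
  set X : NCSeries (XL G) k := word (yWord (FreeMonoid.ofList (psAux y.2 w.toList)))
  set X0 : NCSeries (XL G) k := word (yWord (FreeMonoid.ofList (psAux 1 w.toList)))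
  have e : sOp f (letter x0 ^ ((y.1 : ℕ) - 1) * (letter (xl y.2) * X)) =
      (f * letter x0 ^ ((y.1 : ℕ) - 1) - letter x0 ^ ((y.1 : ℕ) - 1) * tAct y.2 f) *
        (letter (xl y.2) * X) +
      letter x0 ^ ((y.1 : ℕ) - 1) * (letter (xl y.2) * tAct y.2 (sOp f X0)) := by
    have h1 : tAct y.2 (sOp f X0) = tAct y.2 f * X + dOp f X := by
      rw [sOp, (cts_tAct y.2).map_add, tAct_mul, tAct_dOp, hX]
    rw [h1, sOp, dOp_mul, dOp_x0_pow, dOp_mul, dOp_letter_some]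
    noncomm_ring
  have h2 := readY_tAct y.2 1 (sOp f X0)
  rw [mul_one] at h2
  rw [e, (cts_readY (1 : G)).map_add, readY_mul, readY_mul, readY_letter, hw, h2]
  rfl

/-- As `d_f(x₀) = 0`, the operator `s_f` preserves right multiples of `x₀`, that is, the kernel of
`π_Y`. -/
theorem inducedOp_qs_piY (f g : NCSeries (XL G) k) :
    inducedOp f (qs (piY g)) = qs (piY (sOp f g)) := by
  obtain ⟨h, hh⟩ := eq_inclY_add g
  have e : ps (qs (piY g)) = piY g := NCSeries.ext fun w => congrArg (piY g) (psWord_qsWord w)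
  rw [inducedOp, e]
  conv_rhs => rw [hh]
  rw [(cts_sOp f).map_add, sOp_mul, dOp_letter_none, mul_zero, add_zero]
  rw [← readY_one_eq, ← readY_one_eq, (cts_readY (1 : G)).map_add, readY_one_eq (_ * _), piY_mul_letter]
  exact (add_zero _).symm

end Read

end DoubleShuffle
end

noncomputable section

namespace DoubleShuffle

open NCSeries

/-! ### Values of the induced operator on letters -/

section Letter

variable {A G k : Type*} [CommGroup G] [CommRing k]

/-- The series obtained by reversal of the words. -/
def revS (g : NCSeries A k) : NCSeries A k := fun w => g (FreeMonoid.ofList w.toList.reverse)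

theorem revS_letter_mul (a : A) (g : NCSeries A k) :
    revS (letter a * g) = revS g * letter a := by
  ext w
  rcases List.eq_nil_or_concat w.toList with h | ⟨v, b, h⟩
  · have hw : w = 1 := h
    subst hw
    rw [mul_apply_nil, letter_one, mul_zero]
    exact letter_mul_nil a g
  · have hw : w = FreeMonoid.ofList v * FreeMonoid.of b := h.trans List.concat_eq_append
    subst hw
    have e : revS (letter a * g) (FreeMonoid.ofList v * FreeMonoid.of b) =
        (letter a * g : NCSeries A k) (FreeMonoid.of b * FreeMonoid.ofList v.reverse) := by
      refine congrArg (letter a * g : NCSeries A k) ?_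
      change FreeMonoid.ofList (v ++ [b]).reverse = FreeMonoid.ofList (b :: v.reverse)
      rw [List.reverse_append]
      rfl
    rw [e]
    by_cases hb : b = a
    · subst hb
      rw [letter_mul_cons_self, mul_letter_apply_self]
      rfl
    · rw [letter_mul_cons_ne hb, mul_letter_apply_ne _ hb]

theorem revS_pow_mul (a : A) (m : ℕ) (g : NCSeries A k) :
    revS (letter a ^ m * g) = revS g * letter a ^ m := by
  induction m with
  | zero => rw [pow_zero, one_mul, mul_one]
  | succ m ih => rw [pow_succ', mul_assoc, revS_letter_mul, ih, mul_assoc, ← pow_succ, pow_succ']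

theorem mul_x0_pow_apply (f : NCSeries (XL G) k) (m j : ℕ) (p : G) (w : List (YL G)) :
    (f * letter x0 ^ m : NCSeries (XL G) k)
      (yWord (FreeMonoid.ofList (psAux p w)) * FreeMonoid.of x0 ^ j) =
      if m ≤ j then f (yWord (FreeMonoid.ofList (psAux p w)) * FreeMonoid.of x0 ^ (j - m))
      else 0 := by
  induction m generalizing j with
  | zero => simp
  | succ m ih =>
    cases j with
    | zero =>
      rw [pow_zero, mul_one, if_neg (by omega), pow_succ, ← mul_assoc]
      exact congrFun (piY_mul_letter (f * letter x0 ^ m)) (FreeMonoid.ofList (psAux p w))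
    | succ j =>
      rw [pow_succ, ← mul_assoc, pow_succ, ← mul_assoc, mul_letter_apply_self, ih,
        Nat.add_sub_add_right]
      exact if_congr (by omega) rfl rfl

theorem ofList_xword (p : G) (w : List (YL G)) (j : ℕ) :
    FreeMonoid.ofList (xword p w ++ List.replicate j none) =
      yWord (FreeMonoid.ofList (psAux p w)) * FreeMonoid.of x0 ^ j := by
  rw [xword, ← toList_x0_pow]
  rfl

variable [Finite G]

theorem tAct_reverse {f : NCSeries (XL G) k} (hf : ∀ l : List (XL G),
    f (FreeMonoid.ofList l.reverse) = (-1) ^ (l.length + 1) * f (FreeMonoid.ofList l))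
    (ν : G) (l : List (XL G)) : tAct ν f (FreeMonoid.ofList l.reverse) =
      (-1) ^ (l.length + 1) * tAct ν f (FreeMonoid.ofList l) := by
  rw [tAct_eq_pull]
  have := hf (l.map (Option.map (ν⁻¹ * ·)))
  rw [List.length_map, ← List.map_reverse] at this
  exact this

theorem tAct_yWord_apply (f : NCSeries (XL G) k) (ν : G) (w : List (YL G)) (j : ℕ) :
    tAct ν f (yWord (FreeMonoid.ofList (psAux ν w)) * FreeMonoid.of x0 ^ j) =
      family f j w := by
  rw [tAct_eq_pull]
  change f (FreeMonoid.map _ _) = _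
  rw [map_mul, map_psAux, inv_mul_cancel, map_pow, FreeMonoid.map_of]
  rfl

theorem iota_ne_nil {w : List (YL G)} (hw : w ≠ []) : iota w ≠ [] := by
  intro h
  exact hw ((iota_iota w).symm.trans (by rw [h, iota_nil]))

/-- The word must end in `x_ν`, hence the condition on `totL`. In `f x₀^m` the factor `x₀^m`
shortens the last block of `x₀`, a `lastCut`. In `x₀^m t_ν(f)` it stands in front; reversal of words
puts it at the end and replaces the list by its `iota`, up to sign. -/
theorem inducedLetter_apply {f : NCSeries (XL G) k} (hf : ∀ l : List (XL G),
    f (FreeMonoid.ofList l.reverse) = (-1) ^ (l.length + 1) * f (FreeMonoid.ofList l))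
    (y : YL G) (w : FreeMonoid (YL G)) :
    inducedLetter f y w = cutSum (family f) ((y.1 : ℕ) - 1) y.2 w.toList := by
  obtain ⟨n, ν⟩ := y
  dsimp only
  set m := (n : ℕ) - 1
  rcases eq_nil_or_concat' w.toList with h | ⟨v, a, h⟩
  · rw [h, cutSum]
    simp only [iota_nil, lastCut_nil, mul_zero, add_zero, ite_self]
    have hw : w = 1 := h
    rw [hw, inducedLetter, readY_apply_one, mul_apply_nil, letter_one, mul_zero]
  · have htot : totL (v ++ [a]) = totL v * a.2 := by
      rw [totL_append, totL_cons, totL_nil, mul_one]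
    have hz : inducedLetter f (n, ν) w = ((f * letter x0 ^ m - letter x0 ^ m * tAct ν f) *
        letter (xl ν) : NCSeries (XL G) k) (yWord (FreeMonoid.ofList (psAux 1 v)) *
          FreeMonoid.of x0 ^ ((a.1 : ℕ) - 1) * FreeMonoid.of (xl (totL v * a.2))) := by
      rw [inducedLetter]
      change (_ * _ : NCSeries (XL G) k) (yWord (FreeMonoid.ofList (psAux 1 w.toList))) = _
      rw [h, psAux_append, psAux, psAux, yWord_concat, one_mul]
    rw [hz, h, cutSum, htot]
    by_cases hν : totL v * a.2 = ν
    · rw [if_pos hν, hν, mul_letter_apply_self, NCSeries.sub_apply, sub_eq_add_neg]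
      have ha := a.1.pos
      refine congrArg₂ (fun x y : k => x + y) ?_ ?_
      · rw [mul_x0_pow_apply, lastCut_concat]
        refine (if_congr (by omega) ?_ rfl)
        rw [family]
        congr 3
        omega
      -- This is the word of the list without its final `x_ν`. Since `reverse_xword` reverses it
      -- together with a letter `x_1` in front, its reversal is the word of the `iota` list read
      -- from index `ν`, deprived of a final `x_1`.
      · set l : List (XL G) := xword 1 v ++ List.replicate ((a.1 : ℕ) - 1) none with hl
        have e1 : xword 1 (v ++ [a]) = l ++ [some ν] := by
          rw [xword_concat, one_mul, hν, ← List.append_assoc]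
        obtain h2 | ⟨w2, b, hb⟩ := eq_nil_or_concat' (iota (v ++ [a]))
        · exact absurd h2 (iota_ne_nil (by simp))
        have hwt : wtL (v ++ [a]) = wtL w2 + b.1 := by
          rw [← wtL_iota, hb, wtL_append, wtL_cons, wtL_nil, add_zero]
        have hb1 := b.1.pos
        have e2 : l.reverse = xword ν w2 ++ List.replicate ((b.1 : ℕ) - 1) none := by
          have h1 := reverse_xword (1 : G) (v ++ [a])
          rw [e1, htot, hν, one_mul, hb, xword_concat, ← List.cons_append, List.reverse_append,
            ← List.append_assoc] at h1
          have h3 : l.reverse ++ [some 1] = xword ν w2 ++ List.replicate ((b.1 : ℕ) - 1) none ++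
            [some (ν * totL w2 * b.2)] := by
            rw [← List.reverse_cons]
            exact (List.cons.inj h1).2
          exact (List.append_inj' h3 rfl).1
        have e3 : (letter x0 ^ m * tAct ν f : NCSeries (XL G) k)
            (yWord (FreeMonoid.ofList (psAux 1 v)) * FreeMonoid.of x0 ^ ((a.1 : ℕ) - 1)) =
            (revS (tAct ν f) * letter x0 ^ m : NCSeries (XL G) k)
              (yWord (FreeMonoid.ofList (psAux ν w2)) * FreeMonoid.of x0 ^ ((b.1 : ℕ) - 1)) := by
          rw [← revS_pow_mul, ← ofList_xword, ← ofList_xword, ← hl, ← e2, revS,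
            FreeMonoid.toList_ofList, List.reverse_reverse]
        rw [e3, mul_x0_pow_apply, hb, lastCut_concat]
        by_cases hm : m ≤ (b.1 : ℕ) - 1
        · have e4 : revS (tAct ν f) (yWord (FreeMonoid.ofList (psAux ν w2)) *
              FreeMonoid.of x0 ^ ((b.1 : ℕ) - 1 - m)) =
              (-1) ^ (wtL w2 + ((b.1 : ℕ) - 1 - m) + 1) *
                family f ((b.1 : ℕ) - 1 - m) w2 := by
            rw [← ofList_xword, revS, FreeMonoid.toList_ofList, tAct_reverse hf, ofList_xword,
              tAct_yWord_apply, List.length_append, length_xword, List.length_replicate]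
          have e5 : (b.1 : ℕ) - 1 - m = b.1 - (m + 1) := by omega
          rw [if_pos hm, if_pos (by omega), e4, hwt, ← neg_mul, e5]
          congr 1
          rw [← mul_neg_one, ← pow_succ]
          exact neg_one_pow_eq (by omega)
        · rw [if_neg hm, if_neg (by omega), neg_zero, mul_zero]
    · rw [if_neg hν, mul_letter_apply_ne]
      simpa using hν

end Letter

/-! ### The coderivation property for the stuffle coproduct -/

section Coderivation

variable {G k : Type*} [CommGroup G] [Finite G] [CommRing k] [Algebra ℚ k]

theorem NonExceptional.qcop_inducedOp [Fintype G] {ψ : NCSeries (XL G) k}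
    (hψ : NonExceptional ψ) (h : NCSeries (YL G) k) :
    qcop yop 1 (inducedOp (corrected ψ) h) = op1 (inducedOp (corrected ψ)) (qcop yop 1 h) +
      op2 (inducedOp (corrected ψ)) (qcop yop 1 h) := by
  have h1 : inducedOp (corrected ψ) 1 = starLie ψ := by
    have : inducedOp (corrected ψ) (word (FreeMonoid.ofList [])) = _ := inducedOp_word _ _
    rw [starLie_eq, ← readY_one_eq]
    refine this.trans (congrArg (readY 1) ?_)
    exact sOp_one _
  refine qcop_coderivation contractions_yop (cts_inducedOp _) (inducedOp_letter_mul_word _) ?_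
    (qcop_cutSum hψ.dihedral.prim hψ.defect_eq_zero (inducedLetter_apply hψ.corrected_reverse)) h
  rw [h1]
  exact hψ.star

end Coderivation

end DoubleShuffle
end

noncomputable section

namespace DoubleShuffle

namespace NCSeries

/-! ### Homogeneity, and exponentials of coderivations -/

section Degree

variable {W V A B k : Type*} [CommRing k]

/-- A finite linear form vanishes on the series of large order. -/
theorem FinForm.exists_eq_zero {φ : (W → k) → k} (hφ : FinForm φ) (deg : W → ℕ) :
    ∃ N, ∀ r ∈ ordGE k deg N, φ r = 0 := by
  obtain ⟨c, hc⟩ := hφ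
  refine ⟨c.support.sup deg + 1, fun r hr => ?_⟩
  rw [hc]
  refine Finset.sum_eq_zero fun w hw => ?_
  exact (congrArg (c w * ·) (hr w (Nat.lt_succ_of_le (Finset.le_sup hw)))).trans (mul_zero _)

theorem stf_congr_deg {op : A → A → A} {ε : k} {deg : FreeMonoid A → ℕ}
    (hdeg : ∀ u v, deg (u * v) = deg u + deg v)
    (hop : ε ≠ 0 → ∀ a b, deg (FreeMonoid.of (op a b)) = deg (FreeMonoid.of a) + deg (FreeMonoid.of b))
    (u v : List A) {P Q : List A → k}
    (h : ∀ w, deg (FreeMonoid.ofList w) = deg (FreeMonoid.ofList u) + deg (FreeMonoid.ofList v) →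
      P w = Q w) : stf op ε P u v = stf op ε Q u v := by
  have h1 : deg (FreeMonoid.ofList []) = 0 := by
    have := hdeg 1 1
    rw [mul_one] at this
    exact Nat.left_eq_add.1 this
  have hc : ∀ a w, deg (FreeMonoid.ofList (a :: w)) =
      deg (FreeMonoid.of a) + deg (FreeMonoid.ofList w) :=
    fun a w => hdeg (FreeMonoid.of a) (FreeMonoid.ofList w)
  refine pair_induction (p := fun u v => ∀ P Q : List A → k,
    (∀ w, deg (FreeMonoid.ofList w) = deg (FreeMonoid.ofList u) + deg (FreeMonoid.ofList v) →
      P w = Q w) → stf op ε P u v = stf op ε Q u v) (fun v P Q h => ?_) (fun u P Q h => ?_)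
    (fun a u b v ih1 ih2 ih3 P Q h => ?_) u v P Q h
  · rw [stf_nil_left, stf_nil_left, h v (by rw [h1, zero_add])]
  · rw [stf_nil_right, stf_nil_right, h u (by rw [h1, add_zero])]
  · rw [stf_cons_cons, stf_cons_cons]
    simp only [hc] at h ih1 ih2 ih3
    refine congrArg₂ (fun x y : k => x + y) (congrArg₂ (fun x y : k => x + y)
      (ih1 _ _ fun w hw => h _ ?_) (ih2 _ _ fun w hw => h _ ?_)) ?_
    · rw [hc]
      omega
    · rw [hc]
      omega
    · by_cases hε : ε = 0
      · rw [hε, zero_mul, zero_mul]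
      · rw [ih3 _ _ fun w hw => h _ ?_]
        rw [hc, hop hε]
        omega

/-- The degree of a pair of words. -/
def deg2 (deg : FreeMonoid A → ℕ) (p : FreeMonoid A × FreeMonoid A) : ℕ := deg p.1 + deg p.2

theorem qcop_mem_ordGE {op : A → A → A} {ε : k} {deg : FreeMonoid A → ℕ}
    (hdeg : ∀ u v, deg (u * v) = deg u + deg v)
    (hop : ε ≠ 0 → ∀ a b, deg (FreeMonoid.of (op a b)) = deg (FreeMonoid.of a) + deg (FreeMonoid.of b))
    {n : ℕ} {f : NCSeries A k} (hf : f ∈ ordGE k deg n) : qcop op ε f ∈ ordGE k (deg2 deg) n := by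
  intro p hp
  refine (stf_congr_deg hdeg hop p.1.toList p.2.toList (Q := fun _ => 0) fun w hw => ?_).trans ?_
  · exact hf _ (hw.trans_lt hp)
  · exact congrFun ((cts_qcop (k := k) op ε).map_zero) p

theorem tmul_mem_ordGE {deg : FreeMonoid A → ℕ} {m n : ℕ} {f g : NCSeries A k}
    (hf : f ∈ ordGE k deg m) (hg : g ∈ ordGE k deg n) : tmul f g ∈ ordGE k (deg2 deg) (m + n) := by
  intro p hp
  change f p.1 * g p.2 = 0
  by_cases h : deg p.1 < m
  · rw [hf _ h, zero_mul]
  · have : deg p.1 + deg p.2 < m + n := hp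
    rw [hg _ (by omega), mul_zero]

variable [Algebra ℚ k]

/-- The tensor product, as a bilinear map. -/
def tmulBilin (A k : Type*) [CommRing k] [Algebra ℚ k] :
    NCSeries A k →ₗ[ℚ] NCSeries A k →ₗ[ℚ] Tensor2 A k :=
  LinearMap.mk₂ ℚ tmul (fun f f' g => funext fun p => add_mul (f p.1) (f' p.1) (g p.2))
    (fun c f g => funext fun p => smul_mul_assoc c (f p.1) (g p.2))
    (fun f g g' => funext fun p => mul_add (f p.1) (g p.2) (g' p.2))
    (fun c f g => funext fun p => mul_smul_comm c (f p.1) (g p.2))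

/-- A continuous operator as a rational linear map. -/
def Cts.lin {F : (W → k) → (V → k)} (hF : Cts F) : (W → k) →ₗ[ℚ] (V → k) where
  toFun := F
  map_add' := hF.map_add
  map_smul' := hF.map_rat_smul

/-- The exponential of a coderivation preserves the group-like series. -/
theorem qcop_eq_tmul_of_isExp {op : A → A → A} {ε : k} {deg : FreeMonoid A → ℕ}
    (hdeg : ∀ u v, deg (u * v) = deg u + deg v)
    (hop : ε ≠ 0 → ∀ a b, deg (FreeMonoid.of (op a b)) = deg (FreeMonoid.of a) + deg (FreeMonoid.of b))
    {D : NCSeries A k → NCSeries A k} (hD : CtsS D) (hr : Raises (sfil k deg) hD.lin)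
    (hco : ∀ f, qcop op ε (D f) = op1 D (qcop op ε f) + op2 D (qcop op ε f))
    {f g : NCSeries A k} (hf : qcop op ε f = tmul f f) (h : IsExp (sfil k deg) hD.lin f g) :
    qcop op ε g = tmul g g := by
  have hT : Cts (k := k) (W := FreeMonoid A × FreeMonoid A) (V := FreeMonoid A × FreeMonoid A)
      fun T => op1 D T + op2 D T := (cts_op1 hD).add (cts_op2 hD)
  -- Both the coproduct of `g` and `g ⊗ g` are exponentials of `D ⊗ 1 + 1 ⊗ D`, at the coproduct of
  -- `f` and at `f ⊗ f`. The starting points coincide.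
  have h1 : IsExp (fil k (deg2 deg)) (M := Tensor2 A k) hT.lin (qcop op ε f) (qcop op ε g) :=
    h.map (M₁ := Tensor2 A k) (cts_qcop op ε).lin
      (fun n x hx => qcop_mem_ordGE hdeg hop hx) hco
  have h2 : IsExp (fil k (deg2 deg)) (M := Tensor2 A k) hT.lin (tmul f f) (tmul g g) := by
    refine IsExp.bilin (O₁ := sfil k deg) (O₂ := sfil k deg) (O₃ := fil k (deg2 deg))
      (fil_anti _) (sfil_zero deg) (sfil_zero deg) hr hr (tmulBilin A k)
      (fun i j x hx y hy => tmul_mem_ordGE (k := k) hx hy) (fun u v => ?_) h h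
    exact congrArg₂ (fun x y : Tensor2 A k => x + y) (op1_tmul hD u v) (op2_tmul hD u v)
  rw [hf] at h1
  exact h1.unique (fil_sep _) h2

theorem powSeries_sub_sum_mul_mem (a : A) (c : ℕ → k) (N : ℕ) (g : NCSeries A k) :
    (powSeries a c - ∑ n ∈ Finset.range N, c n • letter a ^ n) * g ∈
      ordGE k FreeMonoid.length N := by
  have := mul_mem_ordGE FreeMonoid.length_mul (hasFSum_powSeries a c N) (mem_ordGE_zero g)
  rwa [add_zero] at this

/-- An operator that intertwines the left multiplications by two letters intertwines the left
multiplications by the series in these letters. -/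
theorem apply_powSeries_mul {F : NCSeries A k → NCSeries B k} (hF : CtsS F) {a : A} {b : B}
    (h : ∀ g, F (letter a * g) = letter b * F g) (c : ℕ → k) (g : NCSeries A k) :
    F (powSeries a c * g) = powSeries b c * F g := by
  have hp : ∀ n, F (letter a ^ n * g) = letter b ^ n * F g := by
    intro n
    induction n with
    | zero => rw [pow_zero, pow_zero, one_mul, one_mul]
    | succ n ih => rw [pow_succ', mul_assoc, h, ih, pow_succ', mul_assoc]
  have hS : ∀ N, F ((∑ n ∈ Finset.range N, c n • letter a ^ n) * g) =
      (∑ n ∈ Finset.range N, c n • letter b ^ n) * F g := by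
    intro N
    induction N with
    | zero => simpa using hF.map_zero
    | succ N ih =>
      rw [Finset.sum_range_succ, Finset.sum_range_succ, add_mul, add_mul, hF.map_add, ih,
        smul_mul_assoc, smul_mul_assoc, hF.map_smul, hp]
  ext v
  -- The operator need not respect the filtration, but a single coefficient of it ignores series of
  -- large order. This allows truncation of the power series at `M`.
  obtain ⟨N, hN⟩ := (hF v).exists_eq_zero FreeMonoid.length
  set M := max N (v.length + 1)
  have e1 : powSeries a c * g = (powSeries a c - ∑ n ∈ Finset.range M, c n • letter a ^ n) * g +
      (∑ n ∈ Finset.range M, c n • letter a ^ n) * g := by rw [← add_mul, sub_add_cancel]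
  have e2 : powSeries b c * F g =
      (powSeries b c - ∑ n ∈ Finset.range M, c n • letter b ^ n) * F g +
      (∑ n ∈ Finset.range M, c n • letter b ^ n) * F g := by rw [← add_mul, sub_add_cancel]
  rw [e1, hF.map_add, hS, e2, NCSeries.add_apply, NCSeries.add_apply]
  refine congrArg (fun x : k => x + _) ?_
  exact (hN _ (ordGE_anti (le_max_left _ _) (powSeries_sub_sum_mul_mem a c M g))).trans
    (powSeries_sub_sum_mul_mem b c M (F g) v
      (lt_of_lt_of_le (Nat.lt_succ_self _) (le_max_right _ _))).symm

/-- An operator that intertwines two left multiplications intertwines those by the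
exponentials. -/
theorem apply_expS_mul {degA : FreeMonoid A → ℕ} {degB : FreeMonoid B → ℕ}
    (hA : ∀ u v, degA (u * v) = degA u + degA v) (hB : ∀ u v, degB (u * v) = degB u + degB v)
    {F : NCSeries A k → NCSeries B k} (hF : CtsS F)
    (hdF : ∀ n, ∀ f ∈ ordGE k degA n, F f ∈ ordGE k degB n) {a : NCSeries A k} {b : NCSeries B k}
    (ha : a ∈ ordGE k degA 1) (hb : b ∈ ordGE k degB 1) (h : ∀ g, F (a * g) = b * F g)
    (g : NCSeries A k) : F (expS a * g) = expS b * F g := by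
  have h1 := (isExp_expS_mul hA (c := a) ha g).map (O₁ := sfil k degB) hF.lin hdF
    (s₁ := mulL b) h
  exact h1.unique (sfil_sep _) (isExp_expS_mul hB (c := b) hb (F g))

end Degree

end NCSeries

end DoubleShuffle
end

noncomputable section

namespace DoubleShuffle

open NCSeries

/-! ### Depth, and the depth one part of the flow -/

section Depth

variable {G k : Type*} [CommGroup G] [CommRing k]

/-- The number of letters of a word that differ from `x₀`. -/
def depth (w : FreeMonoid (XL G)) : ℕ := w.toList.countP Option.isSome

theorem depth_mul (u v : FreeMonoid (XL G)) : depth (u * v) = depth u + depth v :=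
  List.countP_append

theorem depth_x0_pow (j : ℕ) : depth (FreeMonoid.of (x0 : XL G) ^ j) = 0 := by
  rw [depth, toList_x0_pow, List.countP_replicate]
  rfl

theorem eq_x0_pow_of_depth {w : FreeMonoid (XL G)} (h : depth w = 0) :
    w = FreeMonoid.of x0 ^ w.length := by
  induction w using FreeMonoid.inductionOn' with
  | one => rfl
  | of_mul a w ih =>
    rw [depth_mul] at h
    cases a with
    | some σ =>
      have h1 : depth (FreeMonoid.of (xl σ)) = 1 := rfl
      rw [h1] at h
      omega
    | none =>
      rw [FreeMonoid.length_mul, FreeMonoid.length_of, add_comm, pow_succ', ← ih (by omega)]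

theorem mem_depth_one {ψ : NCSeries (XL G) k} (h : ∀ j, ψ (FreeMonoid.of x0 ^ j) = 0) :
    ψ ∈ ordGE k depth 1 := fun w hw => by
  rw [eq_x0_pow_of_depth (Nat.lt_one_iff.1 hw), h]

variable [Finite G]

theorem tAct_mem_depth (σ : G) {n : ℕ} {ψ : NCSeries (XL G) k} (h : ψ ∈ ordGE k depth n) :
    tAct σ ψ ∈ ordGE k depth n := by
  intro w hw
  rw [tAct_eq_pull]
  refine h _ (lt_of_eq_of_lt ?_ hw)
  change (w.toList.map _).countP _ = _
  rw [List.countP_map, depth]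
  congr 1
  funext a
  cases a <;> rfl

/-- Each occurrence of a letter `x_σ` is replaced by its commutator with a series of depth at least
one, while `x₀` is killed. -/
theorem dOp_mem_depth {ψ : NCSeries (XL G) k} (hψ : ψ ∈ ordGE k depth 1) (f : NCSeries (XL G) k) :
    dOp ψ f ∈ ordGE k depth 2 := by
  have hx : ∀ σ : G, (letter (xl σ) : NCSeries (XL G) k) ∈ ordGE k depth 1 := by
    intro σ w hw
    refine word_ne ?_
    rintro rfl
    exact absurd hw (lt_irrefl 1)
  have hw : ∀ u : FreeMonoid (XL G), dOp ψ (word u) ∈ ordGE k depth 2 := by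
    intro u
    induction u using FreeMonoid.inductionOn' with
    | one =>
      rw [word_one, dOp_one]
      exact Submodule.zero_mem _
    | of_mul a u ih =>
      rw [← letter_mul_word, dOp_mul]
      have h1 : dOp ψ (letter a) ∈ ordGE k depth 2 := by
        cases a with
        | none =>
          rw [dOp_letter_none]
          exact Submodule.zero_mem _
        | some σ =>
          rw [dOp_letter_some]
          exact Submodule.sub_mem _ (mul_mem_ordGE depth_mul (hx σ) (tAct_mem_depth σ hψ))
            (mul_mem_ordGE depth_mul (tAct_mem_depth σ hψ) (hx σ))
      have h2 := mul_mem_ordGE depth_mul h1 (mem_ordGE_zero (word u : NCSeries (XL G) k))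
      have h3 := mul_mem_ordGE depth_mul (mem_ordGE_zero (letter a : NCSeries (XL G) k)) ih
      rw [zero_add] at h3
      exact Submodule.add_mem _ h2 h3
  -- With the target restricted to words of depth less than two, the claim is an equality of two
  -- continuous maps, which can be checked on words.
  have hF : Cts (k := k) (W := FreeMonoid (XL G)) (V := {w : FreeMonoid (XL G) // depth w < 2})
      fun f w => dOp ψ f w := fun w => cts_dOp ψ w
  intro w h
  exact congrFun (Cts.ext hF Cts.zero (fun u => funext fun v => hw u v v.2) f) ⟨w, h⟩

theorem sOp_mem_depth {ψ : NCSeries (XL G) k} (hψ : ψ ∈ ordGE k depth 1) (f : NCSeries (XL G) k) :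
    sOp ψ f ∈ ordGE k depth 1 :=
  Submodule.add_mem _ (mul_mem_ordGE depth_mul hψ (mem_ordGE_zero f))
    (ordGE_anti one_le_two (dOp_mem_depth hψ f))

theorem apply_one_of_depth {ψ : NCSeries (XL G) k} (hψ : ψ ∈ ordGE k depth 1) : ψ 1 = 0 :=
  hψ 1 Nat.one_pos

/-- The derivation contributes from depth two on, and in the product a factor `ψ` uses up the single
letter `x_ν`, so that only the constant term of `f` is left. -/
theorem sOp_apply_of_depth {ψ : NCSeries (XL G) k} (hψ : ψ ∈ ordGE k depth 1)
    (f : NCSeries (XL G) k) (j : ℕ) (ν : G) :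
    sOp ψ f (FreeMonoid.of x0 ^ j * FreeMonoid.of (xl ν)) =
      ψ (FreeMonoid.of x0 ^ j * FreeMonoid.of (xl ν)) * f 1 := by
  have h1 : depth (FreeMonoid.of x0 ^ j * FreeMonoid.of (xl ν)) < 2 := by
    rw [depth_mul, depth_x0_pow]
    exact one_lt_two
  rw [sOp, NCSeries.add_apply, dOp_mem_depth hψ f _ h1, add_zero, mul_apply_snoc]
  have h2 := mul_mem_ordGE depth_mul hψ
    (mem_ordGE_zero (show NCSeries (XL G) k from fun v => f (v * FreeMonoid.of (xl ν))))
  refine (congrArg (fun x : k => _ + x) (h2 (FreeMonoid.of x0 ^ j) ?_)).trans (add_zero _)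
  rw [depth_x0_pow]
  exact Nat.one_pos

variable [Algebra ℚ k]

/-- The second iterate already vanishes on such words, since `s_ψ(f)` has no constant term: in depth
one the exponential stops at first order. -/
theorem expOp_sOp_apply_of_depth {ψ : NCSeries (XL G) k} (hψ : ψ ∈ ordGE k depth 1)
    (f : NCSeries (XL G) k) (j : ℕ) (ν : G) :
    expOp (sOp ψ) f (FreeMonoid.of x0 ^ j * FreeMonoid.of (xl ν)) =
      f (FreeMonoid.of x0 ^ j * FreeMonoid.of (xl ν)) +
      ψ (FreeMonoid.of x0 ^ j * FreeMonoid.of (xl ν)) * f 1 := by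
  set w := FreeMonoid.of (x0 : XL G) ^ j * FreeMonoid.of (xl ν)
  change ∑ᶠ n, ((n.factorial : ℚ)⁻¹ • (sOp ψ)^[n] f) w = _
  rw [finsum_eq_sum_of_support_subset (s := Finset.range 2), Finset.sum_range_succ,
    Finset.sum_range_one]
  · simp only [Nat.factorial_zero, Nat.factorial_one, Nat.cast_one, inv_one, one_smul,
      Function.iterate_zero, id, Function.iterate_one]
    rw [sOp_apply_of_depth hψ]
  · intro n hn
    simp only [Finset.coe_range, Set.mem_Iio]
    by_contra h
    obtain ⟨m, rfl⟩ : ∃ m, n = m + 2 := ⟨n - 2, by omega⟩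
    refine hn ?_
    have : ((sOp ψ)^[m + 2] f) w = 0 := by
      rw [Function.iterate_succ_apply', sOp_apply_of_depth hψ, Function.iterate_succ_apply',
        apply_one_of_depth (sOp_mem_depth hψ _), mul_zero]
    exact (congrArg (fun x : k => (((m + 2).factorial : ℚ)⁻¹) • x) this).trans (smul_zero (A := k) _)

theorem expOp_sOp_apply_x0 {ψ : NCSeries (XL G) k} (hψ : ψ ∈ ordGE k depth 1)
    (f : NCSeries (XL G) k) {w : FreeMonoid (XL G)} (hw : depth w = 0) :
    expOp (sOp ψ) f w = f w := by
  change ∑ᶠ n, ((n.factorial : ℚ)⁻¹ • (sOp ψ)^[n] f) w = _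
  rw [finsum_eq_single _ 0]
  · simp
  · intro n hn
    obtain ⟨m, rfl⟩ : ∃ m, n = m + 1 := ⟨n - 1, by omega⟩
    have : ((sOp ψ)^[m + 1] f) w = 0 := by
      rw [Function.iterate_succ_apply']
      exact sOp_mem_depth hψ _ _ (by omega)
    exact (congrArg (fun x : k => (((m + 1).factorial : ℚ)⁻¹) • x) this).trans (smul_zero (A := k) _)

theorem corrCoeff_expOp {ψ : NCSeries (XL G) k} (hψ : ψ ∈ ordGE k depth 1)
    {f : NCSeries (XL G) k} (hf : f 1 = 1) (n : ℕ) :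
    corrCoeff (expOp (sOp ψ) f) n = corrCoeff f n + corrCoeff ψ n := by
  unfold corrCoeff
  split_ifs
  · rw [expOp_sOp_apply_of_depth hψ, hf, mul_one, smul_add]
  · rw [add_zero]

end Depth

/-! ### The weight filtration and multiplication by series in `y_1` -/

section Weight

variable {G k : Type*} [CommGroup G] [CommRing k]

/-- The weight of a word in `Y`. -/
def wt (w : FreeMonoid (YL G)) : ℕ := wtL w.toList

theorem wt_mul (u v : FreeMonoid (YL G)) : wt (u * v) = wt u + wt v := wtL_append _ _

theorem wt_of (y : YL G) : wt (FreeMonoid.of y) = y.1 := wtL_cons y []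

theorem wt_yop (a b : YL G) :
    wt (FreeMonoid.of (yop a b)) = wt (FreeMonoid.of a) + wt (FreeMonoid.of b) := by
  rw [wt_of, wt_of, wt_of]
  rfl

theorem wtL_qsAux (p : G) (w : List (YL G)) : wtL (qsAux p w) = wtL w := by
  induction w generalizing p with
  | nil => rfl
  | cons a w ih => rw [qsAux, wtL_cons, wtL_cons, ih]

theorem length_yWord (w : FreeMonoid (YL G)) : (yWord w).length = wt w := by
  have h := length_xword (1 : G) (qsAux 1 w.toList)
  rw [wtL_qsAux, xword, psAux_qsAux] at h
  exact h

theorem ps_mem_wt {n : ℕ} {f : NCSeries (YL G) k} (hf : f ∈ ordGE k wt n) :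
    ps f ∈ ordGE k wt n := fun w hw => hf _ ((wtL_qsAux 1 w.toList).trans_lt hw)

theorem readY_mem_wt (p : G) {n : ℕ} {f : NCSeries (XL G) k}
    (hf : f ∈ ordGE k FreeMonoid.length n) : readY p f ∈ ordGE k wt n :=
  fun w hw => hf _ ((length_xword p w.toList).trans_lt hw)

theorem inclY_mem_length {n : ℕ} {f : NCSeries (YL G) k} (hf : f ∈ ordGE k wt n) :
    inclY f ∈ ordGE k FreeMonoid.length n := by
  intro w hw
  obtain ⟨u, j, rfl⟩ := exists_yWord_mul_pow w
  cases j with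
  | zero =>
    rw [pow_zero, mul_one] at hw ⊢
    rw [inclY_yWord]
    exact hf _ ((length_yWord _).symm.trans_lt hw)
  | succ j =>
    rw [pow_succ, ← mul_assoc]
    exact inclY_mul_of f _

theorem powSeries_mem_wt [Algebra ℚ k] (c : ℕ → k) (h : c 0 = 0) :
    powSeries ((1, 1) : YL G) c ∈ ordGE k wt 1 := by
  intro w hw
  have hw1 : w = 1 := by
    rcases hl : w.toList with _ | ⟨a, l⟩
    · exact hl
    · rw [wt, hl, wtL_cons] at hw
      have := a.1.pos
      omega
  rw [hw1, powSeries_apply_one, h]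

theorem powSeries_mem_length {A : Type*} [Algebra ℚ k] (a : A) (c : ℕ → k) (h : c 0 = 0) :
    powSeries a c ∈ ordGE k FreeMonoid.length 1 := ordGE_one_iff.2 (by rw [powSeries_apply_one, h])

theorem readY_letter_mul [Finite G] (g : NCSeries (XL G) k) :
    readY 1 (letter (xl 1) * g) = letter (1, 1) * readY 1 g := by
  have h := readY_mul (1 : G) 1 1 g
  have h1 := readY_letter (k := k) ((1, 1) : YL G)
  rw [PNat.one_coe, Nat.sub_self, pow_zero] at h1
  rwa [h1, one_mul] at h

variable [Finite G] [Algebra ℚ k]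

theorem readY_powSeries_mul (c : ℕ → k) (g : NCSeries (XL G) k) :
    readY 1 (powSeries (xl 1) c * g) = powSeries (1, 1) c * readY 1 g :=
  apply_powSeries_mul (cts_readY 1) readY_letter_mul c g

theorem readY_expS_mul (c : ℕ → k) (h : c 0 = 0) (g : NCSeries (XL G) k) :
    readY 1 (expS (powSeries (xl 1) c) * g) = expS (powSeries (1, 1) c) * readY 1 g :=
  apply_expS_mul FreeMonoid.length_mul wt_mul (cts_readY 1) (fun _ _ => readY_mem_wt 1)
    (powSeries_mem_length _ c h) (powSeries_mem_wt c h) (readY_powSeries_mul c) g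

theorem sOp_powSeries_mul (ψ : NCSeries (XL G) k) (c : ℕ → k) (g : NCSeries (XL G) k) :
    sOp ψ (powSeries (xl 1) c * g) = powSeries (xl 1) c * sOp ψ g :=
  apply_powSeries_mul (cts_sOp ψ) (sOp_letter_one_mul ψ) c g

theorem inducedOp_mem_wt {f : NCSeries (XL G) k} (hf : f 1 = 0) {n : ℕ} {h : NCSeries (YL G) k}
    (hh : h ∈ ordGE k wt n) : inducedOp f h ∈ ordGE k wt (n + 1) :=
  readY_mem_wt 1 (sOp_mem_ordGE hf n _ (inclY_mem_length (ps_mem_wt hh)))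

theorem corrCoeff_zero (ψ : NCSeries (XL G) k) : corrCoeff ψ 0 = 0 := if_neg (by omega)

theorem powSeries_comm {A : Type*} (a : A) (c d : ℕ → k) :
    powSeries a c * powSeries a d = powSeries a d * powSeries a c := by
  have h := apply_powSeries_mul (CtsS.mul_left (powSeries a c)) (a := a) (b := a) (fun g => by
    change powSeries a c * (letter a * g) = letter a * (powSeries a c * g)
    rw [← mul_assoc, ← mul_powSeries_comm, mul_assoc]) d 1
  simpa using h

theorem sOp_corrected (ψ f : NCSeries (XL G) k) :
    sOp (corrected ψ) f = corrX ψ * f + sOp ψ f := by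
  rw [corrected, sOp_add, corrX, sOp_powSeries, add_comm]

theorem corrected_apply_one {ψ : NCSeries (XL G) k} (h : ψ 1 = 0) : corrected ψ 1 = 0 := by
  rw [corrected, NCSeries.add_apply, h, corrX, powSeries_apply_one, corrCoeff_zero, add_zero]

/-- The corrected action is left multiplication by the correction plus `s_ψ`. Both commute with left
multiplication by series in `x_1`, which `readY 1` turns into series in `y_1`. -/
theorem inducedOp_powSeries_mul (ψ : NCSeries (XL G) k) (c : ℕ → k) (h : NCSeries (YL G) k) :
    inducedOp (corrected ψ) (powSeries (1, 1) c * h) =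
      powSeries (1, 1) c * inducedOp (corrected ψ) h := by
  have hg : h = readY 1 (inclY (ps h)) := by
    rw [readY_one_eq, piY_inclY, qs_ps]
  have hc : (powSeries (xl (1 : G)) c : NCSeries (XL G) k) * corrX ψ =
      corrX ψ * powSeries (xl 1) c := powSeries_comm _ _ _
  rw [hg, ← readY_powSeries_mul, readY_one_eq, inducedOp_qs_piY, readY_one_eq (inclY _),
    inducedOp_qs_piY, ← readY_one_eq, ← readY_one_eq, ← readY_powSeries_mul, sOp_corrected,
    sOp_corrected, sOp_powSeries_mul, mul_add, ← mul_assoc, ← mul_assoc, hc]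

end Weight

end DoubleShuffle
end

noncomputable section

namespace DoubleShuffle

open NCSeries

/-! ### The flow on group-like series -/

section Flow

variable {G k : Type*} [CommGroup G] [Finite G] [CommRing k] [Algebra ℚ k] {ψ : NCSeries (XL G) k}

theorem NonExceptional.mem_depth (hψ : NonExceptional ψ) : ψ ∈ ordGE k depth 1 :=
  mem_depth_one (apply_x0_pow hψ.prim hψ.x0_apply)

theorem qcop_shop_expOp (hψ : QPrim shop 0 ψ) {f : NCSeries (XL G) k}
    (hf : qcop shop 0 f = tmul f f) :
    qcop shop 0 (expOp (sOp ψ) f) = tmul (expOp (sOp ψ) f) (expOp (sOp ψ) f) :=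
  qcop_eq_tmul_of_isExp FreeMonoid.length_mul (fun h => absurd rfl h) (cts_sOp ψ)
    (raises_sOp (QPrim_apply_one hψ)) (sOp_coderivation hψ) hf (isExp_sOp (QPrim_apply_one hψ) f)

/-- The exponential of the corrected tangential action. -/
theorem isExp_sOp_corrected (h1 : ψ 1 = 0) (f : NCSeries (XL G) k) :
    IsExp (sfil k FreeMonoid.length) (cts_sOp (corrected ψ)).lin f
      (expS (corrX ψ) * expOp (sOp ψ) f) := by
  have hc : corrX ψ ∈ sfil k FreeMonoid.length 1 :=
    powSeries_mem_length _ _ (corrCoeff_zero ψ)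
  have h := (isExp_sOp h1 f).commute (sfil_anti _) (sfil_zero _)
    (raises_mulL FreeMonoid.length_mul hc) (raises_sOp h1)
    (LinearMap.ext fun g => (sOp_powSeries_mul ψ _ g).symm)
    (isExp_expS_mul FreeMonoid.length_mul hc _)
  have e : mulL (corrX ψ) + (cts_sOp ψ).lin = (cts_sOp (corrected ψ)).lin :=
    LinearMap.ext fun g => (sOp_corrected ψ g).symm
  rwa [e] at h

theorem expS_powSeries_add {A : Type*} {deg : FreeMonoid A → ℕ}
    (hdeg : ∀ u v, deg (u * v) = deg u + deg v) (a : A) {c d : ℕ → k}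
    (hc : powSeries a c ∈ ordGE k deg 1) (hd : powSeries a d ∈ ordGE k deg 1) :
    expS (powSeries a fun n => c n + d n) = expS (powSeries a c) * expS (powSeries a d) := by
  rw [powSeries_add, expS_add hdeg hc hd (powSeries_comm a c d)]

/-- The corrected action exponentiates to `exp(corrX ψ) exp(s_ψ)`, and `qs π_Y` carries it to the
induced operator. The latter commutes with left multiplication by `exp(corr f)`. The corrections of
`f` and of `ψ` add up to that of the flow, so the prefactors combine into the one of the star
series. -/
theorem isExp_starGroup (hψ : NonExceptional ψ) {f : NCSeries (XL G) k} (hf : f 1 = 1) :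
    IsExp (sfil k wt) (cts_inducedOp (corrected ψ)).lin (starGroup f)
      (starGroup (expOp (sOp ψ) f)) := by
  have h1 := (isExp_sOp_corrected hψ.apply_one f).map (O₁ := sfil k wt) (cts_readY 1).lin
    (fun n x hx => readY_mem_wt 1 hx) (s₁ := (cts_inducedOp (corrected ψ)).lin)
    (fun x => (inducedOp_qs_piY (corrected ψ) x).symm)
  have hcorr : ∀ g : NCSeries (XL G) k, corr g ∈ ordGE k wt 1 := fun g => by
    rw [corr_eq_powSeries]
    exact powSeries_mem_wt _ (corrCoeff_zero g)
  have h2 := h1.map (O₁ := sfil k wt) (mulL (expS (corr f)))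
    (fun n x hx => by
      have := mul_mem_ordGE wt_mul (mem_ordGE_zero (expS (corr f))) hx
      rwa [zero_add] at this)
    (s₁ := (cts_inducedOp (corrected ψ)).lin)
    (fun x => (apply_expS_mul wt_mul wt_mul (cts_inducedOp (corrected ψ))
      (fun n g hg => ordGE_anti (Nat.le_succ n) (inducedOp_mem_wt
        (corrected_apply_one hψ.apply_one) hg)) (hcorr f) (hcorr f) (fun g => by
          rw [corr_eq_powSeries]
          exact inducedOp_powSeries_mul ψ _ g) x).symm)
  have e : starGroup (expOp (sOp ψ) f) =
      expS (corr f) * readY 1 (expS (corrX ψ) * expOp (sOp ψ) f) := by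
    rw [corrX, readY_expS_mul _ (corrCoeff_zero ψ), ← mul_assoc, starGroup, corr_eq_powSeries,
      corr_eq_powSeries, ← expS_powSeries_add wt_mul _ (powSeries_mem_wt _ (corrCoeff_zero f))
      (powSeries_mem_wt _ (corrCoeff_zero ψ)), funext (corrCoeff_expOp hψ.mem_depth hf)]
    rfl
  rw [e]
  exact h2

theorem NonExceptional.isCoderivation (hψ : NonExceptional ψ) (h : NCSeries (YL G) k) :
    qcop yop 1 (inducedOp (corrected ψ) h) = op1 (inducedOp (corrected ψ)) (qcop yop 1 h) +
      op2 (inducedOp (corrected ψ)) (qcop yop 1 h) := by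
  have := Fintype.ofFinite G
  exact hψ.qcop_inducedOp h

theorem qcop_starGroup_expOp (hψ : NonExceptional ψ) {f : NCSeries (XL G) k} (hf : f 1 = 1)
    (h : qcop yop 1 (starGroup f) = tmul (starGroup f) (starGroup f)) :
    qcop yop 1 (starGroup (expOp (sOp ψ) f)) =
      tmul (starGroup (expOp (sOp ψ) f)) (starGroup (expOp (sOp ψ) f)) :=
  qcop_eq_tmul_of_isExp wt_mul (fun _ => wt_yop) (cts_inducedOp (corrected ψ))
    (fun _ _ hg => inducedOp_mem_wt (corrected_apply_one hψ.apply_one) hg) hψ.isCoderivation h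
    (isExp_starGroup hψ hf)

end Flow

/-! ### The distribution relations along the flow -/

section Distribution

theorem sOp_letter_one {G k : Type*} [CommGroup G] [Finite G] [CommRing k] (f : NCSeries (XL G) k) :
    sOp (letter (xl 1)) f = letter (xl 1) * f := by
  rw [sOp, add_eq_left]
  refine eq_of_leibniz (T := id) (dl := fun _ => 0) (g := letter) (H := fun _ => 0)
    (cts_dOp _) Cts.zero (dOp_one _) (fun a f => ?_) (fun a f => ?_) f
  · rw [dOp_mul]
    congr 2
    cases a with
    | none => exact dOp_letter_none _
    | some σ => rw [dOp_letter_some, tAct_letter_some, mul_one, sub_self]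
  · exact ((congrArg₂ (fun x y : NCSeries (XL G) k => x + y) (zero_mul _) (mul_zero _)).trans
      (add_zero _)).symm

variable {G k : Type*} [CommGroup G] [Finite G] [CommRing k] (H : Subgroup G)

theorem proj1_eq_pull (f : NCSeries (XL G) k) : proj1 H f = pull (Option.map Subtype.val) f := rfl

theorem cts_proj1 : CtsS (proj1 (k := k) H) := cts_pull _

theorem proj1_mul (f g : NCSeries (XL G) k) : proj1 H (f * g) = proj1 H f * proj1 H g :=
  pull_mul _ f g

theorem proj1_one : proj1 H (1 : NCSeries (XL G) k) = 1 := pull_one _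

theorem proj1_letter_none : proj1 H (letter x0 : NCSeries (XL G) k) = letter x0 :=
  pull_letter (φ := Option.map (Subtype.val : H → G))
    (Option.map_injective Subtype.val_injective) none

theorem proj1_letter_some (σ : H) : proj1 H (letter (xl (σ : G)) : NCSeries (XL G) k) =
    letter (xl σ) :=
  pull_letter (φ := Option.map (Subtype.val : H → G))
    (Option.map_injective Subtype.val_injective) (some σ)

theorem proj1_letter_of_notMem {σ : G} (h : σ ∉ H) :
    proj1 H (letter (xl σ) : NCSeries (XL G) k) = 0 := by
  refine pull_letter_of_notMem fun a ha => h ?_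
  cases a with
  | none => simp at ha
  | some τ =>
    have : (τ : G) = σ := by simpa using ha
    exact this ▸ τ.2

theorem proj1_tAct (σ : H) (f : NCSeries (XL G) k) :
    proj1 H (tAct (σ : G) f) = tAct σ (proj1 H f) := by
  rw [tAct_eq_pull, tAct_eq_pull, proj1_eq_pull, proj1_eq_pull, pull_pull, pull_pull]
  congr 1
  funext a
  cases a <;> rfl

/-- Letters outside `H` are killed together with their commutators; for labels in `H` the projection
commutes with translation. -/
theorem proj1_dOp (ψ f : NCSeries (XL G) k) :
    proj1 H (dOp ψ f) = dOp (proj1 H ψ) (proj1 H f) := by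
  refine eq_of_leibniz (T := proj1 H) (F := fun f => proj1 H (dOp ψ f))
    (H := fun f => dOp (proj1 H ψ) (proj1 H f)) (dl := fun a => proj1 H (dOp ψ (letter a)))
    (g := fun a => proj1 H (letter a)) ((cts_proj1 H).comp (cts_dOp ψ))
    ((cts_dOp _).comp (cts_proj1 H)) ?_ (fun a f => ?_) (fun a f => ?_) f
  · rw [dOp_one, proj1_one, dOp_one, (cts_proj1 H).map_zero]
  · rw [dOp_mul, (cts_proj1 H).map_add, proj1_mul, proj1_mul]
  · rw [proj1_mul, dOp_mul]
    congr 2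
    cases a with
    | none => rw [proj1_letter_none, dOp_letter_none, dOp_letter_none, (cts_proj1 H).map_zero]
    | some σ =>
      rw [dOp_letter_some, (cts_proj1 H).map_sub, proj1_mul, proj1_mul]
      by_cases h : σ ∈ H
      · lift σ to H using h
        rw [proj1_letter_some, dOp_letter_some, proj1_tAct]
      · rw [proj1_letter_of_notMem H h, zero_mul, mul_zero, sub_zero, (cts_dOp _).map_zero]

theorem proj1_sOp (ψ f : NCSeries (XL G) k) :
    proj1 H (sOp ψ f) = sOp (proj1 H ψ) (proj1 H f) := by
  rw [sOp, sOp, (cts_proj1 H).map_add, proj1_mul, proj1_dOp]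

theorem proj1_mem_length {n : ℕ} {f : NCSeries (XL G) k}
    (hf : f ∈ ordGE k FreeMonoid.length n) : proj1 H f ∈ ordGE k FreeMonoid.length n :=
  mem_ordGE_pull _ hf

theorem cts_proj2 : CtsS (proj2 (k := k) H) := cts_subst fun a => by
  cases a with
  | none => exact (congrArg ((H.index : k) * ·) (letter_one _)).trans (mul_zero _)
  | some σ => exact letter_one _

theorem proj2_mul (f g : NCSeries (XL G) k) : proj2 H (f * g) = proj2 H f * proj2 H g :=
  subst_mul (fun a => by
    cases a with
    | none => exact (congrArg ((H.index : k) * ·) (letter_one _)).trans (mul_zero _)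
    | some σ => exact letter_one _) f g

theorem proj2_one : proj2 H (1 : NCSeries (XL G) k) = 1 := subst_one _

theorem proj2_letter_none :
    proj2 H (letter x0 : NCSeries (XL G) k) = (H.index : k) • letter x0 := subst_letter _ _

theorem proj2_letter_some (σ : G) : proj2 H (letter (xl σ) : NCSeries (XL G) k) =
    letter (xl ⟨σ ^ H.index, H.pow_index_mem σ⟩) := subst_letter _ _

/-- The map `σ ↦ σ^d` on labels is a group morphism, so `p²` turns translation by `σ` into
translation by `σ^d`. This makes `p²` intertwine the special derivations. -/
theorem proj2_tAct (σ : G) (f : NCSeries (XL G) k) :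
    proj2 H (tAct σ f) = tAct ⟨σ ^ H.index, H.pow_index_mem σ⟩ (proj2 H f) := by
  refine eq_of_leibniz (T := proj2 H) (F := fun f => proj2 H (tAct σ f))
    (H := fun f => tAct ⟨σ ^ H.index, H.pow_index_mem σ⟩ (proj2 H f)) (dl := fun _ => 0)
    (g := fun a => proj2 H (tAct σ (letter a))) ((cts_proj2 H).comp (cts_tAct σ))
    ((cts_tAct _).comp (cts_proj2 H)) ?_ (fun a f => ?_) (fun a f => ?_) f
  · rw [tAct_one, proj2_one, tAct_one]
  · rw [tAct_mul, proj2_mul, zero_mul, zero_add]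
  · rw [proj2_mul, tAct_mul, zero_mul, zero_add]
    congr 1
    cases a with
    | none =>
      rw [proj2_letter_none, tAct_letter_none, proj2_letter_none, (cts_tAct _).map_smul,
        tAct_letter_none]
    | some τ =>
      rw [proj2_letter_some, tAct_letter_some, tAct_letter_some, proj2_letter_some]
      congr 2
      exact Subtype.ext (mul_pow σ τ _).symm

theorem proj2_dOp (ψ f : NCSeries (XL G) k) :
    proj2 H (dOp ψ f) = dOp (proj2 H ψ) (proj2 H f) := by
  refine eq_of_leibniz (T := proj2 H) (F := fun f => proj2 H (dOp ψ f))
    (H := fun f => dOp (proj2 H ψ) (proj2 H f)) (dl := fun a => proj2 H (dOp ψ (letter a)))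
    (g := fun a => proj2 H (letter a)) ((cts_proj2 H).comp (cts_dOp ψ))
    ((cts_dOp _).comp (cts_proj2 H)) ?_ (fun a f => ?_) (fun a f => ?_) f
  · rw [dOp_one, proj2_one, dOp_one, (cts_proj2 H).map_zero]
  · rw [dOp_mul, (cts_proj2 H).map_add, proj2_mul, proj2_mul]
  · rw [proj2_mul, dOp_mul]
    congr 2
    cases a with
    | none =>
      rw [proj2_letter_none, dOp_letter_none, (cts_dOp _).map_smul, dOp_letter_none, smul_zero,
        (cts_proj2 H).map_zero]
    | some σ =>
      rw [dOp_letter_some, (cts_proj2 H).map_sub, proj2_mul, proj2_mul, proj2_tAct,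
        proj2_letter_some, dOp_letter_some]

theorem proj2_sOp (ψ f : NCSeries (XL G) k) :
    proj2 H (sOp ψ f) = sOp (proj2 H ψ) (proj2 H f) := by
  rw [sOp, sOp, (cts_proj2 H).map_add, proj2_mul, proj2_dOp]

theorem proj2_mem_length {n : ℕ} {f : NCSeries (XL G) k}
    (hf : f ∈ ordGE k FreeMonoid.length n) : proj2 H f ∈ ordGE k FreeMonoid.length n := by
  intro v hv
  refine finsum_eq_zero_of_forall_eq_zero fun w => ?_
  by_cases hw : w.length < n
  · rw [hf w hw, zero_mul]
  · refine (congrArg (f w * ·) (lift_mem_ordGE (fun a => ?_) w v ?_)).trans (mul_zero _)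
    · cases a with
      | none => exact (congrArg ((H.index : k) * ·) (letter_one _)).trans (mul_zero _)
      | some σ => exact letter_one _
    · exact hv.trans_le (not_lt.1 hw)

theorem distCoeff_add (f g : NCSeries (XL G) k) :
    distCoeff H (f + g) = distCoeff H f + distCoeff H g :=
  finsum_mem_add_distrib (Set.toFinite _)

theorem distCoeff_congr {f g : NCSeries (XL G) k}
    (h : ∀ σ : G, f (FreeMonoid.of (xl σ)) = g (FreeMonoid.of (xl σ))) :
    distCoeff H f = distCoeff H g := by
  unfold distCoeff
  simp only [h]

theorem finForm_distCoeff : FinForm fun f : FreeMonoid (XL G) → k => distCoeff H f := by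
  classical
  have := Fintype.ofFinite G
  have h : (fun f : FreeMonoid (XL G) → k => distCoeff H f) = fun f =>
      ∑ σ ∈ Finset.univ.filter (fun σ : G => σ ^ H.index = 1), f (FreeMonoid.of (xl σ)) := by
    funext f
    refine (finsum_mem_eq_finite_toFinset_sum _ (Set.toFinite {σ : G | σ ^ H.index = 1})).trans ?_
    refine Finset.sum_congr ?_ fun _ _ => rfl
    ext σ
    simp
  rw [h]
  exact FinForm.sum _ fun σ _ => FinForm.eval _

variable [Algebra ℚ k]

theorem smul_letter_mem_length (c : k) {A : Type*} (a : A) :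
    (c • letter a : NCSeries A k) ∈ ordGE k FreeMonoid.length 1 :=
  Submodule.smul_mem _ c (letter_mem_ordGE a)

/-- The flow preserves the distribution relations. -/
theorem proj2_expOp {ψ f : NCSeries (XL G) k} (h1 : ψ 1 = 0)
    (hψ : proj2 H ψ = proj1 H ψ + distCoeff H ψ • letter (xl 1))
    (hf : proj2 H f = expS (distCoeff H f • letter (xl 1)) * proj1 H f) :
    proj2 H (expOp (sOp ψ) f) =
      expS ((distCoeff H f + distCoeff H ψ) • letter (xl 1)) * proj1 H (expOp (sOp ψ) f) := by
  set a := distCoeff H f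
  set c := distCoeff H ψ
  have h1' : proj1 H ψ 1 = 0 := h1
  -- The two projected actions differ by left multiplication by a multiple of `x_1`, which commutes
  -- with them. Hence the two flows differ by the factor `exp(c x_1)`, and the factor of `f` is
  -- carried along unchanged.
  have hs : ∀ g : NCSeries (XL H) k, sOp (proj2 H ψ) g =
      (c • letter (xl 1)) * g + sOp (proj1 H ψ) g := by
    intro g
    rw [hψ, sOp_add, sOp_smul, sOp_letter_one, smul_mul_assoc, add_comm]
  have hcomm : ∀ (r : k) (g : NCSeries (XL H) k), sOp (proj1 H ψ) ((r • letter (xl 1)) * g) =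
      (r • letter (xl 1)) * sOp (proj1 H ψ) g := by
    intro r g
    rw [smul_mul_assoc, (cts_sOp _).map_smul, sOp_letter_one_mul, smul_mul_assoc]
  have hA := (isExp_sOp h1 f).map (O₁ := sfil k FreeMonoid.length) (cts_proj2 H).lin
    (fun n x hx => proj2_mem_length H hx) (s₁ := (cts_sOp (proj2 H ψ)).lin)
    (fun x => proj2_sOp H ψ x)
  have hB := (isExp_sOp h1 f).map (O₁ := sfil k FreeMonoid.length) (cts_proj1 H).lin
    (fun n x hx => proj1_mem_length H hx) (s₁ := (cts_sOp (proj1 H ψ)).lin)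
    (fun x => proj1_sOp H ψ x)
  have hC := hB.map (O₁ := sfil k FreeMonoid.length) (mulL (expS (a • letter (xl 1))))
    (fun n x hx => by
      have := mul_mem_ordGE FreeMonoid.length_mul
        (mem_ordGE_zero (expS (a • letter (xl 1)) : NCSeries (XL H) k)) hx
      rwa [zero_add] at this)
    (s₁ := (cts_sOp (proj1 H ψ)).lin)
    (fun x => (apply_expS_mul FreeMonoid.length_mul FreeMonoid.length_mul (cts_sOp (proj1 H ψ))
      (fun n g hg => ordGE_anti (Nat.le_succ n) (sOp_mem_ordGE h1' n g hg))
      (smul_letter_mem_length a _) (smul_letter_mem_length a _) (hcomm a) x).symm)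
  have hD := hC.commute (sfil_anti _) (sfil_zero _)
    (raises_mulL FreeMonoid.length_mul (smul_letter_mem_length c (xl (1 : H)))) (raises_sOp h1')
    (LinearMap.ext fun g => (hcomm c g).symm)
    (isExp_expS_mul FreeMonoid.length_mul (smul_letter_mem_length c (xl (1 : H))) _)
  have e : mulL (c • letter (xl 1)) + (cts_sOp (proj1 H ψ)).lin = (cts_sOp (proj2 H ψ)).lin :=
    LinearMap.ext fun g => (hs g).symm
  rw [e] at hD
  have h3 : (cts_proj2 H).lin (expOp (sOp ψ) f) = expS (c • letter (xl 1)) *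
      (expS (a • letter (xl 1)) * proj1 H (expOp (sOp ψ) f)) := by
    refine hA.unique (sfil_sep _) ?_
    have hf' : (cts_proj2 H).lin f =
      mulL (expS (a • letter (xl 1))) ((cts_proj1 H).lin f) := hf
    rw [hf']
    exact hD
  refine h3.trans ?_
  rw [← mul_assoc, ← expS_add FreeMonoid.length_mul (smul_letter_mem_length c (xl (1 : H)))
    (smul_letter_mem_length a (xl (1 : H))), ← add_smul, add_comm c a]
  · rw [smul_mul_smul_comm, smul_mul_smul_comm, mul_comm c a]

end Distribution

end DoubleShuffle
end

noncomputable section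

namespace DoubleShuffle

open NCSeries

/-! ### Sets cut out by finite linear forms -/

section Closed

variable {A B V k : Type*} [CommRing k]

/-- The predicate `p` is equivalent to the vanishing of a family of finite linear forms. -/
def FinClosed (p : NCSeries A k → Prop) : Prop :=
  ∀ f : NCSeries A k, (∀ φ : (FreeMonoid A → k) → k, FinForm φ →
    (∀ g : NCSeries A k, p g → φ g = 0) → φ f = 0) → p f

theorem FinClosed.and {p q : NCSeries A k → Prop} (hp : FinClosed p) (hq : FinClosed q) :
    FinClosed fun f => p f ∧ q f := fun f h =>
  ⟨hp f fun φ hφ h' => h φ hφ fun g hg => h' g hg.1,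
    hq f fun φ hφ h' => h φ hφ fun g hg => h' g hg.2⟩

theorem FinClosed.forall {ι : Sort*} {p : ι → NCSeries A k → Prop} (hp : ∀ i, FinClosed (p i)) :
    FinClosed fun f => ∀ i, p i f := fun _ h i =>
  hp i _ fun φ hφ h' => h φ hφ fun g hg => h' g (hg i)

theorem FinClosed.form_eq {φ χ : (FreeMonoid A → k) → k} (hφ : FinForm φ) (hχ : FinForm χ) :
    FinClosed (A := A) fun f => φ f = χ f := fun _ h =>
  sub_eq_zero.1 (h _ (hφ.sub hχ) fun _ hg => sub_eq_zero.2 hg)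

theorem FinClosed.cts_eq {F H : (FreeMonoid A → k) → (V → k)} (hF : Cts F) (hH : Cts H) :
    FinClosed (A := A) fun f => F f = H f := fun f h =>
  funext fun v => FinClosed.form_eq (hF v) (hH v) f fun φ hφ h' => h φ hφ fun g hg =>
    h' g (congrFun hg v)

theorem FinClosed.zero {p : NCSeries A k → Prop} (hp : FinClosed p) : p 0 :=
  hp 0 fun φ hφ _ => by
    obtain ⟨c, hc⟩ := hφ
    exact (hc _).trans (Finset.sum_eq_zero fun w _ => mul_zero _)

theorem FinClosed.add {p : NCSeries A k → Prop} (hp : FinClosed p) {f g : NCSeries A k}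
    (hf : p f) (hg : p g) : p (f + g) :=
  hp _ fun φ hφ h => (hφ.map_add f g).trans (by rw [h f hf, h g hg, add_zero])

theorem FinClosed.smul {p : NCSeries A k → Prop} (hp : FinClosed p) (c : k) {f : NCSeries A k}
    (hf : p f) : p (c • f) :=
  hp _ fun φ hφ h => (hφ.map_smul c f).trans (by rw [h f hf, mul_zero])

/-- A finite linear form does not see terms of large length, so such conditions pass to limits for
the length filtration. -/
theorem FinClosed.of_forall_sub_mem {p : NCSeries A k → Prop} (hp : FinClosed p)
    {f : NCSeries A k} (hf : ∀ n, ∃ g, p g ∧ f - g ∈ ordGE k FreeMonoid.length n) : p f := by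
  refine hp f fun φ hφ h => ?_
  obtain ⟨N, hN⟩ := hφ.exists_eq_zero FreeMonoid.length
  obtain ⟨g, hg, hfg⟩ := hf N
  have h1 := hφ.map_add (f - g) g
  rw [hN _ hfg, h g hg, add_zero] at h1
  have h2 : f = (f - g) + g := (sub_add_cancel f g).symm
  rw [h2]
  exact h1

theorem NCSeries.FinForm.rat_smul [Algebra ℚ k] {W : Type*} {φ : (W → k) → k} (hφ : FinForm φ) (q : ℚ) :
    FinForm fun f => q • φ f := by
  simpa only [Algebra.smul_def] using hφ.const_mul (algebraMap ℚ k q)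

end Closed

/-! ### Continuity of the star map -/

section Star

variable {G k : Type*} [CommGroup G] [Finite G] [CommRing k] [Algebra ℚ k]

theorem finForm_corrCoeff (n : ℕ) :
    FinForm fun f : FreeMonoid (XL G) → k => corrCoeff f n := by
  unfold corrCoeff
  split_ifs
  · exact FinForm.rat_smul (FinForm.eval _) _
  · exact FinForm.zero

theorem cts_corr : CtsS (corr (G := G) (k := k)) := by
  classical
  intro w
  have h : (fun f : FreeMonoid (XL G) → k => corr f w) = fun f =>
      if w = FreeMonoid.of (1, 1) ^ w.length then corrCoeff f w.length else 0 := by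
    funext f
    exact (congrFun (corr_eq_powSeries f) w).trans (powSeries_apply _ _ _)
  rw [h]
  split_ifs
  · exact finForm_corrCoeff _
  · exact FinForm.zero

theorem cts_starLie : CtsS (starLie (G := G) (k := k)) := CtsS.add (cts_readY 1) cts_corr

theorem cts_tmul_add (A : Type*) : Cts (k := k) (W := FreeMonoid A)
    (V := FreeMonoid A × FreeMonoid A) fun f : NCSeries A k => tmul 1 f + tmul f 1 :=
  Cts.add (fun p => (FinForm.eval p.2).const_mul _) fun p => (FinForm.eval p.1).mul_const _

theorem finClosed_qprim {A : Type*} (op : A → A → A) (ε : k) :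
    FinClosed fun f : NCSeries A k => QPrim op ε f :=
  FinClosed.cts_eq (cts_qcop op ε) (cts_tmul_add A)

end Star

/-! ### The space `dmrd₀` as a closed submodule -/

section Linearised

variable {Γ : Subgroup ℂˣ} [Finite Γ] {k : Type*} [CommRing k] [Algebra ℚ k]

theorem coprod_stuffleWord' {G : Type*} [CommGroup G] [Finite G] (f : NCSeries (YL G) k) :
    coprod (stuffleWord G k) f = qcop yop 1 f := by
  have := Fintype.ofFinite G
  exact coprod_stuffleWord f

theorem isPrimitive_stuffleWord' {G : Type*} [CommGroup G] [Finite G] {f : NCSeries (YL G) k} :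
    IsPrimitive (stuffleWord G k) f ↔ QPrim yop 1 f := by
  rw [IsPrimitive, coprod_stuffleWord', QPrim]

theorem finClosed_weightOne : FinClosed fun f : NCSeries (XL Γ) k => WeightOne f :=
  FinClosed.forall fun σ => FinClosed.forall fun τ => FinClosed.forall fun _ =>
    FinClosed.forall fun _ => FinClosed.forall fun p => FinClosed.forall fun q =>
      FinClosed.forall fun _ => FinClosed.form_eq
        (((FinForm.eval (FreeMonoid.of (xl σ))).sub (FinForm.eval (FreeMonoid.of (xl σ⁻¹)))).rat_smul p)
        (((FinForm.eval (FreeMonoid.of (xl τ))).sub (FinForm.eval (FreeMonoid.of (xl τ⁻¹)))).rat_smul q)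

theorem finClosed_dist (H : Subgroup Γ) : FinClosed fun f : NCSeries (XL Γ) k =>
    proj2 H f = proj1 H f + distCoeff H f • letter (xl 1) := by
  have h : CtsS fun f : NCSeries (XL Γ) k => distCoeff H f • (letter (xl 1) : NCSeries (XL H) k) :=
    fun w => (finForm_distCoeff H).mul_const _
  exact FinClosed.cts_eq (cts_proj2 H) ((cts_proj1 H).add h)

theorem mem_dmrd0_iff {ψ : NCSeries (XL Γ) k} : ψ ∈ dmrd0 Γ k ↔
    (ψ (FreeMonoid.of x0) = 0 ∧ ψ (FreeMonoid.of (xl 1)) = 0 ∧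
      QPrim shop 0 ψ ∧ QPrim yop 1 (starLie ψ) ∧
      (∀ H : Subgroup Γ, proj2 H ψ = proj1 H ψ + distCoeff H ψ • letter (xl 1)) ∧ WeightOne ψ) ∧
    ∀ (n : ℕ+) (ν : Γ), starLie ψ (FreeMonoid.of (n, ν)) +
      (-1) ^ (n : ℕ) * starLie ψ (FreeMonoid.of (n, ν⁻¹)) = 0 := by
  rw [← isPrimitive_shuffleWord, ← isPrimitive_stuffleWord']
  rfl

/-- Every defining condition equates two finite linear forms or two continuous linear maps.
Linearity of the space and its stability under limits both come from this. -/
theorem finClosed_dmrd0 : FinClosed fun ψ : NCSeries (XL Γ) k => ψ ∈ dmrd0 Γ k := by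
  have h : FinClosed fun ψ : NCSeries (XL Γ) k =>
      (ψ (FreeMonoid.of x0) = 0 ∧ ψ (FreeMonoid.of (xl 1)) = 0 ∧
        QPrim shop 0 ψ ∧ QPrim yop 1 (starLie ψ) ∧
        (∀ H : Subgroup Γ, proj2 H ψ = proj1 H ψ + distCoeff H ψ • letter (xl 1)) ∧
        WeightOne ψ) ∧
      ∀ (n : ℕ+) (ν : Γ), starLie ψ (FreeMonoid.of (n, ν)) +
        (-1) ^ (n : ℕ) * starLie ψ (FreeMonoid.of (n, ν⁻¹)) = 0 :=
    ((FinClosed.form_eq (FinForm.eval _) FinForm.zero).and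
      ((FinClosed.form_eq (FinForm.eval _) FinForm.zero).and
      ((finClosed_qprim shop 0).and
      ((FinClosed.cts_eq ((cts_qcop yop 1).comp cts_starLie)
        ((cts_tmul_add (YL Γ)).comp cts_starLie)).and
      ((FinClosed.forall finClosed_dist).and finClosed_weightOne))))).and
      (FinClosed.forall fun n => FinClosed.forall fun ν => FinClosed.form_eq
        ((cts_starLie _).add ((cts_starLie _).const_mul _)) FinForm.zero)
  simpa only [mem_dmrd0_iff] using h

theorem nonExceptional_of_mem {ψ : NCSeries (XL Γ) k} (h : ψ ∈ dmrd0 Γ k) : NonExceptional ψ := by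
  obtain ⟨⟨h0, h1, h2, h3, h4, h5⟩, h6⟩ := mem_dmrd0_iff.1 h
  exact ⟨h2, h0, h3, h6⟩

/-- The space `dmrd₀`, as a submodule. -/
def dmrd0Submodule (Γ : Subgroup ℂˣ) [Finite Γ] (k : Type*) [CommRing k] [Algebra ℚ k] :
    Submodule k (NCSeries (XL Γ) k) where
  carrier := dmrd0 Γ k
  zero_mem' := finClosed_dmrd0.zero
  add_mem' := finClosed_dmrd0.add
  smul_mem' c _ := finClosed_dmrd0.smul c

end Linearised

/-! ### Stability of `DMRD_λ` under the flow -/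

section Group

variable {Γ : Subgroup ℂˣ} [Finite Γ] {k : Type*} [CommRing k] [Algebra ℚ k]

theorem mem_DMRD_iff {Φ : NCSeries (XL Γ) k} : Φ ∈ DMRD Γ k ↔
    Φ 1 = 1 ∧ Φ (FreeMonoid.of x0) = 0 ∧ Φ (FreeMonoid.of (xl 1)) = 0 ∧
    qcop shop 0 Φ = tmul Φ Φ ∧ qcop yop 1 (starGroup Φ) = tmul (starGroup Φ) (starGroup Φ) ∧
    (∀ H : Subgroup Γ, proj2 H Φ = expS (distCoeff H Φ • letter (xl 1)) * proj1 H Φ) ∧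
    WeightOne Φ := by
  rw [← coprod_shuffleWord, ← coprod_stuffleWord']
  rfl

theorem expOp_sOp_letter {G : Type*} [CommGroup G] [Finite G] {ψ f : NCSeries (XL G) k}
    (hψ : ψ ∈ ordGE k depth 1) (hf : f 1 = 1) (ν : G) :
    expOp (sOp ψ) f (FreeMonoid.of (xl ν)) =
      f (FreeMonoid.of (xl ν)) + ψ (FreeMonoid.of (xl ν)) := by
  have h := expOp_sOp_apply_of_depth hψ f 0 ν
  rwa [pow_zero, one_mul, hf, mul_one] at h

theorem WeightOne.add {f g : NCSeries (XL Γ) k} (hf : WeightOne f) (hg : WeightOne g) :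
    WeightOne (f + g) := finClosed_weightOne.add hf hg

theorem WeightOne.congr {f g : NCSeries (XL Γ) k} (hf : WeightOne f)
    (h : ∀ σ : Γ, g (FreeMonoid.of (xl σ)) = f (FreeMonoid.of (xl σ))) : WeightOne g := by
  intro σ τ hσ hτ p q hpq
  rw [h, h, h, h]
  exact hf σ τ hσ hτ p q hpq

theorem expOp_sOp_mem_DMRD {ψ Φ : NCSeries (XL Γ) k} (hψ : ψ ∈ dmrd0 Γ k) (hΦ : Φ ∈ DMRD Γ k) :
    expOp (sOp ψ) Φ ∈ DMRD Γ k := by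
  have hne := nonExceptional_of_mem hψ
  obtain ⟨⟨-, a1, a2, -, a4, a5⟩, -⟩ := mem_dmrd0_iff.1 hψ
  obtain ⟨b, b0, b1, b2, b3, b4, b5⟩ := mem_DMRD_iff.1 hΦ
  have hd := hne.mem_depth
  have hl : ∀ σ : Γ, expOp (sOp ψ) Φ (FreeMonoid.of (xl σ)) = (Φ + ψ) (FreeMonoid.of (xl σ)) :=
    expOp_sOp_letter hd b
  refine mem_DMRD_iff.2 ⟨?_, ?_, ?_, qcop_shop_expOp a2 b2, qcop_starGroup_expOp hne b b3,
    fun H => ?_, (b5.add a5).congr hl⟩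
  · rw [expOp_sOp_apply_x0 hd Φ (w := 1) rfl, b]
  · rw [expOp_sOp_apply_x0 hd Φ (w := FreeMonoid.of x0) rfl, b0]
  · rw [hl, NCSeries.add_apply, b1, a1, add_zero]
  · rw [proj2_expOp H hne.apply_one (a4 H) (b4 H), ← distCoeff_add, distCoeff_congr H hl]

/-- The polynomial `α` only involves words of depth one, where the flow adds the coefficients of
`ψ`. Parity makes `ψ` pair to zero with `α`: at weight two and `ν = 1` it says that twice the
coefficient of `x₀ x_1` vanishes, at weight one that the coefficients of `x_ν` and `x_{ν⁻¹}` agree.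
-/
theorem pairing_expOp {ψ Φ : NCSeries (XL Γ) k} (hψ : ψ ∈ dmrd0 Γ k) (hΦ : Φ 1 = 1)
    {α : MonoidAlgebra ℚ (FreeMonoid (XL Γ))} (hα : α ∈ alphaSet Γ) :
    pairing (expOp (sOp ψ) Φ) α = pairing Φ α := by
  have hne := nonExceptional_of_mem hψ
  have hd := hne.mem_depth
  have hp := hne.parity
  rcases hα with ⟨-, rfl⟩ | ⟨-, ν, -, rfl⟩
  · have h1 := hp 2 1
    rw [inv_one, starLie_of] at h1
    have h2 : ((2 : ℕ+) : ℕ) = 2 := rfl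
    rw [h2, Nat.add_one_sub_one, pow_one, neg_one_sq, one_mul] at h1
    have h3 := expOp_sOp_apply_of_depth hd Φ 1 1
    rw [pow_one, eq_zero_of_add_self h1, zero_mul, add_zero] at h3
    rw [pairing, pairing, MonoidAlgebra.coeff_single, Finsupp.sum_single_index (by simp),
      Finsupp.sum_single_index (by simp), h3]
  · have h1 := hp 1 ν
    rw [starLie_of, starLie_of] at h1
    simp only [PNat.one_coe, Nat.sub_self, pow_zero, one_mul, pow_one] at h1
    have e : ∀ f : NCSeries (XL Γ) k, pairing f (MonoidAlgebra.single (FreeMonoid.of (xl ν)) 1 -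
        MonoidAlgebra.single (FreeMonoid.of (xl ν⁻¹)) 1) =
        f (FreeMonoid.of (xl ν)) - f (FreeMonoid.of (xl ν⁻¹)) := by
      intro f
      rw [pairing, MonoidAlgebra.coeff_sub, MonoidAlgebra.coeff_single, MonoidAlgebra.coeff_single,
        Finsupp.sum_sub_index fun _ _ _ => sub_smul _ _ _, Finsupp.sum_single_index (by simp),
        Finsupp.sum_single_index (by simp), one_smul, one_smul]
    rw [e, e, expOp_sOp_letter hd hΦ, expOp_sOp_letter hd hΦ]
    linear_combination h1

end Group

end DoubleShuffle
end

noncomputable section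

namespace DoubleShuffle

open NCSeries

/-! ### The Ihara bracket and the two coproducts -/

section Bracket

/-- The mixed terms `D(1) ⊗ E(1) + E(1) ⊗ D(1)` in the coproduct of `D(E(1))` are symmetric in `D`
and `E`, and disappear in the commutator. -/
theorem NCSeries.qprim_bracket {A k : Type*} [CommRing k] {op : A → A → A} {ε : k}
    {D E : NCSeries A k → NCSeries A k} (hD : CtsS D) (hE : CtsS E)
    (cD : ∀ f, qcop op ε (D f) = op1 D (qcop op ε f) + op2 D (qcop op ε f))
    (cE : ∀ f, qcop op ε (E f) = op1 E (qcop op ε f) + op2 E (qcop op ε f))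
    (pD : QPrim op ε (D 1)) (pE : QPrim op ε (E 1)) : QPrim op ε (D (E 1) - E (D 1)) := by
  have h : ∀ {D E : NCSeries A k → NCSeries A k} (_ : CtsS D)
      (_ : ∀ f, qcop op ε (D f) = op1 D (qcop op ε f) + op2 D (qcop op ε f))
      (_ : QPrim op ε (E 1)), qcop op ε (D (E 1)) =
        (tmul (D 1) (E 1) + tmul (E 1) (D 1)) + (tmul (D (E 1)) 1 + tmul 1 (D (E 1))) := by
    intro D E hD cD pE
    rw [cD, show qcop op ε (E 1) = _ from pE, (cts_op1 hD).map_add, (cts_op2 hD).map_add,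
      op1_tmul hD, op1_tmul hD, op2_tmul hD, op2_tmul hD]
    abel
  unfold QPrim
  rw [show qcop op ε (D (E 1) - E (D 1)) = qcop op ε (D (E 1)) - qcop op ε (E (D 1)) from
    (cts_qcop op ε).map_sub _ _, h hD cD pE, h hE cE pD]
  have h1 : tmul (D (E 1) - E (D 1)) (1 : NCSeries A k) = tmul (D (E 1)) 1 - tmul (E (D 1)) 1 :=
    funext fun p => sub_mul _ _ _
  have h2 : tmul (1 : NCSeries A k) (D (E 1) - E (D 1)) = tmul 1 (D (E 1)) - tmul 1 (E (D 1)) :=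
    funext fun p => mul_sub _ _ _
  rw [h1, h2]
  abel

variable {G k : Type*} [CommGroup G] [Finite G] [CommRing k] [Algebra ℚ k]

theorem corr_eq_zero {ψ : NCSeries (XL G) k} (h : ∀ n, corrCoeff ψ n = 0) : corr ψ = 0 := by
  classical
  ext w
  rw [corr_eq_powSeries, powSeries_apply, h, ite_self]
  rfl

/-- The coefficient of `s_ψ(φ)` in depth one involves the constant term of `φ`, which is zero. In
particular brackets need no correction and satisfy parity trivially. -/
theorem ihara_apply {ψ₁ ψ₂ : NCSeries (XL G) k} (h₁ : ψ₁ ∈ ordGE k depth 1)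
    (h₂ : ψ₂ ∈ ordGE k depth 1) (j : ℕ) (ν : G) :
    ihara ψ₁ ψ₂ (FreeMonoid.of x0 ^ j * FreeMonoid.of (xl ν)) = 0 := by
  rw [ihara, NCSeries.sub_apply, sOp_apply_of_depth h₁, sOp_apply_of_depth h₂,
    apply_one_of_depth (sOp_mem_depth h₁ _), apply_one_of_depth (sOp_mem_depth h₂ _), mul_zero,
    mul_zero, sub_zero]

theorem ihara_mem_depth {ψ₁ ψ₂ : NCSeries (XL G) k} (h₁ : ψ₁ ∈ ordGE k depth 1)
    (h₂ : ψ₂ ∈ ordGE k depth 1) : ihara ψ₁ ψ₂ ∈ ordGE k depth 1 :=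
  Submodule.sub_mem _ (sOp_mem_depth h₁ _) (sOp_mem_depth h₂ _)

theorem corr_ihara {ψ₁ ψ₂ : NCSeries (XL G) k} (h₁ : ψ₁ ∈ ordGE k depth 1)
    (h₂ : ψ₂ ∈ ordGE k depth 1) : corr (ihara ψ₁ ψ₂) = 0 :=
  corr_eq_zero fun n => by
    unfold corrCoeff
    rw [ihara_apply h₁ h₂, smul_zero, ite_self]

/-- The corrections commute with each other and with the tangential actions, so the commutator of
the corrected actions at `1` is the uncorrected bracket. Its image in `Y` is a commutator of
coderivations at `1`. -/
theorem qprim_starLie_ihara {ψ₁ ψ₂ : NCSeries (XL G) k} (h₁ : NonExceptional ψ₁)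
    (h₂ : NonExceptional ψ₂) : QPrim yop 1 (starLie (ihara ψ₁ ψ₂)) := by
  have hD : ∀ ψ φ : NCSeries (XL G) k, inducedOp (corrected ψ) (inducedOp (corrected φ) 1) =
      readY 1 (sOp (corrected ψ) (sOp (corrected φ) 1)) := by
    intro ψ φ
    have e : (1 : NCSeries (YL G) k) = qs (piY 1) := (readY_one_series 1).symm
    rw [e, inducedOp_qs_piY, inducedOp_qs_piY, readY_one_eq]
  have hs : ∀ ψ φ : NCSeries (XL G) k, sOp (corrected ψ) (sOp (corrected φ) 1) =
      corrX ψ * corrX φ + (corrX ψ * sOp φ 1 + corrX φ * sOp ψ 1) + sOp ψ (sOp φ 1) := by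
    intro ψ φ
    have h3 : sOp ψ (corrX φ * 1) = corrX φ * sOp ψ 1 := sOp_powSeries_mul ψ _ 1
    rw [sOp_corrected, sOp_corrected, (cts_sOp ψ).map_add, h3, mul_one, mul_add]
    abel
  have hD1 : ∀ {ψ : NCSeries (XL G) k}, NonExceptional ψ →
      QPrim yop 1 (inducedOp (corrected ψ) 1) := by
    intro ψ h
    have e : (1 : NCSeries (YL G) k) = qs (piY 1) := (readY_one_series 1).symm
    rw [e, inducedOp_qs_piY, sOp_one, corrected, ← starLie_eq]
    exact h.star
  have h := qprim_bracket (cts_inducedOp (corrected ψ₁)) (cts_inducedOp (corrected ψ₂))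
    h₁.isCoderivation h₂.isCoderivation (hD1 h₁) (hD1 h₂)
  have hc : corrX ψ₁ * corrX ψ₂ = corrX ψ₂ * corrX ψ₁ := powSeries_comm _ _ _
  have e : sOp (corrected ψ₁) (sOp (corrected ψ₂) 1) - sOp (corrected ψ₂) (sOp (corrected ψ₁) 1) =
      ihara ψ₁ ψ₂ := by
    rw [hs, hs, hc, ihara]
    abel
  rw [hD, hD, ← (cts_readY (1 : G)).map_sub, e] at h
  rw [starLie, corr_ihara h₁.mem_depth h₂.mem_depth, add_zero]
  exact h

end Bracket

/-! ### Stability of `dmrd₀` under the bracket -/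

section Ihara

variable {Γ : Subgroup ℂˣ} [Finite Γ] {k : Type*} [CommRing k] [Algebra ℚ k]

theorem distCoeff_zero {G : Type*} [CommGroup G] [Finite G] (H : Subgroup G)
    {f : NCSeries (XL G) k} (h : ∀ σ : G, f (FreeMonoid.of (xl σ)) = 0) : distCoeff H f = 0 := by
  unfold distCoeff
  simp only [h, finsum_zero]

/-- The multiples of `x_1` by which the projections differ contribute only terms symmetric in the
two arguments, which cancel in the bracket. -/
theorem proj_ihara {G : Type*} [CommGroup G] [Finite G] (H : Subgroup G)
    {ψ₁ ψ₂ : NCSeries (XL G) k} {c₁ c₂ : k}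
    (h₁ : proj2 H ψ₁ = proj1 H ψ₁ + c₁ • letter (xl 1))
    (h₂ : proj2 H ψ₂ = proj1 H ψ₂ + c₂ • letter (xl 1)) :
    proj2 H (ihara ψ₁ ψ₂) = proj1 H (ihara ψ₁ ψ₂) := by
  have key : ∀ (a b : k) (ψ φ : NCSeries (XL H) k),
      sOp (ψ + a • letter (xl 1)) (sOp (φ + b • letter (xl 1)) 1) =
        (a * b) • (letter (xl 1) * letter (xl 1)) + (a • (letter (xl 1) * φ) +
          b • (letter (xl 1) * ψ)) + sOp ψ (sOp φ 1) := by
    intro a b ψ φ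
    have h3 := sOp_letter_one_mul ψ 1
    rw [mul_one, sOp_one] at h3
    rw [sOp_one, sOp_one, sOp_add, sOp_smul, sOp_letter_one, (cts_sOp ψ).map_add,
      (cts_sOp ψ).map_smul, h3, mul_add, mul_smul_comm, smul_add, smul_smul]
    abel
  rw [ihara, (cts_proj2 H).map_sub, (cts_proj1 H).map_sub]
  simp only [proj2_sOp, proj1_sOp, proj2_one, proj1_one]
  rw [h₁, h₂, key, key, mul_comm c₂ c₁]
  abel

theorem ihara_mem {ψ₁ ψ₂ : NCSeries (XL Γ) k} (h₁ : ψ₁ ∈ dmrd0 Γ k) (h₂ : ψ₂ ∈ dmrd0 Γ k) :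
    ihara ψ₁ ψ₂ ∈ dmrd0 Γ k := by
  have n₁ := nonExceptional_of_mem h₁
  have n₂ := nonExceptional_of_mem h₂
  obtain ⟨⟨-, -, -, -, d₁, -⟩, -⟩ := mem_dmrd0_iff.1 h₁
  obtain ⟨⟨-, -, -, -, d₂, -⟩, -⟩ := mem_dmrd0_iff.1 h₂
  have hl : ∀ σ : Γ, ihara ψ₁ ψ₂ (FreeMonoid.of (xl σ)) = 0 := fun σ => by
    have := ihara_apply n₁.mem_depth n₂.mem_depth 0 σ
    rwa [pow_zero, one_mul] at this
  refine mem_dmrd0_iff.2 ⟨⟨?_, hl 1, ?_, qprim_starLie_ihara n₁ n₂, fun H => ?_,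
    finClosed_weightOne.zero.congr hl⟩, fun n ν => ?_⟩
  · exact ihara_mem_depth n₁.mem_depth n₂.mem_depth _ Nat.one_pos
  · refine qprim_bracket (cts_sOp ψ₁) (cts_sOp ψ₂) (sOp_coderivation n₁.prim)
      (sOp_coderivation n₂.prim) ?_ ?_
    · rw [sOp_one]
      exact n₁.prim
    · rw [sOp_one]
      exact n₂.prim
  · rw [proj_ihara H (d₁ H) (d₂ H), distCoeff_zero H hl, zero_smul, add_zero]
  · rw [starLie_of, starLie_of, ihara_apply n₁.mem_depth n₂.mem_depth,
      ihara_apply n₁.mem_depth n₂.mem_depth, mul_zero, add_zero]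

end Ihara

/-! ### Low order terms of exponentials -/

section LowOrder

variable {A G k : Type*} [CommGroup G] [Finite G] [CommRing k] [Algebra ℚ k]

theorem NCSeries.expS_sub_mem {deg : FreeMonoid A → ℕ} (hdeg : ∀ u v, deg (u * v) = deg u + deg v)
    {c : NCSeries A k} {m : ℕ} (hm : 1 ≤ m) (hc : c ∈ ordGE k deg m) :
    expS c - 1 - c ∈ ordGE k deg (m + 1) := by
  have hc1 : c ∈ ordGE k deg 1 := ordGE_anti hm hc
  have hp : ∀ i, c ^ (i + 1) ∈ ordGE k deg 1 := by
    intro i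
    have := mul_mem_ordGE hdeg hc1 (mem_ordGE_zero (c ^ i))
    rwa [← pow_succ'] at this
  obtain ⟨m, rfl⟩ : ∃ l, m = l + 1 := ⟨m - 1, by omega⟩
  have h := isExp_expS hdeg (c := c) hc1 (m + 1 + 1)
  rw [Finset.sum_range_succ', Finset.sum_range_succ'] at h
  simp only [mulL_pow_apply, mul_one, pow_zero, Nat.factorial_zero, Nat.factorial_one, zero_add,
    Nat.cast_one, inv_one, one_smul, pow_one, mulL_apply, Module.End.one_apply] at h
  have h2 : ∑ i ∈ Finset.range m, ((i + 1 + 1).factorial : ℚ)⁻¹ • c ^ (i + 1 + 1) ∈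
      sfil k deg (m + 1 + 1) := Submodule.sum_mem _ fun i _ => Submodule.smul_mem _ _ (by
        have := mul_mem_ordGE hdeg hc (hp i)
        rwa [← pow_succ'] at this)
  have h3 := Submodule.add_mem _ h h2
  rw [show expS c - 1 - c = expS c - (∑ i ∈ Finset.range m,
    ((i + 1 + 1).factorial : ℚ)⁻¹ • c ^ (i + 1 + 1) + c + 1) + ∑ i ∈ Finset.range m,
    ((i + 1 + 1).factorial : ℚ)⁻¹ • c ^ (i + 1 + 1) by abel]
  exact h3

variable {ψ χ : NCSeries (XL G) k}

theorem sOp_zero_left (f : NCSeries (XL G) k) : sOp 0 f = 0 := by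
  have := sOp_smul (0 : k) 0 f
  rwa [zero_smul, zero_smul] at this

theorem expOp_mem_ordGE (h1 : ψ 1 = 0) {n : ℕ} {f : NCSeries (XL G) k}
    (hf : f ∈ ordGE k FreeMonoid.length n) : expOp (sOp ψ) f ∈ ordGE k FreeMonoid.length n :=
  (isExp_sOp h1 f).mem_of_mem (sfil_anti _) (raises_sOp h1) hf

theorem expOp_sub_mem_ordGE (h1 : ψ 1 = 0) {n : ℕ} {f : NCSeries (XL G) k}
    (hf : f ∈ ordGE k FreeMonoid.length n) :
    expOp (sOp ψ) f - f ∈ ordGE k FreeMonoid.length (n + 1) := by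
  have h := isExp_sOp h1 f (n + 1)
  rw [Finset.sum_range_succ'] at h
  simp only [pow_zero, Nat.factorial_zero, Nat.cast_one, inv_one, one_smul,
    Module.End.one_apply] at h
  have h2 : ∑ i ∈ Finset.range n, ((i + 1).factorial : ℚ)⁻¹ • ((cts_sOp ψ).lin ^ (i + 1)) f ∈
      sfil k FreeMonoid.length (n + 1) := Submodule.sum_mem _ fun i _ =>
    Submodule.smul_mem _ _ (sfil_anti _ (by omega) ((raises_sOp h1).pow_mem hf (i + 1)))
  have h3 := Submodule.add_mem _ h h2
  rwa [sub_add_eq_sub_sub_swap, sub_add_cancel] at h3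

theorem cts_expOp_sOp (h1 : ψ 1 = 0) : CtsS (expOp (sOp ψ)) :=
  cts_expOp (cts_sOp ψ) (sOp_mem_ordGE h1)

theorem expOp_add_cancel (h1 : ψ 1 = 0) (h2 : χ 1 = 0) (h : ψ + χ = 0) (f : NCSeries (XL G) k) :
    expOp (sOp ψ) (expOp (sOp χ) f) = f := by
  have e : (cts_sOp ψ).lin + (cts_sOp χ).lin = 0 := LinearMap.ext fun g => by
    refine (sOp_add ψ χ g).symm.trans ?_
    rw [h, sOp_zero_left]
    rfl
  have hc : Commute (cts_sOp ψ).lin (cts_sOp χ).lin := by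
    rw [eq_neg_of_add_eq_zero_left e]
    exact (Commute.refl _).neg_left
  have h3 := (isExp_sOp h2 f).commute (sfil_anti _) (sfil_zero _) (raises_sOp h1) (raises_sOp h2) hc
    (isExp_sOp h1 _)
  rw [e] at h3
  exact h3.unique (sfil_sep _) (IsExp.zero (sfil_zero _) f)

/-- The difference of the iterates of `s_{ψ+χ}` and `s_ψ` at `1` gains one degree per step beyond
the first, so only the first order term `χ` is visible in length `n + 1`. -/
theorem mtExp_add_sub_mem (h1 : ψ 1 = 0) {n : ℕ} (hχ : χ ∈ ordGE k FreeMonoid.length (n + 1)) :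
    mtExp (ψ + χ) - mtExp ψ - χ ∈ ordGE k FreeMonoid.length (n + 2) := by
  have hχ1 : χ 1 = 0 := hχ 1 (Nat.succ_pos n)
  have hs : (ψ + χ) 1 = 0 := by rw [NCSeries.add_apply, h1, hχ1, add_zero]
  set a := (cts_sOp (ψ + χ)).lin with ha
  set b := (cts_sOp ψ).lin with hb
  have hd : ∀ i, (a ^ (i + 1)) 1 - (b ^ (i + 1)) 1 ∈ ordGE k FreeMonoid.length (n + 1 + i) := by
    intro i
    induction i with
    | zero =>
      have : (a ^ 1) 1 - (b ^ 1) 1 = χ := by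
        rw [pow_one, pow_one]
        change sOp (ψ + χ) 1 - sOp ψ 1 = χ
        rw [sOp_one, sOp_one, add_sub_cancel_left]
      rw [zero_add, this]
      exact hχ
    | succ i ih =>
      have e : (a ^ (i + 1 + 1)) 1 - (b ^ (i + 1 + 1)) 1 =
          sOp ψ ((a ^ (i + 1)) 1 - (b ^ (i + 1)) 1) + sOp χ ((a ^ (i + 1)) 1) := by
        rw [pow_succ' a, pow_succ' b, Module.End.mul_apply, Module.End.mul_apply]
        change sOp (ψ + χ) _ - sOp ψ _ = _
        rw [sOp_add, (cts_sOp ψ).map_sub]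
        abel
      rw [e]
      refine Submodule.add_mem _ (sOp_mem_ordGE h1 _ _ ih) ?_
      have h3 : (a ^ (i + 1)) 1 ∈ ordGE k FreeMonoid.length (i + 1 + 0) :=
        (raises_sOp hs).pow_mem (sfil_zero _ 1) (i + 1)
      have h4 := sOp_mem_ordGE_add hχ h3
      rwa [show i + 1 + 0 + (n + 1) = n + 1 + (i + 1) by ring] at h4
  have hE := Submodule.sub_mem _ (isExp_sOp hs 1 (n + 2)) (isExp_sOp h1 1 (n + 2))
  rw [← ha, ← hb, sub_sub_sub_comm, ← Finset.sum_sub_distrib, Finset.sum_range_succ',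
    Finset.sum_range_succ'] at hE
  simp only [← smul_sub] at hE
  have e1 : (a ^ (0 + 1)) 1 - (b ^ (0 + 1)) 1 = χ := by
    rw [zero_add, pow_one, pow_one]
    change sOp (ψ + χ) 1 - sOp ψ 1 = χ
    rw [sOp_one, sOp_one, add_sub_cancel_left]
  rw [e1, pow_zero, pow_zero, sub_self, smul_zero, add_zero, zero_add, Nat.factorial_one,
    Nat.cast_one, inv_one, one_smul] at hE
  have h2 : ∑ i ∈ Finset.range n, ((i + 1 + 1).factorial : ℚ)⁻¹ •
      ((a ^ (i + 1 + 1)) 1 - (b ^ (i + 1 + 1)) 1) ∈ sfil k FreeMonoid.length (n + 2) :=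
    Submodule.sum_mem _ fun i _ => Submodule.smul_mem _ _ (ordGE_anti (by omega) (hd (i + 1)))
  have h3 := Submodule.add_mem _ hE h2
  rwa [sub_add_eq_sub_sub_swap, sub_add_cancel] at h3

end LowOrder

end DoubleShuffle
end

noncomputable section

namespace DoubleShuffle

open NCSeries

/-! ### Lowest order parts of group-like series -/

section Homogeneous

variable {A B k : Type*} [CommRing k]

/-- The homogeneous part of a series. -/
def homPart (deg : FreeMonoid A → ℕ) (m : ℕ) (f : NCSeries A k) : NCSeries A k :=
  fun w => if deg w = m then f w else 0

theorem sub_homPart_mem {deg : FreeMonoid A → ℕ} {m : ℕ} {f : NCSeries A k}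
    (hf : f ∈ ordGE k deg m) : f - homPart deg m f ∈ ordGE k deg (m + 1) := by
  intro w hw
  change f w - (if deg w = m then f w else 0) = 0
  split_ifs with h
  · exact sub_self _
  · rw [sub_zero]
    exact hf w (by omega)

/-- Linearisation of the group-like series at the unit. -/
theorem qprim_homPart {op : A → A → A} {ε : k} {deg : FreeMonoid A → ℕ}
    (hdeg : ∀ u v, deg (u * v) = deg u + deg v)
    (hop : ε ≠ 0 → ∀ a b, deg (FreeMonoid.of (op a b)) = deg (FreeMonoid.of a) + deg (FreeMonoid.of b))
    (hpos : ∀ w, w ≠ 1 → 0 < deg w) {m : ℕ} (hm : 1 ≤ m) {g : NCSeries A k}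
    (hg : qcop op ε g = tmul g g) (h1 : g - 1 ∈ ordGE k deg m) :
    QPrim op ε (homPart deg m g) := by
  have hz : deg 1 = 0 := by
    have := hdeg 1 1
    rw [mul_one] at this
    exact Nat.left_eq_add.1 this
  refine qcop_eq_iff.2 ⟨if_neg (by rw [show FreeMonoid.ofList [] = (1 : FreeMonoid A) from rfl, hz]; omega), fun u v hu hv => ?_⟩
  have pu := hpos (FreeMonoid.ofList u) hu
  have pv := hpos (FreeMonoid.ofList v) hv
  by_cases h : deg (FreeMonoid.ofList u) + deg (FreeMonoid.ofList v) = m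
  · have e : stf op ε (fun l => homPart deg m g (FreeMonoid.ofList l)) u v =
        stf op ε (fun l => g (FreeMonoid.ofList l)) u v :=
      stf_congr_deg hdeg hop u v fun w hw => if_pos (hw.trans h)
    have e2 := congrFun hg (FreeMonoid.ofList u, FreeMonoid.ofList v)
    -- As `v` has positive degree, `u` has degree less than `m`, where `g` agrees with `1`.
    have e3 : g (FreeMonoid.ofList u) = 0 := by
      have h3 : g (FreeMonoid.ofList u) = (1 : NCSeries A k) (FreeMonoid.ofList u) :=
        sub_eq_zero.1 (h1 (FreeMonoid.ofList u) (by omega))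
      exact h3.trans (one_apply_ne (w := FreeMonoid.ofList u) hu)
    refine e.trans (e2.trans ?_)
    rw [tmul, e3, zero_mul]
  · refine (stf_congr_deg hdeg hop u v (Q := fun _ => 0) fun w hw => if_neg ?_).trans ?_
    · rwa [hw]
    · exact congrFun ((cts_qcop (k := k) op ε).map_zero)
        (FreeMonoid.ofList u, FreeMonoid.ofList v)

theorem lift_apply_of_length_ne {g : A → NCSeries B k} (hg : ∀ a w, w.length ≠ 1 → g a w = 0)
    (u : FreeMonoid A) {v : FreeMonoid B} (h : v.length ≠ u.length) :
    FreeMonoid.lift g u v = 0 := by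
  induction u using FreeMonoid.inductionOn' generalizing v with
  | one =>
    rw [map_one]
    refine one_apply_ne fun hv => h ?_
    rw [hv]
    rfl
  | of_mul a u ih =>
    rw [map_mul, FreeMonoid.lift_eval_of]
    refine Finset.sum_eq_zero fun i _ => ?_
    rw [FreeMonoid.length_mul, FreeMonoid.length_of] at h
    by_cases h1 : (FreeMonoid.ofList (v.toList.take i)).length = 1
    · rw [ih, mul_zero]
      intro h2
      have h3 : (v.toList.take i).length = 1 := h1
      have h4 : (v.toList.drop i).length = u.length := h2
      have h5 := congrArg List.length (List.take_append_drop i v.toList)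
      rw [List.length_append, h3, h4] at h5
      exact h h5.symm
    · rw [hg a _ h1, zero_mul]

end Homogeneous

/-! ### First order expansion of the star series -/

section Linearise

variable {G k : Type*} [CommGroup G] [Finite G] [CommRing k] [Algebra ℚ k]

theorem proj2_apply_of_length (H : Subgroup G) {m : ℕ} {f : NCSeries (XL G) k}
    (hf : ∀ w, w.length ≠ m → f w = 0) {v : FreeMonoid (XL H)} (hv : v.length ≠ m) :
    proj2 H f v = 0 := by
  have hl : ∀ (a : XL H) (w : FreeMonoid (XL H)), w.length ≠ 1 →
      (letter a : NCSeries (XL H) k) w = 0 := by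
    intro a w hw
    refine word_ne ?_
    rintro rfl
    exact hw rfl
  refine finsum_eq_zero_of_forall_eq_zero fun w => ?_
  by_cases hw : w.length = m
  · refine (congrArg (f w * ·) (lift_apply_of_length_ne (fun a u hu => ?_) w ?_)).trans (mul_zero _)
    · cases a with
      | none => exact (congrArg ((H.index : k) * ·) (hl _ _ hu)).trans (mul_zero _)
      | some σ => exact hl _ _ hu
    · rwa [hw]
  · rw [hf w hw, zero_mul]

theorem corr_mem_wt {n : ℕ} {f : NCSeries (XL G) k} (hf : f ∈ ordGE k FreeMonoid.length n) :
    corr f ∈ ordGE k wt n := by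
  classical
  intro w hw
  rw [corr_eq_powSeries, powSeries_apply]
  split_ifs with h
  · unfold corrCoeff
    split_ifs with h2
    · have hwt : wt w = w.length := by
        rw [h, length_of_pow]
        generalize w.length = l
        induction l with
        | zero => rfl
        | succ l ih => rw [pow_succ, wt_mul, ih, wt_of, PNat.one_coe]
      rw [hf, smul_zero]
      rw [FreeMonoid.length_mul, length_of_pow, FreeMonoid.length_of]
      omega
    · rfl
  · rfl

theorem starLie_mem_wt {n : ℕ} {f : NCSeries (XL G) k} (hf : f ∈ ordGE k FreeMonoid.length n) :
    starLie f ∈ ordGE k wt n :=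
  Submodule.add_mem _ (readY_mem_wt 1 hf) (corr_mem_wt hf)

theorem starLie_apply_of_wt {m : ℕ} {f : NCSeries (XL G) k} (hf : ∀ w, w.length ≠ m → f w = 0)
    {w : FreeMonoid (YL G)} (hw : wt w ≠ m) : starLie f w = 0 := by
  rcases lt_or_gt_of_ne hw with h | h
  · exact starLie_mem_wt (n := m) (fun v hv => hf v hv.ne) w h
  · classical
    have h1 : qs (piY f) w = 0 := hf _ (by
      refine ne_of_eq_of_ne ?_ hw
      exact length_xword 1 w.toList)
    rw [starLie, NCSeries.add_apply, h1, zero_add, corr_eq_powSeries, powSeries_apply]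
    split_ifs with h2
    · unfold corrCoeff
      split_ifs with h3
      · have hwt : wt w = w.length := by
          rw [h2, length_of_pow]
          generalize w.length = l
          induction l with
          | zero => rfl
          | succ l ih => rw [pow_succ, wt_mul, ih, wt_of, PNat.one_coe]
        rw [hf, smul_zero]
        rw [FreeMonoid.length_mul, length_of_pow, FreeMonoid.length_of]
        omega
      · rfl
    · rfl

theorem corr_one : corr (1 : NCSeries (XL G) k) = 0 := corr_eq_zero fun n => by
  unfold corrCoeff
  rw [one_apply_ne (mul_of_ne_one _ _), smul_zero, ite_self]

/-- Expansion of `Φ_*` at first order. -/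
theorem starGroup_sub_mem {n : ℕ} {f : NCSeries (XL G) k}
    (hf : f - 1 ∈ ordGE k FreeMonoid.length (n + 1)) :
    starGroup f - 1 - starLie (f - 1) ∈ ordGE k wt (n + 2) := by
  have hc : corr (f - 1) = corr f := by rw [cts_corr.map_sub, corr_one, sub_zero]
  have h1 := corr_mem_wt hf
  have h2 := readY_mem_wt (1 : G) hf
  have h3 := expS_sub_mem wt_mul (Nat.succ_le_succ (Nat.zero_le n)) h1
  set c := corr (f - 1)
  set ρ := readY 1 (f - 1) with hρ
  set r := expS c - 1 - c
  have e1 : expS (corr f) = 1 + c + r := by rw [← hc]; simp only [r]; abel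
  have e2 : qs (piY f) = 1 + ρ := by
    have : readY 1 f - readY 1 1 = ρ := ((cts_readY (1 : G)).map_sub f 1).symm
    rw [readY_one_series] at this
    rw [← this, ← readY_one_eq]
    abel
  have e3 : starGroup f - 1 - starLie (f - 1) = r + (c + r) * ρ := by
    have e4 : starLie (f - 1) = ρ + c := rfl
    rw [e4, starGroup, e1, e2]
    noncomm_ring
  refine (congrArg (· ∈ ordGE k wt (n + 2)) e3).mpr ?_
  refine Submodule.add_mem _ h3 ?_
  have h4 := mul_mem_ordGE wt_mul (Submodule.add_mem _ h1 (ordGE_anti (Nat.le_succ _) h3)) h2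
  exact ordGE_anti (by omega) h4

theorem wt_pos {G : Type*} [CommGroup G] (w : FreeMonoid (YL G)) (hw : w ≠ 1) : 0 < wt w := by
  rcases hl : w.toList with _ | ⟨a, l⟩
  · exact absurd hl hw
  · rw [wt, hl, wtL_cons]
    have := a.1.pos
    omega

/-- To first order `Φ_* - 1` is the linearised star map applied to `Φ - 1`, and that map is
homogeneous for the weight. -/
theorem homPart_starGroup {n : ℕ} {f : NCSeries (XL G) k}
    (hf : f - 1 ∈ ordGE k FreeMonoid.length (n + 1)) :
    homPart wt (n + 1) (starGroup f) = starLie (homPart FreeMonoid.length (n + 1) f) := by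
  set χ := homPart FreeMonoid.length (n + 1) f with hχ
  have e : homPart FreeMonoid.length (n + 1) (f - 1) = χ := by
    ext w
    refine ite_congr rfl (fun h => ?_) fun _ => rfl
    refine (congrArg (f w - ·) (one_apply_ne ?_)).trans (sub_zero _)
    rintro rfl
    exact absurd h (Nat.succ_ne_zero n).symm
  have h1 := starGroup_sub_mem hf
  have h2 := starLie_mem_wt (sub_homPart_mem hf)
  rw [e, cts_starLie.map_sub] at h2
  have h3 := Submodule.add_mem _ h1 h2
  ext w
  by_cases hw : wt w = n + 1
  · have h4 : starGroup f w - (1 : NCSeries (YL G) k) w - starLie (f - 1) w +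
        (starLie (f - 1) w - starLie χ w) = 0 := h3 w (by omega)
    have h5 : (1 : NCSeries (YL G) k) w = 0 := one_apply_ne (by
      rintro rfl
      exact absurd hw (Nat.succ_ne_zero n).symm)
    rw [h5, sub_zero, sub_add_sub_cancel, sub_eq_zero] at h4
    exact (if_pos hw).trans h4
  · exact (if_neg hw).trans (starLie_apply_of_wt (fun w h => if_neg h) hw).symm

end Linearise

/-! ### The image of the exponential -/

section Group

variable {Γ : Subgroup ℂˣ} [Finite Γ] {k : Type*} [CommRing k] [Algebra ℚ k]

/-- The parity condition of the non-exceptional elements. -/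
def ParityCondition {G k : Type*} [CommGroup G] [CommRing k] (f : NCSeries (XL G) k) : Prop :=
  ∀ (n : ℕ+) (ν : G), f (FreeMonoid.of x0 ^ ((n : ℕ) - 1) * FreeMonoid.of (xl ν)) +
    (-1) ^ (n : ℕ) * f (FreeMonoid.of x0 ^ ((n : ℕ) - 1) * FreeMonoid.of (xl ν⁻¹)) = 0

theorem mem_ordGE_of_eq {A : Type*} {deg : FreeMonoid A → ℕ} {n : ℕ} {f g : NCSeries A k}
    (h : f = g) (hg : g ∈ ordGE k deg n) : f ∈ ordGE k deg n :=
  h ▸ hg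

theorem expS_zero {A : Type*} : expS (0 : NCSeries A k) = 1 :=
  (isExp_expS FreeMonoid.length_mul (c := (0 : NCSeries A k)) (Submodule.zero_mem _)).unique
    (sfil_sep _) (IsExp.of_apply_eq_zero (sfil_zero _) (mulL_apply (k := k) _ _ ▸ zero_mul _))

theorem parityCondition_of_mem {ψ : NCSeries (XL Γ) k} (hψ : ψ ∈ dmrd0 Γ k) :
    ParityCondition ψ := fun n ν => by
  have := (mem_dmrd0_iff.1 hψ).2 n ν
  rwa [starLie_of, starLie_of] at this

theorem parityCondition_expOp {ψ f : NCSeries (XL Γ) k} (hψ : ψ ∈ dmrd0 Γ k) (h1 : f 1 = 1)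
    (hf : ParityCondition f) : ParityCondition (expOp (sOp ψ) f) := fun n ν => by
  have hd := (nonExceptional_of_mem hψ).mem_depth
  rw [expOp_sOp_apply_of_depth hd, expOp_sOp_apply_of_depth hd, h1]
  linear_combination hf n ν + parityCondition_of_mem hψ n ν

theorem homPart_of {A : Type*} (m : ℕ) (f : NCSeries A k) (a : A) :
    homPart FreeMonoid.length m f (FreeMonoid.of a) = if m = 1 then f (FreeMonoid.of a) else 0 :=
  if_congr eq_comm rfl rfl

/-- The lowest order term of an element of `DMRD` with the parity condition. -/
theorem homPart_mem_dmrd0 {f : NCSeries (XL Γ) k} (hf : f ∈ DMRD Γ k) (hp : ParityCondition f)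
    {n : ℕ} (h : f - 1 ∈ ordGE k FreeMonoid.length (n + 1)) :
    homPart FreeMonoid.length (n + 1) f ∈ dmrd0 Γ k := by
  obtain ⟨b, b0, b1, b2, b3, b4, b5⟩ := mem_DMRD_iff.1 hf
  set χ := homPart FreeMonoid.length (n + 1) f with hχ
  have hχl : ∀ w, w.length ≠ n + 1 → χ w = 0 := fun w hw => if_neg hw
  have hl : ∀ a, χ (FreeMonoid.of a) = if n + 1 = 1 then f (FreeMonoid.of a) else 0 :=
    fun a => homPart_of _ f a
  have hf1 : ∀ a, n + 1 ≠ 1 → f (FreeMonoid.of a) = 0 := by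
    intro a hn
    have h1 : f (FreeMonoid.of a) - (1 : NCSeries (XL Γ) k) (FreeMonoid.of a) = 0 :=
      h _ (by rw [FreeMonoid.length_of]; omega)
    rwa [one_apply_ne (FreeMonoid.of_ne_one a), sub_zero] at h1
  have hlf : ∀ a, χ (FreeMonoid.of a) = f (FreeMonoid.of a) := by
    intro a
    rw [hl]
    split_ifs with hn
    · rfl
    · exact (hf1 a hn).symm
  have hstar := qprim_homPart wt_mul (fun _ => wt_yop) wt_pos (Nat.succ_le_succ (Nat.zero_le n))
    b3 (by
      have h1 := starGroup_sub_mem h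
      have h2 := Submodule.add_mem _ (ordGE_anti (Nat.le_succ (n + 1)) h1) (starLie_mem_wt h)
      exact mem_ordGE_of_eq (sub_add_cancel _ _).symm h2)
  rw [homPart_starGroup h] at hstar
  refine mem_dmrd0_iff.2 ⟨⟨?_, ?_, ?_, hstar, fun H => ?_, b5.congr fun σ => hlf _⟩, fun m ν => ?_⟩
  · rw [hlf, b0]
  · rw [hlf, b1]
  · refine qprim_homPart FreeMonoid.length_mul (fun h => absurd rfl h) (fun w hw => ?_)
      (Nat.succ_le_succ (Nat.zero_le n)) b2 h
    exact Nat.pos_of_ne_zero fun h0 => hw (FreeMonoid.length_eq_zero.1 h0)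
  · rw [distCoeff_congr H (g := f) fun σ => hlf _]
    set c := distCoeff H f with hc
    -- Beyond order one `f` has no coefficients on letters, so `c` is zero; in order one nothing is
    -- needed.
    have hcm : (c • letter (xl 1) : NCSeries (XL H) k) ∈ ordGE k FreeMonoid.length (n + 1) := by
      by_cases hn : n + 1 = 1
      · rw [hn]
        exact smul_letter_mem_length c _
      · rw [hc, distCoeff_zero H fun σ => hf1 _ hn, zero_smul]
        exact Submodule.zero_mem _
    have h1 := expS_sub_mem FreeMonoid.length_mul (Nat.succ_le_succ (Nat.zero_le n)) hcm
    have hr := sub_homPart_mem h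
    have eχ : homPart FreeMonoid.length (n + 1) (f - 1) = χ := by
      ext w
      refine ite_congr rfl (fun h => ?_) fun _ => rfl
      refine (congrArg (f w - ·) (one_apply_ne ?_)).trans (sub_zero _)
      rintro rfl
      exact absurd h (Nat.succ_ne_zero n).symm
    rw [eχ] at hr
    have hp1 := proj1_mem_length H h
    rw [(cts_proj1 H).map_sub, proj1_one] at hp1
    have hr1 := proj1_mem_length H hr
    have hr2 := proj2_mem_length H hr
    rw [(cts_proj1 H).map_sub, (cts_proj1 H).map_sub, proj1_one] at hr1
    rw [(cts_proj2 H).map_sub, (cts_proj2 H).map_sub, proj2_one, b4 H] at hr2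
    set e := expS (c • letter (xl 1) : NCSeries (XL H) k) with he
    have h2 : (e - 1) * (proj1 H f - 1) ∈ ordGE k FreeMonoid.length (n + 2) := by
      have h3 := Submodule.add_mem _ (ordGE_anti (Nat.le_succ (n + 1)) h1) hcm
      exact ordGE_anti (by omega) (mul_mem_ordGE FreeMonoid.length_mul
        (mem_ordGE_of_eq (sub_add_cancel _ _).symm h3) hp1)
    have hkey : proj2 H χ - (proj1 H χ + c • letter (xl 1)) ∈ ordGE k FreeMonoid.length (n + 2) := by
      have h4 := Submodule.sub_mem _ (Submodule.add_mem _ (Submodule.add_mem _ h1 h2) hr1) hr2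
      -- The group-like relation `proj2 H f = e * proj1 H f`, already substituted in `hr2`, is
      -- expanded around `1`. Each of the four terms has order at least `n + 2`.
      have e4 : proj2 H χ - (proj1 H χ + c • letter (xl 1)) = (e - 1 - c • letter (xl 1)) +
          (e - 1) * (proj1 H f - 1) + (proj1 H f - 1 - proj1 H χ) -
          (e * proj1 H f - 1 - proj2 H χ) := by
        noncomm_ring
      exact mem_ordGE_of_eq e4 h4
    refine sub_eq_zero.1 (NCSeries.ext fun w => ?_)
    -- In larger lengths all terms vanish, because `χ` is homogeneous of degree `n + 1` and both
    -- projections preserve length.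
    by_cases hw : w.length < n + 2
    · exact hkey w hw
    · have z1 : proj2 H χ w = 0 := proj2_apply_of_length H hχl (by omega)
      have z2 : proj1 H χ w = 0 := hχl _ (by
        have : (FreeMonoid.map (Option.map (Subtype.val : H → Γ)) w).length = w.length :=
          List.length_map _
        omega)
      have z3 : (letter (xl 1) : NCSeries (XL H) k) w = 0 := word_ne (by
        rintro rfl
        rw [FreeMonoid.length_of] at hw
        omega)
      rw [NCSeries.sub_apply, NCSeries.add_apply, NCSeries.smul_apply, z1, z2, z3, mul_zero,
        add_zero, sub_zero]
      rfl
  · rw [starLie_of, starLie_of]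
    have hlen : ∀ ν : Γ, (FreeMonoid.of (x0 : XL Γ) ^ ((m : ℕ) - 1) *
        FreeMonoid.of (xl ν)).length = (m : ℕ) - 1 + 1 := by
      intro ν
      rw [FreeMonoid.length_mul, length_of_pow, FreeMonoid.length_of]
    by_cases hm : (m : ℕ) - 1 + 1 = n + 1
    · have : ∀ ν : Γ, χ (FreeMonoid.of (x0 : XL Γ) ^ ((m : ℕ) - 1) * FreeMonoid.of (xl ν)) =
          f (FreeMonoid.of (x0 : XL Γ) ^ ((m : ℕ) - 1) * FreeMonoid.of (xl ν)) :=
        fun ν => if_pos ((hlen ν).trans hm)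
      rw [this, this]
      exact hp m ν
    · rw [hχl _ (by rwa [hlen]), hχl _ (by rwa [hlen]), mul_zero, add_zero]

theorem one_mem_DMRD : (1 : NCSeries (XL Γ) k) ∈ DMRD Γ k := by
  have h1 : ∀ a : XL Γ, (1 : NCSeries (XL Γ) k) (FreeMonoid.of a) = 0 :=
    fun a => one_apply_ne (FreeMonoid.of_ne_one a)
  have hs : starGroup (1 : NCSeries (XL Γ) k) = 1 := by
    rw [starGroup, corr_one, expS_zero, one_mul]
    exact readY_one_series 1
  refine mem_DMRD_iff.2 ⟨one_apply_nil, h1 _, h1 _, qcop_one _ _, ?_, fun H => ?_,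
    finClosed_weightOne.zero.congr fun σ => h1 _⟩
  · rw [hs, qcop_one]
  · rw [proj2_one, proj1_one, distCoeff_zero H fun σ => h1 _, zero_smul, expS_zero, mul_one]

theorem parityCondition_one : ParityCondition (1 : NCSeries (XL Γ) k) := fun n ν => by
  rw [one_apply_ne (mul_of_ne_one _ _), one_apply_ne (mul_of_ne_one _ _), mul_zero, add_zero]

theorem mtExp_zero {G : Type*} [CommGroup G] [Finite G] : mtExp (0 : NCSeries (XL G) k) = 1 :=
  IsExp.unique (sfil_sep _) (isExp_sOp (ψ := (0 : NCSeries (XL G) k)) rfl 1)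
    (IsExp.of_apply_eq_zero (sfil_zero _) (sOp_zero_left 1))

/-- The series that agree with the exponential of an element of `dmrd₀` in lengths at most `n`. -/
theorem exists_next {f : NCSeries (XL Γ) k} (hf : f ∈ DMRD Γ k) (hp : ParityCondition f) (n : ℕ)
    {ψ : NCSeries (XL Γ) k} (hψ : ψ ∈ dmrd0 Γ k)
    (h : f - mtExp ψ ∈ ordGE k FreeMonoid.length (n + 1)) :
    ∃ φ ∈ dmrd0 Γ k, f - mtExp φ ∈ ordGE k FreeMonoid.length (n + 2) ∧
      φ - ψ ∈ ordGE k FreeMonoid.length (n + 1) := by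
  have h1 := (nonExceptional_of_mem hψ).apply_one
  have hf1 : f 1 = 1 := hf.1
  have hneg : -ψ ∈ dmrd0 Γ k := (dmrd0Submodule Γ k).neg_mem hψ
  have hneg1 : (-ψ) 1 = 0 := (nonExceptional_of_mem hneg).apply_one
  -- Translating by `Exp(-ψ)` brings `f` back near the unit without leaving `DMRD` or losing parity.
  -- The leading term of `θ - 1` is the next correction to `ψ`.
  set θ := expOp (sOp (-ψ)) f with hθ
  have hθ1 : θ - 1 ∈ ordGE k FreeMonoid.length (n + 1) := by
    have h2 := expOp_mem_ordGE hneg1 h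
    rw [(cts_expOp_sOp hneg1).map_sub, mtExp, expOp_add_cancel hneg1 h1 (neg_add_cancel ψ)] at h2
    exact h2
  have hχ := homPart_mem_dmrd0 (expOp_sOp_mem_DMRD hneg hf) (parityCondition_expOp hneg hf1 hp) hθ1
  have eχ : θ - 1 - homPart FreeMonoid.length (n + 1) θ ∈ ordGE k FreeMonoid.length (n + 2) := by
    have h2 := sub_homPart_mem hθ1
    have e : homPart FreeMonoid.length (n + 1) (θ - 1) = homPart FreeMonoid.length (n + 1) θ := by
      ext w
      refine ite_congr rfl (fun h => ?_) fun _ => rfl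
      refine (congrArg (θ w - ·) (one_apply_ne ?_)).trans (sub_zero _)
      rintro rfl
      exact absurd h (Nat.succ_ne_zero n).symm
    rwa [e] at h2
  set χ := homPart FreeMonoid.length (n + 1) θ
  have hχm : χ ∈ ordGE k FreeMonoid.length (n + 1) := fun w hw => if_neg hw.ne
  refine ⟨ψ + χ, (dmrd0Submodule Γ k).add_mem hψ hχ, ?_, by rwa [add_sub_cancel_left]⟩
  have h2 := expOp_mem_ordGE h1 eχ
  rw [(cts_expOp_sOp h1).map_sub, (cts_expOp_sOp h1).map_sub,
    expOp_add_cancel h1 hneg1 (add_neg_cancel ψ)] at h2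
  -- Applying `exp(s_ψ)` to the expansion of `θ` shows that `f` is `Exp(ψ) + χ` up to order `n + 2`,
  -- and so is `Exp(ψ + χ)`.
  have h3 := expOp_sub_mem_ordGE h1 hχm
  have h4 := mtExp_add_sub_mem h1 hχm
  have h5 := Submodule.sub_mem _ (Submodule.add_mem _ h2 h3) h4
  have e : f - mtExp (ψ + χ) = f - expOp (sOp ψ) 1 - expOp (sOp ψ) χ + (expOp (sOp ψ) χ - χ) -
      (mtExp (ψ + χ) - mtExp ψ - χ) := by
    rw [show mtExp ψ = expOp (sOp ψ) 1 from rfl]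
    abel
  exact mem_ordGE_of_eq e h5

/-- The image of the exponential. -/
theorem mem_image_mtExp_iff {f : NCSeries (XL Γ) k} :
    f ∈ mtExp '' dmrd0 Γ k ↔ f ∈ DMRD Γ k ∧ ParityCondition f := by
  constructor
  · rintro ⟨ψ, hψ, rfl⟩
    exact ⟨expOp_sOp_mem_DMRD hψ one_mem_DMRD,
      parityCondition_expOp hψ one_apply_nil parityCondition_one⟩
  · rintro ⟨hf, hp⟩
    have h0 : f - mtExp 0 ∈ ordGE k FreeMonoid.length (0 + 1) := by
      rw [mtExp_zero]
      refine ordGE_one_iff.2 ?_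
      exact sub_eq_zero.2 (hf.1.trans one_apply_nil.symm)
    choose! next hn1 hn2 hn3 using fun (n : ℕ) (ψ : NCSeries (XL Γ) k)
      (h : ψ ∈ dmrd0 Γ k ∧ f - mtExp ψ ∈ ordGE k FreeMonoid.length (n + 1)) =>
      exists_next hf hp n h.1 h.2
    let u : ℕ → NCSeries (XL Γ) k := fun n => Nat.rec 0 (fun n ψ => next n ψ) n
    have hu : ∀ n, u n ∈ dmrd0 Γ k ∧ f - mtExp (u n) ∈ ordGE k FreeMonoid.length (n + 1) := by
      intro n
      induction n with
      | zero => exact ⟨finClosed_dmrd0.zero, h0⟩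
      | succ n ih => exact ⟨hn1 n _ ih, hn2 n _ ih⟩
    have hstep : ∀ n m, n ≤ m → u m - u n ∈ ordGE k FreeMonoid.length (n + 1) := by
      intro n m hnm
      induction m, hnm using Nat.le_induction with
      | base =>
        rw [sub_self]
        exact Submodule.zero_mem _
      | succ m hm ih =>
        have h1 := Submodule.add_mem _ (ordGE_anti (Nat.succ_le_succ hm) (hn3 m _ (hu m))) ih
        exact mem_ordGE_of_eq (sub_add_sub_cancel _ _ _).symm h1
    -- From step `n` on the approximations agree in lengths at most `n`, so this diagonal choice is
    -- their limit.
    let ψ : NCSeries (XL Γ) k := fun w => u w.length w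
    have hψu : ∀ n, ψ - u n ∈ ordGE k FreeMonoid.length (n + 1) := by
      intro n w hw
      have h1 := hstep w.length n (Nat.lt_succ_iff.1 hw) w (Nat.lt_succ_self _)
      have h2 : u n w - u w.length w = 0 := h1
      change u w.length w - u n w = 0
      rw [sub_eq_zero.1 h2, sub_self]
    have hψ : ψ ∈ dmrd0 Γ k := finClosed_dmrd0.of_forall_sub_mem fun n =>
      ⟨u n, (hu n).1, ordGE_anti (Nat.le_succ n) (hψu n)⟩
    refine ⟨ψ, hψ, (eq_of_forall_ordGE (deg := FreeMonoid.length) fun n => ?_)⟩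
    have h1 := mtExp_add_sub_mem (nonExceptional_of_mem (hu n).1).apply_one (hψu n)
    have h2 := Submodule.sub_mem _ (Submodule.add_mem _ (ordGE_anti (Nat.le_succ (n + 1)) h1)
      (hψu n)) (hu n).2
    have e : mtExp ψ - f = mtExp (u n + (ψ - u n)) - mtExp (u n) - (ψ - u n) + (ψ - u n) -
        (f - mtExp (u n)) := by
      rw [add_sub_cancel]
      abel
    exact ordGE_anti (Nat.le_succ n) (mem_ordGE_of_eq e h2)

end Group

end DoubleShuffle
end

open DoubleShuffle DoubleShuffle.NCSeries in
theorem proposition10p1 (Γ : Subgroup ℂˣ) [Finite Γ] (k : Type*) [CommRing k] [Algebra ℚ k] :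
    (∀ α ∈ alphaSet Γ, ∀ l : k, ∀ ψ ∈ dmrd0 Γ k, ∀ Φ ∈ DMRDFiber Γ k α l,
      mtMul (mtExp ψ) Φ ∈ DMRDFiber Γ k α l ∧ mtMul (mtExp ψ) Φ = expOp (sOp ψ) Φ) ∧
    (∀ ψ ∈ dmrd0 Γ k, ∃ D : NCSeries (YL Γ) k →ₗ[k] NCSeries (YL Γ) k,
      (∀ g : NCSeries (XL Γ) k,
        D (qs (piY g)) = qs (piY (sOp (sec (ps (starLie ψ))) g))) ∧
      IsCoderivation (stuffleWord Γ k) D) ∧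
    (∃ L : Submodule k (NCSeries (XL Γ) k), (L : Set (NCSeries (XL Γ) k)) = dmrd0 Γ k ∧
      dmrd0 Γ k ⊆ mt Γ k ∧ ∀ ψ₁ ∈ L, ∀ ψ₂ ∈ L, ihara ψ₁ ψ₂ ∈ L) ∧
    (mtExp '' dmrd0 Γ k ⊆ MT Γ k ∧ 1 ∈ mtExp '' dmrd0 Γ k ∧
      (∀ E₁ ∈ mtExp '' dmrd0 Γ k, ∀ E₂ ∈ mtExp '' dmrd0 Γ k,
        mtMul E₁ E₂ ∈ mtExp '' dmrd0 Γ k) ∧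
      (∀ E ∈ mtExp '' dmrd0 Γ k, ∃ F ∈ mtExp '' dmrd0 Γ k,
        mtMul E F = 1 ∧ mtMul F E = 1)) := by
  have hone : ∀ ψ ∈ dmrd0 Γ k, ψ 1 = 0 := fun ψ hψ => (nonExceptional_of_mem hψ).apply_one
  refine ⟨fun α hα l ψ hψ Φ hΦ => ?_, fun ψ hψ => ?_,
    ⟨dmrd0Submodule Γ k, rfl, hone, fun ψ₁ h₁ ψ₂ h₂ => ihara_mem h₁ h₂⟩, ?_, ?_, ?_, ?_⟩
  · rw [mtMul_mtExp (hone ψ hψ)]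
    exact ⟨⟨expOp_sOp_mem_DMRD hψ hΦ.1, (pairing_expOp hψ hΦ.1.1 hα).trans hΦ.2⟩, rfl⟩
  · have hne := nonExceptional_of_mem hψ
    refine ⟨(cts_inducedOp (corrected ψ)).toLinear, fun g => ?_, fun f u v => ?_⟩
    · rw [hne.sec_eq]
      exact inducedOp_qs_piY _ _
    · have h := congrFun (hne.isCoderivation f) (u, v)
      rw [← coprod_stuffleWord', ← coprod_stuffleWord'] at h
      exact h
  · rintro _ ⟨ψ, hψ, rfl⟩
    exact mtExp_apply_one (hone ψ hψ)
  · exact ⟨0, finClosed_dmrd0.zero, mtExp_zero⟩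
  · rintro _ ⟨ψ, hψ, rfl⟩ E hE
    -- Closure under products: left translation by `Exp(ψ)` is the flow, which preserves `DMRD` and
    -- the parity condition, and these characterise the image.
    obtain ⟨h1, h2⟩ := mem_image_mtExp_iff.1 hE
    rw [mtMul_mtExp (hone ψ hψ)]
    exact mem_image_mtExp_iff.2 ⟨expOp_sOp_mem_DMRD hψ h1, parityCondition_expOp hψ h1.1 h2⟩
  · rintro _ ⟨ψ, hψ, rfl⟩
    have hneg : -ψ ∈ dmrd0 Γ k := (dmrd0Submodule Γ k).neg_mem hψ
    refine ⟨_, ⟨-ψ, hneg, rfl⟩, ?_, ?_⟩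
    · rw [mtMul_mtExp (hone ψ hψ)]
      exact expOp_add_cancel (hone ψ hψ) (hone _ hneg) (add_neg_cancel ψ) 1
    · rw [mtMul_mtExp (hone _ hneg)]
      exact expOp_add_cancel (hone _ hneg) (hone ψ hψ) (neg_add_cancel ψ) 1
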